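/- **Setting.** Let $p$ be an odd prime, $F$ a finite extension of $\mathbb{Q}_p$, and $E/F$ a ramified quadratic extension with Galois involution $\mathtt{c}$. Fix a uniformizer $u$ of $E$ with $u^{\mathtt{c}}=-u$, and let $q$ be the cardinality of the residue field of $F$. Let $n=2r$ be a positive even integer and let $V$ be a nondegenerate hermitian space over $E$ of dimension $n$, with form $(\;,\;)$, that is nonsplit (it has no totally isotropic subspace of dimension $r$). **Lattices.** For a finitely generated $O_E$-submodule $L\subset V$ whose $E$-span $V_L$ is nondegenerate, put $L^\vee=\{x\in V_L : (x,y)\in u^{-1}O_E \text{ for all } y\in L\}$. Call $L$ integral if $L\subseteq L^\vee$. In this case $L^\vee/L\simeq\bigoplus_i O_E/(u^{a_i})$ with unique integers $0\le a_1\le\dots\le a_m$, $m=\operatorname{rank}L$, and the type $t(L)$ is the number of $i$ with $a_i\neq 0$. An $O_E$-lattice of $V$ is such an $L$ with $V_L=V$. **Densities.** Let $H$ be the hermitian $O_E$-module $O_E^2$ with moment matrix $\begin{pmatrix}0&u^{-1}\\-u^{-1}&0\end{pmatrix}$, and $H_s=H^{\oplus s}$. For an $O_E$-lattice $\boldsymbol{L}$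 of $V$ and $s\ge 0$ put $$\mathrm{Den}(H_s,\boldsymbol{L})=\lim_{N\to\infty}\frac{|\mathrm{Herm}_{\boldsymbol{L},H_s}(O_F/(u^{2N}))|}{q^{N d}},\qquad d=4sn-n^2,$$ where $\mathrm{Herm}_{\boldsymbol{L},H_s}(O_F/(u^{2N}))$ is the set of $O_E$-linear maps $\boldsymbol{L}/u^{2N}\boldsymbol{L}\to H_s/u^{2N}H_s$ that preserve the pairings modulo $u^{2N-1}O_E$ (and $d$ is the dimension of the generic fibre of the scheme $\mathrm{Herm}_{\boldsymbol{L},H_s}$ when $2s\ge n$). The Siegel series $\mathrm{Den}(X,\boldsymbol{L})$ is the polynomial in $\mathbb{Z}[X]$ such that for every integer $s\ge 0$ $$\mathrm{Den}(q^{-s},\boldsymbol{L})=\frac{\mathrm{Den}(H_{r+s},\boldsymbol{L})}{\prod_{i=s+1}^{r+s}(1-q^{-2i})}.$$ Put $\partial\mathrm{Den}(\boldsymbol{L})=-\left.\frac{\mathrm{d}}{\mathrm{d}X}\right|_{X=1}\mathrm{Den}(X,\boldsymbol{L})$. **Vertical part.** Let $L^\flat\subset V$ be a hermitian $O_E$-module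 of rank $n-1$, that is, a finitely generated $O_E$-submodule whose $E$-span $V_{L^\flat}$ is nondegenerate of dimension $n-1$. For $x\in V\setminus V_{L^\flat}$ put $$\partial\mathrm{Den}^{\mathrm v}_{L^\flat}(x)=\partial\mathrm{Den}(L^\flat+\langle x\rangle)-2\sum_{\substack{L^\flat\subseteq L\subseteq L^\vee\\ t(L\cap V_{L^\flat})=1}}\mathbf{1}_L(x),$$ where $L$ runs over the integral $O_E$-lattices of $V$ containing $L^\flat$ with $t(L\cap V_{L^\flat})=1$. **Fourier transform.** Fix an additive character $\psi_F:F\to\mathbb{C}^\times$ of conductor $O_F$. For a compactly supported locally constant $\phi:V\to\mathbb{C}$ put $\widehat\phi(x)=\int_V\phi(y)\,\psi_F(\mathrm{Tr}_{E/F}(x,y))\,\mathrm{d}y$, where $\mathrm{d}y$ is the self-dual Haar measure on $V$. **Proposition.** The polynomial $\mathrm{Den}(X,\boldsymbol{L})$ exists and is unique for every $O_E$-lattice $\boldsymbol{L}$ of $V$, so that the above is well-defined. For every hermitian $O_E$-module $L^\flat$ of rank $n-1$ contained in $V$, the function $\partial\mathrm{Den}^{\mathrm v}_{L^\flat}$ on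 $V\setminus V_{L^\flat}$ extends uniquely to a locally constant function on $V$. This extension is compactly supported, and the support of its Fourier transform is contained in $V^{\mathrm{int}}=\{x\in V : (x,x)\in O_F\}$. -/

import Mathlib

open scoped NormedField
open Filter Topology MeasureTheory Polynomial

noncomputable section

namespace KRAnalytic

/-! ### Fields -/

section Fields

variable (F : Type*) [NontriviallyNormedField F]
variable (E : Type*) [NontriviallyNormedField E] [NormedAlgebra F E]

/-- `E/F` is a ramified quadratic extension: the degree is two, and some nonzero element of `E`
has an absolute value that is not attained on `F`. -/
structure IsRamifiedQuadratic : Prop where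
  finrank_eq_two : Module.finrank F E = 2
  ramified : ∃ y : E, y ≠ 0 ∧ ∀ x : F, ‖x‖ ≠ ‖y‖

/-- The cardinality of the residue field of `F`. -/
def residueCard [IsUltrametricDist F] : ℕ :=
  Nat.card (IsLocalRing.ResidueField (Valued.integer F))

variable {F}

/-- The additive character `ψ` of `F` has conductor `O_F`: the set of all `y` such that `ψ` is
trivial on `y O_F` is `O_F`. (In particular `ψ` is trivial on `O_F`, hence continuous, and it is
nontrivial.) -/
def HasConductorIntegers (ψ : AddChar F ℂ) : Prop :=
  ∀ y : F, (∀ x : F, ‖x‖ ≤ 1 → ψ (x * y) = 1) ↔ ‖y‖ ≤ 1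

end Fields

variable {F : Type*} [NontriviallyNormedField F] [IsUltrametricDist F]
variable {E : Type*} [NontriviallyNormedField E] [IsUltrametricDist E] [NormedAlgebra F E]
variable {V : Type*} [AddCommGroup V] [Module E V]

/-! ### Hermitian spaces -/

/-- Sesquilinear pairings on `V`, linear in the first and `c`-linear in the second variable. -/
abbrev Pairing (c : E ≃ₐ[F] E) (V : Type*) [AddCommGroup V] [Module E V] : Type _ :=
  V →ₗ[E] V →ₛₗ[(c : E →+* E)] E

variable {c : E ≃ₐ[F] E}

/-- `h` makes `V` a (nondegenerate) hermitian space. -/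
structure IsHermitianSpace (h : Pairing c V) : Prop where
  symm : ∀ x y : V, h y x = c (h x y)
  nondegenerate : ∀ x : V, (∀ y : V, h x y = 0) → x = 0

/-- An even dimensional hermitian space is split if it has a totally isotropic subspace of half
its dimension. -/
def IsSplit (h : Pairing c V) : Prop :=
  ∃ W : Submodule E V, 2 * Module.finrank E W = Module.finrank E V ∧
    ∀ x ∈ W, ∀ y ∈ W, h x y = 0

/-- The set of all `x` in `V` such that `(x, x)` belongs to `O_F`. -/
def intSet (h : Pairing c V) : Set V :=
  {x | ∃ a : F, ‖a‖ ≤ 1 ∧ h x x = algebraMap F E a}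

/-! ### Lattices -/

/-- The `E`-subspace `L ⊗_{O_F} F` of `V` generated by an `O_E`-submodule `L`. -/
def ambient (L : Submodule (Valued.integer E) V) : Submodule E V :=
  Submodule.span E (L : Set V)

/-- The dual `L^∨` of `L` inside `L ⊗_{O_F} F`: the elements `x` such that
`(x, y)` lies in `u⁻¹ O_E` for every `y` in `L`. -/
def dual (u : Valued.integer E) (h : Pairing c V) (L : Submodule (Valued.integer E) V) :
    Submodule (Valued.integer E) V where
  carrier := {x | x ∈ ambient L ∧ ∀ y ∈ L, (u : E) * h x y ∈ Valued.integer E}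
  zero_mem' := ⟨Submodule.zero_mem _, fun y _ => by simp⟩
  add_mem' := by
    rintro a b ⟨ha, ha'⟩ ⟨hb, hb'⟩
    refine ⟨Submodule.add_mem _ ha hb, fun y hy => ?_⟩
    rw [map_add, LinearMap.add_apply, mul_add]
    exact add_mem (ha' y hy) (hb' y hy)
  smul_mem' := by
    rintro r x ⟨hx, hx'⟩
    refine ⟨Submodule.smul_mem _ (r : E) hx, fun y hy => ?_⟩
    have h1 : h (r • x) y = (r : E) * h x y := by
      have h2 : r • x = (r : E) • x := rfl
      rw [h2, map_smul, LinearMap.smul_apply, smul_eq_mul]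
    rw [h1, mul_left_comm]
    exact mul_mem r.2 (hx' y hy)

/-- `L` is integral if it is contained in its dual. -/
def IsIntegralLattice (u : Valued.integer E) (h : Pairing c V)
    (L : Submodule (Valued.integer E) V) : Prop :=
  L ≤ dual u h L

/-- `a` is the sequence of fundamental invariants of the integral lattice `L`: it is
nondecreasing, its length is the rank of `L`, and
`L^∨ / L ≃ ⊕ i, O_E / (u ^ (a i))` as `O_E`-modules. -/
def IsFundamentalInvariants (u : Valued.integer E) (h : Pairing c V)
    (L : Submodule (Valued.integer E) V) (a : Fin (Module.finrank E (ambient L)) → ℕ) : Prop :=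
  Monotone a ∧
    Nonempty ((dual u h L ⧸ L.submoduleOf (dual u h L)) ≃ₗ[Valued.integer E]
      ((i : Fin (Module.finrank E (ambient L))) →
        (Valued.integer E ⧸ Ideal.span {u ^ a i})))

open Classical in
/-- The type `t(L)` of an integral lattice `L`: the number of nonzero fundamental invariants. -/
def latticeType (u : Valued.integer E) (h : Pairing c V)
    (L : Submodule (Valued.integer E) V) : ℕ :=
  if H : ∃ a, IsFundamentalInvariants u h L a then
    Nat.card {i // H.choose i ≠ 0}
  else 0

/-- A hermitian `O_E`-module of rank `m` contained in `V`: a finitely generated (hence free)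
`O_E`-submodule of rank `m` on whose `E`-span the hermitian form is nondegenerate. -/
structure IsHermitianModule (h : Pairing c V) (L : Submodule (Valued.integer E) V) (m : ℕ) :
    Prop where
  fg : L.FG
  rank_eq : Module.finrank E (ambient L) = m
  nondegenerate : ∀ x ∈ ambient L, (∀ y ∈ ambient L, h x y = 0) → x = 0

/-! ### Local densities -/

section Density

variable {M : Type*} [AddCommGroup M] [Module (Valued.integer E) M]
variable {N : Type*} [AddCommGroup N] [Module (Valued.integer E) N]

/-- The submodule `u ^ (2 * k) M` of `M`. For a ramified quadratic extension in which the
uniformizer `u` is anti-invariant, `u ^ 2` is a uniformizer of `F`, so that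
`M / u ^ (2 * k) M = M ⊗_{O_F} O_F / (u ^ (2 * k))`. -/
def powSubmodule (u : Valued.integer E) (M : Type*) [AddCommGroup M]
    [Module (Valued.integer E) M] (k : ℕ) : Submodule (Valued.integer E) M :=
  Ideal.span {u ^ (2 * k)} • (⊤ : Submodule (Valued.integer E) M)

/-- The set `Herm_{L, M} (O_F / (u ^ (2 * k)))` of homomorphisms of hermitian modules from `L` to
`M` over `O_F / (u ^ (2 * k))`, for pairings `bL` on `L` and `bM` on `M`, the latter with values
in `u⁻¹ O_E`: the `O_E`-linear maps from `L / u ^ (2 * k) L` to `M / u ^ (2 * k) M` which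
preserve the pairings modulo `u ^ (2 * k) (u⁻¹ O_E)`. -/
def hermHom (u : Valued.integer E) (bM : M → M → E) {L : Type*} [AddCommGroup L]
    [Module (Valued.integer E) L] (bL : L → L → E) (k : ℕ) :
    Set ((L ⧸ powSubmodule u L k) →ₗ[Valued.integer E] (M ⧸ powSubmodule u M k)) :=
  {φ | ∀ (x y : L) (x' y' : M),
    φ ((powSubmodule u L k).mkQ x) = (powSubmodule u M k).mkQ x' →
    φ ((powSubmodule u L k).mkQ y) = (powSubmodule u M k).mkQ y' →
    ∃ a : Valued.integer E, (u : E) * (bM x' y' - bL x y) = (u : E) ^ (2 * k) * a}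

/-- The dimension over `F` of the generic fibre of `Herm_{L, M}` for nondegenerate hermitian
`L` and `M` of `O_E`-ranks `m ≤ m'`. Over an algebraic closure, this is the space of injective
isometries, a homogeneous space `GL_{m'} / GL_{m' - m}`, of dimension `2 m m' - m ^ 2`. -/
def hermDim (m' m : ℕ) : ℤ := 2 * m * m' - m ^ 2

variable (F) in
/-- The local density `Den(M, L)`, where `m'` and `m` are the ranks of `M` and `L`. -/
def localDensity (u : Valued.integer E) (m' : ℕ) (bM : M → M → E) (m : ℕ) {L : Type*}
    [AddCommGroup L] [Module (Valued.integer E) L] (bL : L → L → E) : ℝ :=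
  limUnder atTop fun k : ℕ =>
    (Nat.card (hermHom u bM bL k) : ℝ) / (residueCard F : ℝ) ^ ((k : ℤ) * hermDim m' m)

end Density

/-- The pairing on `H_s = H^s`, where `H` is the hyperbolic plane `O_E ^ 2` with moment matrix
`(0, u⁻¹; -u⁻¹, 0)`. -/
def hyperbolicPairing (c : E ≃ₐ[F] E) (u : Valued.integer E) (s : ℕ)
    (x y : Fin s → Fin 2 → Valued.integer E) : E :=
  ∑ i : Fin s, ((x i 0 : E) * (u : E)⁻¹ * c (y i 1 : E) - (x i 1 : E) * (u : E)⁻¹ * c (y i 0 : E))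

/-- `Den(H_s, L)` for a lattice `L` of the hermitian space `V`. -/
def denHyperbolic (u : Valued.integer E) (h : Pairing c V) (s : ℕ)
    (L : Submodule (Valued.integer E) V) : ℝ :=
  localDensity F u (2 * s) (hyperbolicPairing c u s) (Module.finrank E (ambient L))
    (fun x y : L => h x y)

/-- `P` is the normalized local Siegel series of the lattice `L` of a hermitian space `V` of
dimension `2 * r`. -/
def IsSiegelSeries (u : Valued.integer E) (h : Pairing c V) (r : ℕ)
    (L : Submodule (Valued.integer E) V) (P : ℤ[X]) : Prop :=
  ∀ s : ℕ, aeval ((residueCard F : ℝ) ^ (-(s : ℤ))) P =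
    denHyperbolic u h (r + s) L /
      ∏ i ∈ Finset.Icc (s + 1) (r + s), (1 - (residueCard F : ℝ) ^ (-(2 * (i : ℤ))))

open Classical in
/-- The normalized local Siegel series `Den(X, L)`. -/
def siegelSeries (u : Valued.integer E) (h : Pairing c V) (r : ℕ)
    (L : Submodule (Valued.integer E) V) : ℤ[X] :=
  if H : ∃ P, IsSiegelSeries u h r L P then H.choose else 0

/-- `∂Den(L)`, the negative of the derivative of the Siegel series at `X = 1`. -/
def derivDen (u : Valued.integer E) (h : Pairing c V) (r : ℕ)
    (L : Submodule (Valued.integer E) V) : ℤ :=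
  -(derivative (siegelSeries u h r L)).eval 1

/-! ### The horizontal and the vertical part -/

/-- `∂Den_{L♭}(x) = ∂Den(L♭ + ⟨x⟩)`. -/
def derivDenAt (u : Valued.integer E) (h : Pairing c V) (r : ℕ)
    (Lb : Submodule (Valued.integer E) V) (x : V) : ℤ :=
  derivDen u h r (Lb ⊔ Submodule.span (Valued.integer E) {x})

/-- The set of integral `O_E`-lattices `L` of `V` containing `L♭` such that
`L ∩ V_{L♭}` has type one. -/
def horizontalLattices (u : Valued.integer E) (h : Pairing c V)
    (Lb : Submodule (Valued.integer E) V) : Set (Submodule (Valued.integer E) V) :=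
  {L | Submodule.IsLattice E L ∧ Lb ≤ L ∧ IsIntegralLattice u h L ∧
    latticeType u h (L ⊓ (ambient Lb).restrictScalars (Valued.integer E)) = 1}

/-- The horizontal part `∂Den^h_{L♭}`: twice the sum of the characteristic functions of the
lattices in `horizontalLattices`. -/
def derivDenHor (u : Valued.integer E) (h : Pairing c V)
    (Lb : Submodule (Valued.integer E) V) (x : V) : ℤ :=
  2 * ∑ᶠ L ∈ horizontalLattices u h Lb, (L : Set V).indicator (fun _ => (1 : ℤ)) x

/-- The vertical part `∂Den^v_{L♭}`, which is meaningful outside `V_{L♭}`. -/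
def derivDenVert (u : Valued.integer E) (h : Pairing c V) (r : ℕ)
    (Lb : Submodule (Valued.integer E) V) (x : V) : ℤ :=
  derivDenAt u h r Lb x - derivDenHor u h Lb x

/-! ### Fourier transform -/

/-- The Fourier transform `x ↦ ∫ φ(y) ψ(Tr_{E/F} (x, y)) dy`. -/
def fourier [MeasurableSpace V] (μ : Measure V) (ψ : AddChar F ℂ) (h : Pairing c V)
    (φ : V → ℂ) (x : V) : ℂ :=
  ∫ y, φ y * ψ (Algebra.trace F E (h x y)) ∂μ

/-- `μ` is the self-dual Haar measure: a Haar measure for which the Fourier inversion formula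
holds. -/
structure IsSelfDualHaar [TopologicalSpace V] [MeasurableSpace V] (μ : Measure V)
    (ψ : AddChar F ℂ) (h : Pairing c V) : Prop where
  isAddHaar : μ.IsAddHaarMeasure
  inversion : ∀ φ : V → ℂ, IsLocallyConstant φ → HasCompactSupport φ →
    ∀ x : V, fourier μ ψ h (fourier μ ψ h φ) x = φ (-x)

end KRAnalytic

end

/-! Existence of the Siegel series. Modulo `u ^ (2 * k)`, sort the hermitian maps from `L` to `H_s`
by their saturation, the largest lattice to which a lift extends with values in `H_s`. It is an
integral overlattice `L'`, and the maps with saturation `L'` come from primitive tuples realizing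
the Gram matrix of `L'`. Such tuples are counted one vector at a time over a finite local ring
(`PrimitiveTuples.card_mul`). Besides the rank, the count only sees the corank of the Gram matrix
modulo `u`, an alternating matrix over the residue field, and this corank is the type. With `ℓ` the
length of `L' / L`, this gives (`exists_isSiegelSeries`) Den(X, L) = ∑ X ^ (2 ℓ) * ∏ (1 - q ^ (2 j)
X ^ 2), the sum over integral `L' ⊇ L`, the product over `0 ≤ j < t(L') / 2`. Uniqueness holds
because the values at infinitely many points `q ^ (-s)` are prescribed.

Derivative. An integral lattice of type zero would make `V` isometric to the hyperbolic space, hence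
split; so all types are at least two (`two_le_latticeType`), every term contains the factor `1 - X ^
2`, and `∂Den(L)` is twice the sum of `w(t(L'))`, where `w(t) = ∏ (1 - q ^ (2 j))` over `1 ≤ j < t /
2`.

Slicing. Group the overlattices by their intersection `K` with the hyperplane of `L♭`. Its rank is
odd, so `t = t(K)` is odd, and a lattice `K + ⟨Y⟩` has type `t - 1` or `t + 1`. For `t = 1` all
weights are one and the sum is exactly the horizontal part. For `t ≠ 1` the weight is `w(t - 1)`
times `1` or `1 - q ^ (t - 1)` (`typeWeight_eq_mul_fiberWeight`). It remains to treat, for each of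
finitely many `K`, the weighted count of the lattices over `K` that contain `x`.

Fourier side. Infinitely many lattices lie over a given `K`, so the extension across the hyperplane
is obtained indirectly. Consider `fiberTransform`, the sum of weight times `vol(L)` times the
characteristic function of `L^∨`. All these `L` lie in one lattice `D` and their volumes are
summable, so the sum converges and is invariant under `D^∨`. The key claim is that it vanishes at
`ξ` when `(ξ, ξ)` is not integral. Then it is a locally constant function supported in `D`. Its
Fourier transform is again locally constant and compactly supported, equals the weighted count off
the hyperplane (`fourier_fiberTransform`), and by Fourier inversion has its own transform supported
on integral vectors.

Key claim. Among the `L` over `K` with `ξ ∈ L^∨`, the total volume has to be `q ^ (t - 1)` times the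
volume of those of type `t + 1` (`tsum_measure_eq`). The generators of `L` over `K` fill a
proportion `1 - 1 / q` of `L`, so this compares the measures of two sets of vectors. As `(ξ, ξ)` has
valuation at most `-2`, projecting along `ξ` changes the relevant pairings only by integral amounts,
and the question descends to a lattice of odd rank in the complement of `ξ`. There
(`measure_isotropic_dual`) let `A` be the part of the dual lattice where `(y, y)` is integral and
`X` the part where it has valuation at least `-2`. Then `X` has `q` times the measure of `A`, by
induction on enlarging the lattice with vectors of integral norm (`measure_dual_self_le`). Rescaling
`X` by `u` gives vectors pairing integrally with the lattice, and these are counted by cosets of the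
radical modulo `u`. -/

noncomputable section

namespace KRAnalytic

/-! ### Ramified quadratic extensions: norms, involution, residue field. -/

section FieldFacts

variable {F : Type*} [NontriviallyNormedField F]
variable {E : Type*} [NontriviallyNormedField E] [IsUltrametricDist E] [NormedAlgebra F E]

/-- The properties of a tamely ramified quadratic extension of local fields, expressed
through the larger field `E`, its involution `c` and the anti-invariant uniformizer `u`. -/
structure RamifiedDatum (c : E ≃ₐ[F] E) (u : Valued.integer E) (q : ℕ) : Prop where
  norm_pos : 0 < ‖(u : E)‖
  norm_lt_one : ‖(u : E)‖ < 1
  exists_zpow : ∀ x : E, x ≠ 0 → ∃ j : ℤ, ‖x‖ = ‖(u : E)‖ ^ j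
  norm_conj : ∀ x, ‖c x‖ = ‖x‖
  conj_conj : ∀ x, c (c x) = x
  conj_u : c (u : E) = -u
  norm_two : ‖(2 : E)‖ = 1
  norm_sub_conj : ∀ x, ‖x‖ ≤ 1 → ‖x - c x‖ < 1
  symm_even : ∀ x, x ≠ 0 → c x = x → ∃ j : ℤ, ‖x‖ = ‖(u : E)‖ ^ (2 * j)
  mem_range_of_symm : ∀ x, c x = x → ∃ a : F, x = algebraMap F E a
  card_residue : Nat.card (IsLocalRing.ResidueField (Valued.integer E)) = q
  properSpace : ProperSpace E
  dvr : IsDiscreteValuationRing (Valued.integer E)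
  finite_residue : Finite (IsLocalRing.ResidueField (Valued.integer E))

theorem mem_integer_iff {x : E} : x ∈ Valued.integer E ↔ ‖x‖ ≤ 1 :=
  Valued.integer.mem_iff

theorem norm_coe_integer_le (x : Valued.integer E) : ‖(x : E)‖ ≤ 1 :=
  Valued.integer.norm_le_one x

theorem isUnit_integer_iff {x : Valued.integer E} : IsUnit x ↔ ‖(x : E)‖ = 1 :=
  Valued.integer.isUnit_iff_norm_eq_one

/-- The elements `1` and `u` are eigenvectors of `c` for the distinct eigenvalues `1` and `-1`,
hence independent, and the degree is two. -/
theorem exists_add_mul_uniformizer (h2 : Module.finrank F E = 2) {c : E ≃ₐ[F] E} {u : E}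
    (hu : u ≠ 0) (hcu : c u = -u) (two : (2 : E) ≠ 0) (z : E) :
    ∃ a b : F, z = algebraMap F E a + algebraMap F E b * u := by
  have li : LinearIndependent F ![(1 : E), u] := by
    rw [LinearIndependent.pair_iff]
    intro s t hst
    simp only [Algebra.smul_def, mul_one] at hst
    have h' := congrArg c hst
    simp only [map_add, map_mul, AlgEquiv.commutes, hcu, map_zero] at h'
    have hs : algebraMap F E s = 0 := by
      have : 2 * algebraMap F E s = 0 := by linear_combination hst + h'
      exact (mul_eq_zero.mp this).resolve_left two
    have ht : algebraMap F E t * u = 0 := by linear_combination hst - hs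
    have ht' := (mul_eq_zero.mp ht).resolve_right hu
    exact ⟨(map_eq_zero _).mp hs, (map_eq_zero _).mp ht'⟩
  have : FiniteDimensional F E := Module.finite_of_finrank_pos (by omega)
  have hs := li.span_eq_top_of_card_eq_finrank (by simp [h2])
  have hz : z ∈ Submodule.span F (Set.range ![(1 : E), u]) := hs ▸ Submodule.mem_top
  simp only [Matrix.range_cons, Matrix.range_empty, Set.union_empty, Set.singleton_union] at hz
  obtain ⟨a, b, hab⟩ := Submodule.mem_span_pair.mp hz
  exact ⟨a, b, by rw [← hab]; simp [Algebra.smul_def]⟩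

/-- Everything rests on the decomposition `x = a + b u` with `a`, `b` in `F`. Norms of `F` are even
powers of `‖u‖`, so the two summands never have equal norm and can be read off from `‖x‖`. Odd
residue characteristic enters through `‖2‖ = 1`. -/
theorem ramifiedDatum [IsUltrametricDist F] (p : ℕ) [Fact p.Prime] (hp : p ≠ 2)
    [NormedAlgebra ℚ_[p] F] [FiniteDimensional ℚ_[p] F]
    (hEF : IsRamifiedQuadratic F E) {c : E ≃ₐ[F] E} {u : Valued.integer E}
    (hu : Irreducible u) (hcu : c (u : E) = -(u : E)) :
    RamifiedDatum c u (residueCard F) := by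
  have h2 := hEF.finrank_eq_two
  have : FiniteDimensional F E := Module.finite_of_finrank_pos (by omega)
  have : ProperSpace F := FiniteDimensional.proper ℚ_[p] F
  have hprop : ProperSpace E := FiniteDimensional.proper F E
  have : CompactSpace (Valued.integer E) := by
    refine isCompact_iff_compactSpace.mp ?_
    convert isCompact_closedBall (0 : E) 1
    ext x
    simp only [SetLike.mem_coe, mem_closedBall_zero_iff]
    exact mem_integer_iff
  letI : (Valued.v : Valuation E NNReal).RankOne :=
    inferInstanceAs (NormedField.valuation (K := E)).RankOne
  have hdvr : IsDiscreteValuationRing (Valued.integer E) :=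
    Valued.integer.isDiscreteValuationRing_of_compactSpace
  have hpos : 0 < ‖(u : E)‖ := Valued.integer.norm_irreducible_pos hu
  have hlt : ‖(u : E)‖ < 1 := Valued.integer.norm_irreducible_lt_one hu
  have hu0 : (u : E) ≠ 0 := norm_pos_iff.mp hpos
  have hfin : Finite (IsLocalRing.ResidueField (Valued.integer E)) := by
    have := (Valued.integer.compactSpace_iff_completeSpace_and_isDiscreteValuationRing_and_finite_residueField
      (K := E)).mp inferInstance
    exact this.2.2
  have hz1 : ∀ x : Valued.integer E, x ≠ 0 → ∃ j : ℤ, ‖(x : E)‖ = ‖(u : E)‖ ^ j := by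
    intro x hx
    obtain ⟨n, v, hv⟩ := IsDiscreteValuationRing.eq_unit_mul_pow_irreducible hx hu
    refine ⟨n, ?_⟩
    have : (x : E) = ((v : Valued.integer E) : E) * (u : E) ^ n := by
      rw [hv]; push_cast; ring
    rw [this, norm_mul, norm_pow, Valued.integer.norm_coe_unit, one_mul, zpow_natCast]
  have hzpow : ∀ x : E, x ≠ 0 → ∃ j : ℤ, ‖x‖ = ‖(u : E)‖ ^ j := by
    intro x hx
    rcases le_total ‖x‖ 1 with h | h
    · exact hz1 ⟨x, mem_integer_iff.mpr h⟩ (fun h0 => hx (congrArg Subtype.val h0))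
    · have h' : ‖x⁻¹‖ ≤ 1 := by rw [norm_inv]; exact inv_le_one_of_one_le₀ h
      obtain ⟨j, hj⟩ := hz1 ⟨x⁻¹, mem_integer_iff.mpr h'⟩
        (fun h0 => inv_ne_zero hx (congrArg Subtype.val h0))
      refine ⟨-j, ?_⟩
      have hj' : ‖x‖⁻¹ = ‖(u : E)‖ ^ j := by rw [← norm_inv]; exact hj
      rw [zpow_neg, ← hj', inv_inv]
  have two : ‖(2 : E)‖ = 1 := by
    have e1 : (2 : E) = algebraMap F E (algebraMap ℚ_[p] F 2) := by
      rw [map_ofNat (algebraMap ℚ_[p] F) 2, map_ofNat (algebraMap F E) 2]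
    rw [e1, norm_algebraMap', norm_algebraMap']
    have : ‖((2 : ℕ) : ℚ_[p])‖ = 1 := by
      rw [Padic.norm_natCast_eq_one_iff]
      exact (Nat.coprime_primes Fact.out Nat.prime_two).mpr hp
    simpa using this
  have two' : (2 : E) ≠ 0 := norm_ne_zero_iff.mp (by rw [two]; exact one_ne_zero)
  have hdec := exists_add_mul_uniformizer h2 hu0 hcu two'
  -- The square of `u` is fixed by `c`, so its `u`-component vanishes.
  obtain ⟨w, hw⟩ : ∃ w : F, (u : E) ^ 2 = algebraMap F E w := by
    obtain ⟨a, b, hab⟩ := hdec ((u : E) ^ 2)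
    have h' := congrArg c hab
    simp only [map_add, map_mul, map_pow, AlgEquiv.commutes, hcu] at h'
    have : 2 * ((u : E) ^ 2 - algebraMap F E a) = 0 := by linear_combination hab + h'
    exact ⟨a, sub_eq_zero.mp ((mul_eq_zero.mp this).resolve_left two')⟩
  have heven : ∀ a : F, a ≠ 0 → ∃ j : ℤ, ‖a‖ = ‖(u : E)‖ ^ (2 * j) := by
    intro a ha
    obtain ⟨j, hj⟩ := hzpow (algebraMap F E a) (by simpa using ha)
    rw [norm_algebraMap'] at hj
    rcases Int.even_or_odd' j with ⟨m, rfl | rfl⟩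
    · exact ⟨m, hj⟩
    -- An element of `F` of odd valuation, divided by a power of `w = u ^ 2`, would have norm `‖u‖`;
    -- its powers would then attain every norm of `E`, against ramification.
    · exfalso
      obtain ⟨y, hy0, hy⟩ := hEF.ramified
      obtain ⟨l, hl⟩ := hzpow y hy0
      have hwn : ‖w‖ = ‖(u : E)‖ ^ (2 : ℤ) := by
        rw [← norm_algebraMap' E w, ← hw, norm_pow]; norm_cast
      apply hy ((a / w ^ m) ^ l)
      rw [norm_zpow, norm_div, norm_zpow, hj, hwn, hl, ← zpow_mul, ← zpow_sub₀ hpos.ne']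
      congr 1
      have : (2 * m + 1 - 2 * m : ℤ) = 1 := by ring
      rw [this, zpow_one]
  have hnorm : ∀ a b : F, ‖algebraMap F E a + algebraMap F E b * u‖
      = max ‖a‖ (‖b‖ * ‖(u : E)‖) := by
    intro a b
    by_cases ha : a = 0
    · subst ha
      have : 0 ≤ ‖b‖ * ‖(u : E)‖ := by positivity
      simp [norm_algebraMap', norm_mul, this]
    by_cases hb : b = 0
    · subst hb
      simp [norm_algebraMap']
    rw [IsUltrametricDist.norm_add_eq_max_of_norm_ne_norm]
    · simp [norm_algebraMap', norm_mul]
    · rw [norm_mul, norm_algebraMap', norm_algebraMap']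
      obtain ⟨i, hi⟩ := heven a ha
      obtain ⟨j, hj⟩ := heven b hb
      rw [hi, hj]
      intro h
      have h3 : ‖(u : E)‖ ^ (2 * i) = ‖(u : E)‖ ^ (2 * j + 1) := by
        rw [h, zpow_add_one₀ hpos.ne']
      have := (zpow_right_injective₀ hpos hlt.ne) h3
      omega
  have hconj : ∀ a b : F, c (algebraMap F E a + algebraMap F E b * u)
      = algebraMap F E a + algebraMap F E (-b) * u := by
    intro a b
    simp [hcu]
  refine ⟨hpos, hlt, hzpow, ?_, ?_, hcu, two, ?_, ?_, ?_, ?_, hprop, hdvr, hfin⟩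
  · intro x
    obtain ⟨a, b, rfl⟩ := hdec x
    rw [hconj, hnorm, hnorm, norm_neg]
  · intro x
    obtain ⟨a, b, rfl⟩ := hdec x
    rw [hconj, hconj, neg_neg]
  · intro x hx
    obtain ⟨a, b, rfl⟩ := hdec x
    rw [hnorm] at hx
    rw [hconj]
    have e1 : algebraMap F E a + algebraMap F E b * u - (algebraMap F E a
      + algebraMap F E (-b) * u) = 2 * (algebraMap F E b * u) := by simp; ring
    rw [e1, norm_mul, two, one_mul, norm_mul, norm_algebraMap']
    have h1 := (le_max_right _ _).trans hx
    -- The valuation of `b u` is odd, so its norm cannot be exactly one.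
    refine lt_of_le_of_ne h1 fun h => ?_
    have hb : b ≠ 0 := by rintro rfl; simp at h
    obtain ⟨j, hj⟩ := heven b hb
    rw [hj, ← zpow_add_one₀ hpos.ne'] at h
    have := (zpow_right_injective₀ hpos hlt.ne) (h.trans (zpow_zero _).symm)
    omega
  · intro x hx hcx
    obtain ⟨a, b, rfl⟩ := hdec x
    rw [hconj] at hcx
    have : 2 * (algebraMap F E b * u) = 0 := by
      rw [map_neg] at hcx; linear_combination -hcx
    have h0 := (mul_eq_zero.mp this).resolve_left two'
    rw [h0, add_zero] at hx ⊢
    rw [norm_algebraMap']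
    exact heven a (by simpa using hx)
  · intro x hcx
    obtain ⟨a, b, rfl⟩ := hdec x
    rw [hconj] at hcx
    have : 2 * (algebraMap F E b * u) = 0 := by
      rw [map_neg] at hcx; linear_combination -hcx
    have h0 := (mul_eq_zero.mp this).resolve_left two'
    exact ⟨a, by rw [h0, add_zero]⟩
  · let f0 : Valued.integer F →+* Valued.integer E :=
      { toFun := fun a => ⟨algebraMap F E a, by
          rw [mem_integer_iff, norm_algebraMap']; exact norm_coe_integer_le a⟩
        map_one' := by ext; simp
        map_mul' := fun a b => by ext; simp
        map_zero' := by ext; simp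
        map_add' := fun a b => by ext; simp }
    let f := (IsLocalRing.residue (Valued.integer E)).comp f0
    have : IsLocalHom f0 := ⟨fun a ha => by
      rw [isUnit_integer_iff] at ha ⊢
      have : ‖algebraMap F E a‖ = 1 := ha
      rwa [norm_algebraMap'] at this⟩
    have : IsLocalHom f := RingHom.isLocalHom_comp _ _
    -- An integral `a + b u` is congruent to `a`, again because `b u` has odd valuation.
    have hsurj : Function.Surjective f := by
      intro y
      obtain ⟨x, rfl⟩ := IsLocalRing.residue_surjective y
      obtain ⟨a, b, hab⟩ := hdec x
      have hx := norm_coe_integer_le x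
      rw [hab, hnorm] at hx
      have ha := (le_max_left _ _).trans hx
      have hb := (le_max_right _ _).trans hx
      refine ⟨⟨a, mem_integer_iff.mpr ha⟩, ?_⟩
      rw [RingHom.comp_apply, ← sub_eq_zero, ← map_sub, IsLocalRing.residue_eq_zero_iff,
        IsLocalRing.mem_maximalIdeal, mem_nonunits_iff, isUnit_integer_iff]
      have e1 : (((f0 ⟨a, mem_integer_iff.mpr ha⟩ - x : Valued.integer E)) : E)
        = -(algebraMap F E b * u) := by
        push_cast
        rw [hab]
        change algebraMap F E a - _ = _
        ring
      rw [e1, norm_neg, norm_mul, norm_algebraMap']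
      intro h
      have hb0 : b ≠ 0 := by rintro rfl; simp at h
      obtain ⟨j, hj⟩ := heven b hb0
      rw [hj, ← zpow_add_one₀ hpos.ne'] at h
      have := (zpow_right_injective₀ hpos hlt.ne) (h.trans (zpow_zero _).symm)
      omega
    have hbij : Function.Bijective (IsLocalRing.ResidueField.lift f) := by
      refine ⟨RingHom.injective _, fun y => ?_⟩
      obtain ⟨x, rfl⟩ := hsurj y
      exact ⟨IsLocalRing.residue _ x, IsLocalRing.ResidueField.lift_residue_apply f x⟩
    exact (Nat.card_congr (Equiv.ofBijective _ hbij)).symm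

end FieldFacts

/-! ### Coranks of alternating matrices under bordering by one row and column. -/

section AlternatingMatrices

variable {k : Type*} [Field k] {n : ℕ}

/-- The kernel of a square matrix, given as a function of two variables. -/
def matrixKer {ι : Type*} [Fintype ι] (σ : ι → ι → k) : Submodule k (ι → k) where
  carrier := {d | ∀ i, ∑ j, σ i j * d j = 0}
  zero_mem' := by simp
  add_mem' := by
    intro a b ha hb i
    simp [mul_add, Finset.sum_add_distrib, ha i, hb i]
  smul_mem' := by
    intro r a ha i
    simp only [Pi.smul_apply, smul_eq_mul, mul_left_comm _ r, ← Finset.mul_sum, ha i, mul_zero]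

theorem mem_matrixKer {ι : Type*} [Fintype ι] {σ : ι → ι → k} {d : ι → k} :
    d ∈ matrixKer σ ↔ ∀ i, ∑ j, σ i j * d j = 0 := Iff.rfl

/-- A square matrix is alternating if it is skew-symmetric with zero diagonal. -/
structure IsAlternating {ι : Type*} (σ : ι → ι → k) : Prop where
  skew : ∀ i j, σ j i = -σ i j
  diag : ∀ i, σ i i = 0

theorem IsAlternating.minor {σ : Fin (n + 1) → Fin (n + 1) → k} (hσ : IsAlternating σ) :
    IsAlternating fun i j : Fin n => σ i.succ j.succ :=
  ⟨fun i j => hσ.skew _ _, fun i => hσ.diag _⟩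

theorem IsAlternating.sum_swap {ι : Type*} [Fintype ι] {σ : ι → ι → k} (hσ : IsAlternating σ)
    (d v : ι → k) : ∑ i, (∑ j, σ i j * d j) * v i = -∑ i, (∑ j, σ i j * v j) * d i := by
  simp_rw [Finset.sum_mul]
  rw [Finset.sum_comm, ← Finset.sum_neg_distrib]
  refine Finset.sum_congr rfl fun i _ => ?_
  rw [← Finset.sum_neg_distrib]
  refine Finset.sum_congr rfl fun j _ => ?_
  rw [hσ.skew i j]; ring

theorem IsAlternating.sum_self [NeZero (2 : k)] {ι : Type*} [Fintype ι] {σ : ι → ι → k}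
    (hσ : IsAlternating σ) (d : ι → k) : ∑ i, (∑ j, σ i j * d j) * d i = 0 := by
  have h := hσ.sum_swap d d
  have h2 : (2 : k) * ∑ i, (∑ j, σ i j * d j) * d i = 0 := by linear_combination h
  exact (mul_eq_zero.mp h2).resolve_left (NeZero.ne _)

theorem mem_matrixKer_cons {σ : Fin (n + 1) → Fin (n + 1) → k} (hσ : IsAlternating σ)
    {w : Fin (n + 1) → k} : w ∈ matrixKer σ ↔
      ∑ j : Fin n, σ j.succ 0 * w j.succ = 0 ∧
      ∀ i : Fin n, σ i.succ 0 * w 0 + ∑ j : Fin n, σ i.succ j.succ * w j.succ = 0 := by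
  rw [mem_matrixKer, Fin.forall_fin_succ]
  simp only [Fin.sum_univ_succ, hσ.diag 0, zero_mul, zero_add]
  refine and_congr_left fun _ => ?_
  simp only [fun j : Fin n => hσ.skew j.succ 0, neg_mul, Finset.sum_neg_distrib, neg_eq_zero]

/-- If `d` maps to the new column, then `w ↦ (w 0, w' + w 0 • d)` identifies the kernel with `k`
times the kernel of the minor. The equation of the new row comes for free: by skewness it reduces to
`d` being isotropic for the minor. -/
theorem finrank_matrixKer_of_mem_range [NeZero (2 : k)] {σ : Fin (n + 1) → Fin (n + 1) → k}
    (hσ : IsAlternating σ) {d : Fin n → k}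
    (hd : ∀ i : Fin n, ∑ j : Fin n, σ i.succ j.succ * d j = σ i.succ 0) :
    Module.finrank k (matrixKer σ)
      = Module.finrank k (matrixKer fun i j : Fin n => σ i.succ j.succ) + 1 := by
  have hσ' := hσ.minor
  let f : matrixKer σ →ₗ[k] k × (matrixKer fun i j : Fin n => σ i.succ j.succ) :=
    { toFun := fun w => (w.1 0, ⟨fun j => w.1 j.succ + w.1 0 * d j, fun i => by
        have := ((mem_matrixKer_cons hσ).mp w.2).2 i
        simp only [mul_add, Finset.sum_add_distrib, mul_left_comm _ (w.1 0), ← Finset.mul_sum, hd]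
        linear_combination this⟩)
      map_add' := fun a b => by
        ext <;> simp; ring
      map_smul' := fun a b => by
        ext <;> simp; ring }
  have hf : Function.Bijective f := by
    constructor
    · intro a b hab
      have h0 : a.1 0 = b.1 0 := congrArg Prod.fst hab
      ext i
      refine Fin.cases h0 (fun j => ?_) i
      have := congrFun (congrArg Subtype.val (congrArg Prod.snd hab)) j
      simp only [f, LinearMap.coe_mk, AddHom.coe_mk, h0] at this
      exact add_right_cancel this
    · rintro ⟨z, v, hv⟩
      refine ⟨⟨Fin.cons z fun j => v j - z * d j, ?_⟩, ?_⟩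
      · rw [mem_matrixKer_cons hσ]
        have h1 : ∀ i : Fin n, ∑ j : Fin n, σ i.succ j.succ * (v j - z * d j)
            = -(z * σ i.succ 0) := by
          intro i
          simp only [mul_sub, Finset.sum_sub_distrib, mul_left_comm _ z, ← Finset.mul_sum, hd]
          rw [mem_matrixKer.mp hv i, zero_sub]
        refine ⟨?_, fun i => ?_⟩
        · simp only [Fin.cons_succ]
          have h2 := hσ'.sum_swap d (fun j => v j - z * d j)
          simp only [hd, h1] at h2
          rw [h2]
          have h3 := hσ'.sum_self d
          simp only [hd] at h3
          simp only [neg_mul, Finset.sum_neg_distrib, neg_neg, mul_assoc, ← Finset.mul_sum, h3,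
            mul_zero]
        · simp only [Fin.cons_zero, Fin.cons_succ, h1]; ring
      · ext <;> simp [f]
  rw [(LinearEquiv.ofBijective f hf).finrank_eq, Module.finrank_prod, Module.finrank_self, add_comm]

/-- The range of a map is the annihilator of the kernel of its transpose, and the transpose of a
skew matrix is its negative. -/
theorem IsAlternating.mem_range_of_forall_ker {ι : Type*} [Fintype ι]
    {σ : ι → ι → k} (hσ : IsAlternating σ) {τ : ι → k}
    (h : ∀ v ∈ matrixKer σ, ∑ i, τ i * v i = 0) : ∃ d : ι → k, ∀ i, ∑ j, σ i j * d j = τ i := by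
  classical
  let f : (ι → k) →ₗ[k] (ι → k) :=
    { toFun := fun v i => ∑ j, σ i j * v j
      map_add' := fun a b => by ext; simp [mul_add, Finset.sum_add_distrib]
      map_smul' := fun a b => by
        ext; simp only [Pi.smul_apply, smul_eq_mul, mul_left_comm _ a, ← Finset.mul_sum]; rfl }
  let φ : Module.Dual k (ι → k) := ∑ i, τ i • LinearMap.proj i
  have hφ : ∀ v, φ v = ∑ i, τ i * v i := fun v => by simp [φ]
  have hmem : φ ∈ (LinearMap.ker f).dualAnnihilator := by
    rw [Submodule.mem_dualAnnihilator]
    intro v hv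
    rw [hφ]
    exact h v fun i => congrFun hv i
  rw [← LinearMap.range_dualMap_eq_dualAnnihilator_ker] at hmem
  obtain ⟨g, hg⟩ := hmem
  have hg' : ∀ w, g w = ∑ i, g (Pi.single i 1) * w i := by
    intro w
    conv_lhs => rw [← Finset.univ_sum_single w]
    rw [map_sum]
    refine Finset.sum_congr rfl fun i _ => ?_
    have : Pi.single i (w i) = w i • (Pi.single i 1 : ι → k) := by
      rw [← Pi.single_smul]; simp
    rw [this, map_smul, smul_eq_mul, mul_comm]
  -- The functional `g` solves the transposed system, which is where the sign comes from.
  refine ⟨fun i => -g (Pi.single i 1), fun i => ?_⟩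
  have h1 : φ (Pi.single i 1) = τ i := by rw [hφ]; simp [Pi.single_apply]
  rw [← h1, ← hg, LinearMap.dualMap_apply, hg']
  refine Finset.sum_congr rfl fun j _ => ?_
  have : f (Pi.single i 1) j = σ j i := by simp [f, Pi.single_apply]
  rw [this, hσ.skew i j]; ring

/-- Here the new coordinate of a kernel vector must vanish, since otherwise dividing by it would
solve for the column. What remains is the part of the kernel of the minor annihilated by the column;
that functional is nonzero there, so the dimension drops by one. -/
theorem finrank_matrixKer_of_not_mem_range {σ : Fin (n + 1) → Fin (n + 1) → k}
    (hσ : IsAlternating σ)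
    (hd : ¬ ∃ d : Fin n → k, ∀ i : Fin n, ∑ j : Fin n, σ i.succ j.succ * d j = σ i.succ 0) :
    Module.finrank k (matrixKer σ) + 1
      = Module.finrank k (matrixKer fun i j : Fin n => σ i.succ j.succ) := by
  let ρ : Fin n → Fin n → k := fun i j => σ i.succ j.succ
  have hσ' : IsAlternating ρ := hσ.minor
  let φ : Module.Dual k (matrixKer ρ) :=
    (∑ i : Fin n, σ i.succ 0 • LinearMap.proj i).comp (matrixKer ρ).subtype
  have hφ : ∀ v, φ v = ∑ i : Fin n, σ i.succ 0 * v.1 i := fun v => by simp [φ]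
  have hφ0 : φ ≠ 0 := by
    intro h0
    refine hd (hσ'.mem_range_of_forall_ker fun v hv => ?_)
    have := hφ ⟨v, hv⟩
    rw [h0] at this
    exact this.symm
  rw [← Module.Dual.finrank_ker_add_one_of_ne_zero hφ0]
  congr 1
  have hw0 : ∀ w ∈ matrixKer σ, w 0 = 0 := by
    intro w hw
    by_contra h0
    refine hd ⟨fun j => -(w 0)⁻¹ * w j.succ, fun i => ?_⟩
    have := ((mem_matrixKer_cons hσ).mp hw).2 i
    simp only [mul_left_comm _ (-(w 0)⁻¹), ← Finset.mul_sum]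
    rw [eq_neg_of_add_eq_zero_right this]
    field_simp
  let f : matrixKer σ →ₗ[k] LinearMap.ker φ :=
    { toFun := fun w => ⟨⟨fun j => w.1 j.succ, fun i => by
        have := ((mem_matrixKer_cons hσ).mp w.2).2 i
        rwa [hw0 _ w.2, mul_zero, zero_add] at this⟩, by
          rw [LinearMap.mem_ker, hφ]; exact ((mem_matrixKer_cons hσ).mp w.2).1⟩
      map_add' := fun a b => rfl
      map_smul' := fun a b => rfl }
  refine (LinearEquiv.ofBijective f ⟨?_, ?_⟩).finrank_eq
  · intro a b hab
    ext i
    refine Fin.cases ?_ (fun j => ?_) i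
    · rw [hw0 _ a.2, hw0 _ b.2]
    · exact congrFun (congrArg (fun x => x.1.1) hab) j
  · rintro ⟨⟨v, hv⟩, hv'⟩
    refine ⟨⟨Fin.cons 0 v, ?_⟩, rfl⟩
    rw [mem_matrixKer_cons hσ]
    rw [LinearMap.mem_ker, hφ] at hv'
    exact ⟨by simpa using hv', fun i => by simpa using mem_matrixKer.mp hv i⟩

/-- Each bordering changes the corank by `1` or `-1`, so the corank has the parity of the size. -/
theorem IsAlternating.even_add_finrank [NeZero (2 : k)] : ∀ {n : ℕ} {σ : Fin n → Fin n → k},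
    IsAlternating σ → Even (n + Module.finrank k (matrixKer σ))
  | 0, σ, _ => by
    have := Module.finrank_zero_of_subsingleton (R := k) (M := matrixKer σ)
    simp [this]
  | n + 1, σ, hσ => by
    have ih := hσ.minor.even_add_finrank
    by_cases hd : ∃ d : Fin n → k, ∀ i : Fin n, ∑ j : Fin n, σ i.succ j.succ * d j = σ i.succ 0
    · obtain ⟨d, hd⟩ := hd
      rw [finrank_matrixKer_of_mem_range hσ hd]
      rw [Nat.even_iff] at ih ⊢; omega
    · have := finrank_matrixKer_of_not_mem_range hσ hd
      rw [Nat.even_iff] at ih ⊢; omega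

end AlternatingMatrices

/-! ### Counting lifts for the standard skew-hermitian form over a finite local ring. -/

section FiniteRingCount

theorem natCard_eq_card_mul_of_fiber {A B : Type*} [Finite A] [Finite B] (f : A → B) (m : ℕ)
    (h : ∀ b, Nat.card {a // f a = b} = m) : Nat.card A = Nat.card B * m := by
  cases nonempty_fintype B
  rw [← Nat.card_congr (Equiv.sigmaFiberEquiv f), Nat.card_sigma]
  simp [h]

variable {R k : Type*} [CommRing R] [Field k] {s : ℕ}

/-- The standard skew-hermitian form on `R ^ (2 s)`. -/
def skewForm (conj : R →+* R) (x y : Fin s → Fin 2 → R) : R :=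
  ∑ i, (x i 0 * conj (y i 1) - x i 1 * conj (y i 0))

theorem skewForm_add_left (conj : R →+* R) (x x' y : Fin s → Fin 2 → R) :
    skewForm conj (x + x') y = skewForm conj x y + skewForm conj x' y := by
  simp only [skewForm, ← Finset.sum_add_distrib, Pi.add_apply]
  exact Finset.sum_congr rfl fun i _ => by ring

theorem skewForm_add_right (conj : R →+* R) (x y y' : Fin s → Fin 2 → R) :
    skewForm conj x (y + y') = skewForm conj x y + skewForm conj x y' := by
  simp only [skewForm, ← Finset.sum_add_distrib, Pi.add_apply, map_add]
  exact Finset.sum_congr rfl fun i _ => by ring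

theorem skewForm_smul_left (conj : R →+* R) (a : R) (x y : Fin s → Fin 2 → R) :
    skewForm conj (a • x) y = a * skewForm conj x y := by
  simp only [skewForm, Finset.mul_sum, Pi.smul_apply, smul_eq_mul]
  exact Finset.sum_congr rfl fun i _ => by ring

theorem skewForm_smul_right (conj : R →+* R) (a : R) (x y : Fin s → Fin 2 → R) :
    skewForm conj x (a • y) = conj a * skewForm conj x y := by
  simp only [skewForm, Finset.mul_sum, Pi.smul_apply, smul_eq_mul, map_mul]
  exact Finset.sum_congr rfl fun i _ => by ring

theorem skewForm_sum_left (conj : R →+* R) {ι : Type*} (t : Finset ι)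
    (x : ι → Fin s → Fin 2 → R) (y : Fin s → Fin 2 → R) :
    skewForm conj (∑ j ∈ t, x j) y = ∑ j ∈ t, skewForm conj (x j) y := by
  classical
  induction t using Finset.induction_on with
  | empty => simp [skewForm]
  | insert a t ha ih => rw [Finset.sum_insert ha, Finset.sum_insert ha, skewForm_add_left, ih]

theorem skewForm_sum_right (conj : R →+* R) {ι : Type*} (t : Finset ι) (x : Fin s → Fin 2 → R)
    (y : ι → Fin s → Fin 2 → R) :
    skewForm conj x (∑ j ∈ t, y j) = ∑ j ∈ t, skewForm conj x (y j) := by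
  classical
  induction t using Finset.induction_on with
  | empty => simp [skewForm]
  | insert a t ha ih => rw [Finset.sum_insert ha, Finset.sum_insert ha, skewForm_add_right, ih]

theorem conj_skewForm {conj : R →+* R} (h : ∀ a, conj (conj a) = a) (x y : Fin s → Fin 2 → R) :
    conj (skewForm conj x y) = -skewForm conj y x := by
  simp only [skewForm, map_sum, map_sub, map_mul, h, ← Finset.sum_neg_distrib]
  exact Finset.sum_congr rfl fun i _ => by ring

/-- A finite local ring with an involution which is trivial on the residue field, of
characteristic different from two. -/
structure IsLocalInvolution (res : R →+* k) (conj : R →+* R) : Prop where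
  finite : Finite R
  surjective : Function.Surjective res
  isUnit : ∀ a, res a ≠ 0 → IsUnit a
  conj_conj : ∀ a, conj (conj a) = a
  res_conj : ∀ a, res (conj a) = res a
  two_ne_zero : (2 : k) ≠ 0

variable {S : Type*} [CommRing S]

/-- Coordinatewise reduction. -/
def redVec (res : R →+* S) (x : Fin s → Fin 2 → R) : Fin s → Fin 2 → S := fun i j => res (x i j)

theorem redVec_add (res : R →+* S) (x y : Fin s → Fin 2 → R) :
    redVec res (x + y) = redVec res x + redVec res y := by
  ext; simp [redVec]

theorem redVec_smul (res : R →+* S) (a : R) (x : Fin s → Fin 2 → R) :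
    redVec res (a • x) = res a • redVec res x := by
  ext; simp [redVec]

theorem redVec_sum (res : R →+* S) {ι : Type*} (t : Finset ι) (x : ι → Fin s → Fin 2 → R) :
    redVec res (∑ j ∈ t, x j) = ∑ j ∈ t, redVec res (x j) := by
  ext; simp [redVec, Finset.sum_apply]

theorem redVec_surjective {res : R →+* S} (h : Function.Surjective res) :
    Function.Surjective (redVec res : (Fin s → Fin 2 → R) → _) := by
  intro y
  choose g hg using h
  exact ⟨fun i j => g (y i j), by ext; simp [redVec, hg]⟩

theorem IsLocalInvolution.res_skewForm {res : R →+* k} {conj : R →+* R}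
    (h : IsLocalInvolution res conj) (x y : Fin s → Fin 2 → R) :
    res (skewForm conj x y) = skewForm (RingHom.id k) (redVec res x) (redVec res y) := by
  simp [skewForm, redVec, h.res_conj]

/-- Coordinates on the span of an independent family extend to the whole space, and the symplectic
form represents every functional. -/
theorem exists_dual_family {n : ℕ} {x : Fin n → Fin s → Fin 2 → k} (hx : LinearIndependent k x) :
    ∃ y : Fin n → Fin s → Fin 2 → k, ∀ i j,
      skewForm (RingHom.id k) (x i) (y j) = if i = j then 1 else 0 := by
  classical
  have hker : LinearMap.ker (Fintype.linearCombination k x) = ⊥ :=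
    LinearMap.ker_eq_bot'.mpr fun g hg => funext (Fintype.linearIndependent_iff.mp hx g hg)
  obtain ⟨g, hg⟩ := LinearMap.exists_leftInverse_of_injective _ hker
  have hg' : ∀ i j, g (x i) j = if i = j then 1 else 0 := by
    intro i j
    have h1 := LinearMap.congr_fun hg (Pi.single i 1)
    have h2 := congrFun h1 j
    simp only [LinearMap.comp_apply, Fintype.linearCombination_apply_single, one_smul,
      LinearMap.id_apply, Pi.single_apply] at h2
    rw [h2]; simp [eq_comm]
  -- The representing vector of a functional exchanges the two coordinates of each plane, with one
  -- sign.
  refine ⟨fun j i' => ![-(g (Pi.single i' (Pi.single 1 1)) j), g (Pi.single i' (Pi.single 0 1)) j],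
    fun i j => ?_⟩
  rw [← hg']
  have hexp : x i = ∑ i', (x i i' 0 • (Pi.single i' (Pi.single 0 1) : Fin s → Fin 2 → k)
      + x i i' 1 • (Pi.single i' (Pi.single 1 1) : Fin s → Fin 2 → k)) := by
    ext a b
    simp only [Finset.sum_apply, Pi.add_apply, Pi.smul_apply, Pi.single_apply]
    rw [Finset.sum_eq_single a]
    · fin_cases b <;> simp
    · intro a' _ ha'
      simp [ha'.symm]
    · simp
  conv_rhs => rw [hexp]
  simp only [map_sum, map_add, map_smul, Finset.sum_apply, Pi.add_apply, Pi.smul_apply, smul_eq_mul,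
    skewForm, RingHom.id_apply]
  refine Finset.sum_congr rfl fun i' _ => ?_
  simp

variable {res : R →+* k} {conj : R →+* R}

/-- Lift a dual family from the residue field. Its matrix of pairings with `x` reduces to the
identity, so it is invertible over the local ring and the system can be solved. The second clause
says that small data have small solutions. -/
theorem IsLocalInvolution.exists_solution (h : IsLocalInvolution res conj) {n : ℕ}
    {x : Fin n → Fin s → Fin 2 → R} (hx : LinearIndependent k fun i => redVec res (x i))
    (τ : Fin n → R) : ∃ v, (∀ i, skewForm conj (x i) v = τ i) ∧
      ((∀ i, res (τ i) = 0) → redVec res v = 0) := by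
  classical
  obtain ⟨ybar, hy⟩ := exists_dual_family hx
  choose y hy' using fun j => redVec_surjective h.surjective (ybar j)
  let A : Matrix (Fin n) (Fin n) R := Matrix.of fun i j => skewForm conj (x i) (y j)
  have hA : A.map res = 1 := by
    ext i j
    simp [A, h.res_skewForm, hy', hy, Matrix.one_apply]
  have hdet : IsUnit A.det := by
    apply h.isUnit
    rw [RingHom.map_det, RingHom.mapMatrix_apply, hA, Matrix.det_one]
    exact one_ne_zero
  let a := A⁻¹.mulVec τ
  -- Coefficients are conjugated because the form is semilinear in its second variable.
  refine ⟨∑ j, conj (a j) • y j, fun i => ?_, fun hτ => ?_⟩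
  · have h1 : A.mulVec a = τ := by
      simp [a, Matrix.mulVec_mulVec, Matrix.mul_nonsing_inv _ hdet]
    rw [← h1, skewForm_sum_right]
    simp only [Matrix.mulVec, dotProduct, skewForm_smul_right, h.conj_conj]
    exact Finset.sum_congr rfl fun j _ => by simp [A, mul_comm]
  · rw [redVec_sum]
    refine Finset.sum_eq_zero fun j _ => ?_
    have : res (a j) = 0 := by
      simp [a, Matrix.mulVec, dotProduct, map_sum, hτ]
    rw [redVec_smul, h.res_conj, this, zero_smul]

/-- The lifts of `vbar` satisfying the equations form a torsor under the solutions of the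
homogeneous system that reduce to zero: correct an arbitrary lift by a small solution. -/
theorem IsLocalInvolution.card_lift (h : IsLocalInvolution res conj) {n : ℕ}
    {x : Fin n → Fin s → Fin 2 → R} (hx : LinearIndependent k fun i => redVec res (x i))
    (τ : Fin n → R) (vbar : Fin s → Fin 2 → k)
    (hv : ∀ i, skewForm (RingHom.id k) (redVec res (x i)) vbar = res (τ i)) :
    Nat.card {v // (∀ i, skewForm conj (x i) v = τ i) ∧ redVec res v = vbar}
      = Nat.card {v // (∀ i, skewForm conj (x i) v = 0) ∧ redVec res v = 0} := by
  obtain ⟨v0, hv0⟩ := redVec_surjective h.surjective vbar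
  obtain ⟨v1, hv1, hv1'⟩ := h.exists_solution hx fun i => τ i - skewForm conj (x i) v0
  have h1 := hv1' fun i => by rw [map_sub, h.res_skewForm, hv0, hv, sub_self]
  refine Nat.card_congr ((Equiv.addRight (v0 + v1)).subtypeEquiv fun v => ?_).symm
  simp only [Equiv.coe_addRight, skewForm_add_right, redVec_add, hv0, h1, hv1]
  refine and_congr (forall_congr' fun i => ⟨fun h => by rw [h]; ring, fun h => ?_⟩)
    ⟨fun h => by rw [h]; simp, fun h => ?_⟩
  · linear_combination h
  · simpa using h

/-- Pairing with `x` maps the vectors over the maximal ideal onto the `n`-tuples of the maximal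
ideal, with all fibres of the same size. -/
theorem IsLocalInvolution.card_ker (h : IsLocalInvolution res conj) {n : ℕ}
    {x : Fin n → Fin s → Fin 2 → R} (hx : LinearIndependent k fun i => redVec res (x i)) :
    Nat.card {a : R // res a = 0} ^ (s * 2)
      = Nat.card {a : R // res a = 0} ^ n *
        Nat.card {v // (∀ i, skewForm conj (x i) v = 0) ∧ redVec res v = 0} := by
  have := h.finite
  let f : {v : Fin s → Fin 2 → R // redVec res v = 0} → (Fin n → {a : R // res a = 0}) :=
    fun v i => ⟨skewForm conj (x i) v.1, by
      rw [h.res_skewForm, v.2]; simp [skewForm]⟩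
  have h1 := natCard_eq_card_mul_of_fiber f
    (Nat.card {v // (∀ i, skewForm conj (x i) v = 0) ∧ redVec res v = 0}) fun τ => by
      rw [← h.card_lift hx (fun i => (τ i).1) 0 (fun i => by rw [(τ i).2]; simp [skewForm])]
      refine Nat.card_congr ⟨fun v => ⟨v.1.1, fun i => congrArg Subtype.val (congrFun v.2 i), v.1.2⟩,
        fun v => ⟨⟨v.1, v.2.2⟩, funext fun i => Subtype.ext (v.2.1 i)⟩, fun v => rfl, fun v => rfl⟩
  rw [Nat.card_fun, Nat.card_fin] at h1
  rw [← h1, pow_mul]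
  have e : {v : Fin s → Fin 2 → R // redVec res v = 0} ≃ (Fin s → Fin 2 → {a : R // res a = 0}) :=
    ⟨fun v i j => ⟨v.1 i j, congrFun (congrFun v.2 i) j⟩,
      fun v => ⟨fun i j => (v i j).1, funext fun i => funext fun j => (v i j).2⟩,
      fun v => rfl, fun v => rfl⟩
  rw [Nat.card_congr e]
  simp [Nat.card_fun, ← pow_mul, mul_comm]

theorem IsLocalInvolution.res_eq_zero_of_skew (h : IsLocalInvolution res conj) {a : R}
    (ha : conj a = -a) : res a = 0 := by
  have h1 := h.res_conj a
  rw [ha, map_neg] at h1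
  have : 2 * res a = 0 := by linear_combination -h1
  exact (mul_eq_zero.mp this).resolve_left h.two_ne_zero

/-- Since `vbar` is independent of the reductions of the `x i`, there is a vector `δ` orthogonal to
the `x i` and pairing to one with a lift of `vbar`. Adding `r • δ` with `r` skew keeps the linear
conditions and moves the self-pairing by `r` times a unit, up to sign. Every lift is therefore
uniquely a lift with self-pairing `a` plus a skew multiple of `δ`. -/
theorem IsLocalInvolution.card_lift_self (h : IsLocalInvolution res conj) {n : ℕ}
    {x : Fin n → Fin s → Fin 2 → R} (hx : LinearIndependent k fun i => redVec res (x i))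
    (τ : Fin n → R) (vbar : Fin s → Fin 2 → k)
    (hv : ∀ i, skewForm (RingHom.id k) (redVec res (x i)) vbar = res (τ i))
    (hspan : vbar ∉ Submodule.span k (Set.range fun i => redVec res (x i)))
    (a : R) (ha : conj a = -a) :
    Nat.card {v // ((∀ i, skewForm conj (x i) v = τ i) ∧ skewForm conj v v = a)
        ∧ redVec res v = vbar} * Nat.card {a : R // conj a = -a}
      = Nat.card {v // (∀ i, skewForm conj (x i) v = 0) ∧ redVec res v = 0} := by
  have := h.finite
  obtain ⟨v0, hv0⟩ := redVec_surjective h.surjective vbar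
  have hx' : LinearIndependent k fun i => redVec res ((Fin.cons v0 x : Fin (n + 1) → _) i) := by
    have : (fun i => redVec res ((Fin.cons v0 x : Fin (n + 1) → _) i))
        = Fin.cons vbar fun i => redVec res (x i) := by
      ext i : 1
      refine Fin.cases ?_ (fun j => ?_) i <;> simp [hv0]
    rw [this]
    exact linearIndependent_finCons.mpr ⟨hx, hspan⟩
  obtain ⟨δ, hδ, -⟩ := h.exists_solution hx' (Fin.cons 1 fun _ => 0)
  have hδ0 : skewForm conj v0 δ = 1 := hδ 0
  have hδi : ∀ i, skewForm conj (x i) δ = 0 := fun i => hδ i.succ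
  rw [← h.card_lift hx τ vbar hv]
  let S := {v // (∀ i, skewForm conj (x i) v = τ i) ∧ redVec res v = vbar}
  let T := {v // ((∀ i, skewForm conj (x i) v = τ i) ∧ skewForm conj v v = a) ∧ redVec res v = vbar}
  let K := {a : R // conj a = -a}
  have hT : ∀ (v : Fin s → Fin 2 → R), redVec res v = vbar → res (skewForm conj v δ) = 1 := by
    intro v hv
    rw [h.res_skewForm, hv, ← hv0, ← h.res_skewForm, hδ0, map_one]
  have hself : ∀ (v : Fin s → Fin 2 → R) (r : R), conj r = -r →
      skewForm conj (v + r • δ) (v + r • δ) = skewForm conj v v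
        - r * (skewForm conj v δ + conj (skewForm conj v δ) + r * skewForm conj δ δ) := by
    intro v r hr
    rw [skewForm_add_left, skewForm_add_right, skewForm_add_right, skewForm_smul_left,
      skewForm_smul_right, skewForm_smul_left, skewForm_smul_right, hr, conj_skewForm h.conj_conj]
    ring
  let f : T × K → S := fun p => ⟨p.1.1 + p.2.1 • δ, fun i => by
    rw [skewForm_add_right, skewForm_smul_right, hδi, mul_zero, add_zero, p.1.2.1.1], by
    rw [redVec_add, redVec_smul, h.res_eq_zero_of_skew p.2.2, zero_smul, add_zero, p.1.2.2]⟩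
  rw [← Nat.card_prod]
  refine Nat.card_eq_of_bijective f ⟨?_, ?_⟩
  · rintro ⟨⟨v, ⟨hv1, hv2⟩, hv3⟩, r, hr⟩ ⟨⟨v', ⟨hv1', hv2'⟩, hv3'⟩, r', hr'⟩ heq
    have heq' : v + r • δ = v' + r' • δ := congrArg Subtype.val heq
    have hrr : r = r' := by
      have e1 : v' = v + (r - r') • δ := by rw [sub_smul, ← add_sub_assoc, heq']; abel
      have e2 := hself v (r - r') (by rw [map_sub, hr, hr']; ring)
      rw [← e1, hv2, hv2'] at e2
      have hu : IsUnit (skewForm conj v δ + conj (skewForm conj v δ)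
          + (r - r') * skewForm conj δ δ) := by
        apply h.isUnit
        rw [map_add, map_add, h.res_conj, hT v hv3, map_mul, map_sub, h.res_eq_zero_of_skew hr,
          h.res_eq_zero_of_skew hr']
        simpa [one_add_one_eq_two] using h.two_ne_zero
      have e3 : (r - r') * (skewForm conj v δ + conj (skewForm conj v δ)
          + (r - r') * skewForm conj δ δ) = 0 := by linear_combination e2
      exact sub_eq_zero.mp (hu.mul_left_eq_zero.mp e3)
    subst hrr
    have : v = v' := add_right_cancel heq'
    subst this
    rfl
  · rintro ⟨v, hv1, hv2⟩
    let ε := skewForm conj v δ + conj (skewForm conj v δ)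
    have hκ : conj (skewForm conj δ δ) = -skewForm conj δ δ := conj_skewForm h.conj_conj _ _
    have hε : conj ε = ε := by simp only [ε, map_add, h.conj_conj]; ring
    -- The required `r` solves a quadratic equation. Instead of approximating, note that the
    -- quadratic map preserves the skew elements and is injective on this finite set, hence
    -- surjective.
    let g : K → K := fun r => ⟨r.1 * (ε + r.1 * skewForm conj δ δ), by
      rw [map_mul, map_add, map_mul, hκ, hε, r.2]; ring⟩
    have hginj : Function.Injective g := by
      intro r r' hrr
      have e1 : r.1 * (ε + r.1 * skewForm conj δ δ) = r'.1 * (ε + r'.1 * skewForm conj δ δ) :=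
        congrArg Subtype.val hrr
      have e2 : (r.1 - r'.1) * (ε + (r.1 + r'.1) * skewForm conj δ δ) = 0 := by
        linear_combination e1
      have hu : IsUnit (ε + (r.1 + r'.1) * skewForm conj δ δ) := by
        apply h.isUnit
        rw [map_add, map_add, h.res_conj, hT v hv2, map_mul, map_add, h.res_eq_zero_of_skew r.2,
          h.res_eq_zero_of_skew r'.2]
        simpa [one_add_one_eq_two] using h.two_ne_zero
      exact Subtype.ext (sub_eq_zero.mp (hu.mul_left_eq_zero.mp e2))
    obtain ⟨r, hr⟩ := (Finite.injective_iff_surjective.mp hginj) ⟨skewForm conj v v - a, by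
      rw [map_sub, conj_skewForm h.conj_conj, ha]; ring⟩
    have hr' : r.1 * (ε + r.1 * skewForm conj δ δ) = skewForm conj v v - a :=
      congrArg Subtype.val hr
    refine ⟨⟨⟨v + r.1 • δ, ⟨fun i => ?_, ?_⟩, ?_⟩, ⟨-r.1, by rw [map_neg, r.2]⟩⟩, ?_⟩
    · rw [skewForm_add_right, skewForm_smul_right, hδi, mul_zero, add_zero, hv1]
    · rw [hself v r.1 r.2]
      linear_combination -hr'
    · rw [redVec_add, redVec_smul, h.res_eq_zero_of_skew r.2, zero_smul, add_zero, hv2]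
    · apply Subtype.ext
      change v + r.1 • δ + (-r.1) • δ = v
      rw [neg_smul, add_neg_cancel_right]

end FiniteRingCount

/-! ### The number of primitive tuples with a given Gram matrix. -/

section PrimitiveCount

variable {R k : Type*} [CommRing R] [Field k] {s : ℕ}

/-- The tuples of vectors in `R ^ (2 s)` with linearly independent reductions and prescribed
Gram matrix. -/
def PrimitiveTuples (s : ℕ) (res : R →+* k) (conj : R →+* R) {n : ℕ} (σ : Fin n → Fin n → R) :
    Type _ :=
  {x : Fin n → Fin s → Fin 2 → R // (LinearIndependent k fun i => redVec res (x i)) ∧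
    ∀ i j, skewForm conj (x i) (x j) = σ i j}

theorem skewForm_id_sum_smul {n : ℕ} (x : Fin n → Fin s → Fin 2 → k) (y : Fin s → Fin 2 → k)
    (d : Fin n → k) : skewForm (RingHom.id k) y (∑ j, d j • x j)
      = ∑ j, skewForm (RingHom.id k) y (x j) * d j := by
  rw [skewForm_sum_right]
  exact Finset.sum_congr rfl fun j _ => by rw [skewForm_smul_right, RingHom.id_apply, mul_comm]

theorem card_solutions [Finite k] {n : ℕ} {x : Fin n → Fin s → Fin 2 → k}
    (hx : LinearIndependent k x) (τ : Fin n → k) :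
    Nat.card {v // ∀ i, skewForm (RingHom.id k) (x i) v = τ i} * Nat.card k ^ n
      = Nat.card k ^ (s * 2) := by
  obtain ⟨y, hy⟩ := exists_dual_family hx
  let f : (Fin s → Fin 2 → k) → (Fin n → k) := fun v i => skewForm (RingHom.id k) (x i) v
  have hsol : ∀ τ : Fin n → k, ∃ v, ∀ i, skewForm (RingHom.id k) (x i) v = τ i := fun τ =>
    ⟨∑ j, τ j • y j, fun i => by rw [skewForm_id_sum_smul]; simp [hy]⟩
  have h1 := natCard_eq_card_mul_of_fiber f
    (Nat.card {v // ∀ i, skewForm (RingHom.id k) (x i) v = τ i}) fun τ' => by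
      obtain ⟨v0, hv0⟩ := hsol fun i => τ' i - τ i
      refine Nat.card_congr ((Equiv.addRight v0).subtypeEquiv fun v => ?_).symm
      simp only [Equiv.coe_addRight, f, funext_iff, skewForm_add_right, hv0]
      refine forall_congr' fun i => ⟨fun h => by rw [h]; ring, fun h => by linear_combination h⟩
  rw [Nat.card_fun, Nat.card_fun, Nat.card_fin, Nat.card_fun, Nat.card_fin, Nat.card_fin,
    ← pow_mul] at h1
  rw [mul_comm s 2, h1, mul_comm]

/-- A vector `∑ d j • x j` of the span satisfies the equations exactly when `d` solves the system
with the Gram matrix as coefficients. -/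
theorem card_solutions_span [Finite k] {n : ℕ} {x : Fin n → Fin s → Fin 2 → k}
    (hx : LinearIndependent k x) (τ : Fin n → k) {σ : Fin n → Fin n → k}
    (hσ : ∀ i j, skewForm (RingHom.id k) (x i) (x j) = σ i j) :
    Nat.card {v // (∀ i, skewForm (RingHom.id k) (x i) v = τ i) ∧
      v ∈ Submodule.span k (Set.range x)} = Nat.card {d : Fin n → k // ∀ i, ∑ j, σ i j * d j = τ i}
    := by
  symm
  refine Nat.card_eq_of_bijective (fun d => ⟨∑ j, d.1 j • x j, fun i => ?_, ?_⟩) ⟨?_, ?_⟩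
  · rw [skewForm_id_sum_smul]; simpa [hσ] using d.2 i
  · exact Submodule.sum_mem _ fun j _ => Submodule.smul_mem _ _ (Submodule.subset_span ⟨j, rfl⟩)
  · intro d d' h
    have h1 : ∑ j, d.1 j • x j = ∑ j, d'.1 j • x j := congrArg Subtype.val h
    have h2 : ∑ j, (d.1 j - d'.1 j) • x j = 0 := by
      simp only [sub_smul, Finset.sum_sub_distrib, h1, sub_self]
    exact Subtype.ext (funext fun j =>
      sub_eq_zero.mp (Fintype.linearIndependent_iff.mp hx _ h2 j))
  · rintro ⟨v, hv, hv'⟩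
    obtain ⟨d, hd⟩ := (Submodule.mem_span_range_iff_exists_fun k).mp hv'
    refine ⟨⟨d, fun i => ?_⟩, Subtype.ext hd⟩
    rw [← hv i, ← hd, skewForm_id_sum_smul]
    simp [hσ]

theorem card_matrix_solutions [Finite k] {n : ℕ} {σ : Fin n → Fin n → k} {τ d : Fin n → k}
    (hd : ∀ i, ∑ j, σ i j * d j = τ i) :
    Nat.card {d : Fin n → k // ∀ i, ∑ j, σ i j * d j = τ i}
      = Nat.card k ^ Module.finrank k (matrixKer σ) := by
  rw [← Module.natCard_eq_pow_finrank (K := k) (V := matrixKer σ)]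
  refine Nat.card_congr ((Equiv.subRight d).subtypeEquiv fun v => ?_)
  simp only [Equiv.subRight_apply, mem_matrixKer, Pi.sub_apply, mul_sub, Finset.sum_sub_distrib,
    hd, sub_eq_zero]

variable {res : R →+* k} {conj : R →+* R}

theorem IsLocalInvolution.card_eq (h : IsLocalInvolution res conj) :
    Nat.card R = Nat.card k * Nat.card {a : R // res a = 0} := by
  have := h.finite
  have : Finite k := Finite.of_surjective res h.surjective
  refine natCard_eq_card_mul_of_fiber res _ fun b => ?_
  obtain ⟨b', rfl⟩ := h.surjective b
  refine Nat.card_congr ((Equiv.subRight b').subtypeEquiv fun v => ?_)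
  simp [sub_eq_zero]

/-- Count reductions first. There are `q ^ (2 s - n)` vectors over the residue field with the right
pairings, and those inside the span correspond to solutions `d` of the reduced Gram system. Each
remaining reduction has the same number of lifts, by `card_lift_self`. -/
theorem IsLocalInvolution.card_next (h : IsLocalInvolution res conj) {n : ℕ}
    {x : Fin n → Fin s → Fin 2 → R} (hx : LinearIndependent k fun i => redVec res (x i))
    (τ : Fin n → R) (a : R) (ha : conj a = -a) {σ : Fin n → Fin n → k}
    (hσ : ∀ i j, res (skewForm conj (x i) (x j)) = σ i j) :
    (Nat.card {v // redVec res v ∉ Submodule.span k (Set.range fun i => redVec res (x i)) ∧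
        (∀ i, skewForm conj (x i) v = τ i) ∧ skewForm conj v v = a} : ℝ)
      * Nat.card {a : R // conj a = -a} * Nat.card R ^ n
      = Nat.card R ^ (s * 2) * (1 - Nat.card {d : Fin n → k // ∀ i, ∑ j, σ i j * d j = res (τ i)}
        * Nat.card k ^ n / Nat.card k ^ (s * 2)) := by
  have := h.finite
  have : Finite k := Finite.of_surjective res h.surjective
  set Z := Nat.card {v // (∀ i, skewForm conj (x i) v = 0) ∧ redVec res v = 0} with hZ
  set A := {v // redVec res v ∉ Submodule.span k (Set.range fun i => redVec res (x i)) ∧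
        (∀ i, skewForm conj (x i) v = τ i) ∧ skewForm conj v v = a}
  let P : (Fin s → Fin 2 → k) → Prop := fun vbar =>
    ∀ i, skewForm (RingHom.id k) (redVec res (x i)) vbar = res (τ i)
  let Q : (Fin s → Fin 2 → k) → Prop := fun vbar =>
    vbar ∈ Submodule.span k (Set.range fun i => redVec res (x i))
  let B := {vbar // P vbar ∧ ¬ Q vbar}
  have hA : Nat.card A * Nat.card {a : R // conj a = -a} = Nat.card B * Z := by
    let f : A × {a : R // conj a = -a} → B := fun v => ⟨redVec res v.1.1, fun i => by
      rw [← h.res_skewForm, v.1.2.2.1], v.1.2.1⟩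
    rw [← Nat.card_prod]
    refine natCard_eq_card_mul_of_fiber f Z fun b => ?_
    rw [hZ, ← h.card_lift_self hx τ b.1 b.2.1 b.2.2 a ha, ← Nat.card_prod]
    refine Nat.card_congr
      ⟨fun v => (⟨v.1.1.1, v.1.1.2.2, congrArg Subtype.val v.2⟩, v.1.2),
        fun v => ⟨(⟨v.1.1, by rw [v.1.2.2]; exact b.2.2, v.1.2.1⟩, v.2), Subtype.ext v.1.2.2⟩,
        fun v => rfl, fun v => rfl⟩
  have hB : Nat.card B + Nat.card {d : Fin n → k // ∀ i, ∑ j, σ i j * d j = res (τ i)}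
      = Nat.card {v // P v} := by
    rw [← card_solutions_span hx (fun i => res (τ i)) (fun i j => by
      rw [← h.res_skewForm, hσ]), add_comm]
    classical
    cases nonempty_fintype k
    simp only [Nat.card_eq_fintype_card, B, Fintype.card_subtype]
    rw [← Finset.filter_filter, ← Finset.filter_filter]
    exact Finset.card_filter_add_card_filter_not _
  have hP := card_solutions hx fun i => res (τ i)
  have hI := h.card_ker hx
  have hR := h.card_eq
  have hk : (0 : ℝ) < Nat.card k := by exact_mod_cast Nat.card_pos
  have hI0 : (0 : ℝ) < Nat.card {a : R // res a = 0} := by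
    have : Nonempty {a : R // res a = 0} := ⟨0, map_zero _⟩
    exact_mod_cast Nat.card_pos
  rw [← hZ] at hI
  have hA' : (Nat.card A : ℝ) * Nat.card {a : R // conj a = -a} = Nat.card B * Z := by
    exact_mod_cast hA
  have hB' : (Nat.card B : ℝ) = Nat.card {v // P v}
      - Nat.card {d : Fin n → k // ∀ i, ∑ j, σ i j * d j = res (τ i)} := by
    rw [← hB]; push_cast; ring
  have hP' : (Nat.card {v // P v} : ℝ) * (Nat.card k : ℝ) ^ n = (Nat.card k : ℝ) ^ (s * 2) := by
    exact_mod_cast hP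
  have hI' : (Nat.card {a : R // res a = 0} : ℝ) ^ (s * 2)
      = (Nat.card {a : R // res a = 0} : ℝ) ^ n * Z := by exact_mod_cast hI
  have hR' : (Nat.card R : ℝ) = Nat.card k * Nat.card {a : R // res a = 0} := by exact_mod_cast hR
  rw [hA', hB', hR', mul_pow, mul_pow, hI']
  field_simp
  rw [← hP']
  ring

theorem PrimitiveTuples.card_succ (h : IsLocalInvolution res conj) {n : ℕ}
    (σ : Fin (n + 1) → Fin (n + 1) → R) (hσ : ∀ i j, conj (σ i j) = -σ j i) (c : ℝ)
    (hc : ∀ x : PrimitiveTuples s res conj fun i j : Fin n => σ i.succ j.succ,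
      (Nat.card {v // redVec res v ∉ Submodule.span k (Set.range fun i => redVec res (x.1 i)) ∧
        (∀ i, skewForm conj (x.1 i) v = σ i.succ 0) ∧ skewForm conj v v = σ 0 0} : ℝ) = c) :
    (Nat.card (PrimitiveTuples s res conj σ) : ℝ)
      = Nat.card (PrimitiveTuples s res conj fun i j : Fin n => σ i.succ j.succ) * c := by
  have := h.finite
  have hfin : Finite (PrimitiveTuples s res conj fun i j : Fin n => σ i.succ j.succ) :=
    inferInstanceAs (Finite {x // _})
  cases nonempty_fintype (PrimitiveTuples s res conj fun i j : Fin n => σ i.succ j.succ)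
  have hred : ∀ (v : Fin s → Fin 2 → R) (x : Fin n → Fin s → Fin 2 → R),
      (fun i => redVec res ((Fin.cons v x : Fin (n + 1) → _) i))
        = Fin.cons (redVec res v) fun i => redVec res (x i) := by
    intro v x
    ext i : 1
    refine Fin.cases ?_ (fun j => ?_) i <;> simp
  let e : PrimitiveTuples s res conj σ ≃
      Σ x : PrimitiveTuples s res conj fun i j : Fin n => σ i.succ j.succ,
        {v // redVec res v ∉ Submodule.span k (Set.range fun i => redVec res (x.1 i)) ∧
          (∀ i, skewForm conj (x.1 i) v = σ i.succ 0) ∧ skewForm conj v v = σ 0 0} :=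
    { toFun := fun y => ⟨⟨fun i => y.1 i.succ, by
          have := y.2.1
          rw [← Fin.cons_self_tail y.1, hred, linearIndependent_finCons] at this
          exact this.1, fun i j => y.2.2 _ _⟩, ⟨y.1 0, by
          have := y.2.1
          rw [← Fin.cons_self_tail y.1, hred, linearIndependent_finCons] at this
          exact this.2, fun i => y.2.2 _ _, y.2.2 _ _⟩⟩
      invFun := fun z => ⟨Fin.cons z.2.1 z.1.1, by
          rw [hred, linearIndependent_finCons]
          exact ⟨z.1.2.1, z.2.2.1⟩, by
          intro i j
          refine Fin.cases ?_ (fun i => ?_) i <;> refine Fin.cases ?_ (fun j => ?_) j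
          · exact z.2.2.2.2
          · have h1 := z.2.2.2.1 j
            have h2 := congrArg conj h1
            rw [conj_skewForm h.conj_conj, hσ] at h2
            exact neg_injective h2
          · exact z.2.2.2.1 i
          · exact z.1.2.2 i j⟩
      -- Only the column of pairings with the new vector was prescribed; its row follows by
      -- conjugation.
      left_inv := fun y => Subtype.ext (Fin.cons_self_tail y.1)
      right_inv := fun z => rfl }
  rw [Nat.card_congr e, Nat.card_sigma]
  push_cast
  rw [Finset.sum_congr rfl fun x _ => hc x]
  simp

/-- Induction on the number of vectors. Let `ρ` be the reduced Gram matrix. When the new column of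
`ρ` lies in the range of its minor, size and corank both grow by one and the factor with `2 i = n +
corank` appears. Otherwise the corank drops by one, `card_next` contributes no correction, and `n +
corank` is unchanged. So the final product depends only on `n + corank`. -/
theorem PrimitiveTuples.card_mul (h : IsLocalInvolution res conj) : ∀ {n : ℕ}
    (σ : Fin n → Fin n → R), (∀ i j, conj (σ i j) = -σ j i) →
    (Nat.card (PrimitiveTuples s res conj σ) : ℝ) * (Nat.card {a : R // conj a = -a} : ℝ) ^ n
        * (Nat.card R : ℝ) ^ (∑ i ∈ Finset.range n, i)
      = (Nat.card R : ℝ) ^ (s * 2 * n)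
        * ∏ i ∈ Finset.range ((n + Module.finrank k (matrixKer fun i j => res (σ i j))) / 2),
          (1 - (Nat.card k : ℝ) ^ (2 * i) / (Nat.card k : ℝ) ^ (s * 2))
  | 0, σ, _ => by
    have h0 : Module.finrank k (matrixKer fun i j => res (σ i j)) = 0 :=
      Module.finrank_zero_of_subsingleton
    have : Unique (PrimitiveTuples s res conj σ) :=
      { default := ⟨finZeroElim, linearIndependent_empty_type, finZeroElim⟩
        uniq := fun a => Subtype.ext (Subsingleton.elim _ _) }
    simp [h0]
  | n + 1, σ, hσ => by
    have := h.finite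
    have : Finite k := Finite.of_surjective res h.surjective
    have : NeZero (2 : k) := ⟨h.two_ne_zero⟩
    have hR0 : (0 : ℝ) < Nat.card R := by exact_mod_cast Nat.card_pos
    have hS0 : (0 : ℝ) < Nat.card {a : R // conj a = -a} := by
      have : Nonempty {a : R // conj a = -a} := ⟨0, by simp⟩
      exact_mod_cast Nat.card_pos
    let ρ : Fin (n + 1) → Fin (n + 1) → k := fun i j => res (σ i j)
    have hρ : IsAlternating ρ := ⟨fun i j => by
      simp only [ρ]
      rw [← h.res_conj (σ i j), hσ, map_neg, neg_neg],
      fun i => h.res_eq_zero_of_skew (hσ i i)⟩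
    have ih := PrimitiveTuples.card_mul h (fun i j : Fin n => σ i.succ j.succ) fun i j => hσ _ _
    -- The proportion of reductions lost because they lie in the span of the earlier vectors.
    let δ : ℝ := Nat.card {d : Fin n → k // ∀ i : Fin n, ∑ j : Fin n, ρ i.succ j.succ * d j = ρ i.succ 0}
      * Nat.card k ^ n / Nat.card k ^ (s * 2)
    have hstep := PrimitiveTuples.card_succ (s := s) h σ hσ ((Nat.card R : ℝ) ^ (s * 2) * (1 - δ)
      / (Nat.card {a : R // conj a = -a} * Nat.card R ^ n)) fun x => by
        rw [eq_div_iff (by positivity), ← mul_assoc]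
        exact h.card_next x.2.1 (fun i => σ i.succ 0) (σ 0 0) (hσ 0 0)
          (fun i j => congrArg res (x.2.2 i j))
    have hprod : (∏ i ∈ Finset.range ((n + 1 + Module.finrank k (matrixKer ρ)) / 2),
          (1 - (Nat.card k : ℝ) ^ (2 * i) / (Nat.card k : ℝ) ^ (s * 2)))
        = (∏ i ∈ Finset.range ((n + Module.finrank k (matrixKer fun i j : Fin n =>
            ρ i.succ j.succ)) / 2), (1 - (Nat.card k : ℝ) ^ (2 * i) / (Nat.card k : ℝ) ^ (s * 2)))
          * (1 - δ) := by
      have hev := hρ.minor.even_add_finrank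
      by_cases hd : ∃ d : Fin n → k, ∀ i : Fin n, ∑ j : Fin n, ρ i.succ j.succ * d j = ρ i.succ 0
      · obtain ⟨d, hd⟩ := hd
        rw [finrank_matrixKer_of_mem_range hρ hd]
        have hcard := card_matrix_solutions (σ := fun i j : Fin n => ρ i.succ j.succ) hd
        obtain ⟨e, he⟩ := hev
        have e1 : (n + 1 + (Module.finrank k (matrixKer fun i j : Fin n => ρ i.succ j.succ) + 1)) / 2
          = e + 1 := by omega
        have e2 : (n + Module.finrank k (matrixKer fun i j : Fin n => ρ i.succ j.succ)) / 2 = e := by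
          omega
        rw [e1, e2, Finset.prod_range_succ]
        congr 2
        simp only [δ]
        rw [hcard]
        push_cast
        rw [← pow_add, add_comm, he, two_mul]
      · have hfr := finrank_matrixKer_of_not_mem_range hρ hd
        have hcard : Nat.card {d : Fin n → k // ∀ i : Fin n, ∑ j : Fin n, ρ i.succ j.succ * d j = ρ i.succ 0} = 0 := by
          have : IsEmpty {d : Fin n → k // ∀ i : Fin n, ∑ j : Fin n, ρ i.succ j.succ * d j = ρ i.succ 0} :=
            ⟨fun d => hd ⟨d.1, d.2⟩⟩
          exact Nat.card_of_isEmpty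
        have e1 : (n + 1 + Module.finrank k (matrixKer ρ)) / 2
          = (n + Module.finrank k (matrixKer fun i j : Fin n => ρ i.succ j.succ)) / 2 := by omega
        rw [e1]
        simp [δ, hcard]
    change _ = _ * ∏ i ∈ Finset.range ((n + 1 + Module.finrank k (matrixKer ρ)) / 2), _
    rw [hprod, hstep, Finset.sum_range_succ, ← mul_assoc]
    have ih' : _ = (Nat.card R : ℝ) ^ (s * 2 * n) * ∏ i ∈ Finset.range ((n + Module.finrank k
      (matrixKer fun i j : Fin n => ρ i.succ j.succ)) / 2), _ := ih
    have hc := div_mul_cancel₀ ((Nat.card R : ℝ) ^ (s * 2) * (1 - δ))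
      (show (Nat.card {a : R // conj a = -a} * (Nat.card R : ℝ) ^ n) ≠ 0 by positivity)
    rw [mul_add (s * 2), mul_one, pow_add _ (s * 2 * n), pow_add _ (∑ i ∈ Finset.range n, i),
      pow_succ]
    linear_combination ((Nat.card (PrimitiveTuples s res conj fun i j : Fin n => σ i.succ j.succ) : ℝ)
      * (Nat.card {a : R // conj a = -a} : ℝ) ^ n * (Nat.card R : ℝ) ^ (∑ i ∈ Finset.range n, i))
      * hc + (Nat.card R : ℝ) ^ (s * 2) * (1 - δ) * ih'

end PrimitiveCount

/-! ### The rings `O_E / u ^ j` with their involution. -/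

section QuotientRings

variable {F : Type*} [NontriviallyNormedField F]
variable {E : Type*} [NontriviallyNormedField E] [IsUltrametricDist E] [NormedAlgebra F E]
variable {c : E ≃ₐ[F] E} {u : Valued.integer E} {q : ℕ}

namespace RamifiedDatum

/-- The involution on the ring of integers. -/
def conjInt (hD : RamifiedDatum c u q) : Valued.integer E →+* Valued.integer E where
  toFun x := ⟨c x, mem_integer_iff.mpr (by rw [hD.norm_conj]; exact norm_coe_integer_le x)⟩
  map_one' := by ext; simp
  map_mul' x y := by ext; simp
  map_zero' := by ext; simp
  map_add' x y := by ext; simp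

@[simp]
theorem coe_conjInt (hD : RamifiedDatum c u q) (x : Valued.integer E) :
    ((hD.conjInt x : Valued.integer E) : E) = c x := rfl

theorem conjInt_conjInt (hD : RamifiedDatum c u q) (x : Valued.integer E) :
    hD.conjInt (hD.conjInt x) = x := Subtype.ext (hD.conj_conj x)

theorem conjInt_u (hD : RamifiedDatum c u q) : hD.conjInt u = -u := Subtype.ext hD.conj_u

theorem ne_zero (hD : RamifiedDatum c u q) : u ≠ 0 := by
  rintro rfl
  exact absurd hD.norm_pos (by simp)

theorem coe_ne_zero (hD : RamifiedDatum c u q) : (u : E) ≠ 0 := norm_pos_iff.mp hD.norm_pos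

theorem norm_lt_one_iff (hD : RamifiedDatum c u q) {x : E} : ‖x‖ < 1 ↔ ‖x‖ ≤ ‖(u : E)‖ := by
  constructor
  · intro h
    by_cases hx : x = 0
    · rw [hx, norm_zero]; exact hD.norm_pos.le
    obtain ⟨j, hj⟩ := hD.exists_zpow x hx
    rw [hj] at h ⊢
    have h1 : 0 < j := by
      by_contra h0
      exact absurd h (not_lt.mpr (one_le_zpow_of_nonpos₀ hD.norm_pos hD.norm_lt_one.le (not_lt.mp h0)))
    calc ‖(u : E)‖ ^ j ≤ ‖(u : E)‖ ^ (1 : ℤ) :=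
          zpow_le_zpow_right_of_le_one₀ hD.norm_pos hD.norm_lt_one.le h1
      _ = _ := zpow_one _
  · intro h
    exact h.trans_lt hD.norm_lt_one

theorem pow_dvd_iff (hD : RamifiedDatum c u q) {x : Valued.integer E} {j : ℕ} :
    u ^ j ∣ x ↔ ‖(x : E)‖ ≤ ‖(u : E)‖ ^ j := by
  constructor
  · rintro ⟨y, rfl⟩
    push_cast
    rw [norm_mul, norm_pow]
    exact mul_le_of_le_one_right (by positivity) (norm_coe_integer_le y)
  · intro h
    have hu := hD.coe_ne_zero
    have hp := hD.norm_pos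
    refine ⟨⟨x / u ^ j, mem_integer_iff.mpr ?_⟩, ?_⟩
    · rw [norm_div, norm_pow, div_le_one (by positivity)]; exact h
    · ext; push_cast; field_simp

theorem dvd_iff (hD : RamifiedDatum c u q) {x : Valued.integer E} :
    u ∣ x ↔ ‖(x : E)‖ < 1 := by
  rw [← pow_one u, hD.pow_dvd_iff, pow_one, hD.norm_lt_one_iff]

theorem residue_eq_zero_iff (hD : RamifiedDatum c u q) {x : Valued.integer E} :
    IsLocalRing.residue (Valued.integer E) x = 0 ↔ u ∣ x := by
  rw [IsLocalRing.residue_eq_zero_iff, IsLocalRing.mem_maximalIdeal, mem_nonunits_iff,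
    isUnit_integer_iff, hD.dvd_iff]
  exact ⟨fun h => lt_of_le_of_ne (norm_coe_integer_le x) h, fun h => h.ne⟩

theorem maximalIdeal_eq (hD : RamifiedDatum c u q) :
    IsLocalRing.maximalIdeal (Valued.integer E) = Ideal.span {u} := by
  ext x
  rw [Ideal.mem_span_singleton, ← hD.residue_eq_zero_iff, IsLocalRing.residue_eq_zero_iff]

theorem dvd_sub_conjInt (hD : RamifiedDatum c u q) (x : Valued.integer E) :
    u ∣ x - hD.conjInt x := by
  rw [hD.dvd_iff]
  exact hD.norm_sub_conj x (norm_coe_integer_le x)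

theorem pow_dvd_conjInt (hD : RamifiedDatum c u q) {x : Valued.integer E} {j : ℕ} :
    u ^ j ∣ hD.conjInt x ↔ u ^ j ∣ x := by
  rw [hD.pow_dvd_iff, hD.pow_dvd_iff, coe_conjInt, hD.norm_conj]

/-- The inverse of two. -/
def half (hD : RamifiedDatum c u q) : Valued.integer E :=
  ⟨2⁻¹, mem_integer_iff.mpr (by rw [norm_inv, hD.norm_two, inv_one])⟩

theorem two_ne_zero (hD : RamifiedDatum c u q) : (2 : E) ≠ 0 :=
  norm_ne_zero_iff.mp (by rw [hD.norm_two]; exact one_ne_zero)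

theorem two_mul_half (hD : RamifiedDatum c u q) : 2 * hD.half = 1 := by
  ext; change (2 : E) * 2⁻¹ = 1
  exact mul_inv_cancel₀ hD.two_ne_zero

theorem conjInt_half (hD : RamifiedDatum c u q) : hD.conjInt hD.half = hD.half := by
  ext; change c (2⁻¹ : E) = 2⁻¹
  rw [map_inv₀, map_ofNat]

theorem residue_two_ne_zero (hD : RamifiedDatum c u q) :
    (2 : IsLocalRing.ResidueField (Valued.integer E)) ≠ 0 := by
  have h := congrArg (IsLocalRing.residue (Valued.integer E)) hD.two_mul_half
  rw [map_mul, map_one, map_ofNat] at h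
  intro h0
  rw [h0, zero_mul] at h
  exact zero_ne_one h

theorem card_quotient_pow (hD : RamifiedDatum c u q) (j : ℕ) :
    Nat.card (Valued.integer E ⧸ Ideal.span {u ^ j}) = q ^ j := by
  have := hD.dvr
  rw [← Ideal.span_singleton_pow, ← hD.maximalIdeal_eq, ← hD.card_residue]
  exact cardQuot_pow_of_prime (P := IsLocalRing.maximalIdeal (Valued.integer E))
    (by rw [hD.maximalIdeal_eq]; simpa using hD.ne_zero)

theorem one_lt_q (hD : RamifiedDatum c u q) : 1 < q := by
  have := hD.finite_residue
  rw [← hD.card_residue]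
  exact Finite.one_lt_card

theorem finite_quotient_pow (hD : RamifiedDatum c u q) (j : ℕ) :
    Finite (Valued.integer E ⧸ Ideal.span {u ^ j}) := by
  apply Nat.finite_of_card_ne_zero
  rw [hD.card_quotient_pow]
  exact pow_ne_zero _ (by have := hD.one_lt_q; omega)

/-- The involution on `O_E / u ^ j`. -/
def conjQuot (hD : RamifiedDatum c u q) (j : ℕ) :
    (Valued.integer E ⧸ Ideal.span {u ^ j}) →+* (Valued.integer E ⧸ Ideal.span {u ^ j}) :=
  Ideal.quotientMap _ hD.conjInt (by
    intro x hx
    rw [Ideal.mem_comap]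
    rw [Ideal.mem_span_singleton] at hx ⊢
    exact hD.pow_dvd_conjInt.mpr hx)

@[simp]
theorem conjQuot_mk (hD : RamifiedDatum c u q) (j : ℕ) (x : Valued.integer E) :
    hD.conjQuot j (Ideal.Quotient.mk _ x) = Ideal.Quotient.mk _ (hD.conjInt x) := rfl

/-- The reduction `O_E / u ^ j → k`. -/
def resQuot (hD : RamifiedDatum c u q) {j : ℕ} (hj : j ≠ 0) :
    (Valued.integer E ⧸ Ideal.span {u ^ j}) →+* IsLocalRing.ResidueField (Valued.integer E) :=
  Ideal.Quotient.lift _ (IsLocalRing.residue (Valued.integer E)) (by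
    intro x hx
    rw [Ideal.mem_span_singleton] at hx
    exact hD.residue_eq_zero_iff.mpr ((dvd_pow_self u hj).trans hx))

@[simp]
theorem resQuot_mk (hD : RamifiedDatum c u q) {j : ℕ} (hj : j ≠ 0) (x : Valued.integer E) :
    hD.resQuot hj (Ideal.Quotient.mk _ x) = IsLocalRing.residue _ x := rfl

theorem mk_eq_mk_iff {j : ℕ} {x y : Valued.integer E} :
    Ideal.Quotient.mk (Ideal.span {u ^ j}) x = Ideal.Quotient.mk _ y ↔ u ^ j ∣ x - y := by
  rw [Ideal.Quotient.eq, Ideal.mem_span_singleton]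

theorem mk_eq_zero_iff {j : ℕ} {x : Valued.integer E} :
    Ideal.Quotient.mk (Ideal.span {u ^ j}) x = 0 ↔ u ^ j ∣ x := by
  rw [Ideal.Quotient.eq_zero_iff_mem, Ideal.mem_span_singleton]

theorem isLocalInvolution (hD : RamifiedDatum c u q) {j : ℕ} (hj : j ≠ 0) :
    IsLocalInvolution (hD.resQuot hj) (hD.conjQuot j) where
  finite := hD.finite_quotient_pow j
  surjective y := by
    obtain ⟨x, rfl⟩ := IsLocalRing.residue_surjective y
    exact ⟨Ideal.Quotient.mk _ x, rfl⟩
  isUnit a ha := by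
    obtain ⟨x, rfl⟩ := Ideal.Quotient.mk_surjective a
    rw [resQuot_mk, IsLocalRing.residue_ne_zero_iff_isUnit] at ha
    exact ha.map _
  conj_conj a := by
    obtain ⟨x, rfl⟩ := Ideal.Quotient.mk_surjective a
    simp [hD.conjInt_conjInt]
  res_conj a := by
    obtain ⟨x, rfl⟩ := Ideal.Quotient.mk_surjective a
    rw [conjQuot_mk, resQuot_mk, resQuot_mk, eq_comm, ← sub_eq_zero, ← map_sub,
      hD.residue_eq_zero_iff]
    exact hD.dvd_sub_conjInt x
  two_ne_zero := hD.residue_two_ne_zero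

/-- Multiplication by `u ^ b` as a map from `O_E / u ^ a` to `O_E / u ^ (a + b)`. -/
def mulPow (u : Valued.integer E) (a b : ℕ) :
    (Valued.integer E ⧸ Ideal.span {u ^ a}) → (Valued.integer E ⧸ Ideal.span {u ^ (a + b)}) :=
  Quotient.lift (fun x => Ideal.Quotient.mk _ (u ^ b * x)) (by
    intro x y hxy
    have h1 : Ideal.Quotient.mk (Ideal.span {u ^ a}) x = Ideal.Quotient.mk _ y := Quotient.sound hxy
    rw [mk_eq_mk_iff] at h1
    rw [mk_eq_mk_iff, ← mul_sub, add_comm, pow_add]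
    exact mul_dvd_mul_left _ h1)

theorem mulPow_mk (a b : ℕ) (x : Valued.integer E) :
    mulPow u a b (Ideal.Quotient.mk _ x) = Ideal.Quotient.mk _ (u ^ b * x) := rfl

theorem mulPow_injective (hD : RamifiedDatum c u q) (a b : ℕ) :
    Function.Injective (mulPow u a b) := by
  intro x y hxy
  obtain ⟨x, rfl⟩ := Ideal.Quotient.mk_surjective x
  obtain ⟨y, rfl⟩ := Ideal.Quotient.mk_surjective y
  rw [mulPow_mk, mulPow_mk, mk_eq_mk_iff, ← mul_sub, add_comm, pow_add] at hxy
  rw [mk_eq_mk_iff]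
  exact (mul_dvd_mul_iff_left (pow_ne_zero _ hD.ne_zero)).mp hxy

theorem exists_mulPow (hD : RamifiedDatum c u q) (a b : ℕ)
    {x : Valued.integer E ⧸ Ideal.span {u ^ (a + b)}}
    (hx : Ideal.Quotient.mk _ (u ^ a) * x = 0) : ∃ y, mulPow u a b y = x := by
  obtain ⟨x, rfl⟩ := Ideal.Quotient.mk_surjective x
  rw [← map_mul, mk_eq_zero_iff, pow_add] at hx
  obtain ⟨y, rfl⟩ := (mul_dvd_mul_iff_left (pow_ne_zero _ hD.ne_zero)).mp hx
  exact ⟨Ideal.Quotient.mk _ y, rfl⟩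

theorem pow_mul_mulPow (a b : ℕ) (y : Valued.integer E ⧸ Ideal.span {u ^ a}) :
    Ideal.Quotient.mk _ (u ^ a) * mulPow u a b y = 0 := by
  obtain ⟨y, rfl⟩ := Ideal.Quotient.mk_surjective y
  rw [mulPow_mk, ← map_mul, mk_eq_zero_iff, pow_add]
  exact mul_dvd_mul_left _ (dvd_mul_right _ _)

/-- The annihilator of `u ^ a` in `O_E / u ^ (a + b)` is the image of multiplication by `u ^ b`, a
copy of `O_E / u ^ a`. -/
theorem card_annihilator (hD : RamifiedDatum c u q) {a j : ℕ} (haj : a ≤ j) :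
    Nat.card {x : Valued.integer E ⧸ Ideal.span {u ^ j} // Ideal.Quotient.mk _ (u ^ a) * x = 0}
      = q ^ a := by
  obtain ⟨b, rfl⟩ := Nat.exists_eq_add_of_le haj
  rw [← hD.card_quotient_pow a]
  refine (Nat.card_eq_of_bijective (fun y => ⟨mulPow u a b y, pow_mul_mulPow a b y⟩) ⟨?_, ?_⟩).symm
  · intro y y' h
    exact hD.mulPow_injective a b (congrArg Subtype.val h)
  · rintro ⟨x, hx⟩
    obtain ⟨y, hy⟩ := hD.exists_mulPow a b hx
    exact ⟨y, Subtype.ext hy⟩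

/-- Multiplication by `u` carries symmetric to skew elements. It is onto because skew elements
reduce to zero. It is injective because a symmetric element divisible by `u ^ (2 * a - 1)` vanishes:
the exponent is odd, so its leading coefficient would have to be skew modulo `u`. Evenness of the
modulus exponent is essential. -/
theorem card_symm_eq_card_skew (hD : RamifiedDatum c u q) (a : ℕ) :
    Nat.card {x // hD.conjQuot (2 * a) x = x} = Nat.card {x // hD.conjQuot (2 * a) x = -x} := by
  rcases Nat.eq_zero_or_pos a with rfl | ha
  · have : Subsingleton (Valued.integer E ⧸ Ideal.span {u ^ (2 * 0)}) := by
      rw [mul_zero, pow_zero, Ideal.span_singleton_one]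
      exact Ideal.Quotient.subsingleton_iff.mpr rfl
    refine Nat.card_congr ((Equiv.refl _).subtypeEquiv fun x => ?_)
    simp only [Subsingleton.elim _ x]
  have hj : 2 * a ≠ 0 := by omega
  obtain ⟨j, hj'⟩ := Nat.exists_eq_succ_of_ne_zero hj
  have hodd : Odd j := ⟨a - 1, by omega⟩
  refine Nat.card_eq_of_bijective (fun x => ⟨Ideal.Quotient.mk _ u * x.1, by
    rw [map_mul, x.2, conjQuot_mk, hD.conjInt_u, map_neg, neg_mul]⟩) ⟨?_, ?_⟩
  · rintro ⟨x, hx⟩ ⟨y, hy⟩ hxy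
    have hxy : Ideal.Quotient.mk _ u * x = Ideal.Quotient.mk _ u * y := congrArg Subtype.val hxy
    obtain ⟨x, rfl⟩ := Ideal.Quotient.mk_surjective x
    obtain ⟨y, rfl⟩ := Ideal.Quotient.mk_surjective y
    rw [← map_mul, ← map_mul, mk_eq_mk_iff, ← mul_sub, hj', pow_succ'] at hxy
    obtain ⟨z, hz⟩ := (mul_dvd_mul_iff_left hD.ne_zero).mp hxy
    rw [conjQuot_mk, mk_eq_mk_iff] at hx hy
    have h1 : u ^ (2 * a) ∣ hD.conjInt (x - y) - (x - y) := by
      have := dvd_sub hx hy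
      convert this using 1
      rw [map_sub]; ring
    rw [hz, map_mul, map_pow, hD.conjInt_u, hodd.neg_pow, hj', pow_succ] at h1
    have h2 : u ^ j * u ∣ u ^ j * (-(hD.conjInt z + z)) := by
      convert h1 using 1; ring
    have h3 := (mul_dvd_mul_iff_left (pow_ne_zero _ hD.ne_zero)).mp h2
    have h4 : u ∣ 2 * z := by
      have := dvd_sub (hD.dvd_sub_conjInt z) h3
      convert this using 1; ring
    have h5 : u ∣ z := by
      have : z = hD.half * (2 * z) := by linear_combination -z * hD.two_mul_half
      rw [this]
      exact h4.mul_left _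
    refine Subtype.ext (mk_eq_mk_iff.mpr ?_)
    rw [hz, hj', pow_succ]
    exact mul_dvd_mul_left _ h5
  · rintro ⟨y, hy⟩
    obtain ⟨y, rfl⟩ := Ideal.Quotient.mk_surjective y
    have h0 := (hD.isLocalInvolution hj).res_eq_zero_of_skew hy
    rw [resQuot_mk, hD.residue_eq_zero_iff] at h0
    obtain ⟨z, rfl⟩ := h0
    rw [conjQuot_mk, ← map_neg, mk_eq_mk_iff, map_mul, hD.conjInt_u] at hy
    refine ⟨⟨Ideal.Quotient.mk _ (hD.half * (z + hD.conjInt z)), ?_⟩, ?_⟩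
    · rw [conjQuot_mk, map_mul, map_add, hD.conjInt_half, hD.conjInt_conjInt, add_comm]
    · apply Subtype.ext
      change Ideal.Quotient.mk _ u * Ideal.Quotient.mk _ _ = Ideal.Quotient.mk _ _
      rw [← map_mul, mk_eq_mk_iff]
      have : u * (hD.half * (z + hD.conjInt z)) - u * z
          = -hD.half * (-u * hD.conjInt z - -(u * z)) := by
        linear_combination u * z * hD.two_mul_half
      rw [this]
      exact hy.mul_left _

/-- As two is invertible, the ring is the direct sum of its symmetric and skew parts, which have
equal size. -/
theorem card_skew (hD : RamifiedDatum c u q) (a : ℕ) :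
    Nat.card {x // hD.conjQuot (2 * a) x = -x} = q ^ a := by
  have hfin := hD.finite_quotient_pow (2 * a)
  set h := Ideal.Quotient.mk (Ideal.span {u ^ (2 * a)}) hD.half with hh
  have h2 : 2 * h = 1 := by
    have := congrArg (Ideal.Quotient.mk (Ideal.span {u ^ (2 * a)})) hD.two_mul_half
    simpa only [map_mul, map_one, map_ofNat] using this
  have hc : hD.conjQuot (2 * a) h = h := by rw [hh, conjQuot_mk, hD.conjInt_half]
  have hcc : ∀ x, hD.conjQuot (2 * a) (hD.conjQuot (2 * a) x) = x := by
    intro x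
    obtain ⟨x, rfl⟩ := Ideal.Quotient.mk_surjective x
    simp [hD.conjInt_conjInt]
  have e : {x // hD.conjQuot (2 * a) x = x} × {x // hD.conjQuot (2 * a) x = -x}
      ≃ (Valued.integer E ⧸ Ideal.span {u ^ (2 * a)}) :=
    { toFun := fun p => p.1.1 + p.2.1
      invFun := fun x => (⟨h * (x + hD.conjQuot _ x), by
        rw [map_mul, map_add, hc, hcc, add_comm]⟩, ⟨h * (x - hD.conjQuot _ x), by
        rw [map_mul, map_sub, hc, hcc]; ring⟩)
      left_inv := fun p => by
        obtain ⟨⟨x, hx⟩, ⟨y, hy⟩⟩ := p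
        refine Prod.ext (Subtype.ext ?_) (Subtype.ext ?_)
        · simp only [map_add, hx, hy]; linear_combination x * h2
        · simp only [map_add, hx, hy]; linear_combination y * h2
      right_inv := fun x => by
        change h * (x + hD.conjQuot _ x) + h * (x - hD.conjQuot _ x) = x
        linear_combination x * h2 }
  have h1 := Nat.card_congr e
  rw [Nat.card_prod, hD.card_symm_eq_card_skew, hD.card_quotient_pow] at h1
  exact Nat.mul_self_inj.mp (h1.trans (by ring))

/-- Multiplication by the even power `u ^ (2 * b)` commutes with the involution, so it identifies
this set with the skew elements of `O_E / u ^ (2 * a)`. -/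
theorem card_skew_annihilator (hD : RamifiedDatum c u q) {a k : ℕ} (hak : a ≤ k) :
    Nat.card {x : Valued.integer E ⧸ Ideal.span {u ^ (2 * k)} //
      hD.conjQuot (2 * k) x = -x ∧ Ideal.Quotient.mk _ (u ^ (2 * a)) * x = 0} = q ^ a := by
  obtain ⟨b, rfl⟩ := Nat.exists_eq_add_of_le hak
  rw [← hD.card_skew a, mul_add]
  have hconj : ∀ y, hD.conjQuot (2 * a + 2 * b) (mulPow u (2 * a) (2 * b) y)
      = mulPow u (2 * a) (2 * b) (hD.conjQuot (2 * a) y) := by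
    intro y
    obtain ⟨y, rfl⟩ := Ideal.Quotient.mk_surjective y
    rw [mulPow_mk, conjQuot_mk, conjQuot_mk, mulPow_mk, map_mul, map_pow, hD.conjInt_u,
      (even_two_mul b).neg_pow]
  have hneg : ∀ y, mulPow u (2 * a) (2 * b) (-y) = -mulPow u (2 * a) (2 * b) y := by
    intro y
    obtain ⟨y, rfl⟩ := Ideal.Quotient.mk_surjective y
    rw [← map_neg, mulPow_mk, mulPow_mk, mul_neg, map_neg]
  refine (Nat.card_eq_of_bijective (fun y => ⟨mulPow u (2 * a) (2 * b) y.1, by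
    rw [hconj, y.2, hneg], pow_mul_mulPow _ _ y.1⟩) ⟨?_, ?_⟩).symm
  · intro y y' h
    exact Subtype.ext (hD.mulPow_injective _ _ (congrArg Subtype.val h))
  · rintro ⟨x, hx, hx'⟩
    obtain ⟨y, rfl⟩ := hD.exists_mulPow (2 * a) (2 * b) hx'
    refine ⟨⟨y, hD.mulPow_injective (2 * a) (2 * b) ?_⟩, rfl⟩
    rw [← hconj, hx, hneg]

end RamifiedDatum

end QuotientRings

/-! ### Lattice bases and elementary divisors. -/

section Lattices

variable {F : Type*} [NontriviallyNormedField F]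
variable {E : Type*} [NontriviallyNormedField E] [IsUltrametricDist E] [NormedAlgebra F E]
variable {c : E ≃ₐ[F] E} {u : Valued.integer E} {q : ℕ}
variable {V : Type*} [AddCommGroup V] [Module E V] {h : Pairing c V}
variable {L : Submodule (Valued.integer E) V} {m : ℕ} {b : Fin m → V}

instance isFractionRing_integer : IsFractionRing (Valued.integer E) E := by
  have : FaithfulSMul (Valued.integer E) E :=
    (faithfulSMul_iff_algebraMap_injective _ _).mpr Subtype.val_injective
  refine IsFractionRing.of_field _ _ fun z => ?_
  rcases le_total ‖z‖ 1 with hz | hz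
  · exact ⟨⟨z, mem_integer_iff.mpr hz⟩, 1, by
      change z = z / ((1 : Valued.integer E) : E)
      simp⟩
  · have h' : ‖z⁻¹‖ ≤ 1 := by rw [norm_inv]; exact inv_le_one_of_one_le₀ hz
    exact ⟨1, ⟨z⁻¹, mem_integer_iff.mpr h'⟩, by
      change z = ((1 : Valued.integer E) : E) / z⁻¹
      simp⟩

theorem integer_smul_def (a : Valued.integer E) (x : V) : a • x = (a : E) • x := rfl

/-- `b` is a basis of the lattice `L`. -/
structure IsLatticeBasis (b : Fin m → V) (L : Submodule (Valued.integer E) V) : Prop where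
  li : LinearIndependent E b
  span_eq : Submodule.span (Valued.integer E) (Set.range b) = L

namespace IsLatticeBasis

theorem mem (hb : IsLatticeBasis b L) (i : Fin m) : b i ∈ L :=
  hb.span_eq ▸ Submodule.subset_span ⟨i, rfl⟩

theorem span_eq_ambient (hb : IsLatticeBasis b L) :
    Submodule.span E (Set.range b) = ambient L := by
  rw [← hb.span_eq, ambient, Submodule.span_span_of_tower]

theorem mem_iff (hb : IsLatticeBasis b L) {x : V} :
    x ∈ L ↔ ∃ a : Fin m → Valued.integer E, ∑ i, a i • b i = x := by
  rw [← hb.span_eq]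
  exact Submodule.mem_span_range_iff_exists_fun _

theorem mem_ambient_iff (hb : IsLatticeBasis b L) {x : V} :
    x ∈ ambient L ↔ ∃ a : Fin m → E, ∑ i, a i • b i = x := by
  rw [← hb.span_eq_ambient]
  exact Submodule.mem_span_range_iff_exists_fun _

theorem coeff_unique (hb : IsLatticeBasis b L) {a a' : Fin m → E}
    (h : ∑ i, a i • b i = ∑ i, a' i • b i) : a = a' := by
  have h2 : ∑ j, (a j - a' j) • b j = 0 := by
    simp only [sub_smul, Finset.sum_sub_distrib, h, sub_self]
  exact funext fun j => sub_eq_zero.mp (Fintype.linearIndependent_iff.mp hb.li _ h2 j)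

theorem sum_mem_iff (hb : IsLatticeBasis b L) {a : Fin m → E} :
    ∑ i, a i • b i ∈ L ↔ ∀ i, ‖a i‖ ≤ 1 := by
  constructor
  · intro hx i
    obtain ⟨a', ha'⟩ := hb.mem_iff.mp hx
    have : (fun i => (a' i : E)) = a := hb.coeff_unique (by simpa [integer_smul_def] using ha')
    rw [← this]
    exact norm_coe_integer_le _
  · intro ha
    exact hb.mem_iff.mpr ⟨fun i => ⟨a i, mem_integer_iff.mpr (ha i)⟩, rfl⟩

theorem finrank_ambient (hb : IsLatticeBasis b L) : Module.finrank E (ambient L) = m := by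
  rw [← hb.span_eq_ambient, finrank_span_eq_card hb.li, Fintype.card_fin]

theorem fg (hb : IsLatticeBasis b L) : L.FG := by
  rw [← hb.span_eq]
  exact Submodule.fg_span (Set.finite_range b)

end IsLatticeBasis

theorem RamifiedDatum.isPrincipalIdealRing (hD : RamifiedDatum c u q) :
    IsPrincipalIdealRing (Valued.integer E) := by
  have := hD.dvr
  infer_instance

instance faithfulSMul_integer : FaithfulSMul (Valued.integer E) E :=
  (faithfulSMul_iff_algebraMap_injective _ _).mpr Subtype.val_injective

theorem isLatticeBasis_of_basis (B : Module.Basis (Fin m) (Valued.integer E) L) :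
    IsLatticeBasis (fun i => (B i : V)) L where
  li := by
    rw [← LinearIndependent.iff_fractionRing (R := Valued.integer E) (K := E)]
    exact B.linearIndependent.map' L.subtype (Submodule.ker_subtype L)
  span_eq := by
    have : Set.range (fun i => (B i : V)) = L.subtype '' Set.range B := by
      rw [← Set.range_comp]; rfl
    rw [this, ← Submodule.map_span, B.span_eq, Submodule.map_subtype_top]

theorem IsLatticeBasis.exists_basis (hb : IsLatticeBasis b L) :
    ∃ B : Module.Basis (Fin m) (Valued.integer E) L, ∀ i, (B i : V) = b i := by
  have hli : LinearIndependent (Valued.integer E) fun i => (⟨b i, hb.mem i⟩ : L) := by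
    refine LinearIndependent.of_comp L.subtype ?_
    exact (LinearIndependent.iff_fractionRing (R := Valued.integer E) (K := E)).mpr hb.li
  refine ⟨Module.Basis.mk hli ?_, fun i => by rw [Module.Basis.mk_apply]⟩
  rintro ⟨x, hx⟩ -
  obtain ⟨a, rfl⟩ := hb.mem_iff.mp hx
  rw [Submodule.mem_span_range_iff_exists_fun]
  refine ⟨a, Subtype.ext ?_⟩
  change L.subtype _ = _
  rw [map_sum]
  rfl

theorem RamifiedDatum.exists_isLatticeBasis (hD : RamifiedDatum c u q) (hL : L.FG)
    (hm : Module.finrank E (ambient L) = m) : ∃ b : Fin m → V, IsLatticeBasis b L := by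
  subst hm
  have := hD.isPrincipalIdealRing
  have : Module.Finite (Valued.integer E) L := Module.Finite.iff_fg.mpr hL
  have : Module.IsTorsionFree (Valued.integer E) V := Module.IsTorsionFree.trans_faithfulSMul _ E _
  have hb := isLatticeBasis_of_basis (Module.finBasis (Valued.integer E) L)
  rw [hb.finrank_ambient]
  exact ⟨_, hb⟩

theorem IsLatticeBasis.finrank (hb : IsLatticeBasis b L) :
    Module.finrank (Valued.integer E) L = m := by
  obtain ⟨B, -⟩ := hb.exists_basis
  rw [Module.finrank_eq_card_basis B, Fintype.card_fin]

/-- Smith normal form over the discrete valuation ring; the unit parts of the invariant factors are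
absorbed, so that the smaller lattice has a basis of powers of `u` times basis vectors. -/
theorem RamifiedDatum.exists_adapted_basis (hD : RamifiedDatum c u q)
    {L' : Submodule (Valued.integer E) V} (hb : IsLatticeBasis b L) (hL' : L'.FG) (hle : L ≤ L')
    (hamb : ambient L = ambient L') :
    ∃ (b' : Fin m → V) (a : Fin m → ℕ), IsLatticeBasis b' L' ∧
      IsLatticeBasis (fun i => (u : E) ^ a i • b' i) L := by
  have := hD.isPrincipalIdealRing
  have := hD.dvr
  have hm : Module.finrank E (ambient L') = m := hamb ▸ hb.finrank_ambient
  obtain ⟨b0, hb0⟩ := hD.exists_isLatticeBasis hL' hm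
  obtain ⟨B0, -⟩ := hb0.exists_basis
  have hrk : Module.finrank (Valued.integer E) (L.submoduleOf L')
      = Module.finrank (Valued.integer E) L' := by
    rw [(Submodule.submoduleOfEquivOfLe hle).finrank_eq, hb.finrank, hb0.finrank]
  obtain ⟨B', a, AB, hAB⟩ := Submodule.exists_smith_normal_form_of_rank_eq B0 hrk
  have hB' := isLatticeBasis_of_basis B'
  have hA := isLatticeBasis_of_basis (AB.map (Submodule.submoduleOfEquivOfLe hle))
  have hA' : ∀ i, ((AB.map (Submodule.submoduleOfEquivOfLe hle) i : L) : V) = a i • (B' i : V) := by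
    intro i
    rw [Module.Basis.map_apply]
    exact congrArg Subtype.val (hAB i)
  simp only [hA'] at hA
  have ha : ∀ i, a i ≠ 0 := by
    intro i h0
    have := hA.li.ne_zero i
    simp [h0] at this
  have hirr : Irreducible u := by
    rw [IsDiscreteValuationRing.irreducible_iff_uniformizer]
    exact hD.maximalIdeal_eq
  choose e w hw using fun i => IsDiscreteValuationRing.eq_unit_mul_pow_irreducible (ha i) hirr
  refine ⟨fun i => B' i, e, hB', ?_, ?_⟩
  · have h2 := hB'.li.units_smul fun i => Units.mk0 ((u : E) ^ e i) (pow_ne_zero _ hD.coe_ne_zero)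
    exact h2
  · have h1 : ∀ i, a i • (B' i : V) = (w i : Valued.integer E) • ((u : E) ^ e i • (B' i : V)) := by
      intro i
      rw [hw i, mul_smul]
      rfl
    apply le_antisymm
    · rw [Submodule.span_le]
      rintro _ ⟨i, rfl⟩
      have h3 := L.smul_mem ((w i)⁻¹ : (Valued.integer E)ˣ).val (hA.mem i)
      simp only [h1] at h3
      rw [← mul_smul, Units.inv_mul, one_smul] at h3
      exact h3
    · conv_lhs => rw [← hA.span_eq]
      rw [Submodule.span_le]
      rintro _ ⟨i, rfl⟩
      simp only [h1]
      exact Submodule.smul_mem _ _ (Submodule.subset_span ⟨i, rfl⟩)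

theorem mem_ambient {x : V} (hx : x ∈ L) : x ∈ ambient L := Submodule.subset_span hx

theorem RamifiedDatum.mem_dual (hD : RamifiedDatum c u q) {x : V} :
    x ∈ dual u h L ↔ x ∈ ambient L ∧ ∀ y ∈ L, ‖h x y‖ ≤ ‖(u : E)‖⁻¹ := by
  have hp := hD.norm_pos
  refine and_congr_right fun _ => forall₂_congr fun y _ => ?_
  rw [mem_integer_iff, norm_mul, ← one_div, le_div_iff₀ hp, mul_comm]

theorem RamifiedDatum.isIntegralLattice_iff (hD : RamifiedDatum c u q) :
    IsIntegralLattice u h L ↔ ∀ x ∈ L, ∀ y ∈ L, ‖h x y‖ ≤ ‖(u : E)‖⁻¹ := by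
  constructor
  · intro hL x hx
    exact (hD.mem_dual.mp (hL hx)).2
  · intro hL x hx
    exact hD.mem_dual.mpr ⟨mem_ambient hx, hL x hx⟩

end Lattices

/-! ### The type as the corank of the Gram matrix modulo `u`. -/

section Types

variable {F : Type*} [NontriviallyNormedField F]
variable {E : Type*} [NontriviallyNormedField E] [IsUltrametricDist E] [NormedAlgebra F E]
variable {c : E ≃ₐ[F] E} {u : Valued.integer E} {q : ℕ}
variable {V : Type*} [AddCommGroup V] [Module E V] {h : Pairing c V}
variable {L : Submodule (Valued.integer E) V} {m : ℕ} {b : Fin m → V}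

open Classical in
/-- The element of `O_E` given by `z`, or zero if `z` is not integral. -/
def toInteger (z : E) : Valued.integer E := if hz : z ∈ Valued.integer E then ⟨z, hz⟩ else 0

theorem coe_toInteger {z : E} (hz : ‖z‖ ≤ 1) : ((toInteger z : Valued.integer E) : E) = z := by
  rw [toInteger, dif_pos (mem_integer_iff.mpr hz)]

/-- The Gram matrix of `b` with respect to the pairing `u * h`. -/
def gram (u : Valued.integer E) (h : Pairing c V) (b : Fin m → V) (i j : Fin m) :
    Valued.integer E :=
  toInteger ((u : E) * h (b i) (b j))

/-- The Gram matrix modulo the maximal ideal. -/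
def residueGram (u : Valued.integer E) (h : Pairing c V) (b : Fin m → V) (i j : Fin m) :
    IsLocalRing.ResidueField (Valued.integer E) :=
  IsLocalRing.residue _ (gram u h b i j)

/-- The dimension of the radical of the Gram matrix modulo the maximal ideal. -/
def corank (u : Valued.integer E) (h : Pairing c V) (b : Fin m → V) : ℕ :=
  Module.finrank (IsLocalRing.ResidueField (Valued.integer E)) (matrixKer (residueGram u h b))

namespace RamifiedDatum

theorem norm_mul_le_one_iff (hD : RamifiedDatum c u q) {z : E} :
    ‖(u : E) * z‖ ≤ 1 ↔ ‖z‖ ≤ ‖(u : E)‖⁻¹ := by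
  rw [norm_mul, ← one_div, le_div_iff₀ hD.norm_pos, mul_comm]

theorem coe_gram (hD : RamifiedDatum c u q) (hL : IsIntegralLattice u h L)
    (hb : IsLatticeBasis b L) (i j : Fin m) :
    (gram u h b i j : E) = u * h (b i) (b j) :=
  coe_toInteger (hD.norm_mul_le_one_iff.mpr
    (hD.isIntegralLattice_iff.mp hL _ (hb.mem i) _ (hb.mem j)))

theorem conjInt_gram (hD : RamifiedDatum c u q) (hh : IsHermitianSpace h)
    (hL : IsIntegralLattice u h L) (hb : IsLatticeBasis b L) (i j : Fin m) :
    hD.conjInt (gram u h b i j) = -gram u h b j i := by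
  refine Subtype.ext ?_
  rw [hD.coe_conjInt]
  push_cast
  rw [hD.coe_gram hL hb, hD.coe_gram hL hb, map_mul, hD.conj_u, hh.symm (b i) (b j), neg_mul]

theorem residue_conjInt (hD : RamifiedDatum c u q) (x : Valued.integer E) :
    IsLocalRing.residue _ (hD.conjInt x) = IsLocalRing.residue _ x := by
  rw [eq_comm, ← sub_eq_zero, ← map_sub, hD.residue_eq_zero_iff]
  exact hD.dvd_sub_conjInt x

theorem isAlternating_residueGram (hD : RamifiedDatum c u q) (hh : IsHermitianSpace h)
    (hL : IsIntegralLattice u h L) (hb : IsLatticeBasis b L) :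
    IsAlternating (residueGram u h b) := by
  have hskew : ∀ i j, residueGram u h b j i = -residueGram u h b i j := by
    intro i j
    rw [residueGram, residueGram, ← map_neg, ← hD.residue_conjInt (-_), map_neg,
      hD.conjInt_gram hh hL hb, neg_neg]
  refine ⟨hskew, fun i => ?_⟩
  have h2 : (2 : IsLocalRing.ResidueField (Valued.integer E)) * residueGram u h b i i = 0 := by
    linear_combination hskew i i
  exact (mul_eq_zero.mp h2).resolve_left hD.residue_two_ne_zero

theorem sesq_sum_left {ι : Type*} (s : Finset ι) (a : ι → E) (v : ι → V) (y : V) :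
    h (∑ j ∈ s, a j • v j) y = ∑ j ∈ s, a j * h (v j) y := by
  rw [map_sum, LinearMap.sum_apply]
  simp

theorem sesq_sum_right {ι : Type*} (s : Finset ι) (a : ι → E) (v : ι → V) (x : V) :
    h x (∑ j ∈ s, a j • v j) = ∑ j ∈ s, c (a j) * h x (v j) := by
  rw [map_sum]
  simp

theorem norm_sum_le_of_forall_le {ι : Type*} (s : Finset ι) (f : ι → E) {C : ℝ} (hC : 0 ≤ C)
    (hf : ∀ i ∈ s, ‖f i‖ ≤ C) : ‖∑ i ∈ s, f i‖ ≤ C :=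
  IsUltrametricDist.norm_sum_le_of_forall_le_of_nonneg hC hf

/-- A bound for a pairing on a lattice can be checked on a basis. -/
theorem forall_mem_norm_le_iff (hD : RamifiedDatum c u q) (hb : IsLatticeBasis b L) {x : V}
    {C : ℝ} (hC : 0 ≤ C) : (∀ y ∈ L, ‖h x y‖ ≤ C) ↔ ∀ i, ‖h x (b i)‖ ≤ C := by
  refine ⟨fun H i => H _ (hb.mem i), fun H y hy => ?_⟩
  obtain ⟨a, rfl⟩ := hb.mem_iff.mp hy
  simp only [integer_smul_def]
  rw [sesq_sum_right]
  refine norm_sum_le_of_forall_le _ _ hC fun i _ => ?_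
  rw [norm_mul, hD.norm_conj]
  calc ‖(a i : E)‖ * ‖h x (b i)‖ ≤ 1 * C :=
        mul_le_mul (norm_coe_integer_le _) (H i) (norm_nonneg _) zero_le_one
    _ = C := one_mul C

/-- The condition for a vector to belong to the radical modulo the maximal ideal. -/
theorem mem_matrixKer_iff (hD : RamifiedDatum c u q) (hh : IsHermitianSpace h)
    (hL : IsIntegralLattice u h L) (hb : IsLatticeBasis b L) (a : Fin m → Valued.integer E) :
    (fun i => IsLocalRing.residue _ (a i)) ∈ matrixKer (residueGram u h b) ↔
      ∀ y ∈ L, ‖h (∑ i, a i • b i) y‖ ≤ 1 := by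
  rw [hD.forall_mem_norm_le_iff hb zero_le_one, mem_matrixKer]
  refine forall_congr' fun i => ?_
  have h1 : ∑ j, residueGram u h b i j * IsLocalRing.residue _ (a j)
      = -IsLocalRing.residue _ (∑ j, gram u h b j i * a j) := by
    rw [map_sum, ← Finset.sum_neg_distrib]
    refine Finset.sum_congr rfl fun j _ => ?_
    rw [(hD.isAlternating_residueGram hh hL hb).skew j i, map_mul, residueGram, neg_mul]
  rw [h1, neg_eq_zero, hD.residue_eq_zero_iff, hD.dvd_iff]
  have h2 : ((∑ j, gram u h b j i * a j : Valued.integer E) : E)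
      = u * h (∑ j, a j • b j) (b i) := by
    simp only [integer_smul_def]
    rw [sesq_sum_left, Finset.mul_sum]
    push_cast
    refine Finset.sum_congr rfl fun j _ => ?_
    rw [hD.coe_gram hL hb]
    ring
  rw [h2, hD.norm_lt_one_iff, norm_mul]
  exact mul_le_iff_le_one_right hD.norm_pos

theorem finite_residueField (hD : RamifiedDatum c u q) :
    Finite (IsLocalRing.ResidueField (Valued.integer E)) := hD.finite_residue

theorem card_matrixKer (hD : RamifiedDatum c u q) (b : Fin m → V) :
    Nat.card (matrixKer (residueGram u h b)) = q ^ corank u h b := by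
  have := hD.finite_residueField
  rw [Module.natCard_eq_pow_finrank (K := IsLocalRing.ResidueField (Valued.integer E)),
    hD.card_residue]
  rfl

theorem sub_mem_iff_residue (hD : RamifiedDatum c u q) (hb : IsLatticeBasis b L)
    (a a' : Fin m → Valued.integer E) :
    (u : E)⁻¹ • (∑ i, a i • b i) - (u : E)⁻¹ • (∑ i, a' i • b i) ∈ L ↔
      (fun i => IsLocalRing.residue _ (a i)) = fun i => IsLocalRing.residue _ (a' i) := by
  have h1 : (u : E)⁻¹ • (∑ i, a i • b i) - (u : E)⁻¹ • (∑ i, a' i • b i)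
      = ∑ i, ((u : E)⁻¹ * (a i - a' i : Valued.integer E)) • b i := by
    rw [← smul_sub, ← Finset.sum_sub_distrib, Finset.smul_sum]
    refine Finset.sum_congr rfl fun i _ => ?_
    rw [← sub_smul, integer_smul_def, smul_smul]
  rw [h1, hb.sum_mem_iff, funext_iff]
  refine forall_congr' fun i => ?_
  rw [← sub_eq_zero (b := IsLocalRing.residue _ (a' i)), ← map_sub, hD.residue_eq_zero_iff,
    hD.dvd_iff, hD.norm_lt_one_iff, norm_mul, norm_inv, inv_mul_le_iff₀ hD.norm_pos, mul_one]

/-- A class killed by `u` is represented by `u⁻¹ ∑ a i • b i`. This vector lies in the dual exactly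
when the reduction of `a` is in the radical, and its class modulo `L` only depends on that
reduction. -/
theorem card_dual_torsion (hD : RamifiedDatum c u q) (hh : IsHermitianSpace h)
    (hL : IsIntegralLattice u h L) (hb : IsLatticeBasis b L) :
    Nat.card {z : dual u h L ⧸ L.submoduleOf (dual u h L) // u • z = 0} = q ^ corank u h b := by
  classical
  rw [← hD.card_matrixKer (h := h) b, eq_comm]
  -- An arbitrary set-theoretic lift suffices, since the class modulo `L` depends only on residues.
  let lift : (Fin m → IsLocalRing.ResidueField (Valued.integer E)) → Fin m → Valued.integer E :=
    fun d i => Function.surjInv IsLocalRing.residue_surjective (d i)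
  have hlift : ∀ d, (fun i => IsLocalRing.residue _ (lift d i)) = d := fun d =>
    funext fun i => Function.surjInv_eq _ _
  have hpre : ∀ a : Fin m → Valued.integer E,
      (fun i => IsLocalRing.residue _ (a i)) ∈ matrixKer (residueGram u h b) ↔
      (u : E)⁻¹ • (∑ i, a i • b i) ∈ dual u h L := by
    intro a
    rw [hD.mem_matrixKer_iff hh hL hb, hD.mem_dual, and_iff_right]
    · refine forall₂_congr fun y hy => ?_
      rw [map_smul, LinearMap.smul_apply, smul_eq_mul, norm_mul, norm_inv]
      exact (mul_le_iff_le_one_right (inv_pos.mpr hD.norm_pos)).symm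
    · exact Submodule.smul_mem _ _ (mem_ambient (hb.mem_iff.mpr ⟨a, rfl⟩))
  have hu : ∀ v : V, u • ((u : E)⁻¹ • v) = v := fun v => by
    rw [integer_smul_def, smul_smul, mul_inv_cancel₀ hD.coe_ne_zero, one_smul]
  let f : matrixKer (residueGram u h b) →
      {z : dual u h L ⧸ L.submoduleOf (dual u h L) // u • z = 0} := fun d =>
    ⟨Submodule.Quotient.mk ⟨(u : E)⁻¹ • (∑ i, lift d i • b i),
      (hpre _).mp (by rw [hlift]; exact d.2)⟩, by
      rw [← Submodule.Quotient.mk_smul, Submodule.Quotient.mk_eq_zero]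
      change u • ((u : E)⁻¹ • (∑ i, lift d i • b i)) ∈ L
      rw [hu]
      exact hb.mem_iff.mpr ⟨_, rfl⟩⟩
  refine Nat.card_congr (Equiv.ofBijective f ⟨?_, ?_⟩)
  · intro d d' hdd
    have h1 := congrArg Subtype.val hdd
    rw [Submodule.Quotient.eq] at h1
    have h2 := (hD.sub_mem_iff_residue hb (lift d) (lift d')).mp h1
    rw [hlift, hlift] at h2
    exact Subtype.ext h2
  · rintro ⟨z, hz⟩
    obtain ⟨⟨v, hv⟩, rfl⟩ := Submodule.Quotient.mk_surjective _ z
    rw [← Submodule.Quotient.mk_smul, Submodule.Quotient.mk_eq_zero] at hz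
    change u • v ∈ L at hz
    obtain ⟨a, ha⟩ := hb.mem_iff.mp hz
    have hv' : v = (u : E)⁻¹ • (∑ i, a i • b i) := by
      rw [ha, integer_smul_def, smul_smul, inv_mul_cancel₀ hD.coe_ne_zero, one_smul]
    have hd : (fun i => IsLocalRing.residue _ (a i)) ∈ matrixKer (residueGram u h b) := by
      rw [hpre, ← hv']; exact hv
    refine ⟨⟨_, hd⟩, Subtype.ext ?_⟩
    rw [Submodule.Quotient.eq]
    change (u : E)⁻¹ • (∑ i, lift _ i • b i) - v ∈ L
    rw [hv', hD.sub_mem_iff_residue hb, hlift]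

theorem card_torsion_pow (hD : RamifiedDatum c u q) (j : ℕ) :
    Nat.card {z : Valued.integer E ⧸ Ideal.span {u ^ j} // u • z = 0} = if j = 0 then 1 else q := by
  have key : Nat.card {z : Valued.integer E ⧸ Ideal.span {u ^ j} // u • z = 0}
      = Nat.card {x : Valued.integer E ⧸ Ideal.span {u ^ j} //
          Ideal.Quotient.mk _ (u ^ (min j 1)) * x = 0} := by
    refine Nat.card_congr (Equiv.subtypeEquivRight fun z => ?_)
    obtain ⟨x, rfl⟩ := Ideal.Quotient.mk_surjective z
    rcases Nat.eq_zero_or_pos j with rfl | hj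
    · have : Subsingleton (Valued.integer E ⧸ Ideal.span {u ^ 0}) :=
        Ideal.Quotient.subsingleton_iff.mpr (by simp)
      exact iff_of_true (Subsingleton.elim _ _) (Subsingleton.elim _ _)
    · rw [min_eq_right hj, pow_one, ← map_mul]
      rfl
  rw [key, hD.card_annihilator (min_le_left j 1)]
  split_ifs with hj
  · simp [hj]
  · rw [min_eq_right (Nat.one_le_iff_ne_zero.mpr hj), pow_one]

/-- Any sequence of fundamental invariants of `L` has `corank` many nonzero entries. -/
theorem card_ne_zero_of_isFundamentalInvariants (hD : RamifiedDatum c u q)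
    (hh : IsHermitianSpace h) (hL : IsIntegralLattice u h L) (hb : IsLatticeBasis b L)
    {a : Fin (Module.finrank E (ambient L)) → ℕ} (ha : IsFundamentalInvariants u h L a) :
    Nat.card {i // a i ≠ 0} = corank u h b := by
  classical
  obtain ⟨-, ⟨e⟩⟩ := ha
  have h1 := hD.card_dual_torsion hh hL hb
  have h2 : Nat.card {z : dual u h L ⧸ L.submoduleOf (dual u h L) // u • z = 0}
      = ∏ i, Nat.card {z : Valued.integer E ⧸ Ideal.span {u ^ a i} // u • z = 0} := by
    rw [← Nat.card_pi]
    refine Nat.card_congr ((e.toEquiv.subtypeEquiv (q := fun w => ∀ i, u • w i = 0)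
      fun z => ?_).trans (Equiv.subtypePiEquivPi
        (p := fun i (w : Valued.integer E ⧸ Ideal.span {u ^ a i}) => u • w = 0)))
    change _ ↔ ∀ i, u • e z i = 0
    rw [← e.map_eq_zero_iff, map_smul, funext_iff]
    rfl
  rw [h2] at h1
  simp only [hD.card_torsion_pow] at h1
  -- Each nontrivial cyclic summand has `u`-torsion of order `q`, so comparing torsion counts the
  -- nonzero invariants.
  have h3 : ∏ i, (if a i = 0 then 1 else q) = q ^ Nat.card {i // a i ≠ 0} := by
    rw [Finset.prod_ite, Finset.prod_const_one, one_mul, Finset.prod_const,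
      Nat.card_eq_fintype_card, Fintype.card_subtype]
  rw [h3] at h1
  exact Nat.pow_right_injective hD.one_lt_q h1

end RamifiedDatum
end Types

/-! ### Dual lattices, fundamental invariants and finiteness. -/

section Duality

variable {F : Type*} [NontriviallyNormedField F]
variable {E : Type*} [NontriviallyNormedField E] [IsUltrametricDist E] [NormedAlgebra F E]
variable {c : E ≃ₐ[F] E} {u : Valued.integer E} {q : ℕ}
variable {V : Type*} [AddCommGroup V] [Module E V] {h : Pairing c V}
variable {L : Submodule (Valued.integer E) V} {m : ℕ} {b : Fin m → V}

/-- The form is nondegenerate on the subspace spanned by `L`. -/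
def NondegenerateOn (h : Pairing c V) (L : Submodule (Valued.integer E) V) : Prop :=
  ∀ x ∈ ambient L, (∀ y ∈ ambient L, h x y = 0) → x = 0

theorem ambient_mono {L L' : Submodule (Valued.integer E) V} (hle : L ≤ L') :
    ambient L ≤ ambient L' := Submodule.span_mono hle

theorem ambient_le_iff {W : Submodule E V} : ambient L ≤ W ↔ ∀ x ∈ L, x ∈ W :=
  Submodule.span_le

theorem IsLatticeBasis.forall_ambient_eq_zero (hb : IsLatticeBasis b L) {x : V}
    (hx : ∀ i, h x (b i) = 0) : ∀ y ∈ ambient L, h x y = 0 := by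
  intro y hy
  obtain ⟨a, rfl⟩ := hb.mem_ambient_iff.mp hy
  rw [RamifiedDatum.sesq_sum_right]
  simp [hx]

/-- The coefficients of a vector are bounded in terms of its pairings with a basis. -/
theorem RamifiedDatum.exists_coeff_bound (hD : RamifiedDatum c u q) (hb : IsLatticeBasis b L)
    (hnd : NondegenerateOn h L) : ∃ C : ℝ, 0 < C ∧ ∀ (a : Fin m → E) (D : ℝ), 0 ≤ D →
      (∀ i, ‖h (∑ j, a j • b j) (b i)‖ ≤ D) → ∀ j, ‖a j‖ ≤ C * D := by
  have := hD.properSpace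
  let T : (Fin m → E) →ₗ[E] (Fin m → E) :=
    { toFun := fun a i => h (∑ j, a j • b j) (b i)
      map_add' := by
        intro x y
        funext i
        simp [add_smul, Finset.sum_add_distrib]
      map_smul' := by
        intro r x
        funext i
        simp [Finset.mul_sum, mul_assoc] }
  have hT : Function.Injective T := by
    rw [← LinearMap.ker_eq_bot, LinearMap.ker_eq_bot']
    intro a ha
    have h1 : ∑ j, a j • b j = 0 :=
      hnd _ (hb.mem_ambient_iff.mpr ⟨a, rfl⟩) (hb.forall_ambient_eq_zero fun i => congrFun ha i)
    exact hb.coeff_unique (a' := 0) (by simpa using h1)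
  obtain ⟨K, hK, hA⟩ := (LinearMap.injective_iff_antilipschitz T).mp hT
  refine ⟨K, hK, fun a D hD0 hx j => ?_⟩
  have h1 : ‖a‖ ≤ K * ‖T a‖ := by simpa using hA.le_mul_dist a 0
  have h2 : ‖T a‖ ≤ D := (pi_norm_le_iff_of_nonneg hD0).mpr hx
  calc ‖a j‖ ≤ ‖a‖ := norm_le_pi_norm a j
    _ ≤ K * ‖T a‖ := h1
    _ ≤ K * D := by gcongr

theorem RamifiedDatum.exists_pow_mul_le_one (hD : RamifiedDatum c u q) (C : ℝ) :
    ∃ a : ℕ, ‖(u : E)‖ ^ a * C ≤ 1 := by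
  rcases le_or_gt C 1 with hC | hC
  · exact ⟨0, by simpa using hC⟩
  · obtain ⟨a, ha⟩ := exists_pow_lt_of_lt_one (inv_pos.mpr (zero_lt_one.trans hC)) hD.norm_lt_one
    refine ⟨a, ?_⟩
    have h0 : 0 < C := zero_lt_one.trans hC
    calc ‖(u : E)‖ ^ a * C ≤ C⁻¹ * C := by gcongr
      _ = 1 := inv_mul_cancel₀ h0.ne'

theorem RamifiedDatum.exists_pow_smul_mem (hD : RamifiedDatum c u q) (hb : IsLatticeBasis b L)
    (hnd : NondegenerateOn h L) (D : ℝ) (hD0 : 0 ≤ D) :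
    ∃ a : ℕ, ∀ x ∈ ambient L, (∀ i, ‖h x (b i)‖ ≤ D) → (u : E) ^ a • x ∈ L := by
  obtain ⟨C, -, hC⟩ := hD.exists_coeff_bound hb hnd
  obtain ⟨a, ha⟩ := hD.exists_pow_mul_le_one (C * D)
  refine ⟨a, fun x hx hxi => ?_⟩
  obtain ⟨w, rfl⟩ := hb.mem_ambient_iff.mp hx
  rw [Finset.smul_sum]
  simp only [smul_smul]
  rw [hb.sum_mem_iff]
  intro j
  rw [norm_mul, norm_pow]
  exact (mul_le_mul_of_nonneg_left (hC w D hD0 hxi j) (by positivity)).trans ha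

theorem RamifiedDatum.exists_pow_smul_dual (hD : RamifiedDatum c u q) (hb : IsLatticeBasis b L)
    (hnd : NondegenerateOn h L) : ∃ a : ℕ, ∀ x ∈ dual u h L, (u : E) ^ a • x ∈ L := by
  obtain ⟨a, ha⟩ := hD.exists_pow_smul_mem hb hnd ‖(u : E)‖⁻¹ (inv_nonneg.mpr (norm_nonneg _))
  refine ⟨a, fun x hx => ?_⟩
  rw [hD.mem_dual] at hx
  exact ha x hx.1 fun i => hx.2 _ (hb.mem i)

theorem IsLatticeBasis.smul (hb : IsLatticeBasis b L) {w : E} (hw : w ≠ 0) :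
    IsLatticeBasis (fun i => w • b i)
      (Submodule.span (Valued.integer E) (Set.range fun i => w • b i)) :=
  ⟨hb.li.units_smul fun _ => Units.mk0 w hw, rfl⟩

theorem IsLatticeBasis.mem_span_smul_iff (hb : IsLatticeBasis b L) {w : E} (hw : w ≠ 0) {x : V} :
    x ∈ Submodule.span (Valued.integer E) (Set.range fun i => w • b i) ↔ w⁻¹ • x ∈ L := by
  rw [(hb.smul hw).mem_iff, hb.mem_iff]
  refine exists_congr fun a => ?_
  rw [eq_inv_smul_iff₀ hw, Finset.smul_sum]
  simp only [integer_smul_def, smul_comm w]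

theorem RamifiedDatum.fg_of_le (hD : RamifiedDatum c u q) {L L' : Submodule (Valued.integer E) V}
    (hL' : L'.FG) (hle : L ≤ L') : L.FG := by
  have := hD.isPrincipalIdealRing
  have : Module.Finite (Valued.integer E) L' := Module.Finite.iff_fg.mpr hL'
  have : IsNoetherian (Valued.integer E) L' := inferInstance
  have h1 : (L.submoduleOf L').FG := IsNoetherian.noetherian _
  have h2 := h1.map L'.subtype
  rwa [Submodule.submoduleOf, Submodule.map_comap_subtype, inf_eq_right.mpr hle] at h2

theorem RamifiedDatum.fg_dual (hD : RamifiedDatum c u q) (hb : IsLatticeBasis b L)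
    (hnd : NondegenerateOn h L) : (dual u h L).FG := by
  obtain ⟨a, ha⟩ := hD.exists_pow_smul_dual hb hnd
  have hw : ((u : E) ^ a)⁻¹ ≠ 0 := inv_ne_zero (pow_ne_zero _ hD.coe_ne_zero)
  refine hD.fg_of_le (hb.smul hw).fg fun x hx => ?_
  rw [hb.mem_span_smul_iff hw, inv_inv]
  exact ha x hx

theorem ambient_dual (hL : IsIntegralLattice u h L) : ambient (dual u h L) = ambient L :=
  le_antisymm (ambient_le_iff.mpr fun _ hx => hx.1) (ambient_mono hL)

/-- Read the invariants off a basis of the dual adapted to the inclusion of `L`. -/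
theorem RamifiedDatum.exists_isFundamentalInvariants (hD : RamifiedDatum c u q)
    (hL : IsIntegralLattice u h L) (hb : IsLatticeBasis b L) (hnd : NondegenerateOn h L) :
    ∃ a, IsFundamentalInvariants u h L a := by
  have hm := hb.finrank_ambient
  subst hm
  obtain ⟨b', a, hb', ha⟩ := hD.exists_adapted_basis hb (hD.fg_dual hb hnd) hL
    (ambient_dual hL).symm
  let T : (Fin (Module.finrank E (ambient L)) → Valued.integer E) →ₗ[Valued.integer E]
      (dual u h L ⧸ L.submoduleOf (dual u h L)) :=
    (L.submoduleOf (dual u h L)).mkQ ∘ₗ Fintype.linearCombination (Valued.integer E)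
      (fun i => (⟨b' i, hb'.mem i⟩ : dual u h L))
  have hcoe : ∀ w, ((Fintype.linearCombination (Valued.integer E)
      (fun i => (⟨b' i, hb'.mem i⟩ : dual u h L)) w : dual u h L) : V) = ∑ i, w i • b' i := by
    intro w
    rw [Fintype.linearCombination_apply]
    change (dual u h L).subtype _ = _
    rw [map_sum]
    rfl
  have hsurj : Function.Surjective T := by
    intro z
    obtain ⟨⟨v, hv⟩, rfl⟩ := Submodule.Quotient.mk_surjective _ z
    obtain ⟨w, hw⟩ := hb'.mem_iff.mp hv
    refine ⟨w, ?_⟩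
    change Submodule.Quotient.mk _ = _
    congr 1
    exact Subtype.ext ((hcoe w).trans hw)
  have hker : LinearMap.ker T = Submodule.pi Set.univ fun i =>
      (Ideal.span {u ^ a i} : Submodule (Valued.integer E) (Valued.integer E)) := by
    ext w
    rw [LinearMap.mem_ker, Submodule.mem_pi]
    change Submodule.Quotient.mk _ = 0 ↔ _
    rw [Submodule.Quotient.mk_eq_zero]
    change ((Fintype.linearCombination (Valued.integer E)
      (fun i => (⟨b' i, hb'.mem i⟩ : dual u h L)) w : dual u h L) : V) ∈ L ↔ _
    rw [hcoe]
    have h1 : ∑ i, w i • b' i = ∑ i, ((w i : E) * ((u : E) ^ a i)⁻¹) • ((u : E) ^ a i • b' i) := by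
      refine Finset.sum_congr rfl fun i _ => ?_
      rw [smul_smul, mul_assoc, inv_mul_cancel₀ (pow_ne_zero _ hD.coe_ne_zero), mul_one]
      rfl
    rw [h1, ha.sum_mem_iff]
    refine forall_congr' fun i => ?_
    rw [norm_mul, norm_inv, norm_pow, mul_inv_le_iff₀ (pow_pos hD.norm_pos _), one_mul]
    simp only [Set.mem_univ, forall_true_left]
    exact hD.pow_dvd_iff.symm.trans Ideal.mem_span_singleton.symm
  have e0 := Submodule.quotientPi (R := Valued.integer E) fun i =>
    (Ideal.span {u ^ a i} : Submodule (Valued.integer E) (Valued.integer E))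
  have e2 := Submodule.quotEquivOfEq _ _ hker
  have e1 := ((T.quotKerEquivOfSurjective hsurj).symm.trans e2).trans e0
  -- Elementary divisors come unordered; sorting makes them monotone.
  have e3 := (LinearEquiv.piCongrLeft (Valued.integer E)
    (fun i => Valued.integer E ⧸ Ideal.span {u ^ a i}) (Tuple.sort a)).symm
  exact ⟨a ∘ Tuple.sort a, Tuple.monotone_sort a, ⟨e1.trans e3⟩⟩

/-- This removes the choice in the definition of the type and makes it computable by linear algebra
over the residue field in any basis. -/
theorem RamifiedDatum.latticeType_eq (hD : RamifiedDatum c u q) (hh : IsHermitianSpace h)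
    (hL : IsIntegralLattice u h L) (hb : IsLatticeBasis b L) (hnd : NondegenerateOn h L) :
    latticeType u h L = corank u h b := by
  have H := hD.exists_isFundamentalInvariants hL hb hnd
  rw [latticeType, dif_pos H]
  exact hD.card_ne_zero_of_isFundamentalInvariants hh hL hb H.choose_spec

theorem RamifiedDatum.even_add_corank (hD : RamifiedDatum c u q) (hh : IsHermitianSpace h)
    (hL : IsIntegralLattice u h L) (hb : IsLatticeBasis b L) : Even (m + corank u h b) := by
  have : NeZero (2 : IsLocalRing.ResidueField (Valued.integer E)) := ⟨hD.residue_two_ne_zero⟩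
  exact (hD.isAlternating_residueGram hh hL hb).even_add_finrank

/-- The quotient of a lattice by a sublattice is finite. -/
theorem RamifiedDatum.finite_quotient (hD : RamifiedDatum c u q)
    {D : Submodule (Valued.integer E) V} (hb : IsLatticeBasis b D) {a : ℕ}
    (ha : ∀ x ∈ D, (u : E) ^ a • x ∈ L) : Finite (D ⧸ L.submoduleOf D) := by
  have := hD.finite_quotient_pow a
  let f : (Fin m → Valued.integer E ⧸ Ideal.span {u ^ a}) → D ⧸ L.submoduleOf D := fun w =>
    Submodule.Quotient.mk ⟨∑ i, (w i).out • b i, hb.mem_iff.mpr ⟨_, rfl⟩⟩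
  refine Finite.of_surjective f fun z => ?_
  obtain ⟨⟨v, hv⟩, rfl⟩ := Submodule.Quotient.mk_surjective _ z
  obtain ⟨w, hw⟩ := hb.mem_iff.mp hv
  refine ⟨fun i => Ideal.Quotient.mk _ (w i), (Submodule.Quotient.eq _).mpr ?_⟩
  change ∑ i, (Ideal.Quotient.mk (Ideal.span {u ^ a}) (w i)).out • b i - v ∈ L
  have h1 : ∀ i, u ^ a ∣ (Ideal.Quotient.mk (Ideal.span {u ^ a}) (w i)).out - w i := fun i =>
    RamifiedDatum.mk_eq_mk_iff.mp (Ideal.Quotient.mk_out _)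
  choose d hd using h1
  rw [← hw, ← Finset.sum_sub_distrib]
  simp only [← sub_smul, hd, mul_smul, ← Finset.smul_sum]
  exact ha _ (hb.mem_iff.mpr ⟨d, rfl⟩)

/-- Intermediate lattices are determined by their images in the finite quotient `D / (L ∩ D)`. -/
theorem RamifiedDatum.finite_between (hD : RamifiedDatum c u q)
    {D : Submodule (Valued.integer E) V} (hDfg : D.FG) {a : ℕ}
    (ha : ∀ x ∈ D, (u : E) ^ a • x ∈ L) : {L' | L ≤ L' ∧ L' ≤ D}.Finite := by
  obtain ⟨b, hb⟩ := hD.exists_isLatticeBasis hDfg rfl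
  have := hD.finite_quotient hb ha
  have hfin : Finite (Submodule (Valued.integer E) (D ⧸ L.submoduleOf D)) :=
    Finite.of_injective (fun p => (p : Set (D ⧸ L.submoduleOf D))) SetLike.coe_injective
  refine Set.Finite.of_finite_image (f := fun L' : Submodule (Valued.integer E) V =>
    (L'.submoduleOf D).map (L.submoduleOf D).mkQ) (Set.toFinite _) ?_
  rintro L₁ ⟨h1, h1'⟩ L₂ ⟨h2, h2'⟩ heq
  have h3 := congrArg (Submodule.comap (L.submoduleOf D).mkQ) heq
  simp only [Submodule.comap_map_mkQ] at h3
  rw [sup_eq_right.mpr (Submodule.comap_mono h1), sup_eq_right.mpr (Submodule.comap_mono h2)] at h3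
  have h4 := congrArg (Submodule.map D.subtype) h3
  rwa [Submodule.submoduleOf, Submodule.submoduleOf, Submodule.map_comap_subtype,
    Submodule.map_comap_subtype, inf_eq_right.mpr h1', inf_eq_right.mpr h2'] at h4

end Duality

/-! ### Primitive tuples whose Gram matrix is known only after scaling by powers of `u`. -/

section ScaledTuples

variable {F : Type*} [NontriviallyNormedField F]
variable {E : Type*} [NontriviallyNormedField E] [IsUltrametricDist E] [NormedAlgebra F E]
variable {c : E ≃ₐ[F] E} {u : Valued.integer E} {q : ℕ}

namespace RamifiedDatum

theorem pow_mul_conjQuot_eq_zero (hD : RamifiedDatum c u q) {k a : ℕ}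
    {x : Valued.integer E ⧸ Ideal.span {u ^ (2 * k)}}
    (hx : Ideal.Quotient.mk _ (u ^ a) * x = 0) :
    Ideal.Quotient.mk _ (u ^ a) * hD.conjQuot (2 * k) x = 0 := by
  have h1 := congrArg (hD.conjQuot (2 * k)) hx
  rw [map_mul, conjQuot_mk, map_pow, hD.conjInt_u, map_zero, neg_pow, map_mul, mul_assoc] at h1
  rcases neg_one_pow_eq_or (Valued.integer E) a with h2 | h2
  · simpa [h2] using h1
  · simpa [h2] using h1

/-- A diagonal entry is skew and killed by `u ^ (2 * e i)`, with `q ^ e i` choices. An entry above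
the diagonal is only killed by `u ^ (e i + e j)`, with `q ^ (e i + e j)` choices, and determines its
mirror image. The exponents add up to `n * ∑ e i`. -/
theorem card_annihilator_matrices (hD : RamifiedDatum c u q) {k : ℕ} : ∀ {n : ℕ} (e : Fin n → ℕ),
    (∀ i, e i ≤ k) → Nat.card {σ : Fin n → Fin n → Valued.integer E ⧸ Ideal.span {u ^ (2 * k)} //
      (∀ i j, hD.conjQuot (2 * k) (σ i j) = -σ j i) ∧
      ∀ i j, Ideal.Quotient.mk _ (u ^ (e i + e j)) * σ i j = 0} = q ^ (n * ∑ i, e i)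
  | 0, e, _ => by
    rw [zero_mul, pow_zero, Nat.card_eq_one_iff_unique]
    exact ⟨inferInstance, ⟨⟨finZeroElim, finZeroElim, finZeroElim⟩⟩⟩
  | n + 1, e, he => by
    have ih := card_annihilator_matrices hD (fun i : Fin n => e i.succ) fun i => he _
    have hcc : ∀ x, hD.conjQuot (2 * k) (hD.conjQuot (2 * k) x) = x := by
      intro x
      obtain ⟨x, rfl⟩ := Ideal.Quotient.mk_surjective x
      simp [hD.conjInt_conjInt]
    let A := {x : Valued.integer E ⧸ Ideal.span {u ^ (2 * k)} //
      hD.conjQuot (2 * k) x = -x ∧ Ideal.Quotient.mk _ (u ^ (2 * e 0)) * x = 0}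
    let B := (i : Fin n) → {x : Valued.integer E ⧸ Ideal.span {u ^ (2 * k)} //
      Ideal.Quotient.mk _ (u ^ (e 0 + e i.succ)) * x = 0}
    let C := {σ : Fin n → Fin n → Valued.integer E ⧸ Ideal.span {u ^ (2 * k)} //
      (∀ i j, hD.conjQuot (2 * k) (σ i j) = -σ j i) ∧
      ∀ i j : Fin n, Ideal.Quotient.mk _ (u ^ (e i.succ + e j.succ)) * σ i j = 0}
    let eqv : {σ : Fin (n + 1) → Fin (n + 1) → Valued.integer E ⧸ Ideal.span {u ^ (2 * k)} //
      (∀ i j, hD.conjQuot (2 * k) (σ i j) = -σ j i) ∧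
      ∀ i j, Ideal.Quotient.mk _ (u ^ (e i + e j)) * σ i j = 0} ≃ A × B × C :=
      { toFun := fun σ => (⟨σ.1 0 0, σ.2.1 0 0, by
            have h0 := σ.2.2 0 0
            rwa [← two_mul (e 0)] at h0⟩,
          fun i => ⟨σ.1 0 i.succ, σ.2.2 0 i.succ⟩,
          ⟨fun i j => σ.1 i.succ j.succ, fun i j => σ.2.1 _ _, fun i j => σ.2.2 _ _⟩)
        invFun := fun p => ⟨Fin.cons (Fin.cons p.1.1 fun i => (p.2.1 i).1)
            fun i => Fin.cons (-hD.conjQuot (2 * k) (p.2.1 i).1) (p.2.2.1 i), by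
          intro i j
          refine Fin.cases ?_ (fun i => ?_) i <;> refine Fin.cases ?_ (fun j => ?_) j
          · simpa using p.1.2.1
          · simp
          · simp [hcc]
          · simpa using p.2.2.2.1 i j, by
          intro i j
          refine Fin.cases ?_ (fun i => ?_) i <;> refine Fin.cases ?_ (fun j => ?_) j
          · simpa [two_mul] using p.1.2.2
          · simpa using (p.2.1 j).2
          · have := hD.pow_mul_conjQuot_eq_zero (p.2.1 i).2
            rw [add_comm]
            simpa using this
          · simpa using p.2.2.2.2 i j⟩
        left_inv := by
          rintro ⟨σ, hσ, hσ'⟩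
          refine Subtype.ext (funext fun i => funext fun j => ?_)
          refine Fin.cases ?_ (fun i => ?_) i <;> refine Fin.cases ?_ (fun j => ?_) j
          · simp
          · simp
          · simp [hσ]
          · simp
        right_inv := by
          rintro ⟨⟨x, hx⟩, r, ⟨σ, hσ⟩⟩
          rfl }
    have hB : Nat.card B = ∏ i : Fin n, q ^ (e 0 + e i.succ) := by
      rw [Nat.card_pi]
      refine Finset.prod_congr rfl fun i _ => ?_
      exact hD.card_annihilator (by have := he 0; have := he i.succ; omega)
    rw [Nat.card_congr eqv, Nat.card_prod, Nat.card_prod, hD.card_skew_annihilator (he 0), hB]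
    rw [show Nat.card C = q ^ (n * ∑ i : Fin n, e i.succ) from ih, Finset.prod_pow_eq_pow_sum,
      ← pow_add, ← pow_add, Fin.sum_univ_succ, Finset.sum_add_distrib]
    congr 1
    simp only [Finset.sum_const, Finset.card_univ, Fintype.card_fin, smul_eq_mul]
    ring

theorem resQuot_eq_zero_of_pow_mul (hD : RamifiedDatum c u q) {j a : ℕ} (hj : j ≠ 0) (ha : a < j)
    {x : Valued.integer E ⧸ Ideal.span {u ^ j}} (hx : Ideal.Quotient.mk _ (u ^ a) * x = 0) :
    hD.resQuot hj x = 0 := by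
  obtain ⟨x, rfl⟩ := Ideal.Quotient.mk_surjective x
  rw [← map_mul, mk_eq_zero_iff] at hx
  rw [resQuot_mk, hD.residue_eq_zero_iff]
  obtain ⟨d, rfl⟩ := Nat.exists_eq_add_of_lt ha
  rw [add_assoc, pow_add] at hx
  have h1 := (mul_dvd_mul_iff_left (pow_ne_zero a hD.ne_zero)).mp hx
  exact (dvd_pow_self u (Nat.succ_ne_zero d)).trans h1

/-- The number of primitive tuples with a given Gram matrix modulo `u ^ (2 * k)`. -/
theorem card_primitiveTuples (hD : RamifiedDatum c u q) {s n k : ℕ} (hk : 2 * k ≠ 0)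
    (σ : Fin n → Fin n → Valued.integer E ⧸ Ideal.span {u ^ (2 * k)})
    (hσ : ∀ i j, hD.conjQuot (2 * k) (σ i j) = -σ j i) :
    (Nat.card (PrimitiveTuples s (hD.resQuot hk) (hD.conjQuot (2 * k)) σ) : ℝ)
      = (q : ℝ) ^ ((k : ℤ) * hermDim (2 * s) n)
        * ∏ i ∈ Finset.range ((n + Module.finrank (IsLocalRing.ResidueField (Valued.integer E))
          (matrixKer fun i j => hD.resQuot hk (σ i j))) / 2),
          (1 - (q : ℝ) ^ (2 * i) / (q : ℝ) ^ (s * 2)) := by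
  have h1 := PrimitiveTuples.card_mul (s := s) (hD.isLocalInvolution hk) σ hσ
  rw [hD.card_quotient_pow, hD.card_skew, hD.card_residue] at h1
  have hq : (q : ℝ) ≠ 0 := by
    have := hD.one_lt_q
    positivity
  -- The exponents match: `k (4 s n - n ^ 2) + k n + k n (n - 1) = 4 k s n`.
  have h2 : (q : ℝ) ^ ((k : ℤ) * hermDim (2 * s) n) * (((q ^ k : ℕ) : ℝ) ^ n
      * ((q ^ (2 * k) : ℕ) : ℝ) ^ (∑ i ∈ Finset.range n, i))
      = ((q ^ (2 * k) : ℕ) : ℝ) ^ (s * 2 * n) := by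
    push_cast
    rw [← pow_mul, ← pow_mul, ← pow_mul, ← zpow_natCast, ← zpow_natCast, ← zpow_natCast,
      ← zpow_add₀ hq, ← zpow_add₀ hq]
    congr 1
    have h3 := Finset.sum_range_id_mul_two n
    have h4 : ((∑ i ∈ Finset.range n, i : ℕ) : ℤ) * 2 = n * (n - 1) := by
      rcases Nat.eq_zero_or_pos n with rfl | hn
      · simp
      · have := congrArg (Nat.cast (R := ℤ)) h3
        push_cast [Nat.cast_sub hn] at this
        push_cast
        exact this
    push_cast at h4 ⊢
    rw [hermDim]
    push_cast
    linear_combination (k : ℤ) * h4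
  rw [← h2, mul_assoc] at h1
  have h5 : (((q ^ k : ℕ) : ℝ) ^ n * ((q ^ (2 * k) : ℕ) : ℝ) ^ (∑ i ∈ Finset.range n, i)) ≠ 0 := by
    push_cast
    positivity
  refine mul_right_cancel₀ h5 ?_
  rw [h1]
  ring

/-- Primitive tuples `x` such that the tuple `u ^ e i • x i` has a given Gram matrix. -/
def ScaledTuples (hD : RamifiedDatum c u q) (s : ℕ) {n k : ℕ} (hk : 2 * k ≠ 0) (e : Fin n → ℕ)
    (τ : Fin n → Fin n → Valued.integer E ⧸ Ideal.span {u ^ (2 * k)}) : Type _ :=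
  {x : Fin n → Fin s → Fin 2 → Valued.integer E ⧸ Ideal.span {u ^ (2 * k)} //
    (LinearIndependent (IsLocalRing.ResidueField (Valued.integer E))
      fun i => redVec (hD.resQuot hk) (x i)) ∧
    ∀ i j, Ideal.Quotient.mk _ (u ^ (e i + e j)) *
      (skewForm (hD.conjQuot (2 * k)) (x i) (x j) - τ i j) = 0}

/-- The actual Gram matrix is `τ` plus an error killed by the powers `u ^ (e i + e j)`. Since these
exponents are below `2 * k`, the error vanishes modulo `u` and leaves the corank unchanged. Every
error therefore contributes the same number of primitive tuples. -/
theorem card_scaledTuples (hD : RamifiedDatum c u q) {s n k : ℕ} (hk : 2 * k ≠ 0) (e : Fin n → ℕ)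
    (he : ∀ i, e i < k) (τ : Fin n → Fin n → Valued.integer E ⧸ Ideal.span {u ^ (2 * k)})
    (hτ : ∀ i j, hD.conjQuot (2 * k) (τ i j) = -τ j i) :
    (Nat.card (hD.ScaledTuples s hk e τ) : ℝ) = (q : ℝ) ^ (n * ∑ i, e i)
      * ((q : ℝ) ^ ((k : ℤ) * hermDim (2 * s) n)
        * ∏ i ∈ Finset.range ((n + Module.finrank (IsLocalRing.ResidueField (Valued.integer E))
          (matrixKer fun i j => hD.resQuot hk (τ i j))) / 2),
          (1 - (q : ℝ) ^ (2 * i) / (q : ℝ) ^ (s * 2))) := by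
  have hI := hD.isLocalInvolution hk
  have := hI.finite
  have hfin : Finite (hD.ScaledTuples s hk e τ) := Subtype.finite
  let S := {σ : Fin n → Fin n → Valued.integer E ⧸ Ideal.span {u ^ (2 * k)} //
      (∀ i j, hD.conjQuot (2 * k) (σ i j) = -σ j i) ∧
      ∀ i j, Ideal.Quotient.mk _ (u ^ (e i + e j)) * σ i j = 0}
  let f : hD.ScaledTuples s hk e τ → S := fun x =>
    ⟨fun i j => skewForm (hD.conjQuot (2 * k)) (x.1 i) (x.1 j) - τ i j, fun i j => by
      rw [map_sub, conj_skewForm hI.conj_conj, hτ]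
      ring, x.2.2⟩
  have hcard : Nat.card S = q ^ (n * ∑ i, e i) :=
    hD.card_annihilator_matrices e fun i => (he i).le
  have key := natCard_eq_card_mul_of_fiber f
    (Nat.card (PrimitiveTuples s (hD.resQuot hk) (hD.conjQuot (2 * k)) τ)) fun σ => by
    have h1 : Nat.card {x // f x = σ} = Nat.card (PrimitiveTuples s (hD.resQuot hk)
        (hD.conjQuot (2 * k)) (τ + σ.1)) := by
      refine Nat.card_congr
        { toFun := fun x => ⟨x.1.1, x.1.2.1, fun i j => ?_⟩
          invFun := fun x => ⟨⟨x.1, x.2.1, fun i j => ?_⟩, ?_⟩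
          left_inv := fun x => rfl
          right_inv := fun x => rfl }
      · have h2 := congrFun (congrFun (congrArg Subtype.val x.2) i) j
        change skewForm _ (x.1.1 i) (x.1.1 j) - τ i j = σ.1 i j at h2
        simp only [Pi.add_apply]
        linear_combination h2
      · rw [x.2.2, Pi.add_apply, Pi.add_apply, add_sub_cancel_left]
        exact σ.2.2 i j
      · refine Subtype.ext (funext fun i => funext fun j => ?_)
        change skewForm _ (x.1 i) (x.1 j) - τ i j = _
        rw [x.2.2, Pi.add_apply, Pi.add_apply, add_sub_cancel_left]
    rw [h1]
    have h2 : ∀ i j, hD.conjQuot (2 * k) ((τ + σ.1) i j) = -(τ + σ.1) j i := fun i j => by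
      simp only [Pi.add_apply, map_add, hτ, σ.2.1]
      ring
    have h3 : (fun i j => hD.resQuot hk ((τ + σ.1) i j)) = fun i j => hD.resQuot hk (τ i j) := by
      funext i j
      have h4 : e i + e j < 2 * k := by have := he i; have := he j; omega
      rw [Pi.add_apply, Pi.add_apply, map_add, hD.resQuot_eq_zero_of_pow_mul hk h4 (σ.2.2 i j),
        add_zero]
    have h5 := hD.card_primitiveTuples (s := s) hk _ h2
    rw [h3, ← hD.card_primitiveTuples (s := s) hk _ hτ] at h5
    exact_mod_cast h5
  rw [key, hcard, ← hD.card_primitiveTuples hk _ hτ]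
  push_cast
  ring

end RamifiedDatum
end ScaledTuples

/-! ### Hermitian maps modulo `u ^ (2 * k)` and their saturations. -/

section HermitianHoms

variable {F : Type*} [NontriviallyNormedField F]
variable {E : Type*} [NontriviallyNormedField E] [IsUltrametricDist E] [NormedAlgebra F E]
variable {c : E ≃ₐ[F] E} {u : Valued.integer E} {q : ℕ}
variable {V : Type*} [AddCommGroup V] [Module E V] {h : Pairing c V}
variable {L L' : Submodule (Valued.integer E) V} {n s k : ℕ} {b b' : Fin n → V}

theorem skewForm_redVec {R S : Type*} [CommRing R] [CommRing S] (f : R →+* S) {conj : R →+* R}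
    {conj' : S →+* S} (hf : ∀ a, conj' (f a) = f (conj a)) (x y : Fin s → Fin 2 → R) :
    skewForm conj' (redVec f x) (redVec f y) = f (skewForm conj x y) := by
  simp [skewForm, redVec, hf]

theorem mem_powSubmodule {M : Type*} [AddCommGroup M] [Module (Valued.integer E) M] {x : M} :
    x ∈ powSubmodule u M k ↔ ∃ y, u ^ (2 * k) • y = x := by
  rw [powSubmodule, Submodule.ideal_span_singleton_smul, Submodule.mem_smul_pointwise_iff_exists]
  simp

theorem redVec_mk_eq_iff {j : ℕ} {x y : Fin s → Fin 2 → Valued.integer E} :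
    redVec (Ideal.Quotient.mk (Ideal.span {u ^ j})) x = redVec (Ideal.Quotient.mk _) y ↔
      ∃ z, u ^ j • z = x - y := by
  constructor
  · intro hxy
    have h1 : ∀ i l, u ^ j ∣ x i l - y i l := fun i l =>
      RamifiedDatum.mk_eq_mk_iff.mp (congrFun (congrFun hxy i) l)
    choose z hz using h1
    exact ⟨z, funext fun i => funext fun l => (hz i l).symm⟩
  · rintro ⟨z, hz⟩
    refine funext fun i => funext fun l => RamifiedDatum.mk_eq_mk_iff.mpr ⟨z i l, ?_⟩
    exact (congrFun (congrFun hz i) l).symm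

theorem mkQ_powSubmodule_eq_iff {x y : Fin s → Fin 2 → Valued.integer E} :
    (powSubmodule u (Fin s → Fin 2 → Valued.integer E) k).mkQ x
      = (powSubmodule u (Fin s → Fin 2 → Valued.integer E) k).mkQ y ↔
    redVec (Ideal.Quotient.mk (Ideal.span {u ^ (2 * k)})) x = redVec (Ideal.Quotient.mk _) y := by
  rw [redVec_mk_eq_iff, ← mem_powSubmodule, Submodule.mkQ_apply, Submodule.mkQ_apply,
    Submodule.Quotient.eq]

theorem exists_linearMap_lift {M : Type*} [AddCommGroup M] [Module (Valued.integer E) M]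
    (hb : IsLatticeBasis b L)
    (φ : (L ⧸ powSubmodule u L k) →ₗ[Valued.integer E] (M ⧸ powSubmodule u M k)) :
    ∃ φ₀ : L →ₗ[Valued.integer E] M,
      ∀ x, φ ((powSubmodule u L k).mkQ x) = (powSubmodule u M k).mkQ (φ₀ x) := by
  obtain ⟨B, -⟩ := hb.exists_basis
  have := Module.Free.of_basis B
  obtain ⟨φ₀, hφ⟩ := Module.projective_lifting_property (powSubmodule u M k).mkQ
    (φ ∘ₗ (powSubmodule u L k).mkQ) (Submodule.mkQ_surjective _)
  exact ⟨φ₀, fun x => (LinearMap.congr_fun hφ x).symm⟩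

theorem exists_linearMap_reduction {M : Type*} [AddCommGroup M] [Module (Valued.integer E) M]
    (φ₀ : L →ₗ[Valued.integer E] M) :
    ∃ φ : (L ⧸ powSubmodule u L k) →ₗ[Valued.integer E] (M ⧸ powSubmodule u M k),
      ∀ x, φ ((powSubmodule u L k).mkQ x) = (powSubmodule u M k).mkQ (φ₀ x) := by
  refine ⟨Submodule.mapQ _ _ φ₀ fun x hx => ?_, fun x => rfl⟩
  obtain ⟨y, rfl⟩ := mem_powSubmodule.mp hx
  exact mem_powSubmodule.mpr ⟨φ₀ y, (map_smul φ₀ _ _).symm⟩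

/-- The saturation of a lattice with respect to a homomorphism `φ` to a free module, among the
lattices contained in `u ^ (-a) L`. -/
def saturation (u : Valued.integer E) {M : Type*} [AddCommGroup M] [Module (Valued.integer E) M]
    (a : ℕ) (φ : L →ₗ[Valued.integer E] M) : Submodule (Valued.integer E) V where
  carrier := {v | ∃ (x : L) (z : M), u ^ a • v = x ∧ φ x = u ^ a • z}
  zero_mem' := ⟨0, 0, by simp, by simp⟩
  add_mem' := by
    rintro v w ⟨x, z, h1, h2⟩ ⟨x', z', h1', h2'⟩
    exact ⟨x + x', z + z', by rw [smul_add, h1, h1']; rfl, by rw [map_add, h2, h2', smul_add]⟩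
  smul_mem' := by
    rintro r v ⟨x, z, h1, h2⟩
    exact ⟨r • x, r • z, by rw [smul_comm, h1]; rfl, by rw [map_smul, h2, smul_comm]⟩

theorem le_saturation {M : Type*} [AddCommGroup M] [Module (Valued.integer E) M]
    {a : ℕ} {φ : L →ₗ[Valued.integer E] M} : L ≤ saturation u a φ := fun x hx =>
  ⟨u ^ a • ⟨x, hx⟩, φ ⟨x, hx⟩, rfl, map_smul φ _ _⟩

/-- The saturation only depends on the reduction of the homomorphism. -/
theorem saturation_congr {M : Type*} [AddCommGroup M] [Module (Valued.integer E) M]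
    {a j : ℕ} (haj : a ≤ j) {φ φ' : L →ₗ[Valued.integer E] M}
    (hφ : ∀ x, ∃ z, u ^ j • z = φ x - φ' x) : saturation u a φ = saturation u a φ' := by
  have key : ∀ φ φ' : L →ₗ[Valued.integer E] M, (∀ x, ∃ z, u ^ j • z = φ x - φ' x) →
      saturation u a φ ≤ saturation u a φ' := by
    rintro φ φ' hφ v ⟨x, z, h1, h2⟩
    obtain ⟨z', hz'⟩ := hφ x
    refine ⟨x, z - u ^ (j - a) • z', h1, ?_⟩
    rw [smul_sub, smul_smul, ← pow_add, Nat.add_sub_cancel' haj, hz', h2]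
    abel
  refine le_antisymm (key _ _ hφ) (key _ _ fun x => ?_)
  obtain ⟨z, hz⟩ := hφ x
  exact ⟨-z, by rw [smul_neg, hz]; abel⟩

namespace RamifiedDatum

theorem mul_hyperbolicPairing (hD : RamifiedDatum c u q) (x y : Fin s → Fin 2 → Valued.integer E) :
    (u : E) * hyperbolicPairing c u s x y
      = ((skewForm hD.conjInt x y : Valued.integer E) : E) := by
  have hu := hD.coe_ne_zero
  rw [hyperbolicPairing, skewForm, Finset.mul_sum]
  push_cast
  refine Finset.sum_congr rfl fun i _ => ?_
  rw [hD.coe_conjInt, hD.coe_conjInt]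
  field_simp

/-- `φ` preserves the pairings modulo `u ^ (2 * k)`. -/
def Preserves (hD : RamifiedDatum c u q) (h : Pairing c V) (k : ℕ)
    (φ : L →ₗ[Valued.integer E] (Fin s → Fin 2 → Valued.integer E)) : Prop :=
  ∀ x y : L, ‖((skewForm hD.conjInt (φ x) (φ y) : Valued.integer E) : E) - u * h x y‖
    ≤ ‖(u : E)‖ ^ (2 * k)

theorem norm_skewForm_sub_le (hD : RamifiedDatum c u q) {j : ℕ}
    {x x' y y' : Fin s → Fin 2 → Valued.integer E}
    (hx : redVec (Ideal.Quotient.mk (Ideal.span {u ^ j})) x = redVec (Ideal.Quotient.mk _) x')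
    (hy : redVec (Ideal.Quotient.mk (Ideal.span {u ^ j})) y = redVec (Ideal.Quotient.mk _) y') :
    ‖((skewForm hD.conjInt x y : Valued.integer E) : E) - (skewForm hD.conjInt x' y' :
      Valued.integer E)‖ ≤ ‖(u : E)‖ ^ j := by
  have h1 : u ^ j ∣ skewForm hD.conjInt x y - skewForm hD.conjInt x' y' := by
    rw [← mk_eq_mk_iff, ← skewForm_redVec _ (hD.conjQuot_mk j), ← skewForm_redVec _
      (hD.conjQuot_mk j), hx, hy]
  exact hD.pow_dvd_iff.mp h1

theorem norm_sub_le_of_le (x y z : E) {C : ℝ} (h1 : ‖x - y‖ ≤ C) (h2 : ‖y - z‖ ≤ C) :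
    ‖x - z‖ ≤ C := by
  have : x - z = (x - y) + (y - z) := by ring
  rw [this]
  exact (IsUltrametricDist.norm_add_le_max _ _).trans (max_le h1 h2)

theorem mem_hermHom_iff (hD : RamifiedDatum c u q)
    {φ : (L ⧸ powSubmodule u L k) →ₗ[Valued.integer E]
      ((Fin s → Fin 2 → Valued.integer E) ⧸ powSubmodule u (Fin s → Fin 2 → Valued.integer E) k)}
    {φ₀ : L →ₗ[Valued.integer E] (Fin s → Fin 2 → Valued.integer E)}
    (hφ : ∀ x, φ ((powSubmodule u L k).mkQ x) = (powSubmodule u _ k).mkQ (φ₀ x)) :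
    φ ∈ hermHom u (hyperbolicPairing c u s) (fun x y : L => h x y) k ↔ hD.Preserves h k φ₀ := by
  constructor
  · intro H x y
    obtain ⟨a, ha⟩ := H x y _ _ (hφ x) (hφ y)
    rw [mul_sub, hD.mul_hyperbolicPairing] at ha
    rw [ha, norm_mul, norm_pow]
    exact mul_le_of_le_one_right (by positivity) (norm_coe_integer_le a)
  · intro H x y x' y' hx hy
    rw [hφ, eq_comm, mkQ_powSubmodule_eq_iff] at hx hy
    have h1 := norm_sub_le_of_le _ _ _ (hD.norm_skewForm_sub_le hx hy) (H x y)
    have hu : (u : E) ^ (2 * k) ≠ 0 := pow_ne_zero _ hD.coe_ne_zero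
    refine ⟨⟨((u : E) ^ (2 * k))⁻¹ * (u * (hyperbolicPairing c u s x' y' - h x y)),
      mem_integer_iff.mpr ?_⟩, ?_⟩
    · rw [mul_sub, hD.mul_hyperbolicPairing, norm_mul, norm_inv, norm_pow,
        inv_mul_le_iff₀ (pow_pos hD.norm_pos _), mul_one]
      exact h1
    · change _ = _ * (((u : E) ^ (2 * k))⁻¹ * _)
      rw [mul_inv_cancel_left₀ hu]

theorem Preserves.isIntegralLattice {hD : RamifiedDatum c u q}
    {φ : L →ₗ[Valued.integer E] (Fin s → Fin 2 → Valued.integer E)} (hφ : hD.Preserves h k φ) :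
    IsIntegralLattice u h L := by
  rw [hD.isIntegralLattice_iff]
  intro x hx y hy
  rw [← hD.norm_mul_le_one_iff]
  have h1 := hφ ⟨x, hx⟩ ⟨y, hy⟩
  have h2 := (hφ ⟨x, hx⟩ ⟨y, hy⟩).trans (pow_le_one₀ (norm_nonneg _) hD.norm_lt_one.le)
  rw [norm_sub_rev] at h2
  have := norm_sub_le_of_le _ _ 0 h2 (by rw [sub_zero]; exact norm_coe_integer_le _)
  rwa [sub_zero] at this

/-- For `v`, `w` in the saturation, the vectors `u ^ a v` and `u ^ a w` map to multiples of `u ^ a`,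
so the pairing of their images is divisible by `u ^ (2 * a)`. The allowed error `u ^ (2 * k)` is
divisible by it as well because `a ≤ k`. -/
theorem Preserves.isIntegralLattice_saturation {hD : RamifiedDatum c u q} {a : ℕ} (ha : a ≤ k)
    {φ : L →ₗ[Valued.integer E] (Fin s → Fin 2 → Valued.integer E)} (hφ : hD.Preserves h k φ) :
    IsIntegralLattice u h (saturation u a φ) := by
  rw [hD.isIntegralLattice_iff]
  rintro v ⟨x, z, h1, h2⟩ w ⟨x', z', h1', h2'⟩
  rw [← hD.norm_mul_le_one_iff]
  have h3 := hφ x x'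
  have h4 : (u : E) * h (x : V) (x' : V) = (u : E) ^ a * c ((u : E) ^ a) * (u * h v w) := by
    rw [← h1, ← h1', integer_smul_def, integer_smul_def]
    simp
    ring
  rw [h2, h2', skewForm_smul_left, skewForm_smul_right, h4] at h3
  push_cast at h3
  rw [hD.coe_conjInt] at h3
  push_cast at h3
  rw [← mul_assoc, ← mul_sub, norm_mul, norm_mul, hD.norm_conj, norm_pow, ← pow_add] at h3
  have hp : 0 < ‖(u : E)‖ ^ (a + a) := pow_pos hD.norm_pos _
  have h5 : ‖(u : E)‖ ^ (2 * k) ≤ ‖(u : E)‖ ^ (a + a) :=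
    pow_le_pow_of_le_one hD.norm_pos.le hD.norm_lt_one.le (by omega)
  have h6 := (mul_le_iff_le_one_right hp).mp (h3.trans h5)
  rw [norm_sub_rev] at h6
  have := norm_sub_le_of_le _ _ 0 h6 (by rw [sub_zero]; exact norm_coe_integer_le _)
  rwa [sub_zero] at this

theorem redVec_residue_eq_zero_iff (hD : RamifiedDatum c u q)
    {x : Fin s → Fin 2 → Valued.integer E} :
    redVec (IsLocalRing.residue (Valued.integer E)) x = 0 ↔ ∃ z, u • z = x := by
  constructor
  · intro hx
    have h1 : ∀ i l, u ∣ x i l := fun i l =>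
      hD.residue_eq_zero_iff.mp (congrFun (congrFun hx i) l)
    choose z hz using h1
    exact ⟨z, funext fun i => funext fun l => (hz i l).symm⟩
  · rintro ⟨z, rfl⟩
    funext i l
    exact hD.residue_eq_zero_iff.mpr (dvd_mul_right u (z i l))

theorem smul_vec_cancel (hD : RamifiedDatum c u q) {x y : Fin s → Fin 2 → Valued.integer E} {a : ℕ}
    (hxy : u ^ a • x = u ^ a • y) : x = y := by
  funext i l
  exact mul_left_cancel₀ (pow_ne_zero a hD.ne_zero) (congrFun (congrFun hxy i) l)

/-- A family with independent reductions spans a saturated submodule; one factor `u` is peeled off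
at a time. -/
theorem dvd_of_primitive (hD : RamifiedDatum c u q) {x : Fin n → Fin s → Fin 2 → Valued.integer E}
    (hx : LinearIndependent (IsLocalRing.ResidueField (Valued.integer E))
      fun i => redVec (IsLocalRing.residue _) (x i)) {d : Fin n → Valued.integer E} :
    ∀ {a : ℕ} {z : Fin s → Fin 2 → Valued.integer E}, ∑ i, d i • x i = u ^ a • z →
      ∀ i, u ^ a ∣ d i
  | 0, _, _, i => by simp
  | a + 1, z, hz, i => by
    rw [pow_succ, mul_smul] at hz
    choose e he using dvd_of_primitive hD hx hz
    simp only [he, mul_smul, ← Finset.smul_sum] at hz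
    have h1 := hD.smul_vec_cancel hz
    have h2 := hD.redVec_residue_eq_zero_iff.mpr ⟨z, h1.symm⟩
    rw [redVec_sum] at h2
    simp only [redVec_smul] at h2
    have h3 := Fintype.linearIndependent_iff.mp hx _ h2 i
    rw [he, pow_succ]
    exact mul_dvd_mul_left _ (hD.residue_eq_zero_iff.mp h3)

variable {e : Fin n → ℕ}

/-- Primitivity of the `x i` means that a combination of the `u ^ e i • x i` is divisible by `u ^ a`
only for the evident reason, namely that the source vector lies in `u ^ a L'`. -/
theorem saturation_eq_of_primitive (hD : RamifiedDatum c u q) (hb' : IsLatticeBasis b' L')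
    (hb : IsLatticeBasis (fun i => (u : E) ^ e i • b' i) L) {a : ℕ} (he : ∀ i, e i ≤ a)
    {φ : L →ₗ[Valued.integer E] (Fin s → Fin 2 → Valued.integer E)}
    {x : Fin n → Fin s → Fin 2 → Valued.integer E}
    (hx : LinearIndependent (IsLocalRing.ResidueField (Valued.integer E))
      fun i => redVec (IsLocalRing.residue _) (x i))
    (hφ : ∀ i, φ ⟨_, hb.mem i⟩ = u ^ e i • x i) : saturation u a φ = L' := by
  have hsum : ∀ d : Fin n → Valued.integer E, ∀ y : L, (y : V) = ∑ i, d i • ((u : E) ^ e i • b' i) →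
      φ y = ∑ i, (d i * u ^ e i) • x i := by
    intro d y hy
    have : y = ∑ i, d i • (⟨_, hb.mem i⟩ : L) := by
      refine Subtype.ext (hy.trans ?_)
      change _ = L.subtype _
      rw [map_sum]
      rfl
    rw [this, map_sum]
    refine Finset.sum_congr rfl fun i _ => ?_
    rw [map_smul, hφ, smul_smul]
  ext v
  constructor
  · rintro ⟨y, z, h1, h2⟩
    obtain ⟨d, hd⟩ := hb.mem_iff.mp y.2
    rw [hsum d y hd.symm] at h2
    have h3 := hD.dvd_of_primitive hx h2
    choose w hw using h3
    refine hb'.mem_iff.mpr ⟨w, ?_⟩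
    have h4 : u ^ a • v = u ^ a • ∑ i, w i • b' i := by
      rw [h1, ← hd, Finset.smul_sum]
      refine Finset.sum_congr rfl fun i _ => ?_
      rw [smul_smul, ← hw, mul_smul]
      rfl
    have h5 := congrArg (fun v => ((u : E) ^ a)⁻¹ • v) h4
    have hu : (u : E) ^ a ≠ 0 := pow_ne_zero _ hD.coe_ne_zero
    simp only [integer_smul_def _ v, integer_smul_def _ (∑ i, w i • b' i)] at h5
    push_cast at h5
    rw [inv_smul_smul₀ hu, inv_smul_smul₀ hu] at h5
    exact h5.symm
  · intro hv
    obtain ⟨w, rfl⟩ := hb'.mem_iff.mp hv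
    have h1 : u ^ a • ∑ i, w i • b' i = ∑ i, (u ^ (a - e i) * w i) • ((u : E) ^ e i • b' i) := by
      rw [Finset.smul_sum]
      refine Finset.sum_congr rfl fun i _ => ?_
      have h2 : u ^ a = u ^ (a - e i) * u ^ e i := by rw [← pow_add, Nat.sub_add_cancel (he i)]
      rw [h2, smul_smul, mul_right_comm, mul_smul _ (u ^ e i)]
      rfl
    refine ⟨⟨_, h1 ▸ hb.mem_iff.mpr ⟨_, rfl⟩⟩, ∑ i, w i • x i, rfl, ?_⟩
    rw [hsum _ _ h1, Finset.smul_sum]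
    refine Finset.sum_congr rfl fun i _ => ?_
    rw [smul_smul, mul_right_comm, ← pow_add, Nat.sub_add_cancel (he i)]

/-- The converse. The saturation is taken with `a + 1` rather than `a`: a relation between the
reductions of the `x i` produces a vector of `u⁻¹ L'` on which the map extends, and one further
power of `u` is needed to bring it into `L`. -/
theorem exists_primitive_of_saturation_eq (hD : RamifiedDatum c u q) (hb' : IsLatticeBasis b' L')
    (hb : IsLatticeBasis (fun i => (u : E) ^ e i • b' i) L) {a : ℕ} (he : ∀ i, e i ≤ a)
    {φ : L →ₗ[Valued.integer E] (Fin s → Fin 2 → Valued.integer E)}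
    (hφ : saturation u (a + 1) φ = L') :
    ∃ x : Fin n → Fin s → Fin 2 → Valued.integer E,
      (LinearIndependent (IsLocalRing.ResidueField (Valued.integer E))
        fun i => redVec (IsLocalRing.residue _) (x i)) ∧
      ∀ i, φ ⟨_, hb.mem i⟩ = u ^ e i • x i := by
  have h1 : ∀ i, ∃ x, φ ⟨_, hb.mem i⟩ = u ^ e i • x := by
    intro i
    have h2 : b' i ∈ saturation u (a + 1) φ := hφ ▸ hb'.mem i
    obtain ⟨y, z, h3, h4⟩ := h2
    have h5 : y = u ^ (a + 1 - e i) • (⟨_, hb.mem i⟩ : L) := by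
      refine Subtype.ext ?_
      rw [← h3]
      change _ = u ^ (a + 1 - e i) • (u ^ e i • b' i)
      rw [smul_smul, ← pow_add, Nat.sub_add_cancel ((he i).trans (Nat.le_succ a))]
    rw [h5, map_smul] at h4
    refine ⟨z, hD.smul_vec_cancel (a := a + 1 - e i) ?_⟩
    rw [h4, smul_smul, ← pow_add, Nat.sub_add_cancel ((he i).trans (Nat.le_succ a))]
  choose x hx using h1
  refine ⟨x, ?_, hx⟩
  rw [Fintype.linearIndependent_iff]
  intro d0 hd0 i
  choose d hd using fun i => IsLocalRing.residue_surjective (d0 i)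
  simp only [← hd] at hd0 ⊢
  simp only [← redVec_smul] at hd0
  rw [← redVec_sum, hD.redVec_residue_eq_zero_iff] at hd0
  obtain ⟨z, hz⟩ := hd0
  -- If the relation `d` were nontrivial, this vector would lie in the saturation but not in `L'`.
  let v : V := (u : E)⁻¹ • ∑ i, d i • b' i
  have hv : v ∈ saturation u (a + 1) φ := by
    have h2 : u ^ (a + 1) • v
        = ((∑ i, (d i * u ^ (a - e i)) • (⟨_, hb.mem i⟩ : L) : L) : V) := by
      change _ = L.subtype _
      rw [map_sum]
      simp only [v]
      rw [integer_smul_def, smul_smul]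
      push_cast
      rw [pow_succ, mul_assoc, mul_inv_cancel₀ hD.coe_ne_zero, mul_one, Finset.smul_sum]
      refine Finset.sum_congr rfl fun i _ => ?_
      change u ^ a • d i • b' i = (d i * u ^ (a - e i)) • (u ^ e i • b' i)
      rw [smul_smul, smul_smul, mul_assoc, ← pow_add, Nat.sub_add_cancel (he i), mul_comm]
    refine ⟨_, z, h2, ?_⟩
    rw [pow_succ, mul_smul, hz, map_sum, Finset.smul_sum]
    refine Finset.sum_congr rfl fun i _ => ?_
    rw [map_smul, hx, smul_smul, smul_smul, mul_assoc, ← pow_add, Nat.sub_add_cancel (he i),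
      mul_comm]
  rw [hφ] at hv
  have h3 : v = ∑ i, ((u : E)⁻¹ * d i) • b' i := by
    simp only [v, Finset.smul_sum, mul_smul]
    rfl
  rw [h3, hb'.sum_mem_iff] at hv
  have h4 := hv i
  rw [norm_mul, norm_inv, inv_mul_le_iff₀ hD.norm_pos, mul_one] at h4
  rw [hD.residue_eq_zero_iff, hD.dvd_iff, hD.norm_lt_one_iff]
  exact h4

end RamifiedDatum
end HermitianHoms

/-! ### Counting hermitian maps with a prescribed saturation. -/

section DensityCount

variable {F : Type*} [NontriviallyNormedField F]
variable {E : Type*} [NontriviallyNormedField E] [IsUltrametricDist E] [NormedAlgebra F E]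
variable {c : E ≃ₐ[F] E} {u : Valued.integer E} {q : ℕ}
variable {V : Type*} [AddCommGroup V] [Module E V] {h : Pairing c V}
variable {L L' : Submodule (Valued.integer E) V} {n s k : ℕ} {b b' : Fin n → V} {e : Fin n → ℕ}

theorem IsLatticeBasis.linearMap_sum (hb : IsLatticeBasis b L) {M : Type*} [AddCommGroup M]
    [Module (Valued.integer E) M] (φ : L →ₗ[Valued.integer E] M) (x : L) :
    ∃ d : Fin n → Valued.integer E, (x : V) = ∑ i, d i • b i ∧
      φ x = ∑ i, d i • φ ⟨b i, hb.mem i⟩ := by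
  obtain ⟨d, hd⟩ := hb.mem_iff.mp x.2
  refine ⟨d, hd.symm, ?_⟩
  have : x = ∑ i, d i • (⟨b i, hb.mem i⟩ : L) := by
    refine Subtype.ext (hd.symm.trans ?_)
    change _ = L.subtype _
    rw [map_sum]
    rfl
  conv_lhs => rw [this, map_sum]
  exact Finset.sum_congr rfl fun i _ => map_smul _ _ _

/-- A homomorphism of reductions is determined by the reductions of the values on a basis. -/
theorem IsLatticeBasis.eq_iff_redVec (hb : IsLatticeBasis b L)
    {φ φ' : (L ⧸ powSubmodule u L k) →ₗ[Valued.integer E]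
      ((Fin s → Fin 2 → Valued.integer E) ⧸ powSubmodule u (Fin s → Fin 2 → Valued.integer E) k)}
    {φ₀ φ₀' : L →ₗ[Valued.integer E] (Fin s → Fin 2 → Valued.integer E)}
    (hφ : ∀ x, φ ((powSubmodule u L k).mkQ x) = (powSubmodule u _ k).mkQ (φ₀ x))
    (hφ' : ∀ x, φ' ((powSubmodule u L k).mkQ x) = (powSubmodule u _ k).mkQ (φ₀' x)) :
    φ = φ' ↔ ∀ i, redVec (Ideal.Quotient.mk (Ideal.span {u ^ (2 * k)})) (φ₀ ⟨b i, hb.mem i⟩)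
      = redVec (Ideal.Quotient.mk _) (φ₀' ⟨b i, hb.mem i⟩) := by
  simp only [← mkQ_powSubmodule_eq_iff, ← hφ, ← hφ']
  constructor
  · rintro rfl i
    rfl
  · intro H
    refine Submodule.linearMap_qext _ (LinearMap.ext fun x => ?_)
    obtain ⟨d, -, h1⟩ := hb.linearMap_sum (φ ∘ₗ (powSubmodule u L k).mkQ
      - φ' ∘ₗ (powSubmodule u L k).mkQ) x
    rw [← sub_eq_zero]
    change (φ ∘ₗ (powSubmodule u L k).mkQ - φ' ∘ₗ (powSubmodule u L k).mkQ) x = 0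
    rw [h1]
    refine Finset.sum_eq_zero fun i _ => ?_
    have h2 : (φ ∘ₗ (powSubmodule u L k).mkQ - φ' ∘ₗ (powSubmodule u L k).mkQ)
        ⟨b i, hb.mem i⟩ = 0 := sub_eq_zero.mpr (H i)
    rw [h2, smul_zero]

namespace RamifiedDatum

theorem skewForm_sum_sum {R : Type*} [CommRing R] (conj : R →+* R) (d d' : Fin n → R)
    (x : Fin n → Fin s → Fin 2 → R) : skewForm conj (∑ i, d i • x i) (∑ j, d' j • x j)
      = ∑ i, ∑ j, d i * conj (d' j) * skewForm conj (x i) (x j) := by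
  rw [skewForm_sum_left]
  refine Finset.sum_congr rfl fun i _ => ?_
  rw [skewForm_sum_right]
  refine Finset.sum_congr rfl fun j _ => ?_
  rw [skewForm_smul_left, skewForm_smul_right, mul_assoc]

theorem preserves_iff (hD : RamifiedDatum c u q) (hL : IsIntegralLattice u h L)
    (hb : IsLatticeBasis b L)
    {φ : L →ₗ[Valued.integer E] (Fin s → Fin 2 → Valued.integer E)} :
    hD.Preserves h k φ ↔ ∀ i j, skewForm (hD.conjQuot (2 * k))
      (redVec (Ideal.Quotient.mk _) (φ ⟨b i, hb.mem i⟩))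
      (redVec (Ideal.Quotient.mk _) (φ ⟨b j, hb.mem j⟩))
        = Ideal.Quotient.mk (Ideal.span {u ^ (2 * k)}) (gram u h b i j) := by
  have key : ∀ i j, skewForm (hD.conjQuot (2 * k))
      (redVec (Ideal.Quotient.mk _) (φ ⟨b i, hb.mem i⟩))
      (redVec (Ideal.Quotient.mk _) (φ ⟨b j, hb.mem j⟩))
        = Ideal.Quotient.mk (Ideal.span {u ^ (2 * k)}) (gram u h b i j) ↔
      ‖((skewForm hD.conjInt (φ ⟨b i, hb.mem i⟩) (φ ⟨b j, hb.mem j⟩) : Valued.integer E) : E)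
        - u * h (b i) (b j)‖ ≤ ‖(u : E)‖ ^ (2 * k) := by
    intro i j
    rw [skewForm_redVec _ (hD.conjQuot_mk _), mk_eq_mk_iff, hD.pow_dvd_iff, ← hD.coe_gram hL hb]
    rfl
  simp only [key]
  refine ⟨fun H i j => H _ _, fun H x y => ?_⟩
  obtain ⟨d, hx, hφx⟩ := hb.linearMap_sum φ x
  obtain ⟨d', hy, hφy⟩ := hb.linearMap_sum φ y
  have h1 : ((skewForm hD.conjInt (φ x) (φ y) : Valued.integer E) : E) - u * h x y
      = ∑ i, ∑ j, (d i : E) * c (d' j) * (((skewForm hD.conjInt (φ ⟨b i, hb.mem i⟩)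
        (φ ⟨b j, hb.mem j⟩) : Valued.integer E) : E) - u * h (b i) (b j)) := by
    rw [hφx, hφy, skewForm_sum_sum, hx, hy]
    simp only [integer_smul_def]
    rw [sesq_sum_left, Finset.mul_sum]
    push_cast
    rw [← Finset.sum_sub_distrib]
    refine Finset.sum_congr rfl fun i _ => ?_
    rw [sesq_sum_right, Finset.mul_sum, Finset.mul_sum, ← Finset.sum_sub_distrib]
    refine Finset.sum_congr rfl fun j _ => ?_
    rw [hD.coe_conjInt]
    ring
  rw [h1]
  refine norm_sum_le_of_forall_le _ _ (by positivity) fun i _ =>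
    norm_sum_le_of_forall_le _ _ (by positivity) fun j _ => ?_
  rw [norm_mul, norm_mul, hD.norm_conj]
  have h2 : ‖(d i : E)‖ * ‖(d' j : E)‖ ≤ 1 :=
    mul_le_one₀ (norm_coe_integer_le _) (norm_nonneg _) (norm_coe_integer_le _)
  calc _ ≤ 1 * _ := mul_le_mul_of_nonneg_right h2 (norm_nonneg _)
    _ ≤ _ := by rw [one_mul]; exact H i j

/-- Pulling the power `u ^ e j` out of the second variable costs a sign, because `c u = -u`; the
condition is a vanishing, so the sign is harmless. -/
theorem scaled_iff (hD : RamifiedDatum c u q) (hL : IsIntegralLattice u h L)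
    (hL' : IsIntegralLattice u h L') (hb' : IsLatticeBasis b' L')
    (hb : IsLatticeBasis (fun i => (u : E) ^ e i • b' i) L) (i j : Fin n)
    (x y : Fin s → Fin 2 → Valued.integer E ⧸ Ideal.span {u ^ (2 * k)}) :
    Ideal.Quotient.mk _ (u ^ (e i + e j)) * (skewForm (hD.conjQuot (2 * k)) x y
        - Ideal.Quotient.mk _ (gram u h b' i j)) = 0 ↔
      skewForm (hD.conjQuot (2 * k)) (Ideal.Quotient.mk (Ideal.span {u ^ (2 * k)}) (u ^ e i) • x)
        (Ideal.Quotient.mk (Ideal.span {u ^ (2 * k)}) (u ^ e j) • y)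
        = Ideal.Quotient.mk _ (gram u h (fun i => (u : E) ^ e i • b' i) i j) := by
  have h1 : gram u h (fun i => (u : E) ^ e i • b' i) i j
      = u ^ e i * hD.conjInt (u ^ e j) * gram u h b' i j := by
    refine Subtype.ext ?_
    push_cast
    rw [hD.coe_gram hL hb, hD.coe_conjInt, hD.coe_gram hL' hb']
    simp
    ring
  rw [h1, skewForm_smul_left, skewForm_smul_right, conjQuot_mk, map_mul, map_mul, ← sub_eq_zero
    (b := _ * _ * _), mul_assoc (Ideal.Quotient.mk _ (u ^ e i)), ← mul_sub, ← mul_sub, ← mul_assoc, pow_add,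
    map_mul (Ideal.Quotient.mk _) (u ^ e i), map_pow hD.conjInt, hD.conjInt_u, neg_pow u (e j),
    map_mul (Ideal.Quotient.mk _) (_ ^ _)]
  rcases neg_one_pow_eq_or (Valued.integer E) (e j) with h2 | h2
  · rw [h2, map_one, one_mul]
  · rw [h2, map_neg, map_one, neg_one_mul, mul_neg, neg_mul, neg_eq_zero]

/-- A scaled tuple `x` defines the map sending the `i`-th basis vector of `L` to `u ^ e i • x i`,
and every map with saturation `L'` arises in this way. The tuple is determined up to the annihilator
of `u ^ e i` in each of the `2 s` coordinates of `x i`, so each fibre has `q ^ (2 s ∑ e i)`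
elements. -/
theorem card_hermHom_saturation (hD : RamifiedDatum c u q) (hL : IsIntegralLattice u h L)
    (hL' : IsIntegralLattice u h L') (hb' : IsLatticeBasis b' L')
    (hb : IsLatticeBasis (fun i => (u : E) ^ e i • b' i) L) {a : ℕ} (he : ∀ i, e i ≤ a)
    (hak : a < k) (hk : 2 * k ≠ 0) :
    Nat.card (hD.ScaledTuples s hk e fun i j => Ideal.Quotient.mk _ (gram u h b' i j))
      = Nat.card {φ // φ ∈ hermHom u (hyperbolicPairing c u s) (fun x y : L => h x y) k ∧
        ∃ φ₀ : L →ₗ[Valued.integer E] (Fin s → Fin 2 → Valued.integer E),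
          (∀ x, φ ((powSubmodule u L k).mkQ x) = (powSubmodule u _ k).mkQ (φ₀ x)) ∧
          saturation u (a + 1) φ₀ = L'} * q ^ (2 * s * ∑ i, e i) := by
  classical
  have hI := hD.isLocalInvolution hk
  have := hI.finite
  have hfin : Finite (hD.ScaledTuples s hk e fun i j =>
    Ideal.Quotient.mk _ (gram u h b' i j)) := Subtype.finite
  obtain ⟨B, hB⟩ := hb.exists_basis
  have hB' : ∀ i, B i = ⟨_, hb.mem i⟩ := fun i => Subtype.ext (hB i)
  have hsurj : Function.Surjective (redVec (s := s)
    (Ideal.Quotient.mk (Ideal.span {u ^ (2 * k)}))) := redVec_surjective Ideal.Quotient.mk_surjective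
  choose lift hlift using hsurj
  let T := {φ // φ ∈ hermHom u (hyperbolicPairing c u s) (fun x y : L => h x y) k ∧
        ∃ φ₀ : L →ₗ[Valued.integer E] (Fin s → Fin 2 → Valued.integer E),
          (∀ x, φ ((powSubmodule u L k).mkQ x) = (powSubmodule u _ k).mkQ (φ₀ x)) ∧
          saturation u (a + 1) φ₀ = L'}
  let S := hD.ScaledTuples s hk e fun i j => Ideal.Quotient.mk _ (gram u h b' i j)
  have hmk : ∀ (i : Fin n) (x : Fin s → Fin 2 → Valued.integer E),
      redVec (Ideal.Quotient.mk (Ideal.span {u ^ (2 * k)})) (u ^ e i • x)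
        = Ideal.Quotient.mk (Ideal.span {u ^ (2 * k)}) (u ^ e i)
          • redVec (Ideal.Quotient.mk _) x := fun i x => redVec_smul _ _ _
  have hred : ∀ x : Fin s → Fin 2 → Valued.integer E, redVec (IsLocalRing.residue _) x
      = redVec (hD.resQuot hk) (redVec (Ideal.Quotient.mk _) x) := fun x => rfl
  have hΨ : ∀ x : S, ∃ φ : T, ∃ φ₀ : L →ₗ[Valued.integer E] (Fin s → Fin 2 → Valued.integer E),
      (∀ x, φ.1 ((powSubmodule u L k).mkQ x) = (powSubmodule u _ k).mkQ (φ₀ x)) ∧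
      ∀ i, redVec (Ideal.Quotient.mk (Ideal.span {u ^ (2 * k)})) (φ₀ ⟨_, hb.mem i⟩)
        = Ideal.Quotient.mk (Ideal.span {u ^ (2 * k)}) (u ^ e i) • x.1 i := by
    intro x
    let φ₀ : L →ₗ[Valued.integer E] (Fin s → Fin 2 → Valued.integer E) :=
      B.constr (Valued.integer E) fun i => u ^ e i • lift (x.1 i)
    have h0 : ∀ i, φ₀ ⟨_, hb.mem i⟩ = u ^ e i • lift (x.1 i) := fun i => by
      rw [← hB', Module.Basis.constr_basis]
    have h1 : ∀ i, redVec (Ideal.Quotient.mk (Ideal.span {u ^ (2 * k)})) (φ₀ ⟨_, hb.mem i⟩)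
        = Ideal.Quotient.mk (Ideal.span {u ^ (2 * k)}) (u ^ e i) • x.1 i := fun i => by
      rw [h0, hmk, hlift]
    obtain ⟨φ, hφ⟩ := exists_linearMap_reduction (u := u) (k := k) φ₀
    refine ⟨⟨φ, (hD.mem_hermHom_iff hφ).mpr ((hD.preserves_iff hL hb).mpr fun i j => ?_),
      φ₀, hφ, hD.saturation_eq_of_primitive hb' hb (fun i => (he i).trans (Nat.le_succ a))
        (x := fun i => lift (x.1 i)) ?_ h0⟩, φ₀, hφ, h1⟩
    · rw [h1, h1]
      exact (hD.scaled_iff hL hL' hb' hb i j _ _).mp (x.2.2 i j)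
    · simp only [hred, hlift]
      exact x.2.1
  choose Ψ Ψ₀ hΨ1 hΨ2 using hΨ
  have hΨeq : ∀ x x' : S, Ψ x = Ψ x' ↔ ∀ i,
      Ideal.Quotient.mk (Ideal.span {u ^ (2 * k)}) (u ^ e i) • x.1 i
        = Ideal.Quotient.mk (Ideal.span {u ^ (2 * k)}) (u ^ e i) • x'.1 i := by
    intro x x'
    simp only [← hΨ2]
    rw [Subtype.ext_iff]
    exact hb.eq_iff_redVec (hΨ1 x) (hΨ1 x')
  have hΨsurj : Function.Surjective Ψ := by
    rintro ⟨φ, hφ, φ₀, hφ₀, hsat⟩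
    obtain ⟨x, hx, hφx⟩ := hD.exists_primitive_of_saturation_eq hb' hb he hsat
    have hev : ∀ i, redVec (Ideal.Quotient.mk (Ideal.span {u ^ (2 * k)})) (φ₀ ⟨_, hb.mem i⟩)
        = Ideal.Quotient.mk (Ideal.span {u ^ (2 * k)}) (u ^ e i)
          • redVec (Ideal.Quotient.mk _) (x i) := fun i => by rw [hφx, hmk]
    let y : S := ⟨fun i => redVec (Ideal.Quotient.mk _) (x i), hx, fun i j => by
      rw [hD.scaled_iff hL hL' hb' hb, ← hev, ← hev]
      exact (hD.preserves_iff hL hb).mp ((hD.mem_hermHom_iff hφ₀).mp hφ) i j⟩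
    refine ⟨y, Subtype.ext ((hb.eq_iff_redVec (hΨ1 y) hφ₀).mpr fun i => ?_)⟩
    rw [hΨ2, hev]
  have hfinT : Finite T := Finite.of_surjective Ψ hΨsurj
  refine natCard_eq_card_mul_of_fiber Ψ _ fun φ => ?_
  obtain ⟨x, rfl⟩ := hΨsurj φ
  have hlt : ∀ i, e i < 2 * k := fun i => by have := he i; omega
  -- The fibre over a map is a torsor under this group; adding its elements keeps the reductions
  -- modulo `u`, hence primitivity.
  let A := (i : Fin n) → Fin s → Fin 2 → {z : Valued.integer E ⧸ Ideal.span {u ^ (2 * k)} //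
    Ideal.Quotient.mk _ (u ^ e i) * z = 0}
  have hA : Nat.card A = q ^ (2 * s * ∑ i, e i) := by
    simp only [A, Nat.card_pi, hD.card_annihilator (hlt _).le, Finset.prod_const, Finset.card_univ,
      Fintype.card_fin, ← pow_mul, Finset.prod_pow_eq_pow_sum]
    rw [← Finset.sum_mul, ← Finset.sum_mul]
    congr 1
    ring
  rw [← hA]
  have hsmul : ∀ (w : A) (i : Fin n), Ideal.Quotient.mk (Ideal.span {u ^ (2 * k)}) (u ^ e i)
      • (fun j l => x.1 i j l + (w i j l).1)
        = Ideal.Quotient.mk (Ideal.span {u ^ (2 * k)}) (u ^ e i) • x.1 i := by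
    intro w i
    funext j l
    simp only [Pi.smul_apply, smul_eq_mul, mul_add, (w i j l).2, add_zero]
  refine Nat.card_congr
    { toFun := fun y => fun i j l => ⟨y.1.1 i j l - x.1 i j l, ?_⟩
      invFun := fun w => ⟨⟨fun i j l => x.1 i j l + (w i j l).1, ?_, fun i j => ?_⟩, ?_⟩
      left_inv := fun y => ?_
      right_inv := fun w => ?_ }
  · have h1 := congrFun (congrFun ((hΨeq _ _).mp y.2 i) j) l
    simp only [Pi.smul_apply, smul_eq_mul] at h1
    rw [mul_sub, h1, sub_self]
  · have h1 : (fun i => redVec (hD.resQuot hk) fun j l => x.1 i j l + (w i j l).1)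
        = fun i => redVec (hD.resQuot hk) (x.1 i) := by
      funext i j l
      simp only [redVec]
      rw [map_add, hD.resQuot_eq_zero_of_pow_mul hk (hlt i) (w i j l).2, add_zero]
    rw [h1]
    exact x.2.1
  · rw [hD.scaled_iff hL hL' hb' hb, hsmul, hsmul]
    exact (hD.scaled_iff hL hL' hb' hb i j _ _).mp (x.2.2 i j)
  · exact (hΨeq _ _).mpr fun i => hsmul w i
  · refine Subtype.ext (Subtype.ext ?_)
    funext i j l
    exact add_sub_cancel _ _
  · funext i j l
    exact Subtype.ext (add_sub_cancel_left _ _)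

end RamifiedDatum
end DensityCount

/-! ### The density as a sum over integral overlattices. -/

section DensityFormula

variable {F : Type*} [NontriviallyNormedField F]
variable {E : Type*} [NontriviallyNormedField E] [IsUltrametricDist E] [NormedAlgebra F E]
variable {c : E ≃ₐ[F] E} {u : Valued.integer E} {q : ℕ}
variable {V : Type*} [AddCommGroup V] [Module E V] {h : Pairing c V}
variable {L L' : Submodule (Valued.integer E) V} {n : ℕ} {b : Fin n → V}

/-- The integral lattices containing `L`. -/
def integralOverlattices (u : Valued.integer E) (h : Pairing c V)
    (L : Submodule (Valued.integer E) V) : Set (Submodule (Valued.integer E) V) :=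
  {L' | L ≤ L' ∧ IsIntegralLattice u h L'}

theorem IsHermitianSpace.nondegenerateOn (hh : IsHermitianSpace h) (hL : ambient L = ⊤) :
    NondegenerateOn h L := by
  intro x _ hx
  exact hh.nondegenerate x fun y => hx y (hL ▸ Submodule.mem_top)

theorem ambient_eq_top_of_le (hle : L ≤ L') (hL : ambient L = ⊤) : ambient L' = ⊤ :=
  top_le_iff.mp (hL ▸ ambient_mono hle)

namespace RamifiedDatum

theorem le_dual_of_mem_integralOverlattices (hD : RamifiedDatum c u q) (hL : ambient L = ⊤)
    (hL' : L' ∈ integralOverlattices u h L) : L' ≤ dual u h L := by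
  intro x hx
  rw [hD.mem_dual, hL]
  exact ⟨Submodule.mem_top, fun y hy => hD.isIntegralLattice_iff.mp hL'.2 x hx y (hL'.1 hy)⟩

theorem finite_integralOverlattices (hD : RamifiedDatum c u q) (hh : IsHermitianSpace h)
    (hb : IsLatticeBasis b L) (hL : ambient L = ⊤) : (integralOverlattices u h L).Finite := by
  have hnd := hh.nondegenerateOn hL
  obtain ⟨a, ha⟩ := hD.exists_pow_smul_dual hb hnd
  exact (hD.finite_between (hD.fg_dual hb hnd) ha).subset fun L' hL' =>
    ⟨hL'.1, hD.le_dual_of_mem_integralOverlattices hL hL'⟩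

theorem fg_of_mem_integralOverlattices (hD : RamifiedDatum c u q) (hh : IsHermitianSpace h)
    (hb : IsLatticeBasis b L) (hL : ambient L = ⊤) (hL' : L' ∈ integralOverlattices u h L) :
    L'.FG :=
  hD.fg_of_le (hD.fg_dual hb (hh.nondegenerateOn hL))
    (hD.le_dual_of_mem_integralOverlattices hL hL')

/-- The number of homomorphisms to hyperbolic lattices, as a sum over integral overlattices. -/
theorem exists_card_hermHom (hD : RamifiedDatum c u q) (hh : IsHermitianSpace h)
    (hb : IsLatticeBasis b L) (hL : ambient L = ⊤) (S : Finset (Submodule (Valued.integer E) V))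
    (hS : ∀ L', L' ∈ S ↔ L' ∈ integralOverlattices u h L) :
    ∃ ℓ : Submodule (Valued.integer E) V → ℕ, ∀ s : ℕ, ∀ᶠ k : ℕ in atTop,
      (Nat.card (hermHom u (hyperbolicPairing c u s) (fun x y : L => h x y) k) : ℝ)
          / (q : ℝ) ^ ((k : ℤ) * hermDim (2 * s) n)
        = ∑ L' ∈ S, (q : ℝ) ^ (n * ℓ L') / (q : ℝ) ^ (2 * s * ℓ L')
          * ∏ i ∈ Finset.range ((n + latticeType u h L') / 2),
            (1 - (q : ℝ) ^ (2 * i) / (q : ℝ) ^ (s * 2)) := by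
  classical
  have hnd := hh.nondegenerateOn hL
  obtain ⟨a, ha⟩ := hD.exists_pow_smul_dual hb hnd
  have hq : (0 : ℝ) < q := by exact_mod_cast zero_lt_one.trans hD.one_lt_q
  -- All elementary divisors are bounded by one exponent `a` with `u ^ a L^∨ ⊆ L`. Outside `S` the
  -- values are irrelevant defaults.
  have hadapt : ∀ L', ∃ (b' : Fin n → V) (e : Fin n → ℕ), L' ∈ S → IsLatticeBasis b' L' ∧
      IsLatticeBasis (fun i => (u : E) ^ e i • b' i) L ∧ ∀ i, e i ≤ a := by
    intro L'
    by_cases hL' : L' ∈ S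
    · rw [hS] at hL'
      obtain ⟨b', e, hb', he⟩ := hD.exists_adapted_basis hb
        (hD.fg_of_mem_integralOverlattices hh hb hL hL') hL'.1
        (hL.trans (ambient_eq_top_of_le hL'.1 hL).symm)
      refine ⟨b', e, fun _ => ⟨hb', he, fun i => ?_⟩⟩
      have h1 := ha _ (hD.le_dual_of_mem_integralOverlattices hL hL' (hb'.mem i))
      have h2 : (u : E) ^ a • b' i = ∑ j, (if j = i then (u : E) ^ a * ((u : E) ^ e i)⁻¹ else 0)
          • ((u : E) ^ e j • b' j) := by
        rw [Finset.sum_eq_single i]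
        · rw [if_pos rfl, smul_smul, mul_assoc, inv_mul_cancel₀ (pow_ne_zero _ hD.coe_ne_zero),
            mul_one]
        · intro j _ hj
          rw [if_neg hj, zero_smul]
        · simp
      rw [h2, he.sum_mem_iff] at h1
      have h3 := h1 i
      rw [if_pos rfl, norm_mul, norm_inv, norm_pow, norm_pow, mul_inv_le_iff₀
        (pow_pos hD.norm_pos _), one_mul] at h3
      exact (pow_le_pow_iff_right_of_lt_one₀ hD.norm_pos hD.norm_lt_one).mp h3
    · exact ⟨b, fun _ => 0, fun h => absurd h hL'⟩
  choose b' e hbe using hadapt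
  -- The sum of the exponents is the length of `L' / L`.
  refine ⟨fun L' => ∑ i, e L' i, fun s => ?_⟩
  filter_upwards [eventually_gt_atTop a] with k hak
  have hk : 2 * k ≠ 0 := by omega
  by_cases hint : IsIntegralLattice u h L
  swap
  -- If `L` is not integral, it has neither integral overlattices nor hermitian maps, and both sides
  -- vanish.
  · have h1 : S = ∅ := by
      refine Finset.eq_empty_of_forall_notMem fun L' hL' => hint ?_
      rw [hS] at hL'
      rw [hD.isIntegralLattice_iff]
      intro x hx y hy
      exact hD.isIntegralLattice_iff.mp hL'.2 x (hL'.1 hx) y (hL'.1 hy)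
    have h2 : hermHom u (hyperbolicPairing c u s) (fun x y : L => h x y) k = ∅ := by
      refine Set.eq_empty_of_forall_notMem fun φ hφ => hint ?_
      obtain ⟨φ₀, hφ₀⟩ := exists_linearMap_lift hb φ
      exact ((hD.mem_hermHom_iff hφ₀).mp hφ).isIntegralLattice
    rw [h1, h2]
    simp
  let lift := fun φ : (L ⧸ powSubmodule u L k) →ₗ[Valued.integer E]
      ((Fin s → Fin 2 → Valued.integer E) ⧸ powSubmodule u (Fin s → Fin 2 → Valued.integer E) k) =>
    (exists_linearMap_lift hb φ).choose
  have hlift : ∀ φ x, φ ((powSubmodule u L k).mkQ x) = (powSubmodule u _ k).mkQ (lift φ x) :=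
    fun φ => (exists_linearMap_lift hb φ).choose_spec
  let H := hermHom u (hyperbolicPairing c u s) (fun x y : L => h x y) k
  let f : H → S := fun φ => ⟨saturation u (a + 1) (lift φ), (hS _).mpr ⟨le_saturation,
    ((hD.mem_hermHom_iff (hlift φ)).mp φ.2).isIntegralLattice_saturation hak⟩⟩
  have hfib : ∀ L' : S, (Nat.card {φ // f φ = L'} : ℝ) * (q : ℝ) ^ (2 * s * ∑ i, e L' i)
      = (q : ℝ) ^ (n * ∑ i, e L' i) * ((q : ℝ) ^ ((k : ℤ) * hermDim (2 * s) n)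
        * ∏ i ∈ Finset.range ((n + latticeType u h L'.1) / 2),
          (1 - (q : ℝ) ^ (2 * i) / (q : ℝ) ^ (s * 2))) := by
    rintro ⟨L', hL'⟩
    obtain ⟨hb', he, hea⟩ := hbe L' hL'
    rw [hS] at hL'
    have h1 := hD.card_hermHom_saturation (s := s) hint hL'.2 hb' he hea hak hk
    have hτ : ∀ i j, hD.conjQuot (2 * k) (Ideal.Quotient.mk _ (gram u h (b' L') i j))
        = -Ideal.Quotient.mk _ (gram u h (b' L') j i) := fun i j => by
      rw [conjQuot_mk, hD.conjInt_gram hh hL'.2 hb', map_neg]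
    have h2 := hD.card_scaledTuples (s := s) hk (e L') (fun i => (hea i).trans_lt hak) _ hτ
    rw [h1] at h2
    have h3 : Nat.card {φ // f φ = ⟨L', (hS L').mpr hL'⟩} = Nat.card
        {φ // φ ∈ hermHom u (hyperbolicPairing c u s) (fun x y : L => h x y) k ∧
        ∃ φ₀ : L →ₗ[Valued.integer E] (Fin s → Fin 2 → Valued.integer E),
          (∀ x, φ ((powSubmodule u L k).mkQ x) = (powSubmodule u _ k).mkQ (φ₀ x)) ∧
          saturation u (a + 1) φ₀ = L'} := by
      refine Nat.card_congr
        { toFun := fun φ => ⟨φ.1.1, φ.1.2, lift φ.1.1, hlift _, congrArg Subtype.val φ.2⟩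
          invFun := fun φ => ⟨⟨φ.1, φ.2.1⟩, ?_⟩
          left_inv := fun φ => rfl
          right_inv := fun φ => rfl }
      obtain ⟨φ, hφ, φ₀, hφ₀, hsat⟩ := φ
      refine Subtype.ext (Eq.trans ?_ hsat)
      -- The saturation does not depend on the lift, since `a + 1 ≤ 2 * k`.
      refine saturation_congr (j := 2 * k) (by omega) fun x => ?_
      rw [← redVec_mk_eq_iff, ← mkQ_powSubmodule_eq_iff, ← hlift, ← hφ₀]
    rw [h3, hD.latticeType_eq hh hL'.2 hb' (hh.nondegenerateOn (ambient_eq_top_of_le hL'.1 hL))]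
    push_cast at h2
    exact h2
  have hfinT : ∀ L' : S, Finite {φ // f φ = L'} := by
    intro L'
    have h1 := hfib L'
    have hHf : Finite ((L ⧸ powSubmodule u L k) →ₗ[Valued.integer E]
      ((Fin s → Fin 2 → Valued.integer E) ⧸
        powSubmodule u (Fin s → Fin 2 → Valued.integer E) k)) := by
      have hR := hD.finite_quotient_pow (2 * k)
      let ev : ((L ⧸ powSubmodule u L k) →ₗ[Valued.integer E]
        ((Fin s → Fin 2 → Valued.integer E) ⧸
          powSubmodule u (Fin s → Fin 2 → Valued.integer E) k)) →
          (Fin n → Fin s → Fin 2 → Valued.integer E ⧸ Ideal.span {u ^ (2 * k)}) :=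
        fun φ i => redVec (Ideal.Quotient.mk _) (lift φ ⟨b i, hb.mem i⟩)
      refine Finite.of_injective ev fun φ φ' hφ => ?_
      exact (hb.eq_iff_redVec (hlift φ) (hlift φ')).mpr fun i => congrFun hφ i
    infer_instance
  have hcard : Nat.card H = ∑ L' : S, Nat.card {φ // f φ = L'} := by
    rw [← Nat.card_congr (Equiv.sigmaFiberEquiv f), Nat.card_sigma]
  change (Nat.card H : ℝ) / _ = _
  rw [hcard, Nat.cast_sum, Finset.sum_div, ← Finset.sum_coe_sort S]
  refine Finset.sum_congr rfl fun L' _ => ?_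
  have h1 := hfib L'
  have h2 : (q : ℝ) ^ ((k : ℤ) * hermDim (2 * s) n) ≠ 0 := zpow_ne_zero _ hq.ne'
  have h3 : (q : ℝ) ^ (2 * s * ∑ i, e L' i) ≠ 0 := pow_ne_zero _ hq.ne'
  rw [div_mul_eq_mul_div, div_eq_div_iff h2 h3, h1]
  ring

end RamifiedDatum
end DensityFormula

/-! ### In a nonsplit space every full integral lattice has positive type. -/

section Nonsplit

variable {F : Type*} [NontriviallyNormedField F]
variable {E : Type*} [NontriviallyNormedField E] [IsUltrametricDist E] [NormedAlgebra F E]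
variable {c : E ≃ₐ[F] E} {u : Valued.integer E} {q : ℕ}
variable {V : Type*} [AddCommGroup V] [Module E V] {h : Pairing c V}
variable {L L' : Submodule (Valued.integer E) V} {n r : ℕ} {b : Fin n → V}

namespace RamifiedDatum

theorem continuous_conj (hD : RamifiedDatum c u q) : Continuous c :=
  (AddMonoidHomClass.isometry_of_norm c hD.norm_conj).continuous

/-- A hermitian space that is isometric to the standard hyperbolic one is split. -/
theorem isSplit_of_isometry (hD : RamifiedDatum c u q) (hh : IsHermitianSpace h)
    (hV : Module.finrank E V = 2 * r) (hb : IsLatticeBasis b L) (hL : ambient L = ⊤)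
    {x : Fin n → Fin r → Fin 2 → E}
    (hx : ∀ i j, skewForm (c : E →+* E) (x i) (x j) = u * h (b i) (b j)) : IsSplit h := by
  have hspan : ⊤ ≤ Submodule.span E (Set.range b) := by rw [hb.span_eq_ambient, hL]
  let B := Module.Basis.mk hb.li hspan
  have : FiniteDimensional E V := Module.Finite.of_basis B
  let T : V →ₗ[E] (Fin r → Fin 2 → E) := B.constr E x
  have hTb : ∀ a : Fin n → E, T (∑ i, a i • b i) = ∑ i, a i • x i := by
    intro a
    rw [map_sum]
    refine Finset.sum_congr rfl fun i _ => ?_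
    rw [map_smul, ← Module.Basis.mk_apply hb.li hspan i, Module.Basis.constr_basis]
  have hT : ∀ v w, skewForm (c : E →+* E) (T v) (T w) = u * h v w := by
    intro v w
    obtain ⟨a, rfl⟩ := hb.mem_ambient_iff.mp (hL ▸ Submodule.mem_top : v ∈ ambient L)
    obtain ⟨a', rfl⟩ := hb.mem_ambient_iff.mp (hL ▸ Submodule.mem_top : w ∈ ambient L)
    rw [hTb, hTb, skewForm_sum_sum, sesq_sum_left, Finset.mul_sum]
    refine Finset.sum_congr rfl fun i _ => ?_
    rw [sesq_sum_right, Finset.mul_sum, Finset.mul_sum]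
    refine Finset.sum_congr rfl fun j _ => ?_
    rw [hx]
    simp only [RingHom.coe_coe]
    ring
  have hinj : Function.Injective T := by
    rw [← LinearMap.ker_eq_bot, LinearMap.ker_eq_bot']
    intro v hv
    refine hh.nondegenerate v fun w => ?_
    have h1 := hT v w
    rw [hv, eq_comm] at h1
    have h2 : skewForm (c : E →+* E) (0 : Fin r → Fin 2 → E) (T w) = 0 := by simp [skewForm]
    rw [h2] at h1
    exact (mul_eq_zero.mp h1).resolve_left hD.coe_ne_zero
  have hfr : Module.finrank E V = Module.finrank E (Fin r → Fin 2 → E) := by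
    rw [hV, Module.finrank_pi_fintype]
    simp [mul_comm]
  have hsurj := (LinearMap.injective_iff_surjective_of_finrank_eq_finrank hfr).mp hinj
  let P : (Fin r → Fin 2 → E) →ₗ[E] (Fin r → E) :=
    LinearMap.pi fun i => LinearMap.proj 0 ∘ₗ LinearMap.proj i
  have hP : Function.Surjective (P ∘ₗ T) := by
    intro y
    obtain ⟨v, hv⟩ := hsurj fun i _ => y i
    exact ⟨v, by rw [LinearMap.comp_apply, hv]; rfl⟩
  -- The preimage of the standard Lagrangian on which all first coordinates vanish.
  refine ⟨LinearMap.ker (P ∘ₗ T), ?_, ?_⟩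
  · have h1 := (P ∘ₗ T).finrank_range_add_finrank_ker
    rw [LinearMap.range_eq_top.mpr hP, finrank_top, Module.finrank_fin_fun, hV] at h1
    omega
  · intro v hv w hw
    have h1 := hT v w
    have hz : ∀ z ∈ LinearMap.ker (P ∘ₗ T), ∀ i, T z i 0 = 0 := fun z hz i =>
      congrFun (LinearMap.mem_ker.mp hz) i
    have h2 : skewForm (c : E →+* E) (T v) (T w) = 0 := by
      simp [skewForm, hz v hv, hz w hw]
    rw [h2, eq_comm] at h1
    exact (mul_eq_zero.mp h1).resolve_left hD.coe_ne_zero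

/-- An integral lattice whose Gram matrix is invertible modulo the maximal ideal embeds in a
hyperbolic lattice of the same rank. -/
theorem exists_isometry (hD : RamifiedDatum c u q) (hh : IsHermitianSpace h)
    (hint : IsIntegralLattice u h L) {b : Fin (2 * r) → V} (hb : IsLatticeBasis b L)
    (hc : corank u h b = 0) : ∃ x : Fin (2 * r) → Fin r → Fin 2 → E,
      ∀ i j, skewForm (c : E →+* E) (x i) (x j) = u * h (b i) (b j) := by
  have := hD.properSpace
  have hcont := hD.continuous_conj
  -- Approximate isometries modulo higher and higher powers of `u` form a decreasing sequence of
  -- compact sets; a common point is an exact isometry.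
  let K : ℕ → Set (Fin (2 * r) → Fin r → Fin 2 → E) := fun k =>
    (Set.univ.pi fun _ => Set.univ.pi fun _ => Set.univ.pi fun _ => Metric.closedBall 0 1) ∩
    {x | ∀ i j, ‖skewForm (c : E →+* E) (x i) (x j) - u * h (b i) (b j)‖
      ≤ ‖(u : E)‖ ^ (2 * (k + 1))}
  have hKclosed : ∀ k, IsClosed {x : Fin (2 * r) → Fin r → Fin 2 → E | ∀ i j,
      ‖skewForm (c : E →+* E) (x i) (x j) - u * h (b i) (b j)‖ ≤ ‖(u : E)‖ ^ (2 * (k + 1))} := by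
    intro k
    simp only [Set.ofPred_forall]
    refine isClosed_iInter fun i => isClosed_iInter fun j => ?_
    refine isClosed_le ?_ continuous_const
    simp only [skewForm, RingHom.coe_coe]
    fun_prop
  have hball : IsCompact (Set.univ.pi fun _ : Fin (2 * r) => Set.univ.pi fun _ : Fin r =>
      Set.univ.pi fun _ : Fin 2 => Metric.closedBall (0 : E) 1) :=
    isCompact_univ_pi fun _ => isCompact_univ_pi fun _ => isCompact_univ_pi fun _ =>
      isCompact_closedBall _ _
  have hKcompact : ∀ k, IsCompact (K k) := fun k => hball.inter_right (hKclosed k)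
  have hKanti : ∀ k, K (k + 1) ⊆ K k := by
    rintro k x ⟨hx, hx'⟩
    exact ⟨hx, fun i j => (hx' i j).trans
      (pow_le_pow_of_le_one hD.norm_pos.le hD.norm_lt_one.le (by omega))⟩
  have hKne : ∀ k, (K k).Nonempty := by
    intro k
    have hk : 2 * (k + 1) ≠ 0 := by omega
    have h1 := hD.card_primitiveTuples (s := r) hk
      (fun i j => Ideal.Quotient.mk _ (gram u h b i j)) fun i j => by
        rw [conjQuot_mk, hD.conjInt_gram hh hint hb, map_neg]
    have hq1 : (1 : ℝ) < q := by exact_mod_cast hD.one_lt_q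
    have h2 : Nat.card (PrimitiveTuples r (hD.resQuot hk) (hD.conjQuot (2 * (k + 1)))
        fun i j => Ideal.Quotient.mk _ (gram u h b i j)) ≠ 0 := by
      intro h0
      rw [h0, Nat.cast_zero, eq_comm] at h1
      refine absurd h1 (mul_ne_zero (zpow_ne_zero _ (by positivity)) ?_)
      -- With corank zero the product runs over `i < r`, so no factor is `1 - q ^ (2 r) / q ^ (2 r)`
      -- and the count is nonzero.
      rw [Finset.prod_ne_zero_iff]
      intro i hi
      have h3 : Module.finrank (IsLocalRing.ResidueField (Valued.integer E))
          (matrixKer fun i j => hD.resQuot hk (Ideal.Quotient.mk _ (gram u h b i j))) = 0 := hc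
      rw [h3, add_zero, Nat.mul_div_cancel_left _ two_pos, Finset.mem_range] at hi
      have h4 : (q : ℝ) ^ (2 * i) < (q : ℝ) ^ (r * 2) := pow_lt_pow_right₀ hq1 (by omega)
      have h5 : (q : ℝ) ^ (2 * i) / (q : ℝ) ^ (r * 2) < 1 := (div_lt_one (by positivity)).mpr h4
      linarith
    obtain ⟨⟨x, -, hx⟩⟩ := (Nat.card_ne_zero.mp h2).1
    choose y hy using redVec_surjective (s := r) (res := Ideal.Quotient.mk
      (Ideal.span {u ^ (2 * (k + 1))})) Ideal.Quotient.mk_surjective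
    refine ⟨fun i j l => (y (x i) j l : E), ?_, fun i j => ?_⟩
    · simp only [Set.mem_pi, Set.mem_univ, forall_true_left, mem_closedBall_zero_iff]
      exact fun i j l => norm_coe_integer_le _
    · have h3 := hx i j
      rw [← hy (x i), ← hy (x j), skewForm_redVec _ (hD.conjQuot_mk _), mk_eq_mk_iff,
        hD.pow_dvd_iff] at h3
      push_cast at h3
      rw [hD.coe_gram hint hb] at h3
      convert h3 using 3
      simp [skewForm]
  obtain ⟨x, hx⟩ := IsCompact.nonempty_iInter_of_sequence_nonempty_isCompact_isClosed K hKanti hKne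
    (hKcompact 0) fun k => (hKcompact k).isClosed
  refine ⟨x, fun i j => ?_⟩
  rw [← sub_eq_zero, ← norm_le_zero_iff]
  have h1 : ∀ k, ‖skewForm (c : E →+* E) (x i) (x j) - u * h (b i) (b j)‖
      ≤ ‖(u : E)‖ ^ (2 * (k + 1)) := fun k => (Set.mem_iInter.mp hx k).2 i j
  have h2 : Tendsto (fun k : ℕ => ‖(u : E)‖ ^ (2 * (k + 1))) atTop (𝓝 0) := by
    refine (tendsto_pow_atTop_nhds_zero_of_lt_one hD.norm_pos.le hD.norm_lt_one).comp ?_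
    exact tendsto_atTop_mono (fun k => show k ≤ 2 * (k + 1) by omega) tendsto_id
  exact ge_of_tendsto' h2 h1

/-- In a nonsplit space of even dimension, integral lattices have positive even type. -/
theorem two_le_latticeType (hD : RamifiedDatum c u q) (hh : IsHermitianSpace h)
    (hV : Module.finrank E V = 2 * r) (hns : ¬ IsSplit h) (hint : IsIntegralLattice u h L)
    {b : Fin (2 * r) → V} (hb : IsLatticeBasis b L) (hL : ambient L = ⊤) :
    2 ≤ latticeType u h L ∧ Even (latticeType u h L) := by
  rw [hD.latticeType_eq hh hint hb (hh.nondegenerateOn hL)]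
  have h1 := hD.even_add_corank hh hint hb
  have h2 : Even (corank u h b) := by
    rw [Nat.even_add] at h1
    exact h1.mp (even_two_mul r)
  refine ⟨?_, h2⟩
  have h3 : corank u h b ≠ 0 := by
    -- Type zero would give an isometry with the hyperbolic space of rank `2 r`, contradicting
    -- nonsplitness.
    intro h0
    obtain ⟨x, hx⟩ := hD.exists_isometry hh hint hb h0
    exact hns (hD.isSplit_of_isometry hh hV hb hL hx)
  obtain ⟨e, he⟩ := h2
  omega

end RamifiedDatum
end Nonsplit

/-! ### The Siegel series and its derivative at one. -/

section Siegel

variable {F : Type*} [NontriviallyNormedField F] [IsUltrametricDist F]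
variable {E : Type*} [NontriviallyNormedField E] [IsUltrametricDist E] [NormedAlgebra F E]
variable {c : E ≃ₐ[F] E} {u : Valued.integer E}
variable {V : Type*} [AddCommGroup V] [Module E V] {h : Pairing c V}
variable {L L' : Submodule (Valued.integer E) V} {r : ℕ} {b : Fin (2 * r) → V}

/-- The contribution of an overlattice of type `t` and colength `ℓ` to the Siegel series. -/
def siegelTerm (q ℓ t : ℕ) : ℤ[X] :=
  X ^ (2 * ℓ) * ∏ j ∈ Finset.range (t / 2), (1 - C ((q : ℤ) ^ (2 * j)) * X ^ 2)

/-- The value at `X = 1` of `∏ 1 ≤ j < t / 2, (1 - q ^ (2 * j) * X ^ 2)`. -/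
def typeWeight (q t : ℕ) : ℤ := ∏ j ∈ Finset.Ico 1 (t / 2), (1 - (q : ℤ) ^ (2 * j))

/-- For `t ≥ 2` the factor with `j = 0` is `1 - X ^ 2`. It vanishes at one, so only its own
derivative `-2` contributes, times the remaining factors at one. -/
theorem derivative_siegelTerm (q ℓ : ℕ) {t : ℕ} (ht : 2 ≤ t) :
    (derivative (siegelTerm q ℓ t)).eval 1 = -2 * typeWeight q t := by
  have h1 : siegelTerm q ℓ t = (1 - X ^ 2) * (X ^ (2 * ℓ) *
      ∏ j ∈ Finset.Ico 1 (t / 2), (1 - C ((q : ℤ) ^ (2 * j)) * X ^ 2)) := by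
    rw [siegelTerm, Finset.range_eq_Ico, Finset.prod_eq_prod_Ico_succ_bot (by omega)]
    simp
    ring
  rw [h1, derivative_mul]
  simp [eval_prod, typeWeight]

/-- The first `r` factors of the density are exactly the normalizing denominator, read in reverse
order. -/
theorem prod_range_eq_prod_Icc (q : ℝ) (hq : 0 < q) (r s : ℕ) :
    ∏ i ∈ Finset.range r, (1 - q ^ (2 * i) / q ^ ((r + s) * 2))
      = ∏ i ∈ Finset.Icc (s + 1) (r + s), (1 - q ^ (-(2 * (i : ℤ)))) := by
  rw [← Finset.prod_range_reflect]
  have h1 : Finset.Icc (s + 1) (r + s) = Finset.Ico (s + 1) (r + s + 1) := rfl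
  rw [h1, Finset.prod_Ico_eq_prod_range]
  have h2 : r + s + 1 - (s + 1) = r := by omega
  rw [h2]
  refine Finset.prod_congr rfl fun i hi => ?_
  rw [Finset.mem_range] at hi
  congr 1
  rw [div_eq_iff (pow_ne_zero _ hq.ne'), ← zpow_natCast, ← zpow_natCast, ← zpow_add₀ hq.ne']
  congr 1
  push_cast
  omega

namespace RamifiedDatum

/-- In the product over `i < r + t / 2`, the factors with `i < r` cancel the denominator, and those
with `i = r + j` become `1 - q ^ (2 j) X ^ 2` at `X = q ^ (-s)`. The quotient of powers of `q` in
front becomes `X ^ (2 ℓ)`. -/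
theorem exists_isSiegelSeries (hD : RamifiedDatum c u (residueCard F)) (hh : IsHermitianSpace h)
    (hb : IsLatticeBasis b L) (hL : ambient L = ⊤) (S : Finset (Submodule (Valued.integer E) V))
    (hS : ∀ L', L' ∈ S ↔ L' ∈ integralOverlattices u h L) :
    ∃ ℓ : Submodule (Valued.integer E) V → ℕ, IsSiegelSeries u h r L
      (∑ L' ∈ S, siegelTerm (residueCard F) (ℓ L') (latticeType u h L')) := by
  obtain ⟨ℓ, hℓ⟩ := hD.exists_card_hermHom hh hb hL S hS
  refine ⟨ℓ, fun s => ?_⟩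
  set q := residueCard F with hqdef
  have hq1 : (1 : ℝ) < q := by exact_mod_cast hD.one_lt_q
  have hq : (0 : ℝ) < q := by positivity
  have h1 : denHyperbolic u h (r + s) L = ∑ L' ∈ S, (q : ℝ) ^ (2 * r * ℓ L')
      / (q : ℝ) ^ (2 * (r + s) * ℓ L') * ∏ i ∈ Finset.range ((2 * r + latticeType u h L') / 2),
        (1 - (q : ℝ) ^ (2 * i) / (q : ℝ) ^ ((r + s) * 2)) := by
    -- The normalized counts are eventually constant in `k`, so the limit is their eventual value.
    refine Tendsto.limUnder_eq ?_
    rw [hb.finrank_ambient]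
    exact tendsto_const_nhds.congr' ((hℓ (r + s)).mono fun k hk => hk.symm)
  have h2 : ∏ i ∈ Finset.Icc (s + 1) (r + s), (1 - (q : ℝ) ^ (-(2 * (i : ℤ)))) ≠ 0 := by
    rw [Finset.prod_ne_zero_iff]
    intro i hi
    rw [Finset.mem_Icc] at hi
    have : (q : ℝ) ^ (-(2 * (i : ℤ))) < 1 := zpow_lt_one_of_neg₀ hq1 (by omega)
    linarith
  rw [h1, map_sum, eq_div_iff h2, Finset.sum_mul]
  refine Finset.sum_congr rfl fun L' hL' => ?_
  rw [hS] at hL'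
  obtain ⟨b', hb'⟩ := hD.exists_isLatticeBasis (hD.fg_of_mem_integralOverlattices hh hb hL hL')
    (show Module.finrank E (ambient L') = 2 * r by
      rw [ambient_eq_top_of_le hL'.1 hL, ← hL, hb.finrank_ambient])
  have h3 : (2 * r + latticeType u h L') / 2 = r + latticeType u h L' / 2 := by omega
  rw [h3, Finset.prod_range_add, prod_range_eq_prod_Icc _ hq, siegelTerm]
  have h4 : (q : ℝ) ^ (2 * r * ℓ L') / (q : ℝ) ^ (2 * (r + s) * ℓ L')
      = ((q : ℝ) ^ (-(s : ℤ))) ^ (2 * ℓ L') := by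
    rw [div_eq_iff (pow_ne_zero _ hq.ne'), ← zpow_natCast, ← zpow_natCast, ← zpow_natCast,
      ← zpow_mul, ← zpow_add₀ hq.ne']
    congr 1
    push_cast
    ring
  have h5 : ∀ j : ℕ, (q : ℝ) ^ (2 * (r + j)) / (q : ℝ) ^ ((r + s) * 2)
      = (q : ℝ) ^ (2 * j) * ((q : ℝ) ^ (-(s : ℤ))) ^ 2 := by
    intro j
    rw [div_eq_iff (pow_ne_zero _ hq.ne'), ← zpow_natCast, ← zpow_natCast, ← zpow_natCast,
      ← zpow_natCast, ← zpow_mul, ← zpow_add₀ hq.ne', ← zpow_add₀ hq.ne']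
    congr 1
    push_cast
    ring
  simp only [h4, h5]
  simp only [map_mul, map_pow, map_prod, map_sub, map_one, aeval_X, aeval_C]
  simp only [algebraMap_int_eq, eq_intCast, Int.cast_pow, Int.cast_natCast]
  ring

theorem isSiegelSeries_unique (hD : RamifiedDatum c u (residueCard F)) {P Q : ℤ[X]}
    (hP : IsSiegelSeries u h r L P) (hQ : IsSiegelSeries u h r L Q) : P = Q := by
  have hq1 : (1 : ℝ) < residueCard F := by exact_mod_cast hD.one_lt_q
  refine Polynomial.map_injective (Int.castRingHom ℝ) Int.cast_injective ?_
  refine Polynomial.eq_of_infinite_eval_eq _ _ ?_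
  refine (Set.infinite_range_of_injective (f := fun s : ℕ => (residueCard F : ℝ) ^ (-(s : ℤ)))
    fun s s' hs => ?_).mono ?_
  · have := (zpow_right_injective₀ (by positivity) hq1.ne') hs
    simpa using this
  · rintro _ ⟨s, rfl⟩
    have h1 := (hP s).trans (hQ s).symm
    rw [aeval_def, aeval_def, eval₂_eq_eval_map, eval₂_eq_eval_map] at h1
    exact h1

/-- `∂Den(L)` as a sum over integral overlattices. -/
theorem derivDen_eq (hD : RamifiedDatum c u (residueCard F)) (hh : IsHermitianSpace h)
    (hV : Module.finrank E V = 2 * r) (hns : ¬ IsSplit h)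
    (hb : IsLatticeBasis b L) (hL : ambient L = ⊤) (S : Finset (Submodule (Valued.integer E) V))
    (hS : ∀ L', L' ∈ S ↔ L' ∈ integralOverlattices u h L) :
    derivDen u h r L = 2 * ∑ L' ∈ S, typeWeight (residueCard F) (latticeType u h L') := by
  obtain ⟨ℓ, hℓ⟩ := hD.exists_isSiegelSeries hh hb hL S hS
  have h1 : siegelSeries u h r L
      = ∑ L' ∈ S, siegelTerm (residueCard F) (ℓ L') (latticeType u h L') := by
    have hex : ∃ P, IsSiegelSeries u h r L P := ⟨_, hℓ⟩
    rw [siegelSeries, dif_pos hex]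
    exact hD.isSiegelSeries_unique hex.choose_spec hℓ
  rw [derivDen, h1, derivative_sum, eval_finsetSum, Finset.mul_sum, ← Finset.sum_neg_distrib]
  refine Finset.sum_congr rfl fun L' hL' => ?_
  rw [hS] at hL'
  obtain ⟨b', hb'⟩ := hD.exists_isLatticeBasis (hD.fg_of_mem_integralOverlattices hh hb hL hL')
    (show Module.finrank E (ambient L') = 2 * r by
      rw [ambient_eq_top_of_le hL'.1 hL, ← hL, hb.finrank_ambient])
  rw [derivative_siegelTerm _ _ (hD.two_le_latticeType hh hV hns hL'.2 hb'
    (ambient_eq_top_of_le hL'.1 hL)).1]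
  ring

end RamifiedDatum
end Siegel

/-! ### Parity of valuations of symmetric elements, and topology of lattices. -/

section Topology

variable {F : Type*} [NontriviallyNormedField F]
variable {E : Type*} [NontriviallyNormedField E] [IsUltrametricDist E] [NormedAlgebra F E]
variable {c : E ≃ₐ[F] E} {u : Valued.integer E} {q : ℕ}
variable {V : Type*} [AddCommGroup V] [Module E V] {h : Pairing c V}
variable {L : Submodule (Valued.integer E) V} {m : ℕ} {b : Fin m → V}

namespace RamifiedDatum

/-- A symmetric element of absolute value less than `‖u‖ ^ (2 * (j - 1))` has absolute value at
most `‖u‖ ^ (2 * j)`. -/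
theorem symm_norm_le (hD : RamifiedDatum c u q) {z : E} (hz : c z = z) {j : ℤ}
    (hlt : ‖z‖ < ‖(u : E)‖ ^ (2 * (j - 1))) : ‖z‖ ≤ ‖(u : E)‖ ^ (2 * j) := by
  by_cases h0 : z = 0
  · rw [h0, norm_zero]
    exact zpow_nonneg (norm_nonneg _) _
  · obtain ⟨i, hi⟩ := hD.symm_even z h0 hz
    rw [hi] at hlt ⊢
    rw [zpow_lt_zpow_iff_right_of_lt_one₀ hD.norm_pos hD.norm_lt_one] at hlt
    exact zpow_le_zpow_right_of_le_one₀ hD.norm_pos hD.norm_lt_one.le (by omega)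

/-- Symmetric elements have even valuation, so valuation at least `-1` already means integral. -/
theorem symm_norm_le_one (hD : RamifiedDatum c u q) {z : E} (hz : c z = z)
    (hle : ‖z‖ ≤ ‖(u : E)‖⁻¹) : ‖z‖ ≤ 1 := by
  have h1 := hD.symm_norm_le (j := 0) hz (hle.trans_lt ?_)
  · simpa using h1
  · rw [← zpow_neg_one]
    exact zpow_lt_zpow_right_of_lt_one₀ hD.norm_pos hD.norm_lt_one (by norm_num)

theorem symm_norm_lt_of_lt (hD : RamifiedDatum c u q) {z : E} (hz : c z = z)
    (hlt : ‖z‖ < ‖(u : E)‖ ^ (-2 : ℤ)) : ‖z‖ ≤ 1 := by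
  have h1 := hD.symm_norm_le (j := 0) hz (by simpa using hlt)
  simpa using h1

theorem self_symm (hh : IsHermitianSpace h) (x : V) : c (h x x) = h x x := (hh.symm x x).symm

theorem mem_intSet_iff [IsUltrametricDist F] (hD : RamifiedDatum c u q) (hh : IsHermitianSpace h)
    {x : V} : x ∈ intSet h ↔ ‖h x x‖ ≤ 1 := by
  constructor
  · rintro ⟨a, ha, hx⟩
    rwa [hx, norm_algebraMap']
  · intro hx
    obtain ⟨a, ha⟩ := hD.mem_range_of_symm _ (self_symm hh x)
    refine ⟨a, ?_, ha⟩
    rwa [ha, norm_algebraMap'] at hx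

theorem algebraMap_trace (hD : RamifiedDatum c u q) (h2 : Module.finrank F E = 2) (z : E) :
    algebraMap F E (Algebra.trace F E z) = z + c z := by
  obtain ⟨a, ha⟩ := hD.mem_range_of_symm (z + c z) (by rw [map_add, hD.conj_conj, add_comm])
  have h3 := congrArg (Algebra.trace F E) ha
  rw [map_add, Algebra.trace_algebraMap, h2, Algebra.trace_eq_of_algEquiv] at h3
  have h4 : (2 : F) * Algebra.trace F E z = 2 * a := by
    simpa [two_mul] using h3
  have h5 : (2 : F) ≠ 0 := by
    intro h0
    apply hD.two_ne_zero
    rw [← map_ofNat (algebraMap F E) 2, h0, map_zero]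
  rw [mul_left_cancel₀ h5 h4, ha]

theorem norm_trace (hD : RamifiedDatum c u q) (h2 : Module.finrank F E = 2) (z : E) :
    ‖Algebra.trace F E z‖ = ‖z + c z‖ := by
  rw [← hD.algebraMap_trace h2, norm_algebraMap']

theorem norm_add_le_of_le {x y : E} {C : ℝ} (hx : ‖x‖ ≤ C) (hy : ‖y‖ ≤ C) : ‖x + y‖ ≤ C :=
  (IsUltrametricDist.norm_add_le_max _ _).trans (max_le hx hy)

theorem norm_add_lt_of_lt {x y : E} {C : ℝ} (hx : ‖x‖ < C) (hy : ‖y‖ < C) : ‖x + y‖ < C :=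
  (IsUltrametricDist.norm_add_le_max _ _).trans_lt (max_lt hx hy)

theorem norm_sub_le_of_le' {x y : E} {C : ℝ} (hx : ‖x‖ ≤ C) (hy : ‖y‖ ≤ C) : ‖x - y‖ ≤ C := by
  rw [sub_eq_add_neg]
  exact norm_add_le_of_le hx (by rwa [norm_neg])

theorem one_lt_inv_norm (hD : RamifiedDatum c u q) : 1 < ‖(u : E)‖⁻¹ :=
  (one_lt_inv₀ hD.norm_pos).mpr hD.norm_lt_one

theorem norm_pairing_comm (hD : RamifiedDatum c u q) (hh : IsHermitianSpace h) (x y : V) :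
    ‖h x y‖ = ‖h y x‖ := by
  rw [hh.symm y x, hD.norm_conj]

theorem pairing_add_self (x y : V) : h (x + y) (x + y) = h x x + h x y + h y x + h y y := by
  simp only [map_add, LinearMap.add_apply]
  ring

theorem pairing_smul_left (a : E) (x y : V) : h (a • x) y = a * h x y := by simp

theorem pairing_smul_right (a : E) (x y : V) : h x (a • y) = c a * h x y := by simp

theorem isIntegralLattice_sup_span (hD : RamifiedDatum c u q) (hh : IsHermitianSpace h)
    (hL : IsIntegralLattice u h L) {z : V} (hz : ∀ v ∈ L, ‖h z v‖ ≤ ‖(u : E)‖⁻¹)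
    (hzz : ‖h z z‖ ≤ ‖(u : E)‖⁻¹) :
    IsIntegralLattice u h (L ⊔ Submodule.span (Valued.integer E) {z}) := by
  rw [hD.isIntegralLattice_iff] at hL ⊢
  have hmul : ∀ (a : Valued.integer E) {w : E}, ‖w‖ ≤ ‖(u : E)‖⁻¹ → ‖(a : E) * w‖ ≤ ‖(u : E)‖⁻¹ :=
    fun a w hw => by
      rw [norm_mul]
      exact (mul_le_of_le_one_left (norm_nonneg _) (norm_coe_integer_le a)).trans hw
  have hmul' : ∀ (a : Valued.integer E) {w : E}, ‖w‖ ≤ ‖(u : E)‖⁻¹ →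
      ‖c (a : E) * w‖ ≤ ‖(u : E)‖⁻¹ := fun a w hw => by
    rw [norm_mul, hD.norm_conj]
    exact (mul_le_of_le_one_left (norm_nonneg _) (norm_coe_integer_le a)).trans hw
  intro x hx y hy
  obtain ⟨x₁, hx₁, x₂, hx₂, rfl⟩ := Submodule.mem_sup.mp hx
  obtain ⟨y₁, hy₁, y₂, hy₂, rfl⟩ := Submodule.mem_sup.mp hy
  obtain ⟨a, rfl⟩ := Submodule.mem_span_singleton.mp hx₂
  obtain ⟨a', rfl⟩ := Submodule.mem_span_singleton.mp hy₂
  simp only [integer_smul_def, map_add, LinearMap.add_apply, pairing_smul_left,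
    pairing_smul_right]
  refine norm_add_le_of_le (norm_add_le_of_le (hL _ hx₁ _ hy₁) (hmul a (hz _ hy₁)))
    (norm_add_le_of_le (hmul' a' ?_) (hmul' a' (hmul a hzz)))
  rw [hD.norm_pairing_comm hh]
  exact hz _ hx₁

variable [TopologicalSpace V] [IsTopologicalAddGroup V] [ContinuousSMul E V] [T2Space V]
variable [FiniteDimensional E V]

theorem continuous_pairing_left (hD : RamifiedDatum c u q) (y : V) : Continuous fun x => h x y := by
  have := hD.properSpace
  exact (h.flip y).continuous_of_finiteDimensional

theorem continuous_pairing_right (hD : RamifiedDatum c u q) (hh : IsHermitianSpace h) (x : V) :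
    Continuous fun y => h x y := by
  have h1 : (fun y => h x y) = fun y => c (h y x) := funext fun y => hh.symm y x
  rw [h1]
  exact hD.continuous_conj.comp (hD.continuous_pairing_left x)

theorem continuous_self (hD : RamifiedDatum c u q) (hh : IsHermitianSpace h) :
    Continuous fun x => h x x := by
  have := hD.properSpace
  let B := Module.finBasis E V
  have h1 : (fun x => h x x) = fun x => ∑ i, B.coord i x * h (B i) x := by
    funext x
    conv_lhs => rw [← B.sum_repr x]
    rw [sesq_sum_left]
    simp only [Module.Basis.coord_apply, B.sum_repr]
  rw [h1]
  refine continuous_finsetSum _ fun i _ => ?_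
  exact (B.coord i).continuous_of_finiteDimensional.mul (hD.continuous_pairing_right hh _)

theorem isCompact_lattice (hD : RamifiedDatum c u q) (hb : IsLatticeBasis b L) :
    IsCompact (L : Set V) := by
  have := hD.properSpace
  have h1 : IsCompact (Set.univ.pi fun _ : Fin m => Metric.closedBall (0 : E) 1) :=
    isCompact_univ_pi fun _ => isCompact_closedBall _ _
  have h2 : (L : Set V) = (fun a : Fin m → E => ∑ i, a i • b i) ''
      (Set.univ.pi fun _ : Fin m => Metric.closedBall (0 : E) 1) := by
    ext x
    constructor
    · intro hx
      obtain ⟨a, rfl⟩ := hb.mem_iff.mp hx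
      refine ⟨fun i => a i, ?_, rfl⟩
      simp only [Set.mem_pi, Set.mem_univ, forall_true_left, mem_closedBall_zero_iff]
      exact fun i => norm_coe_integer_le _
    · rintro ⟨a, ha, rfl⟩
      simp only [Set.mem_pi, Set.mem_univ, forall_true_left, mem_closedBall_zero_iff] at ha
      exact hb.sum_mem_iff.mpr ha
  rw [h2]
  exact h1.image (by fun_prop)

theorem isClosed_lattice (hD : RamifiedDatum c u q) (hL : L.FG) : IsClosed (L : Set V) := by
  obtain ⟨b, hb⟩ := hD.exists_isLatticeBasis hL rfl
  exact (hD.isCompact_lattice hb).isClosed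

theorem isOpen_lattice (hD : RamifiedDatum c u q) (hL : L.FG) (htop : ambient L = ⊤) :
    IsOpen (L : Set V) := by
  have := hD.properSpace
  obtain ⟨b, hb⟩ := hD.exists_isLatticeBasis hL rfl
  let B := Module.Basis.mk hb.li (by rw [hb.span_eq_ambient, htop])
  have h2 : (L : Set V) = ⋂ i, (fun x => B.coord i x) ⁻¹' Metric.closedBall (0 : E) 1 := by
    ext x
    simp only [Set.mem_iInter, Set.mem_preimage, mem_closedBall_zero_iff, SetLike.mem_coe]
    conv_lhs => rw [← B.sum_repr x]
    simp only [B, Module.Basis.mk_apply, hb.sum_mem_iff]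
    rfl
  rw [h2]
  refine isOpen_iInter_of_finite fun i => ?_
  exact (IsUltrametricDist.isOpen_closedBall _ one_ne_zero).preimage
    (B.coord i).continuous_of_finiteDimensional

theorem isClosed_dual (hD : RamifiedDatum c u q) : IsClosed (dual u h L : Set V) := by
  have := hD.properSpace
  have h1 : (dual u h L : Set V)
      = (ambient L : Set V) ∩ ⋂ y ∈ L, {x | ‖h x y‖ ≤ ‖(u : E)‖⁻¹} := by
    ext x
    simp only [Set.mem_inter_iff, Set.mem_iInter, SetLike.mem_coe, hD.mem_dual]
    rfl
  rw [h1]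
  refine (Submodule.closed_of_finiteDimensional _).inter (isClosed_biInter fun y _ => ?_)
  exact isClosed_le (hD.continuous_pairing_left y).norm continuous_const

end RamifiedDatum

/-- The measure of a disjoint union of translates. -/
theorem measure_eq_card_mul {V : Type*} [AddCommGroup V] [MeasurableSpace V] [MeasurableAdd V]
    {ν : Measure V}
    {ι : Type*} [Finite ι] (x : ι → V) {A M : Set V} (hM : MeasurableSet M)
    (hinv : ∀ i, ν {y | y - x i ∈ M} = ν M) (hA : ∀ y, y ∈ A ↔ ∃ i, y - x i ∈ M)
    (hdisj : ∀ y i j, y - x i ∈ M → y - x j ∈ M → i = j) : ν A = Nat.card ι * ν M := by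
  classical
  cases nonempty_fintype ι
  have h1 : A = ⋃ i, {y | y - x i ∈ M} := by
    ext y
    simp only [Set.mem_iUnion, Set.mem_ofPred_eq, hA]
  have h2 : ∀ i, MeasurableSet {y | y - x i ∈ M} := fun i => by
    simp only [sub_eq_add_neg]
    exact (measurable_add_const (-x i)) hM
  rw [h1, measure_iUnion ?_ h2, tsum_fintype]
  · simp only [hinv, Finset.sum_const, Finset.card_univ, Nat.card_eq_fintype_card, nsmul_eq_mul]
  · intro i j hij
    rw [Function.onFun, Set.disjoint_left]
    intro y hy hy'
    exact hij (hdisj y i j hy hy')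

end Topology

/-! ### Vectors of integral norm in the discriminant module. -/

section BalancedTranslates

/-- A ternary quadratic form over a finite field has a nontrivial zero. -/
theorem exists_ternary_zero {k : Type*} [Field k] [Finite k] (a : Fin 3 → Fin 3 → k) :
    ∃ x : Fin 3 → k, x ≠ 0 ∧ ∑ i, ∑ j, a i j * x i * x j = 0 := by
  classical
  cases nonempty_fintype k
  let f : MvPolynomial (Fin 3) k :=
    ∑ i, ∑ j, MvPolynomial.C (a i j) * MvPolynomial.X i * MvPolynomial.X j
  have hdeg : f.totalDegree < Fintype.card (Fin 3) := by
    refine lt_of_le_of_lt (b := 2) ?_ (by simp)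
    refine MvPolynomial.totalDegree_finsetSum_le fun i _ =>
      MvPolynomial.totalDegree_finsetSum_le fun j _ => ?_
    refine (MvPolynomial.totalDegree_mul _ _).trans ?_
    have h1 := MvPolynomial.totalDegree_mul (MvPolynomial.C (a i j)) (MvPolynomial.X i)
    rw [MvPolynomial.totalDegree_C, MvPolynomial.totalDegree_X] at h1
    rw [MvPolynomial.totalDegree_X]
    omega
  obtain ⟨p, hp⟩ := CharP.exists k
  have hpp : p.Prime := (CharP.char_is_prime_or_zero k p).resolve_right
    (CharP.char_ne_zero_of_finite k p)
  have hev : ∀ x, MvPolynomial.eval x f = ∑ i, ∑ j, a i j * x i * x j := fun x => by simp [f]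
  -- Chevalley–Warning: the number of zeros is divisible by `p`, and zero is one of them.
  have h2 := char_dvd_card_solutions p hdeg
  have h3 : 1 < Fintype.card {x : Fin 3 → k // MvPolynomial.eval x f = 0} := by
    have h4 : 0 < Fintype.card {x : Fin 3 → k // MvPolynomial.eval x f = 0} :=
      Fintype.card_pos_iff.mpr ⟨⟨0, by rw [hev]; simp⟩⟩
    exact hpp.one_lt.trans_le (Nat.le_of_dvd h4 h2)
  obtain ⟨⟨x, hx⟩, hne⟩ := Fintype.exists_ne_of_one_lt_card h3
    ⟨0, by rw [hev]; simp⟩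
  exact ⟨x, fun h0 => hne (Subtype.ext h0), by rw [← hev, hx]⟩

variable {F : Type*} [NontriviallyNormedField F]
variable {E : Type*} [NontriviallyNormedField E] [IsUltrametricDist E] [NormedAlgebra F E]
variable {c : E ≃ₐ[F] E} {u : Valued.integer E} {q : ℕ}
variable {V : Type*} [AddCommGroup V] [Module E V] {h : Pairing c V}
variable {L : Submodule (Valued.integer E) V} {m : ℕ} {b : Fin m → V} {z : V}

namespace RamifiedDatum

theorem residue_eq_iff (hD : RamifiedDatum c u q) {x y : Valued.integer E} :
    IsLocalRing.residue _ x = IsLocalRing.residue _ y ↔ ‖(x : E) - y‖ < 1 := by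
  rw [← sub_eq_zero, ← map_sub, hD.residue_eq_zero_iff, hD.dvd_iff]
  rfl

theorem norm_conj_sub_lt (hD : RamifiedDatum c u q) (x : Valued.integer E) :
    ‖c (x : E) - x‖ < 1 := by
  rw [norm_sub_rev]
  exact hD.norm_sub_conj _ (norm_coe_integer_le x)

/-- The values of the form on a translate by a multiple of an isotropic vector. -/
theorem norm_translate_le_one_iff (hD : RamifiedDatum c u q) (hh : IsHermitianSpace h) {y : V}
    (hzz : ‖h z z‖ ≤ 1) (hzy : ‖h z y‖ ≤ ‖(u : E)‖ ^ (-2 : ℤ)) (α : Valued.integer E) :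
    ‖h (y - (α : E) • z) (y - (α : E) • z)‖ ≤ 1 ↔
      ‖h y y - α * (h z y + c (h z y))‖ < ‖(u : E)‖ ^ (-2 : ℤ) := by
  have h1 : 1 < ‖(u : E)‖ ^ (-2 : ℤ) :=
    one_lt_zpow_of_neg₀ hD.norm_pos hD.norm_lt_one (by norm_num)
  have h2 : ‖h (y - (α : E) • z) (y - (α : E) • z) - (h y y - α * (h z y + c (h z y)))‖
      < ‖(u : E)‖ ^ (-2 : ℤ) := by
    -- The difference contains `c α - α`, which is divisible by `u`, and the integral multiple of
    -- `(z, z)`; both are negligible at valuation `-2`.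
    have h3 : h (y - (α : E) • z) (y - (α : E) • z) - (h y y - α * (h z y + c (h z y)))
        = -((c (α : E) - α) * c (h z y)) + α * c (α : E) * h z z := by
      simp only [map_sub, LinearMap.sub_apply, pairing_smul_left, pairing_smul_right,
        hh.symm z y]
      ring
    rw [h3]
    refine norm_add_lt_of_lt ?_ ?_
    · rw [norm_neg, norm_mul, hD.norm_conj (h z y)]
      rcases (norm_nonneg (h z y)).eq_or_lt with h0 | h0
      · rw [← h0, mul_zero]
        exact zero_lt_one.trans h1
      · exact (mul_lt_of_lt_one_left h0 (hD.norm_conj_sub_lt α)).trans_le hzy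
    · refine lt_of_le_of_lt ?_ h1
      rw [norm_mul, norm_mul, hD.norm_conj]
      exact mul_le_one₀ (mul_le_one₀ (norm_coe_integer_le _) (norm_nonneg _)
        (norm_coe_integer_le _)) (norm_nonneg _) hzz
  constructor
  · intro h3
    have := norm_add_lt_of_lt (h3.trans_lt h1) (by rwa [← norm_neg, neg_sub] at h2)
    simpa using this
  · intro h3
    refine hD.symm_norm_lt_of_lt (self_symm hh _) ?_
    have := norm_add_lt_of_lt h2 h3
    simpa using this

/-- At an even valuation the leading coefficient can be measured against the symmetric element `u ^
2`, where `c` is trivial modulo `u`; the trace doubles it and two is a unit. -/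
theorem norm_trace_eq (hD : RamifiedDatum c u q) {w : E} (hw : ‖w‖ = ‖(u : E)‖ ^ (-2 : ℤ)) :
    ‖w + c w‖ = ‖(u : E)‖ ^ (-2 : ℤ) := by
  have hu := hD.coe_ne_zero
  have hu2 : ‖(u : E) ^ 2‖ = ‖(u : E)‖ ^ (2 : ℤ) := by rw [norm_pow]; norm_cast
  have h1 : ‖(u : E) ^ 2 * w‖ = 1 := by
    rw [norm_mul, hw, hu2, ← zpow_add₀ hD.norm_pos.ne']
    simp
  have h2 : (u : E) ^ 2 * (w + c w) = 2 * ((u : E) ^ 2 * w)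
      - ((u : E) ^ 2 * w - c ((u : E) ^ 2 * w)) := by
    rw [map_mul, map_pow, hD.conj_u]
    ring
  have h3 : ‖(u : E) ^ 2 * (w + c w)‖ = 1 := by
    rw [h2, sub_eq_add_neg, IsUltrametricDist.norm_add_eq_max_of_norm_ne_norm]
    · rw [norm_mul, hD.norm_two, h1, one_mul, norm_neg]
      exact max_eq_left (hD.norm_sub_conj _ h1.le).le
    · rw [norm_mul, hD.norm_two, h1, one_mul, norm_neg]
      exact (hD.norm_sub_conj _ h1.le).ne'
  rw [norm_mul, hu2] at h3
  rw [zpow_neg]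
  exact eq_inv_of_mul_eq_one_right h3

theorem mem_dual_sup_span (hD : RamifiedDatum c u q) (hz : z ∈ ambient L) {y : V} :
    y ∈ dual u h (L ⊔ Submodule.span (Valued.integer E) {z}) ↔
      y ∈ dual u h L ∧ ‖h y z‖ ≤ ‖(u : E)‖⁻¹ := by
  have hamb : ambient (L ⊔ Submodule.span (Valued.integer E) {z}) = ambient L := by
    refine le_antisymm (ambient_le_iff.mpr fun x hx => ?_) (ambient_mono le_sup_left)
    obtain ⟨x₁, hx₁, x₂, hx₂, rfl⟩ := Submodule.mem_sup.mp hx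
    obtain ⟨a, rfl⟩ := Submodule.mem_span_singleton.mp hx₂
    exact add_mem (mem_ambient hx₁) (Submodule.smul_mem _ (a : E) hz)
  rw [hD.mem_dual, hD.mem_dual, hamb, and_assoc]
  refine and_congr_right fun _ => ⟨fun H => ⟨fun v hv => H v (Submodule.mem_sup_left hv),
    H z (Submodule.mem_sup_right (Submodule.mem_span_singleton_self z))⟩, fun H v hv => ?_⟩
  obtain ⟨x₁, hx₁, x₂, hx₂, rfl⟩ := Submodule.mem_sup.mp hv
  obtain ⟨a, rfl⟩ := Submodule.mem_span_singleton.mp hx₂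
  rw [map_add, integer_smul_def, pairing_smul_right]
  refine norm_add_le_of_le (H.1 _ hx₁) ?_
  rw [norm_mul, hD.norm_conj]
  exact (mul_le_of_le_one_left (norm_nonneg _) (norm_coe_integer_le a)).trans H.2

theorem norm_eq_of_mem_dual (hD : RamifiedDatum c u q) {y : V}
    (hy : y ∈ dual u h L) (huz : u • z ∈ L) : ‖h y z‖ ≤ ‖(u : E)‖ ^ (-2 : ℤ) := by
  have h1 := (hD.mem_dual.mp hy).2 _ huz
  rw [integer_smul_def, pairing_smul_right, norm_mul, hD.norm_conj] at h1
  have h2 : ‖(u : E)‖ ^ (-2 : ℤ) = ‖(u : E)‖⁻¹ * ‖(u : E)‖⁻¹ := by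
    rw [← zpow_neg_one, ← zpow_add₀ hD.norm_pos.ne']
    norm_num
  rw [h2, ← div_eq_inv_mul, le_div_iff₀ hD.norm_pos, mul_comm]
  exact h1

/-- If no vector of integral norm can be adjoined, then `u` kills the discriminant module. For `z`
with `u ^ (j + 2) z ∈ L`, the pairing of `u ^ j z` with `u ^ (j + 1) z` has valuation at least `-2`.
Hence `(u ^ j z, u ^ j z)` has valuation at least `-3`, so at least `-2` by parity. Thus `u ^ (j +
1) z` has integral norm and lies in `L`. -/
theorem smul_mem_of_forall_isotropic (hD : RamifiedDatum c u q) (hh : IsHermitianSpace h)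
    (hno : ∀ z ∈ dual u h L, u • z ∈ L → ‖h z z‖ ≤ 1 → z ∈ L) : ∀ (j : ℕ) (z : V),
      z ∈ dual u h L → u ^ j • z ∈ L → u • z ∈ L
  | 0, z, _, hz' => L.smul_mem u (by simpa using hz')
  | 1, z, _, hz' => by simpa using hz'
  | j + 2, z, hz, hz' => by
    refine smul_mem_of_forall_isotropic hD hh hno (j + 1) z hz ?_
    have h1 : u ^ j • z ∈ dual u h L := Submodule.smul_mem _ _ hz
    have h2 : u • u ^ (j + 1) • z ∈ L := by
      rw [smul_smul, ← pow_succ']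
      exact hz'
    refine hno _ (Submodule.smul_mem _ _ hz) h2 ?_
    have h3 := hD.norm_eq_of_mem_dual h1 h2
    have h4 : u ^ (j + 1) • z = (u : E) • (u ^ j • z) := by
      rw [pow_succ', mul_smul]
      rfl
    rw [h4, pairing_smul_right, norm_mul, hD.norm_conj] at h3
    rw [h4, pairing_smul_right, pairing_smul_left, norm_mul, norm_mul, hD.norm_conj]
    have hp := hD.norm_pos
    set t := h (u ^ j • z) (u ^ j • z) with ht
    have h5 : ‖t‖ ≤ ‖(u : E)‖ ^ (2 * (-1) : ℤ) := by
      refine hD.symm_norm_le (self_symm hh _) ?_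
      have h6 : ‖t‖ ≤ ‖(u : E)‖ ^ (-3 : ℤ) := by
        have h7 : ‖(u : E)‖ ^ (-2 : ℤ) = ‖(u : E)‖ * ‖(u : E)‖ ^ (-3 : ℤ) := by
          rw [← zpow_one_add₀ hp.ne']
          norm_num
        rw [h7] at h3
        exact le_of_mul_le_mul_left h3 hp
      exact h6.trans_lt (zpow_lt_zpow_right_of_lt_one₀ hp hD.norm_lt_one (by norm_num))
    calc ‖(u : E)‖ * (‖(u : E)‖ * ‖t‖) ≤ ‖(u : E)‖ * (‖(u : E)‖ * ‖(u : E)‖ ^ (2 * (-1) : ℤ)) := by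
          gcongr
      _ = 1 := by
          rw [← zpow_one_add₀ hp.ne', ← zpow_one_add₀ hp.ne']
          norm_num

/-- Three independent vectors of the radical carry a ternary quadratic form modulo `u`. A nontrivial
zero gives `y ∈ L` with `(y, y)` divisible by `u`, and then `u⁻¹ y` has integral norm, lies in the
dual and is not in `L`. -/
theorem corank_le_two (hD : RamifiedDatum c u q) (hh : IsHermitianSpace h)
    (hL : IsIntegralLattice u h L) (hb : IsLatticeBasis b L)
    (hno : ∀ z ∈ dual u h L, u • z ∈ L → ‖h z z‖ ≤ 1 → z ∈ L) : corank u h b ≤ 2 := by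
  have := hD.finite_residueField
  by_contra! hlt
  let B := Module.finBasis (IsLocalRing.ResidueField (Valued.integer E))
    (matrixKer (residueGram u h b))
  let w : Fin 3 → matrixKer (residueGram u h b) := fun l => B (Fin.castLE hlt l)
  have hw : LinearIndependent (IsLocalRing.ResidueField (Valued.integer E)) w :=
    B.linearIndependent.comp _ (Fin.castLE_injective hlt)
  choose a ha using fun l i => IsLocalRing.residue_surjective ((w l).1 i)
  let v : Fin 3 → V := fun l => ∑ i, a l i • b i
  have hvL : ∀ l, v l ∈ L := fun l => hb.mem_iff.mpr ⟨_, rfl⟩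
  have hv : ∀ l, ∀ y ∈ L, ‖h (v l) y‖ ≤ 1 := fun l => by
    refine (hD.mem_matrixKer_iff hh hL hb (a l)).mp ?_
    simp only [ha]
    exact (w l).2
  obtain ⟨x, hx0, hx⟩ := exists_ternary_zero fun l l' =>
    IsLocalRing.residue (Valued.integer E) (toInteger (h (v l) (v l')))
  choose X hX using fun l => IsLocalRing.residue_surjective (x l)
  have hY : ∑ l, X l • v l = ∑ i, (∑ l, X l * a l i) • b i := by
    simp only [v, Finset.smul_sum, smul_smul, Finset.sum_smul]
    rw [Finset.sum_comm]
  set y : V := ∑ l, X l • v l with hydef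
  have hyL : y ∈ L := Submodule.sum_mem _ fun l _ => L.smul_mem _ (hvL l)
  have hyL' : ∀ w ∈ L, ‖h y w‖ ≤ 1 := by
    intro w hw
    simp only [hydef, integer_smul_def]
    rw [sesq_sum_left]
    refine norm_sum_le_of_forall_le _ _ zero_le_one fun l _ => ?_
    rw [norm_mul]
    exact mul_le_one₀ (norm_coe_integer_le _) (norm_nonneg _) (hv l w hw)
  have hyy : ‖h y y‖ < 1 := by
    have h1 : h y y = ((∑ l, ∑ l', X l * hD.conjInt (X l') * toInteger (h (v l) (v l')) :
        Valued.integer E) : E) := by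
      simp only [hydef, integer_smul_def]
      rw [sesq_sum_left]
      push_cast
      refine Finset.sum_congr rfl fun l _ => ?_
      rw [sesq_sum_right, Finset.mul_sum]
      refine Finset.sum_congr rfl fun l' _ => ?_
      rw [coe_toInteger (hv l _ (hvL l')), hD.coe_conjInt]
      ring
    rw [h1, ← hD.dvd_iff, ← hD.residue_eq_zero_iff, ← hx, map_sum]
    refine Finset.sum_congr rfl fun l _ => ?_
    rw [map_sum]
    refine Finset.sum_congr rfl fun l' _ => ?_
    rw [map_mul, map_mul, hD.residue_conjInt, hX, hX]
    ring
  have hp := hD.norm_pos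
  have hz : (u : E)⁻¹ • y ∈ L := by
    refine hno _ (hD.mem_dual.mpr ⟨Submodule.smul_mem _ _ (mem_ambient hyL), fun w hw => ?_⟩) ?_ ?_
    · rw [pairing_smul_left, norm_mul, norm_inv]
      exact mul_le_of_le_one_right (inv_nonneg.mpr hp.le) (hyL' w hw)
    · rw [integer_smul_def, smul_smul, mul_inv_cancel₀ hD.coe_ne_zero, one_smul]
      exact hyL
    -- Scaling by `u⁻¹` lowers the positive valuation of `(y, y)` by two; the result exceeds `-2`
    -- and is even, hence nonnegative.
    · refine hD.symm_norm_lt_of_lt (self_symm hh _) ?_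
      rw [pairing_smul_left, pairing_smul_right, norm_mul, norm_mul, hD.norm_conj, norm_inv,
        ← mul_assoc]
      have h2 : ‖(u : E)‖ ^ (-2 : ℤ) = ‖(u : E)‖⁻¹ * ‖(u : E)‖⁻¹ := by
        rw [← zpow_neg_one, ← zpow_add₀ hD.norm_pos.ne']
        norm_num
      rw [h2]
      exact mul_lt_of_lt_one_right (by positivity) hyy
  have h3 := hD.sub_mem_iff_residue hb (fun i => ∑ l, X l * a l i) 0
  simp only [Pi.zero_apply, zero_smul, Finset.sum_const_zero, smul_zero, sub_zero, map_zero] at h3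
  rw [← hY] at h3
  have h4 := h3.mp hz
  have h5 : ∑ l, x l • w l = 0 := by
    refine Subtype.ext (funext fun i => ?_)
    have h6 := congrFun h4 i
    rw [map_sum] at h6
    rw [Submodule.coe_sum, Finset.sum_apply]
    refine Eq.trans (Finset.sum_congr rfl fun l _ => ?_) h6
    rw [map_mul, hX, ha]
    rfl
  exact hx0 (funext (Fintype.linearIndependent_iff.mp hw x h5))

end RamifiedDatum

end BalancedTranslates

/-! ### Measure of the vectors of integral norm in the dual of a lattice of odd rank. -/

section IsotropicMeasure

variable {F : Type*} [NontriviallyNormedField F]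
variable {E : Type*} [NontriviallyNormedField E] [IsUltrametricDist E] [NormedAlgebra F E]
variable {c : E ≃ₐ[F] E} {u : Valued.integer E} {q : ℕ}
variable {V : Type*} [AddCommGroup V] [Module E V] {h : Pairing c V}
variable {L : Submodule (Valued.integer E) V} {m : ℕ} {b : Fin m → V} {z : V}

/-- A set-theoretic section of the residue map. -/
def residueLift (x : IsLocalRing.ResidueField (Valued.integer E)) : Valued.integer E :=
  (IsLocalRing.residue_surjective x).choose

theorem residue_residueLift (x : IsLocalRing.ResidueField (Valued.integer E)) :
    IsLocalRing.residue (Valued.integer E) (residueLift x) = x :=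
  (IsLocalRing.residue_surjective x).choose_spec

theorem ambient_sup_span (hz : z ∈ ambient L) :
    ambient (L ⊔ Submodule.span (Valued.integer E) {z}) = ambient L := by
  refine le_antisymm (ambient_le_iff.mpr fun x hx => ?_) (ambient_mono le_sup_left)
  obtain ⟨x₁, hx₁, x₂, hx₂, rfl⟩ := Submodule.mem_sup.mp hx
  obtain ⟨a, rfl⟩ := Submodule.mem_span_singleton.mp hx₂
  exact add_mem (mem_ambient hx₁) (Submodule.smul_mem _ (a : E) hz)

/-- A measure is invariant under translation by the vectors of `W`. -/
def IsTranslationInvariant [MeasurableSpace V] (ν : Measure V) (W : Submodule E V) : Prop :=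
  ∀ a ∈ W, ∀ S, MeasurableSet S → ν {y | y - a ∈ S} = ν S

/-- The vectors that are congruent modulo `L` to a vector pairing integrally with `L`. -/
def nearDual (h : Pairing c V) (L : Submodule (Valued.integer E) V) : Set V :=
  {y | ∃ l ∈ L, ∀ v ∈ L, ‖h (y - l) v‖ ≤ 1}

namespace RamifiedDatum

theorem inv_norm_mul_self (hD : RamifiedDatum c u q) :
    ‖(u : E)‖⁻¹ * ‖(u : E)‖⁻¹ = ‖(u : E)‖ ^ (-2 : ℤ) := by
  rw [← zpow_neg_one, ← zpow_add₀ hD.norm_pos.ne']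
  norm_num

theorem one_le_zpow_neg_two (hD : RamifiedDatum c u q) : 1 < ‖(u : E)‖ ^ (-2 : ℤ) :=
  one_lt_zpow_of_neg₀ hD.norm_pos hD.norm_lt_one (by norm_num)

theorem norm_eq_zpow_neg_two (hD : RamifiedDatum c u q) {w : E}
    (hle : ‖w‖ ≤ ‖(u : E)‖ ^ (-2 : ℤ)) (hlt : ¬‖w‖ ≤ ‖(u : E)‖⁻¹) :
    ‖w‖ = ‖(u : E)‖ ^ (-2 : ℤ) := by
  have h0 : w ≠ 0 := fun h0 => hlt (by rw [h0, norm_zero]; exact inv_nonneg.mpr (norm_nonneg _))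
  obtain ⟨i, hi⟩ := hD.exists_zpow w h0
  rw [hi] at hle hlt ⊢
  rw [← zpow_neg_one] at hlt
  rw [zpow_le_zpow_iff_right_of_lt_one₀ hD.norm_pos hD.norm_lt_one] at hle hlt
  congr 1
  omega

variable [TopologicalSpace V] [IsTopologicalAddGroup V] [ContinuousSMul E V] [T2Space V]
variable [FiniteDimensional E V] [MeasurableSpace V] [BorelSpace V] {ν : Measure V}

theorem measurableSet_self_le (hD : RamifiedDatum c u q) (hh : IsHermitianSpace h) (C : ℝ) :
    MeasurableSet {y : V | ‖h y y‖ ≤ C} :=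
  (isClosed_le (hD.continuous_self hh).norm continuous_const).measurableSet

theorem measurableSet_pairing_le (hD : RamifiedDatum c u q) (x : V) (C : ℝ) :
    MeasurableSet {y : V | ‖h y x‖ ≤ C} :=
  (isClosed_le (hD.continuous_pairing_left x).norm continuous_const).measurableSet

theorem measurableSet_dual (hD : RamifiedDatum c u q) :
    MeasurableSet (dual u h L : Set V) := hD.isClosed_dual.measurableSet

/-- Where `(y, z)` has valuation exactly `-2`, subtracting `κ z` changes `(y, y)` by `κ` times the
trace of `(z, y)`, up to terms of larger valuation, and that trace again has valuation `-2`. So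
exactly one residue `κ` makes the norm integral, and the larger set is the disjoint union of `q`
translates of the smaller one. -/
theorem measure_translates (hD : RamifiedDatum c u q) (hh : IsHermitianSpace h)
    (hν : IsTranslationInvariant ν (ambient L))
    (hzL : z ∈ dual u h L) (huz : u • z ∈ L) (hzz : ‖h z z‖ ≤ 1) :
    ν ({y | y ∈ dual u h L ∧ ‖h y y‖ ≤ ‖(u : E)‖ ^ (-2 : ℤ)} \ {y | ‖h y z‖ ≤ ‖(u : E)‖⁻¹})
      = q * ν ({y | y ∈ dual u h L ∧ ‖h y y‖ ≤ 1} \ {y | ‖h y z‖ ≤ ‖(u : E)‖⁻¹}) := by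
  have := hD.finite_residueField
  have h1 := hD.one_le_zpow_neg_two
  have hp := hD.norm_pos
  have hzdual : ∀ a : Valued.integer E, (a : E) • z ∈ dual u h L := fun a =>
    Submodule.smul_mem (dual u h L) a hzL
  have hazz : ∀ a : Valued.integer E, ‖(a : E) * h z z‖ ≤ ‖(u : E)‖⁻¹ := fun a => by
    rw [norm_mul]
    exact (mul_le_one₀ (norm_coe_integer_le _) (norm_nonneg _) hzz).trans hD.one_lt_inv_norm.le
  have hiff : ∀ (a : Valued.integer E) (y : V),
      ‖h (y - (a : E) • z) z‖ ≤ ‖(u : E)‖⁻¹ ↔ ‖h y z‖ ≤ ‖(u : E)‖⁻¹ := fun a y => by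
    have h2 : h (y - (a : E) • z) z = h y z - a * h z z := by simp
    rw [h2]
    refine ⟨fun H => ?_, fun H => norm_sub_le_of_le' H (hazz a)⟩
    have := norm_add_le_of_le H (hazz a)
    simpa using this
  have hzy : ∀ y ∈ dual u h L, ‖h z y‖ ≤ ‖(u : E)‖ ^ (-2 : ℤ) := fun y hy => by
    rw [hD.norm_pairing_comm hh]
    exact hD.norm_eq_of_mem_dual hy huz
  rw [← hD.card_residue]
  refine measure_eq_card_mul (fun κ => (residueLift κ : E) • z) ?_ ?_ ?_ ?_
  · exact ((hD.measurableSet_dual.inter (hD.measurableSet_self_le hh 1))).diff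
      (hD.measurableSet_pairing_le z _)
  · intro κ
    refine hν _ (Submodule.smul_mem _ _ hzL.1) _ ?_
    exact ((hD.measurableSet_dual.inter (hD.measurableSet_self_le hh 1))).diff
      (hD.measurableSet_pairing_le z _)
  · intro y
    constructor
    · rintro ⟨⟨hy, hyy⟩, hyz⟩
      have hyz : ¬‖h y z‖ ≤ ‖(u : E)‖⁻¹ := hyz
      have hw : ‖h z y‖ = ‖(u : E)‖ ^ (-2 : ℤ) := by
        refine hD.norm_eq_zpow_neg_two (hzy y hy) ?_
        rwa [hD.norm_pairing_comm hh]
      have hT := hD.norm_trace_eq hw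
      set T := h z y + c (h z y)
      have hT0 : T ≠ 0 := norm_pos_iff.mp (by rw [hT]; positivity)
      have hα : ‖h y y / T‖ ≤ 1 := by
        rw [norm_div, hT]
        exact div_le_one_of_le₀ hyy (by positivity)
      -- The required residue class: the one cancelling the leading term of `(y, y)`.
      let α : Valued.integer E := toInteger (h y y / T)
      refine ⟨IsLocalRing.residue _ α, ⟨⟨sub_mem hy (hzdual _), ?_⟩, ?_⟩⟩
      · refine (hD.norm_translate_le_one_iff hh hzz (hzy y hy) _).mpr ?_
        have h2 := hD.residue_eq_iff.mp (residue_residueLift (IsLocalRing.residue _ α))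
        have h3 : h y y - (residueLift (IsLocalRing.residue _ α) : E) * T
            = -((residueLift (IsLocalRing.residue _ α) : E) - α) * T := by
          rw [coe_toInteger hα]
          field_simp
          ring
        change ‖h y y - (residueLift (IsLocalRing.residue _ α) : E) * T‖ < _
        rw [h3, norm_mul, norm_neg, hT]
        exact mul_lt_of_lt_one_left (by positivity) h2
      · exact fun H => hyz ((hiff _ _).mp H)
    · rintro ⟨κ, ⟨⟨hy, hyy⟩, hyz⟩⟩
      set a : Valued.integer E := residueLift κ
      have hyd : y ∈ dual u h L := by
        have := add_mem hy (hzdual a)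
        simpa using this
      refine ⟨⟨hyd, ?_⟩, fun H => hyz ((hiff _ _).mpr H)⟩
      have h2 : h y y = h (y - (a : E) • z) (y - (a : E) • z) + (h y ((a : E) • z)
          + h ((a : E) • z) (y - (a : E) • z)) := by
        simp only [map_sub, LinearMap.sub_apply]
        ring
      rw [h2]
      refine norm_add_le_of_le (hyy.trans h1.le) (norm_add_le_of_le ?_ ?_)
      · rw [pairing_smul_right, norm_mul, hD.norm_conj, hD.norm_pairing_comm hh]
        exact (mul_le_of_le_one_left (norm_nonneg _) (norm_coe_integer_le _)).trans (hzy y hyd)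
      · rw [pairing_smul_left, norm_mul]
        exact (mul_le_of_le_one_left (norm_nonneg _) (norm_coe_integer_le _)).trans (hzy _ hy)
  · rintro y κ κ' ⟨⟨hy, hyy⟩, hyz⟩ ⟨⟨-, hyy'⟩, -⟩
    have hyd : y ∈ dual u h L := by
      have := add_mem hy (hzdual (residueLift κ))
      simpa using this
    have hw : ‖h z y‖ = ‖(u : E)‖ ^ (-2 : ℤ) := by
      refine hD.norm_eq_zpow_neg_two (hzy y hyd) ?_
      rw [hD.norm_pairing_comm hh]
      exact fun H => hyz ((hiff _ _).mpr H)
    have hT := hD.norm_trace_eq hw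
    have h2 := (hD.norm_translate_le_one_iff hh hzz (hzy y hyd) _).mp hyy
    have h3 := (hD.norm_translate_le_one_iff hh hzz (hzy y hyd) _).mp hyy'
    rw [← norm_neg] at h2
    have h4 := norm_add_lt_of_lt h2 h3
    rw [← residue_residueLift κ, ← residue_residueLift κ', hD.residue_eq_iff]
    have h5 : -(h y y - residueLift κ * (h z y + c (h z y)))
        + (h y y - residueLift κ' * (h z y + c (h z y)))
        = ((residueLift κ : E) - residueLift κ') * (h z y + c (h z y)) := by ring
    rw [h5, norm_mul, hT] at h4
    exact lt_of_mul_lt_mul_right (by simpa using h4) (by positivity)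

/-- The base case. By `corank_le_two` and oddness of the rank, the corank is one, and `u` kills the
discriminant module, so `L` has index `q` in its dual. The vectors of integral norm are exactly `L`,
and the bound by `‖u‖ ^ (-2)` holds on the whole dual. -/
theorem measure_dual_of_forall_isotropic (hD : RamifiedDatum c u q) (hh : IsHermitianSpace h)
    (hν : IsTranslationInvariant ν (ambient L))
    (hL : IsIntegralLattice u h L) (hb : IsLatticeBasis b L) (hnd : NondegenerateOn h L)
    (hm : Odd m) (hno : ∀ z ∈ dual u h L, u • z ∈ L → ‖h z z‖ ≤ 1 → z ∈ L) :
    ν {y | y ∈ dual u h L ∧ ‖h y y‖ ≤ ‖(u : E)‖ ^ (-2 : ℤ)}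
      = q * ν {y | y ∈ dual u h L ∧ ‖h y y‖ ≤ 1} := by
  obtain ⟨a, ha⟩ := hD.exists_pow_smul_dual hb hnd
  have hu : ∀ y ∈ dual u h L, u • y ∈ L := fun y hy =>
    hD.smul_mem_of_forall_isotropic hh hno a y hy (by simpa [integer_smul_def] using ha y hy)
  have hcorank : corank u h b = 1 := by
    have h1 := hD.corank_le_two hh hL hb hno
    have h2 := hD.even_add_corank hh hL hb
    obtain ⟨i, hi⟩ := hm
    obtain ⟨j, hj⟩ := h2
    omega
  have hA : {y | y ∈ dual u h L ∧ ‖h y y‖ ≤ 1} = (L : Set V) := by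
    ext y
    refine ⟨fun hy => hno y hy.1 (hu y hy.1) hy.2, fun hy => ⟨hL hy, ?_⟩⟩
    exact hD.symm_norm_le_one (self_symm hh _) (hD.isIntegralLattice_iff.mp hL y hy y hy)
  have hX : {y | y ∈ dual u h L ∧ ‖h y y‖ ≤ ‖(u : E)‖ ^ (-2 : ℤ)} = (dual u h L : Set V) := by
    ext y
    exact ⟨fun hy => hy.1, fun hy => ⟨hy, hD.norm_eq_of_mem_dual hy (hu y hy)⟩⟩
  have hcard : Nat.card (dual u h L ⧸ L.submoduleOf (dual u h L)) = q := by
    have h1 := hD.card_dual_torsion hh hL hb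
    rw [hcorank, pow_one] at h1
    rw [← h1]
    refine Nat.card_congr (Equiv.subtypeUnivEquiv fun x => ?_).symm
    obtain ⟨y, rfl⟩ := Submodule.Quotient.mk_surjective _ x
    rw [← Submodule.Quotient.mk_smul, Submodule.Quotient.mk_eq_zero]
    exact hu y y.2
  have hfin : Finite (dual u h L ⧸ L.submoduleOf (dual u h L)) :=
    Nat.finite_of_card_ne_zero (by rw [hcard]; exact (zero_lt_one.trans hD.one_lt_q).ne')
  have hmeas : MeasurableSet (L : Set V) := (hD.isClosed_lattice hb.fg).measurableSet
  rw [hA, hX, ← hcard]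
  refine measure_eq_card_mul (fun x => ((x.out : dual u h L) : V)) hmeas
    (fun x => hν _ x.out.2.1 _ hmeas) (fun y => ?_) fun y i j hi hj => ?_
  · constructor
    · intro hy
      refine ⟨Submodule.Quotient.mk ⟨y, hy⟩, ?_⟩
      have h1 : (Submodule.Quotient.mk (p := L.submoduleOf (dual u h L)) ⟨y, hy⟩)
          = Submodule.Quotient.mk (Quotient.out (Submodule.Quotient.mk
            (p := L.submoduleOf (dual u h L)) ⟨y, hy⟩)) := (Quotient.out_eq _).symm
      have h2 := (Submodule.Quotient.eq _).mp h1
      exact h2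
    · rintro ⟨x, hx⟩
      have := add_mem (hL hx) x.out.2
      simpa using this
  · rw [← Quotient.out_eq i, ← Quotient.out_eq j]
    refine (Submodule.Quotient.eq _).mpr ?_
    have h2 := sub_mem hj hi
    rw [sub_sub_sub_cancel_left] at h2
    exact h2

/-- In odd rank, the form is isotropic on a `q`-th of the vectors in the dual lattice at which its
values are as small as possible. -/
theorem measure_dual_self_le (hD : RamifiedDatum c u q) (hh : IsHermitianSpace h) (hm : Odd m) :
    ∀ (N : ℕ) (L : Submodule (Valued.integer E) V) (b : Fin m → V),
      IsTranslationInvariant ν (ambient L) → IsIntegralLattice u h L → IsLatticeBasis b L →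
      NondegenerateOn h L → {L' | L ≤ L' ∧ L' ≤ dual u h L}.ncard ≤ N →
      ν {y | y ∈ dual u h L ∧ ‖h y y‖ ≤ ‖(u : E)‖ ^ (-2 : ℤ)}
        = q * ν {y | y ∈ dual u h L ∧ ‖h y y‖ ≤ 1} := by
  intro N
  induction N with
  | zero =>
    intro L b hν hL hb hnd hN
    obtain ⟨a, ha⟩ := hD.exists_pow_smul_dual hb hnd
    have hfin := hD.finite_between (hD.fg_dual hb hnd) ha
    rw [Nat.le_zero, Set.ncard_eq_zero hfin] at hN
    exact absurd hN (Set.Nonempty.ne_empty ⟨L, le_rfl, hL⟩)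
  | succ N ih =>
    intro L b hν hL hb hnd hN
    -- If some `z` of integral norm can be adjoined, split according to `‖(y, z)‖ ≤ ‖u‖⁻¹`. That
    -- part of the dual is the dual of `L + ⟨z⟩`, covered by induction, and the rest is
    -- `measure_translates`.
    by_cases hno : ∀ z ∈ dual u h L, u • z ∈ L → ‖h z z‖ ≤ 1 → z ∈ L
    · exact hD.measure_dual_of_forall_isotropic hh hν hL hb hnd hm hno
    push Not at hno
    obtain ⟨z, hzL, huz, hzz, hzn⟩ := hno
    have hamb := ambient_sup_span hzL.1
    have hL1 := hD.isIntegralLattice_sup_span hh hL (hD.mem_dual.mp hzL).2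
      (hzz.trans hD.one_lt_inv_norm.le)
    have hfg : (L ⊔ Submodule.span (Valued.integer E) {z}).FG :=
      hb.fg.sup (Submodule.fg_span_singleton z)
    obtain ⟨b₁, hb₁⟩ := hD.exists_isLatticeBasis hfg (by rw [hamb, hb.finrank_ambient])
    have hle : dual u h (L ⊔ Submodule.span (Valued.integer E) {z}) ≤ dual u h L := fun y hy =>
      ((hD.mem_dual_sup_span hzL.1).mp hy).1
    obtain ⟨a, ha⟩ := hD.exists_pow_smul_dual hb hnd
    have hfin := hD.finite_between (hD.fg_dual hb hnd) ha
    have hih := ih _ b₁ (by rwa [hamb]) hL1 hb₁ (by rwa [NondegenerateOn, hamb]) (by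
      -- Fewer lattices lie between `L + ⟨z⟩` and its dual: at least `L` itself is lost.
      refine Nat.le_of_lt_succ (lt_of_lt_of_le (Set.ncard_lt_ncard ?_ hfin) hN)
      refine ⟨fun L' hL' => ⟨le_sup_left.trans hL'.1, hL'.2.trans hle⟩, fun H => ?_⟩
      exact hzn ((H ⟨le_rfl, hL⟩).1 (Submodule.mem_sup_right
        (Submodule.mem_span_singleton_self z))))
    have hinter : ∀ C : ℝ, {y | y ∈ dual u h L ∧ ‖h y y‖ ≤ C} ∩ {y | ‖h y z‖ ≤ ‖(u : E)‖⁻¹}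
        = {y | y ∈ dual u h (L ⊔ Submodule.span (Valued.integer E) {z}) ∧ ‖h y y‖ ≤ C} := by
      intro C
      ext y
      simp only [Set.mem_inter_iff, Set.mem_ofPred_eq, hD.mem_dual_sup_span hzL.1]
      tauto
    rw [← measure_inter_add_sdiff _ (hD.measurableSet_pairing_le z ‖(u : E)‖⁻¹),
      ← measure_inter_add_sdiff {y | y ∈ dual u h L ∧ ‖h y y‖ ≤ 1}
        (hD.measurableSet_pairing_le z ‖(u : E)‖⁻¹), hinter, hinter,
      hD.measure_translates hh hν hzL huz hzz, hih, mul_add]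

/-- Coset representatives of `u • L` in `L`. -/
theorem measure_eq_pow_mul_of_smul (hD : RamifiedDatum c u q) (hb : IsLatticeBasis b L)
    (hν : IsTranslationInvariant ν (ambient L)) :
    ν L = (q : ENNReal) ^ m * ν {y | (u : E)⁻¹ • y ∈ L} := by
  have := hD.finite_residueField
  have hmeas : MeasurableSet {y : V | (u : E)⁻¹ • y ∈ L} :=
    ((hD.isClosed_lattice hb.fg).preimage (continuous_const_smul _)).measurableSet
  have hcard : (q : ENNReal) ^ m
      = (Nat.card (Fin m → IsLocalRing.ResidueField (Valued.integer E)) : ENNReal) := by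
    rw [Nat.card_fun, Nat.card_fin, hD.card_residue]
    push_cast
    rfl
  rw [hcard]
  refine measure_eq_card_mul (fun κ => ∑ i, residueLift (κ i) • b i) hmeas (fun κ => ?_)
    (fun y => ?_) fun y i j hi hj => ?_
  · exact hν _ (mem_ambient (hb.mem_iff.mpr ⟨_, rfl⟩)) _ hmeas
  · constructor
    · intro hy
      obtain ⟨a, rfl⟩ := hb.mem_iff.mp hy
      refine ⟨fun i => IsLocalRing.residue _ (a i), ?_⟩
      rw [Set.mem_ofPred_eq, smul_sub, hD.sub_mem_iff_residue hb]
      simp only [residue_residueLift]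
    · rintro ⟨κ, hκ⟩
      have h1 := L.smul_mem u hκ
      rw [integer_smul_def, smul_smul, mul_inv_cancel₀ hD.coe_ne_zero, one_smul] at h1
      have h2 := add_mem h1 (hb.mem_iff.mpr ⟨fun i => residueLift (κ i), rfl⟩)
      simpa using h2
  · have h1 : (u : E)⁻¹ • (y - ∑ l, residueLift (j l) • b l)
        - (u : E)⁻¹ • (y - ∑ l, residueLift (i l) • b l) ∈ L := sub_mem hj hi
    rw [smul_sub, smul_sub, sub_sub_sub_cancel_left, hD.sub_mem_iff_residue hb] at h1
    simpa only [residue_residueLift] using h1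

/-- Scaling a union of cosets of `L`. -/
theorem measure_eq_pow_mul_of_invariant (hD : RamifiedDatum c u q) (hb : IsLatticeBasis b L)
    (hν : IsTranslationInvariant ν (ambient L)) (hnd : NondegenerateOn h L) {X : Set V}
    (hX : X ⊆ dual u h L) (hXL : ∀ y ∈ X, ∀ l ∈ L, y + l ∈ X) :
    ν X = (q : ENNReal) ^ m * ν {y | (u : E)⁻¹ • y ∈ X} := by
  obtain ⟨a, ha⟩ := hD.exists_pow_smul_dual hb hnd
  obtain ⟨b', hb'⟩ := hD.exists_isLatticeBasis (hD.fg_dual hb hnd) rfl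
  have hfin : Finite (dual u h L ⧸ L.submoduleOf (dual u h L)) :=
    hD.finite_quotient hb' (a := a) ha
  -- The set is a finite union of cosets of `L`, so the claim reduces to rescaling `L` itself.
  let ι := {x : dual u h L ⧸ L.submoduleOf (dual u h L) // ((x.out : dual u h L) : V) ∈ X}
  have hout : ∀ y (hy : y ∈ dual u h L), y - ((Quotient.out (Submodule.Quotient.mk
      (p := L.submoduleOf (dual u h L)) ⟨y, hy⟩) : dual u h L) : V) ∈ L := fun y hy => by
    have h1 : (Submodule.Quotient.mk (p := L.submoduleOf (dual u h L)) ⟨y, hy⟩)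
        = Submodule.Quotient.mk (Quotient.out (Submodule.Quotient.mk
          (p := L.submoduleOf (dual u h L)) ⟨y, hy⟩)) := (Quotient.out_eq _).symm
    have h2 := (Submodule.Quotient.eq _).mp h1
    exact h2
  have huniq : ∀ i j : ι, ((i.1.out : dual u h L) : V) - ((j.1.out : dual u h L) : V) ∈ L →
      i = j := fun i j hij => by
    refine Subtype.ext ?_
    rw [← Quotient.out_eq i.1, ← Quotient.out_eq j.1]
    exact (Submodule.Quotient.eq _).mpr hij
  have hex : ∀ y, y ∈ X ↔ ∃ i : ι, y - ((i.1.out : dual u h L) : V) ∈ L := fun y => by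
    constructor
    · intro hy
      refine ⟨⟨Submodule.Quotient.mk ⟨y, hX hy⟩, ?_⟩, hout y (hX hy)⟩
      have := hXL y hy _ (neg_mem (hout y (hX hy)))
      simpa using this
    · rintro ⟨i, hi⟩
      have := hXL _ i.2 _ hi
      simpa using this
  have hmeas : MeasurableSet (L : Set V) := (hD.isClosed_lattice hb.fg).measurableSet
  have hmeas' : MeasurableSet {y : V | (u : E)⁻¹ • y ∈ L} :=
    ((hD.isClosed_lattice hb.fg).preimage (continuous_const_smul _)).measurableSet
  have h1 : ν X = Nat.card ι * ν L := by
    refine measure_eq_card_mul (fun i : ι => ((i.1.out : dual u h L) : V)) hmeas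
      (fun i => hν _ i.1.out.2.1 _ hmeas) hex fun y i j hi hj => huniq i j ?_
    have h2 := sub_mem hj hi
    rwa [sub_sub_sub_cancel_left] at h2
  have h2 : ν {y | (u : E)⁻¹ • y ∈ X} = Nat.card ι * ν {y | (u : E)⁻¹ • y ∈ L} := by
    have h3 : ∀ (i : ι) (y : V), y - (u : E) • ((i.1.out : dual u h L) : V)
        ∈ {y : V | (u : E)⁻¹ • y ∈ L} ↔ (u : E)⁻¹ • y - ((i.1.out : dual u h L) : V) ∈ L := by
      intro i y
      rw [Set.mem_ofPred_eq, smul_sub, smul_smul, inv_mul_cancel₀ hD.coe_ne_zero, one_smul]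
    refine measure_eq_card_mul (fun i : ι => (u : E) • ((i.1.out : dual u h L) : V)) hmeas'
      (fun i => hν _ (Submodule.smul_mem _ _ i.1.out.2.1) _ hmeas') (fun y => ?_)
      fun y i j hi hj => huniq i j ?_
    · rw [Set.mem_ofPred_eq, hex]
      exact exists_congr fun i => (h3 i y).symm
    · have h4 := sub_mem ((h3 j y).mp hj) ((h3 i y).mp hi)
      rwa [sub_sub_sub_cancel_left] at h4
  rw [h1, h2, hD.measure_eq_pow_mul_of_smul hb hν, mul_left_comm]

/-- Near-dual vectors of integral norm are translates, by vectors of `L`, of those pairing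
integrally with `L`. Two translating vectors give the same set exactly when they agree modulo the
radical, so there are `q ^ (m - corank)` disjoint translates. -/
theorem measure_nearDual (hD : RamifiedDatum c u q) (hh : IsHermitianSpace h)
    (hν : IsTranslationInvariant ν (ambient L))
    (hL : IsIntegralLattice u h L) (hb : IsLatticeBasis b L) :
    (q : ENNReal) ^ corank u h b * ν {y | y ∈ ambient L ∧ y ∈ nearDual h L ∧ ‖h y y‖ ≤ 1}
      = (q : ENNReal) ^ m * ν {y | y ∈ ambient L ∧ (∀ v ∈ L, ‖h y v‖ ≤ 1) ∧ ‖h y y‖ ≤ 1} := by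
  have := hD.finite_residueField
  let K := matrixKer (residueGram u h b)
  let x : ((Fin m → IsLocalRing.ResidueField (Valued.integer E)) ⧸ K) → V := fun κ =>
    ∑ i, residueLift (κ.out i) • b i
  have hxL : ∀ κ, x κ ∈ L := fun κ => hb.mem_iff.mpr ⟨_, rfl⟩
  have hcard : (q : ENNReal) ^ m = (q : ENNReal) ^ corank u h b
      * (Nat.card ((Fin m → IsLocalRing.ResidueField (Valued.integer E)) ⧸ K) : ENNReal) := by
    have h1 := Submodule.card_eq_card_quotient_mul_card K
    rw [hD.card_matrixKer, Nat.card_fun, Nat.card_fin, hD.card_residue] at h1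
    rw [← Nat.cast_pow, h1]
    push_cast
    rw [mul_comm]
  have hmeas : MeasurableSet
      {y | y ∈ ambient L ∧ (∀ v ∈ L, ‖h y v‖ ≤ 1) ∧ ‖h y y‖ ≤ 1} := by
    have := hD.properSpace
    refine (Submodule.closed_of_finiteDimensional (ambient L)).measurableSet.inter
      (MeasurableSet.inter ?_ (hD.measurableSet_self_le hh 1))
    have h1 : {y : V | ∀ v ∈ L, ‖h y v‖ ≤ 1} = ⋂ i, {y | ‖h y (b i)‖ ≤ 1} := by
      ext y
      simp only [Set.mem_iInter, Set.mem_ofPred_eq, hD.forall_mem_norm_le_iff hb zero_le_one]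
    have h2 := MeasurableSet.iInter fun i => hD.measurableSet_pairing_le (h := h) (b i) 1
    rw [← h1] at h2
    exact h2
  have hself : ∀ y : V, ∀ l ∈ L, (∀ v ∈ L, ‖h y v‖ ≤ 1) → ‖h y y‖ ≤ 1 →
      ‖h (y + l) (y + l)‖ ≤ 1 := by
    intro y l hl hy hyy
    rw [pairing_add_self]
    refine norm_add_le_of_le (norm_add_le_of_le (norm_add_le_of_le hyy (hy l hl)) ?_) ?_
    · rw [hD.norm_pairing_comm hh]
      exact hy l hl
    · exact hD.symm_norm_le_one (self_symm hh _) (hD.isIntegralLattice_iff.mp hL l hl l hl)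
  have hker : ∀ a a' : Fin m → Valued.integer E,
      (∀ v ∈ L, ‖h (∑ i, a i • b i - ∑ i, a' i • b i) v‖ ≤ 1) ↔
      (fun i => IsLocalRing.residue _ (a i)) - (fun i => IsLocalRing.residue _ (a' i)) ∈ K := by
    intro a a'
    have h1 := hD.mem_matrixKer_iff hh hL hb (fun i => a i - a' i)
    simp only [map_sub, sub_smul, Finset.sum_sub_distrib] at h1
    simp only [map_sub]
    exact h1.symm
  have hfin : Finite ((Fin m → IsLocalRing.ResidueField (Valued.integer E)) ⧸ K) :=
    Finite.of_surjective _ (Submodule.Quotient.mk_surjective K)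
  have key : ν {y | y ∈ ambient L ∧ y ∈ nearDual h L ∧ ‖h y y‖ ≤ 1}
      = Nat.card ((Fin m → IsLocalRing.ResidueField (Valued.integer E)) ⧸ K)
        * ν {y | y ∈ ambient L ∧ (∀ v ∈ L, ‖h y v‖ ≤ 1) ∧ ‖h y y‖ ≤ 1} := by
    refine measure_eq_card_mul x hmeas (fun κ => hν _ (mem_ambient (hxL κ)) _ hmeas)
      (fun y => ?_) fun y i j hi hj => ?_
    · constructor
      · rintro ⟨hy, ⟨l, hl, hyl⟩, hyy⟩
        obtain ⟨a, rfl⟩ := hb.mem_iff.mp hl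
        set κ : (Fin m → IsLocalRing.ResidueField (Valued.integer E)) ⧸ K :=
          Submodule.Quotient.mk fun i => IsLocalRing.residue _ (a i) with hκ
        have h1 : (Submodule.Quotient.mk (p := K) fun i => IsLocalRing.residue _ (a i))
            = Submodule.Quotient.mk κ.out := (Quotient.out_eq _).symm
        rw [Submodule.Quotient.eq] at h1
        have h2 := (hker a fun i => residueLift (κ.out i)).mpr (by
          simp only [residue_residueLift]
          exact h1)
        have h3 : ∀ v ∈ L, ‖h (y - x κ) v‖ ≤ 1 := fun v hv => by
          have h4 : y - x κ = (y - ∑ i, a i • b i) + (∑ i, a i • b i - x κ) := by abel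
          rw [h4, map_add, LinearMap.add_apply]
          exact norm_add_le_of_le (hyl v hv) (h2 v hv)
        refine ⟨κ, sub_mem hy (mem_ambient (hxL κ)), h3, ?_⟩
        have h5 : h (y - x κ) (y - x κ) = h y y - h (x κ) (x κ) - h (y - x κ) (x κ)
            - h (x κ) (y - x κ) := by
          simp only [map_sub, LinearMap.sub_apply]
          ring
        rw [h5]
        refine norm_sub_le_of_le' (norm_sub_le_of_le' (norm_sub_le_of_le' hyy ?_)
          (h3 _ (hxL κ))) ?_
        · exact hD.symm_norm_le_one (self_symm hh _)
            (hD.isIntegralLattice_iff.mp hL _ (hxL κ) _ (hxL κ))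
        · rw [hD.norm_pairing_comm hh]
          exact h3 _ (hxL κ)
      · rintro ⟨κ, hy, hyv, hyy⟩
        have h1 := add_mem hy (mem_ambient (hxL κ))
        have h2 := hself _ _ (hxL κ) hyv hyy
        rw [sub_add_cancel] at h1 h2
        exact ⟨h1, ⟨x κ, hxL κ, hyv⟩, h2⟩
    · have h1 : ∀ v ∈ L, ‖h (x i - x j) v‖ ≤ 1 := fun v hv => by
        have h2 := norm_sub_le_of_le' (hj.2.1 v hv) (hi.2.1 v hv)
        have h3 : h (x i - x j) v = h (y - x j) v - h (y - x i) v := by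
          simp only [map_sub, LinearMap.sub_apply]
          ring
        rwa [h3]
      have h2 := (hker _ _).mp h1
      simp only [residue_residueLift] at h2
      rw [← Quotient.out_eq i, ← Quotient.out_eq j]
      exact (Submodule.Quotient.eq _).mpr h2
  rw [key, hcard, mul_assoc]

/-- The measure of the isotropic vectors in the dual lattice, in odd rank. -/
theorem measure_isotropic_dual (hD : RamifiedDatum c u q) (hh : IsHermitianSpace h)
    (hν : IsTranslationInvariant ν (ambient L))
    (hL : IsIntegralLattice u h L) (hb : IsLatticeBasis b L) (hnd : NondegenerateOn h L)
    (hm : Odd m) :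
    ν {y | y ∈ dual u h L ∧ ‖h y y‖ ≤ 1} = (q : ENNReal) ^ (corank u h b - 1)
      * ν {y | y ∈ ambient L ∧ y ∈ nearDual h L ∧ ‖h y y‖ ≤ 1} := by
  have h1 := hD.measure_dual_self_le hh hm _ L b hν hL hb hnd le_rfl
  have h2 := hD.measure_nearDual hh hν hL hb
  have h3 := hD.measure_eq_pow_mul_of_invariant hb hν hnd
    (X := {y | y ∈ dual u h L ∧ ‖h y y‖ ≤ ‖(u : E)‖ ^ (-2 : ℤ)}) (fun y hy => hy.1) (by
      rintro y ⟨hy, hyy⟩ l hl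
      refine ⟨add_mem hy (hL hl), ?_⟩
      have h1 := hD.one_le_zpow_neg_two
      have h4 : ‖(u : E)‖⁻¹ ≤ ‖(u : E)‖ ^ (-2 : ℤ) := by
        rw [← hD.inv_norm_mul_self]
        exact le_mul_of_one_le_left (inv_nonneg.mpr hD.norm_pos.le) hD.one_lt_inv_norm.le
      rw [pairing_add_self]
      refine norm_add_le_of_le (norm_add_le_of_le (norm_add_le_of_le hyy ?_) ?_) ?_
      · exact ((hD.mem_dual.mp hy).2 l hl).trans h4
      · rw [hD.norm_pairing_comm hh]
        exact ((hD.mem_dual.mp hy).2 l hl).trans h4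
      · exact (hD.isIntegralLattice_iff.mp hL l hl l hl).trans h4)
  -- Multiplying by `u` turns the dual condition into integral pairing with `L`, and the bound `‖u‖
  -- ^ (-2)` on the norm into integrality.
  have h4 : {y : V | (u : E)⁻¹ • y ∈ {y | y ∈ dual u h L ∧ ‖h y y‖ ≤ ‖(u : E)‖ ^ (-2 : ℤ)}}
      = {y | y ∈ ambient L ∧ (∀ v ∈ L, ‖h y v‖ ≤ 1) ∧ ‖h y y‖ ≤ 1} := by
    ext y
    have hp := inv_pos.mpr hD.norm_pos
    have h5 : (u : E)⁻¹ • y ∈ ambient L ↔ y ∈ ambient L :=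
      Submodule.smul_mem_iff _ (inv_ne_zero hD.coe_ne_zero)
    simp only [Set.mem_ofPred_eq, hD.mem_dual, h5, and_assoc, pairing_smul_left,
      pairing_smul_right, norm_mul, hD.norm_conj, norm_inv]
    refine and_congr_right fun _ => and_congr (forall₂_congr fun v _ => ?_) ?_
    · exact ⟨fun H => le_of_mul_le_mul_left (by rwa [mul_one]) hp,
        fun H => mul_le_of_le_one_right hp.le H⟩
    · rw [← mul_assoc, hD.inv_norm_mul_self]
      have hp2 := zero_lt_one.trans hD.one_le_zpow_neg_two
      exact ⟨fun H => le_of_mul_le_mul_left (by rwa [mul_one]) hp2,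
        fun H => mul_le_of_le_one_right hp2.le H⟩
  rw [h4, ← h2, h1] at h3
  -- Positivity comes from oddness of the rank; it makes the truncated subtraction in the exponent
  -- genuine.
  have h5 : 1 ≤ corank u h b := by
    have h2 := hD.even_add_corank hh hL hb
    obtain ⟨i, hi⟩ := hm
    obtain ⟨j, hj⟩ := h2
    omega
  have hq : (q : ENNReal) ≠ 0 := Nat.cast_ne_zero.mpr (zero_lt_one.trans hD.one_lt_q).ne'
  rw [← ENNReal.mul_right_inj hq (ENNReal.natCast_ne_top q), h3, ← mul_assoc, ← pow_succ',
    Nat.sub_add_cancel h5]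

end RamifiedDatum

end IsotropicMeasure

/-! ### Integral lattices with prescribed intersection with a hyperplane. -/

section FiberLattices

variable {F : Type*} [NontriviallyNormedField F]
variable {E : Type*} [NontriviallyNormedField E] [IsUltrametricDist E] [NormedAlgebra F E]
variable {c : E ≃ₐ[F] E} {u : Valued.integer E} {q : ℕ}
variable {V : Type*} [AddCommGroup V] [Module E V] {h : Pairing c V}
variable {L K : Submodule (Valued.integer E) V} {m : ℕ} {b : Fin m → V} {Y : V}

/-- An integral lattice of odd rank `m` in a nondegenerate hyperplane. -/
structure IsIntegralHyperlattice (u : Valued.integer E) (h : Pairing c V) (m : ℕ)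
    (K : Submodule (Valued.integer E) V) : Prop where
  fg : K.FG
  integral : IsIntegralLattice u h K
  finrank_ambient : Module.finrank E (ambient K) = m
  nondegenerate : NondegenerateOn h K
  odd : Odd m
  finrank_space : Module.finrank E V = m + 1

/-- The integral lattices that meet the hyperplane spanned by `K` in `K`. -/
def fiberLattices (u : Valued.integer E) (h : Pairing c V)
    (K : Submodule (Valued.integer E) V) : Set (Submodule (Valued.integer E) V) :=
  {L | L.FG ∧ ambient L = ⊤ ∧ IsIntegralLattice u h L ∧
    L ⊓ (ambient K).restrictScalars (Valued.integer E) = K}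

theorem le_of_mem_fiberLattices (hL : L ∈ fiberLattices u h K) : K ≤ L := by
  rw [← hL.2.2.2]
  exact inf_le_left

theorem mem_of_mem_fiberLattices (hL : L ∈ fiberLattices u h K) {x : V} (hx : x ∈ L)
    (hxK : x ∈ ambient K) : x ∈ K := by
  rw [← hL.2.2.2]
  exact ⟨hx, hxK⟩

theorem mem_sup_span_iff {x : V} : x ∈ K ⊔ Submodule.span (Valued.integer E) {Y} ↔
    ∃ l ∈ K, ∃ a : Valued.integer E, l + (a : E) • Y = x := by
  simp only [Submodule.mem_sup, Submodule.mem_span_singleton]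
  constructor
  · rintro ⟨l, hl, _, ⟨a, rfl⟩, hx⟩
    exact ⟨l, hl, a, hx⟩
  · rintro ⟨l, hl, a, hx⟩
    exact ⟨l, hl, _, ⟨a, rfl⟩, hx⟩

theorem mem_sup_span_self : Y ∈ K ⊔ Submodule.span (Valued.integer E) {Y} :=
  Submodule.mem_sup_right (Submodule.mem_span_singleton_self Y)

theorem IsLatticeBasis.ambient_eq_top (hb : IsLatticeBasis b L) (hV : Module.finrank E V = m)
    [FiniteDimensional E V] : ambient L = ⊤ :=
  Submodule.eq_top_of_finrank_eq (by rw [hb.finrank_ambient, hV])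

theorem IsLatticeBasis.cons (hb : IsLatticeBasis b K) (hY : Y ∉ ambient K) :
    IsLatticeBasis (Fin.cons Y b : Fin (m + 1) → V)
      (K ⊔ Submodule.span (Valued.integer E) {Y}) where
  li := linearIndependent_finCons.mpr ⟨hb.li, by rwa [hb.span_eq_ambient]⟩
  span_eq := by
    rw [Fin.range_cons, Submodule.span_insert, hb.span_eq, sup_comm]

namespace RamifiedDatum

theorem exists_pow_smul_mem_of_mem_ambient (hD : RamifiedDatum c u q) {x : V}
    (hx : x ∈ ambient L) : ∃ a : ℕ, (u : E) ^ a • x ∈ L := by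
  induction hx using Submodule.span_induction with
  | mem x hx => exact ⟨0, by simpa using hx⟩
  | zero => exact ⟨0, by simp⟩
  | add x y _ _ hx hy =>
    obtain ⟨a, ha⟩ := hx
    obtain ⟨a', ha'⟩ := hy
    refine ⟨a + a', ?_⟩
    rw [smul_add]
    refine add_mem ?_ ?_
    · rw [add_comm, pow_add, mul_smul]
      exact L.smul_mem (u ^ a') ha
    · rw [pow_add, mul_smul]
      exact L.smul_mem (u ^ a) ha'
  | smul e x _ hx =>
    obtain ⟨a, ha⟩ := hx
    obtain ⟨a', ha'⟩ := hD.exists_pow_mul_le_one ‖e‖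
    have h1 : ‖(u : E) ^ a' * e‖ ≤ 1 := by rwa [norm_mul, norm_pow]
    refine ⟨a' + a, ?_⟩
    have h2 : (u : E) ^ (a' + a) • e • x = ((u : E) ^ a' * e) • (u : E) ^ a • x := by
      rw [smul_smul, smul_smul]
      ring_nf
    rw [h2, ← coe_toInteger h1]
    exact L.smul_mem _ ha

theorem exists_pow_smul_le (hD : RamifiedDatum c u q) (hK : K.FG) (hL : ambient L = ⊤) :
    ∃ a : ℕ, ∀ x ∈ K, (u : E) ^ a • x ∈ L := by
  obtain ⟨b, hb⟩ := hD.exists_isLatticeBasis hK rfl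
  have h1 : ∀ i, ∃ a : ℕ, (u : E) ^ a • b i ∈ L := fun i =>
    hD.exists_pow_smul_mem_of_mem_ambient (by rw [hL]; trivial)
  choose a ha using h1
  refine ⟨∑ i, a i, fun x hx => ?_⟩
  obtain ⟨w, rfl⟩ := hb.mem_iff.mp hx
  rw [Finset.smul_sum]
  refine Submodule.sum_mem _ fun i hi => ?_
  rw [smul_comm]
  refine L.smul_mem _ ?_
  have h2 : ∑ j, a j = (∑ j, a j - a i) + a i :=
    (Nat.sub_add_cancel (Finset.single_le_sum (fun _ _ => Nat.zero_le _) hi)).symm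
  rw [h2, pow_add, mul_smul]
  exact L.smul_mem (u ^ _) (ha i)

variable [FiniteDimensional E V]

/-- A normal vector of a nondegenerate hyperplane. -/
theorem exists_normal (hD : RamifiedDatum c u q) (hh : IsHermitianSpace h)
    (hK : IsIntegralHyperlattice u h m K) :
    ∃ e : V, (∀ x, h x e = 0 ↔ x ∈ ambient K) ∧ h e e ≠ 0 := by
  obtain ⟨b, hb⟩ := hD.exists_isLatticeBasis hK.fg hK.finrank_ambient
  let T : V →ₗ[E] (Fin m → E) := LinearMap.pi fun i => h.flip (b i)
  have hker : LinearMap.ker T ≠ ⊥ := LinearMap.ker_ne_bot_of_finrank_lt (by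
    rw [Module.finrank_fin_fun, hK.finrank_space]
    exact Nat.lt_succ_self m)
  obtain ⟨e, heT, he0⟩ := Submodule.exists_mem_ne_zero_of_ne_bot hker
  have heb : ∀ i, h e (b i) = 0 := fun i => congrFun (LinearMap.mem_ker.mp heT) i
  have he : ∀ x ∈ ambient K, h e x = 0 := hb.forall_ambient_eq_zero heb
  have he' : ∀ x ∈ ambient K, h x e = 0 := fun x hx => by rw [hh.symm e x, he x hx, map_zero]
  have heK : e ∉ ambient K := fun heK => he0 (hK.nondegenerate e heK he)
  have htop := (hb.cons heK).ambient_eq_top hK.finrank_space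
  have hdec : ∀ x : V, ∃ w ∈ ambient K, ∃ a : E, w + a • e = x := by
    intro x
    have hx : x ∈ Submodule.span E (Set.range (Fin.cons e b : Fin (m + 1) → V)) := by
      rw [(hb.cons heK).span_eq_ambient, htop]
      trivial
    rw [Fin.range_cons, Submodule.mem_span_insert, hb.span_eq_ambient] at hx
    obtain ⟨a, w, hw, rfl⟩ := hx
    exact ⟨w, hw, a, add_comm _ _⟩
  have hee : h e e ≠ 0 := by
    intro hee
    refine he0 (hh.nondegenerate e fun x => ?_)
    obtain ⟨w, hw, a, rfl⟩ := hdec x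
    rw [map_add, he w hw, pairing_smul_right, hee]
    simp
  refine ⟨e, fun x => ⟨fun hx => ?_, he' x⟩, hee⟩
  obtain ⟨w, hw, a, rfl⟩ := hdec x
  rw [map_add, LinearMap.add_apply, he' w hw, pairing_smul_left, zero_add] at hx
  rw [(mul_eq_zero.mp hx).resolve_right hee, zero_smul, add_zero]
  exact hw

/-- Pairing with a normal vector `e` embeds `L / K` in `E`. A basis vector of `L` with the largest
value generates the image, and the kernel on `L` is `K`. -/
theorem exists_generator (hD : RamifiedDatum c u q) (hh : IsHermitianSpace h)
    (hK : IsIntegralHyperlattice u h m K) (hL : L ∈ fiberLattices u h K) :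
    ∃ Y, Y ∉ ambient K ∧ K ⊔ Submodule.span (Valued.integer E) {Y} = L := by
  obtain ⟨e, he, -⟩ := hD.exists_normal hh hK
  obtain ⟨b, hb⟩ := hD.exists_isLatticeBasis hL.1
    (by rw [hL.2.1, finrank_top, hK.finrank_space])
  obtain ⟨i, -, hi⟩ := Finset.exists_max_image Finset.univ (fun i => ‖h (b i) e‖)
    ⟨0, Finset.mem_univ _⟩
  have hi : ∀ x ∈ L, ‖h x e‖ ≤ ‖h (b i) e‖ := by
    intro x hx
    rw [hD.norm_pairing_comm hh]
    refine (hD.forall_mem_norm_le_iff hb (norm_nonneg _)).mpr (fun j => ?_) x hx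
    rw [hD.norm_pairing_comm hh]
    exact hi j (Finset.mem_univ _)
  have hne : h (b i) e ≠ 0 := by
    intro h0
    have h1 : (⊤ : Submodule E V) ≤ ambient K := by
      rw [← hL.2.1, ambient_le_iff]
      intro x hx
      rw [← he, ← norm_le_zero_iff]
      exact (hi x hx).trans (by rw [h0, norm_zero])
    have h2 := Submodule.finrank_mono h1
    rw [finrank_top, hK.finrank_space, hK.finrank_ambient] at h2
    omega
  refine ⟨b i, fun hb => hne ((he _).mpr hb), le_antisymm ?_ fun x hx => ?_⟩
  · refine sup_le (le_of_mem_fiberLattices hL) ?_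
    rw [Submodule.span_singleton_le_iff_mem]
    exact hb.mem i
  · have h1 : ‖h x e / h (b i) e‖ ≤ 1 := by
      rw [norm_div]
      exact div_le_one_of_le₀ (hi x hx) (norm_nonneg _)
    have h2 : x - (h x e / h (b i) e) • b i ∈ L := by
      rw [← coe_toInteger h1]
      exact sub_mem hx (L.smul_mem _ (hb.mem i))
    have h3 : x - (h x e / h (b i) e) • b i ∈ ambient K := by
      rw [← he, map_sub, LinearMap.sub_apply, pairing_smul_left, div_mul_cancel₀ _ hne, sub_self]
    refine mem_sup_span_iff.mpr ⟨_, mem_of_mem_fiberLattices hL h2 h3,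
      toInteger (h x e / h (b i) e), ?_⟩
    rw [coe_toInteger h1, sub_add_cancel]

theorem sup_span_inf_ambient (hY : Y ∉ ambient K) :
    (K ⊔ Submodule.span (Valued.integer E) {Y}) ⊓
      (ambient K).restrictScalars (Valued.integer E) = K := by
  refine le_antisymm ?_ (le_inf le_sup_left fun x hx => mem_ambient hx)
  rintro x ⟨hx, hxK⟩
  obtain ⟨l, hl, a, rfl⟩ := mem_sup_span_iff.mp hx
  have h1 : (a : E) • Y ∈ ambient K := by
    have := sub_mem hxK (mem_ambient hl)
    rwa [add_sub_cancel_left] at this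
  have h2 : (a : E) = 0 := by
    by_contra h0
    exact hY ((Submodule.smul_mem_iff _ h0).mp h1)
  rw [h2, zero_smul, add_zero]
  exact hl

theorem sup_span_mem_fiberLattices (hD : RamifiedDatum c u q) (hh : IsHermitianSpace h)
    (hK : IsIntegralHyperlattice u h m K) (hY : Y ∉ ambient K)
    (hYK : ∀ v ∈ K, ‖h Y v‖ ≤ ‖(u : E)‖⁻¹) (hYY : ‖h Y Y‖ ≤ 1) :
    K ⊔ Submodule.span (Valued.integer E) {Y} ∈ fiberLattices u h K := by
  obtain ⟨b, hb⟩ := hD.exists_isLatticeBasis hK.fg hK.finrank_ambient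
  exact ⟨hK.fg.sup (Submodule.fg_span_singleton Y), (hb.cons hY).ambient_eq_top hK.finrank_space,
    hD.isIntegralLattice_sup_span hh hK.integral hYK (hYY.trans hD.one_lt_inv_norm.le),
    sup_span_inf_ambient hY⟩

theorem norm_le_of_mem_fiberLattices (hD : RamifiedDatum c u q) (hh : IsHermitianSpace h)
    (hL : L ∈ fiberLattices u h K) {x : V} (hx : x ∈ L) :
    (∀ v ∈ K, ‖h x v‖ ≤ ‖(u : E)‖⁻¹) ∧ ‖h x x‖ ≤ 1 := by
  have h1 := hD.isIntegralLattice_iff.mp hL.2.2.1 x hx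
  exact ⟨fun v hv => h1 v (le_of_mem_fiberLattices hL hv),
    hD.symm_norm_le_one (self_symm hh x) (h1 x hx)⟩

/-- The generators of `K ⊔ ⟨Y⟩` over `K`. -/
theorem sup_span_eq_iff (hD : RamifiedDatum c u q) (hY : Y ∉ ambient K) {X : V} :
    K ⊔ Submodule.span (Valued.integer E) {X} = K ⊔ Submodule.span (Valued.integer E) {Y} ↔
      X ∈ K ⊔ Submodule.span (Valued.integer E) {Y} ∧
        X ∉ K ⊔ Submodule.span (Valued.integer E) {(u : E) • Y} := by
  constructor
  · intro H
    have hX := mem_sup_span_self (K := K) (Y := X)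
    rw [H] at hX
    refine ⟨hX, fun hX' => ?_⟩
    have hY' := mem_sup_span_self (K := K) (Y := Y)
    rw [← H] at hY'
    obtain ⟨l, hl, a, hla⟩ := mem_sup_span_iff.mp hY'
    obtain ⟨l', hl', a', hla'⟩ := mem_sup_span_iff.mp hX'
    have h1 : (1 - (a : E) * a' * u) • Y ∈ ambient K := by
      have h2 : (1 - (a : E) * a' * u) • Y = l + (a : E) • l' := by
        rw [sub_smul, one_smul]
        nth_rewrite 1 [← hla]
        rw [← hla', smul_add, smul_smul, smul_smul, mul_assoc]
        abel
      rw [h2]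
      exact add_mem (mem_ambient hl) (Submodule.smul_mem _ _ (mem_ambient hl'))
    have h3 : (1 - (a : E) * a' * u) ≠ 0 := by
      intro h0
      have h4 : ‖(a : E) * a' * u‖ < 1 := by
        rw [norm_mul, norm_mul]
        exact mul_lt_one_of_nonneg_of_lt_one_right (mul_le_one₀ (norm_coe_integer_le _)
          (norm_nonneg _) (norm_coe_integer_le _)) (norm_nonneg _) hD.norm_lt_one
      rw [← sub_eq_zero.mp h0, norm_one] at h4
      exact lt_irrefl _ h4
    exact hY ((Submodule.smul_mem_iff _ h3).mp h1)
  · rintro ⟨hX, hX'⟩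
    refine le_antisymm (sup_le le_sup_left ?_) (sup_le le_sup_left ?_)
    · rwa [Submodule.span_singleton_le_iff_mem]
    · rw [Submodule.span_singleton_le_iff_mem]
      obtain ⟨l, hl, a, rfl⟩ := mem_sup_span_iff.mp hX
      have ha : ‖(a : E)‖ = 1 := by
        refine le_antisymm (norm_coe_integer_le a) (not_lt.mp fun hlt => hX' ?_)
        obtain ⟨a', rfl⟩ := hD.dvd_iff.mpr hlt
        refine mem_sup_span_iff.mpr ⟨l, hl, a', ?_⟩
        rw [smul_smul, mul_comm (a' : E)]
        rfl
      have ha0 : (a : E) ≠ 0 := norm_pos_iff.mp (by rw [ha]; exact one_pos)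
      have h1 : ‖(a : E)⁻¹‖ ≤ 1 := by rw [norm_inv, ha, inv_one]
      refine mem_sup_span_iff.mpr ⟨-((toInteger (a : E)⁻¹ : Valued.integer E) • l),
        neg_mem (K.smul_mem _ hl), toInteger (a : E)⁻¹, ?_⟩
      rw [integer_smul_def, coe_toInteger h1, smul_add, smul_smul, inv_mul_cancel₀ ha0, one_smul]
      abel

theorem mem_dual_sup_span_iff (hD : RamifiedDatum c u q) {ξ : V}
    (htop : ambient (K ⊔ Submodule.span (Valued.integer E) {Y}) = ⊤) :
    ξ ∈ dual u h (K ⊔ Submodule.span (Valued.integer E) {Y}) ↔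
      (∀ v ∈ K, ‖h ξ v‖ ≤ ‖(u : E)‖⁻¹) ∧ ‖h ξ Y‖ ≤ ‖(u : E)‖⁻¹ := by
  rw [hD.mem_dual, htop]
  simp only [Submodule.mem_top, true_and]
  refine ⟨fun H => ⟨fun v hv => H v (Submodule.mem_sup_left hv), H _ mem_sup_span_self⟩,
    fun H v hv => ?_⟩
  obtain ⟨l, hl, a, rfl⟩ := mem_sup_span_iff.mp hv
  rw [map_add, pairing_smul_right]
  refine norm_add_le_of_le (H.1 l hl) ?_
  rw [norm_mul, hD.norm_conj]
  exact (mul_le_of_le_one_left (norm_nonneg _) (norm_coe_integer_le a)).trans H.2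

/-- The type of a lattice generated by one vector over a hyperlattice. -/
theorem latticeType_sup_span (hD : RamifiedDatum c u q) (hh : IsHermitianSpace h)
    (hK : IsIntegralHyperlattice u h m K) (hb : IsLatticeBasis b K) (hY : Y ∉ ambient K)
    (hL : K ⊔ Submodule.span (Valued.integer E) {Y} ∈ fiberLattices u h K) :
    (Y ∈ nearDual h K → latticeType u h (K ⊔ Submodule.span (Valued.integer E) {Y})
        = corank u h b + 1) ∧
      (Y ∉ nearDual h K → latticeType u h (K ⊔ Submodule.span (Valued.integer E) {Y}) + 1
        = corank u h b) := by
  have : NeZero (2 : IsLocalRing.ResidueField (Valued.integer E)) := ⟨hD.residue_two_ne_zero⟩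
  have hcons := hb.cons hY
  have hint := hL.2.2.1
  rw [hD.latticeType_eq hh hint hcons (hh.nondegenerateOn hL.2.1)]
  have halt := hD.isAlternating_residueGram hh hint hcons
  -- Subtracting a vector of `K` from `Y` to make the pairings integral means that the new Gram
  -- column lies in the range of the old matrix modulo `u`. The bordering lemmas then give the
  -- change of type.
  have hnear : Y ∈ nearDual h K ↔ ∃ d : Fin m → IsLocalRing.ResidueField (Valued.integer E),
      ∀ i : Fin m, ∑ j : Fin m,
        residueGram u h (Fin.cons Y b : Fin (m + 1) → V) i.succ j.succ * d j
          = residueGram u h (Fin.cons Y b : Fin (m + 1) → V) i.succ 0 := by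
    have key : ∀ a : Fin m → Valued.integer E,
        (∀ v ∈ K, ‖h (Y - ∑ j, a j • b j) v‖ ≤ 1) ↔ ∀ i : Fin m, ∑ j : Fin m,
        residueGram u h (Fin.cons Y b : Fin (m + 1) → V) i.succ j.succ
            * IsLocalRing.residue _ (a j)
          = residueGram u h (Fin.cons Y b : Fin (m + 1) → V) i.succ 0 := by
      intro a
      rw [hD.forall_mem_norm_le_iff hb zero_le_one]
      refine forall_congr' fun i => ?_
      have h1 : ∑ j : Fin m, residueGram u h (Fin.cons Y b : Fin (m + 1) → V) i.succ j.succ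
            * IsLocalRing.residue _ (a j)
          = IsLocalRing.residue _ (∑ j : Fin m,
            gram u h (Fin.cons Y b : Fin (m + 1) → V) i.succ j.succ * hD.conjInt (a j)) := by
        rw [map_sum]
        refine Finset.sum_congr rfl fun j _ => ?_
        rw [map_mul, hD.residue_conjInt]
        rfl
      rw [h1, residueGram, hD.residue_eq_iff]
      have h2 : ((∑ j : Fin m, gram u h (Fin.cons Y b : Fin (m + 1) → V) i.succ j.succ
            * hD.conjInt (a j) : Valued.integer E) : E)
          - (gram u h (Fin.cons Y b : Fin (m + 1) → V) i.succ 0 : E)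
          = -((u : E) * h (b i) (Y - ∑ j, a j • b j)) := by
        push_cast
        simp only [hD.coe_gram hint hcons, Fin.cons_succ, Fin.cons_zero, integer_smul_def]
        rw [map_sub, sesq_sum_right, mul_sub, Finset.mul_sum, neg_sub]
        congr 1
        refine Finset.sum_congr rfl fun j _ => ?_
        rw [hD.coe_conjInt]
        ring
      have hp := hD.norm_pos
      rw [h2, norm_neg, hD.norm_lt_one_iff, norm_mul, hD.norm_pairing_comm hh (b i)]
      exact ⟨fun H => mul_le_of_le_one_right hp.le H,
        fun H => le_of_mul_le_mul_left (by rwa [mul_one]) hp⟩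
    constructor
    · rintro ⟨l, hl, hYl⟩
      obtain ⟨a, rfl⟩ := hb.mem_iff.mp hl
      exact ⟨_, (key a).mp hYl⟩
    · rintro ⟨d, hd⟩
      refine ⟨_, hb.mem_iff.mpr ⟨fun j => residueLift (d j), rfl⟩, (key _).mpr ?_⟩
      simpa only [residue_residueLift] using hd
  rw [hnear]
  constructor
  · rintro ⟨d, hd⟩
    exact finrank_matrixKer_of_mem_range halt hd
  · intro hd
    exact finrank_matrixKer_of_not_mem_range halt hd

/-- A lattice that contains all the vectors that can occur in an integral lattice over `K`. -/
theorem exists_bounding_lattice (hD : RamifiedDatum c u q) (hh : IsHermitianSpace h)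
    (hK : IsIntegralHyperlattice u h m K) :
    ∃ D : Submodule (Valued.integer E) V, D.FG ∧ ambient D = ⊤ ∧ K ≤ D ∧
      ∀ x : V, (∀ v ∈ K, ‖h x v‖ ≤ ‖(u : E)‖⁻¹) → ‖h x x‖ ≤ 1 → x ∈ D := by
  obtain ⟨e, he, hee⟩ := hD.exists_normal hh hK
  obtain ⟨b, hb⟩ := hD.exists_isLatticeBasis hK.fg hK.finrank_ambient
  have heK : e ∉ ambient K := fun H => hee ((he e).mpr H)
  have hp := hD.norm_pos
  obtain ⟨a, ha⟩ := hD.exists_pow_smul_mem hb hK.nondegenerate ‖(u : E)‖⁻¹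
    (inv_nonneg.mpr (norm_nonneg _))
  let C : ℝ := max 1 (‖(u : E)‖⁻¹ ^ (2 * a + 1))
  obtain ⟨a', ha'⟩ := hD.exists_pow_mul_le_one (max 1 (C / ‖h e e‖))
  have hcons := hb.cons heK
  have hw : ((u : E) ^ (a + a'))⁻¹ ≠ 0 := inv_ne_zero (pow_ne_zero _ hD.coe_ne_zero)
  have hle : ∀ n : ℕ, ‖(u : E) ^ n‖ ≤ 1 := fun n => by
    rw [norm_pow]
    exact pow_le_one₀ hp.le hD.norm_lt_one.le
  refine ⟨_, (hcons.smul hw).fg, (hcons.smul hw).ambient_eq_top hK.finrank_space, ?_, ?_⟩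
  · intro x hx
    rw [hcons.mem_span_smul_iff hw, inv_inv, ← coe_toInteger (hle _)]
    exact Submodule.smul_mem _ _ (Submodule.mem_sup_left hx)
  intro x hxK hxx
  rw [hcons.mem_span_smul_iff hw, inv_inv]
  -- Decompose `x` along the hyperplane and its normal. The component `w` is bounded by its pairings
  -- with `K`; then `(x, x) - (w, w)` bounds the coefficient `α`.
  set α := h x e / h e e with hα
  set w := x - α • e with hwdef
  have hwK : w ∈ ambient K := by
    rw [← he, hwdef, map_sub, LinearMap.sub_apply, pairing_smul_left, hα,
      div_mul_cancel₀ _ hee, sub_self]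
  have hxw : x = w + α • e := by rw [hwdef, sub_add_cancel]
  have hev : ∀ v ∈ ambient K, h e v = 0 := fun v hv => by
    rw [hh.symm v e, (he v).mpr hv, map_zero]
  have hwv : ∀ v ∈ K, h w v = h x v := fun v hv => by
    rw [hwdef, map_sub, LinearMap.sub_apply, pairing_smul_left, hev v (mem_ambient hv), mul_zero,
      sub_zero]
  have hwa : (u : E) ^ a • w ∈ K := ha w hwK fun i => by
    rw [hwv _ (hb.mem i)]
    exact hxK _ (hb.mem i)
  have hww : ‖h w w‖ ≤ C := by
    have h1 := hD.isIntegralLattice_iff.mp hK.integral _ hwa _ hwa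
    rw [pairing_smul_left, pairing_smul_right, norm_mul, norm_mul, hD.norm_conj, norm_pow] at h1
    refine le_trans ?_ (le_max_right _ _)
    rw [inv_pow, ← one_div, le_div_iff₀ (by positivity)]
    calc ‖h w w‖ * ‖(u : E)‖ ^ (2 * a + 1)
        = ‖(u : E)‖ ^ a * (‖(u : E)‖ ^ a * ‖h w w‖) * ‖(u : E)‖ := by ring
      _ ≤ ‖(u : E)‖⁻¹ * ‖(u : E)‖ := by gcongr
      _ = 1 := inv_mul_cancel₀ hp.ne'
  have hαα : ‖α‖ * ‖α‖ * ‖h e e‖ ≤ C := by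
    have h1 : α * c α * h e e = h x x - h w w := by
      conv_rhs => rw [hxw]
      simp only [map_add, LinearMap.add_apply, pairing_smul_left, pairing_smul_right,
        hev w hwK, (he w).mpr hwK]
      ring
    have h2 : ‖α * c α * h e e‖ = ‖α‖ * ‖α‖ * ‖h e e‖ := by
      rw [norm_mul, norm_mul, hD.norm_conj]
    rw [← h2, h1]
    exact norm_sub_le_of_le' (hxx.trans (le_max_left _ _)) hww
  have hα1 : ‖α‖ ≤ max 1 (C / ‖h e e‖) := by
    rcases le_or_gt ‖α‖ 1 with h1 | h1
    · exact h1.trans (le_max_left _ _)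
    · refine le_trans ?_ (le_max_right _ _)
      rw [le_div_iff₀ (norm_pos_iff.mpr hee)]
      refine le_trans ?_ hαα
      gcongr
      exact le_mul_of_one_le_left (norm_nonneg _) h1.le
  have hα2 : ‖(u : E) ^ (a + a') * α‖ ≤ 1 := by
    rw [pow_add, mul_assoc, norm_mul]
    refine mul_le_one₀ (hle a) (norm_nonneg _) (le_trans ?_ ha')
    rw [norm_mul, norm_pow]
    gcongr
  refine mem_sup_span_iff.mpr ⟨(u : E) ^ (a + a') • w, ?_, toInteger ((u : E) ^ (a + a') * α), ?_⟩
  · rw [add_comm, pow_add, mul_smul, ← coe_toInteger (hle a')]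
    exact K.smul_mem _ hwa
  · rw [coe_toInteger hα2, mul_smul, ← smul_add, ← hxw]

/-- Every such lattice contains `u ^ a D` for some `a` and lies in `D`; for each `a` only finitely
many lattices do. -/
theorem countable_fiberLattices (hD : RamifiedDatum c u q) (hh : IsHermitianSpace h)
    (hK : IsIntegralHyperlattice u h m K) : (fiberLattices u h K).Countable := by
  obtain ⟨D, hDfg, hDtop, -, hDle⟩ := hD.exists_bounding_lattice hh hK
  obtain ⟨b, hb⟩ := hD.exists_isLatticeBasis hDfg rfl
  have hne : ∀ a : ℕ, (u : E) ^ a ≠ 0 := fun a => pow_ne_zero _ hD.coe_ne_zero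
  have h1 : fiberLattices u h K ⊆ ⋃ a : ℕ, {L | Submodule.span (Valued.integer E)
      (Set.range fun i => (u : E) ^ a • b i) ≤ L ∧ L ≤ D} := by
    intro L hL
    obtain ⟨a, ha⟩ := hD.exists_pow_smul_le hDfg hL.2.1
    refine Set.mem_iUnion.mpr ⟨a, ?_, fun x hx => ?_⟩
    · rw [Submodule.span_le]
      rintro _ ⟨i, rfl⟩
      exact ha _ (hb.mem i)
    · obtain ⟨h2, h3⟩ := hD.norm_le_of_mem_fiberLattices hh hL hx
      exact hDle x h2 h3
  refine (Set.countable_iUnion fun a => Set.Finite.countable ?_).mono h1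
  refine hD.finite_between hDfg (a := a) fun x hx => ?_
  rw [hb.mem_span_smul_iff (hne a), smul_smul, inv_mul_cancel₀ (hne a), one_smul]
  exact hx

end RamifiedDatum

end FiberLattices

/-! ### Projection along a vector of nonintegral norm. -/

section Orthogonal

variable {F : Type*} [NontriviallyNormedField F]
variable {E : Type*} [NontriviallyNormedField E] [IsUltrametricDist E] [NormedAlgebra F E]
variable {c : E ≃ₐ[F] E} {u : Valued.integer E} {q : ℕ}
variable {V : Type*} [AddCommGroup V] [Module E V] {h : Pairing c V}
variable {L K : Submodule (Valued.integer E) V} {m : ℕ} {b : Fin m → V} {ξ : V}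

/-- The projection to the orthogonal complement of an anisotropic vector. -/
def orthProj (h : Pairing c V) (ξ : V) : V →ₗ[E] V :=
  LinearMap.id - LinearMap.smulRight ((h ξ ξ)⁻¹ • h.flip ξ) ξ

theorem orthProj_apply (ξ y : V) : orthProj h ξ y = y - ((h ξ ξ)⁻¹ * h y ξ) • ξ := by
  simp [orthProj]

theorem orthProj_add_smul (ξ y : V) : orthProj h ξ y + ((h ξ ξ)⁻¹ * h y ξ) • ξ = y := by
  rw [orthProj_apply, sub_add_cancel]

theorem pairing_orthProj (hξ : h ξ ξ ≠ 0) (y : V) : h (orthProj h ξ y) ξ = 0 := by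
  rw [orthProj_apply, map_sub, LinearMap.sub_apply, RamifiedDatum.pairing_smul_left]
  field_simp
  ring

theorem orthProj_of_pairing_eq_zero {y : V} (hy : h y ξ = 0) : orthProj h ξ y = y := by
  rw [orthProj_apply, hy, mul_zero, zero_smul, sub_zero]

theorem pairing_sub_orthProj (hh : IsHermitianSpace h) (hξ : h ξ ξ ≠ 0) (y z : V) :
    h y z - h (orthProj h ξ y) (orthProj h ξ z) = (h ξ ξ)⁻¹ * h y ξ * c (h z ξ) := by
  have h1 : h y z = h (orthProj h ξ y + ((h ξ ξ)⁻¹ * h y ξ) • ξ) z := by rw [orthProj_add_smul]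
  have h2 : h (orthProj h ξ y) z = h (orthProj h ξ y) (orthProj h ξ z) := by
    conv_lhs => rw [← orthProj_add_smul (h := h) ξ z]
    rw [map_add, RamifiedDatum.pairing_smul_right, pairing_orthProj hξ, mul_zero, add_zero]
  rw [h1, map_add, LinearMap.add_apply, h2, RamifiedDatum.pairing_smul_left, hh.symm z ξ]
  ring

namespace RamifiedDatum

/-- By parity, a nonintegral `(ξ, ξ)` has valuation at most `-2`. The correction is `(y, ξ)` times
the conjugate of `(z, ξ)`, divided by `(ξ, ξ)`: two factors of valuation at least `-1`, so it is
integral. -/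
theorem norm_pairing_sub_orthProj_le (hD : RamifiedDatum c u q) (hh : IsHermitianSpace h)
    (hξ : 1 < ‖h ξ ξ‖) {y z : V} (hy : ‖h y ξ‖ ≤ ‖(u : E)‖⁻¹) (hz : ‖h z ξ‖ ≤ ‖(u : E)‖⁻¹) :
    ‖h y z - h (orthProj h ξ y) (orthProj h ξ z)‖ ≤ 1 := by
  have h0 : h ξ ξ ≠ 0 := norm_pos_iff.mp (zero_lt_one.trans hξ)
  have h1 : ‖(u : E)‖ ^ (-2 : ℤ) ≤ ‖h ξ ξ‖ := by
    by_contra! hlt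
    exact absurd (hD.symm_norm_lt_of_lt (self_symm hh ξ) hlt) (not_le.mpr hξ)
  have hp := inv_pos.mpr hD.norm_pos
  rw [pairing_sub_orthProj hh h0, mul_assoc, norm_mul, norm_mul, norm_inv, hD.norm_conj,
    ← div_eq_inv_mul]
  refine div_le_one_of_le₀ (le_trans ?_ h1) (norm_nonneg _)
  rw [← hD.inv_norm_mul_self]
  gcongr

variable [FiniteDimensional E V]

theorem orthProj_mem_ambient (hK : IsIntegralHyperlattice u h m K)
    (hb : IsLatticeBasis b K) (hξK : ξ ∉ ambient K) (hξ : h ξ ξ ≠ 0) {K₂ : Submodule (Valued.integer E) V}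
    (hb₂ : IsLatticeBasis (fun i => orthProj h ξ (b i)) K₂) (y : V) :
    orthProj h ξ y ∈ ambient K₂ := by
  have hy : y ∈ Submodule.span E (Set.range (Fin.cons ξ b : Fin (m + 1) → V)) := by
    rw [(hb.cons hξK).span_eq_ambient, (hb.cons hξK).ambient_eq_top hK.finrank_space]
    trivial
  rw [Fin.range_cons, Submodule.mem_span_insert, hb.span_eq_ambient] at hy
  obtain ⟨a, w, hw, rfl⟩ := hy
  have h1 : orthProj h ξ ξ = 0 := by
    rw [orthProj_apply, inv_mul_cancel₀ hξ, one_smul, sub_self]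
  rw [map_add, map_smul, h1, smul_zero, zero_add]
  obtain ⟨d, rfl⟩ := hb.mem_ambient_iff.mp hw
  rw [map_sum]
  exact hb₂.mem_ambient_iff.mpr ⟨d, by simp only [map_smul]⟩

theorem isLatticeBasis_orthProj (hb : IsLatticeBasis b K) (hξK : ξ ∉ ambient K) :
    IsLatticeBasis (fun i => orthProj h ξ (b i))
      (Submodule.span (Valued.integer E) (Set.range fun i => orthProj h ξ (b i))) where
  li := by
    refine Fintype.linearIndependent_iff.mpr fun d hd => ?_
    have h1 : orthProj h ξ (∑ i, d i • b i) = 0 := by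
      rw [map_sum, ← hd]
      simp only [map_smul]
    have h2 := orthProj_add_smul (h := h) ξ (∑ i, d i • b i)
    rw [h1, zero_add] at h2
    have h3 : ∑ i, d i • b i ∈ ambient K := hb.mem_ambient_iff.mpr ⟨d, rfl⟩
    have h4 : (h ξ ξ)⁻¹ * h (∑ i, d i • b i) ξ = 0 := by
      by_contra h0
      rw [← h2, Submodule.smul_mem_iff _ h0] at h3
      exact hξK h3
    rw [h4, zero_smul] at h2
    exact Fintype.linearIndependent_iff.mp hb.li d h2.symm
  span_eq := rfl

theorem mem_span_orthProj_iff (hb : IsLatticeBasis b K) {y : V} :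
    y ∈ Submodule.span (Valued.integer E) (Set.range fun i => orthProj h ξ (b i)) ↔
      ∃ l ∈ K, orthProj h ξ l = y := by
  refine (Submodule.mem_span_range_iff_exists_fun (Valued.integer E)).trans ?_
  constructor
  · rintro ⟨a, rfl⟩
    exact ⟨_, hb.mem_iff.mpr ⟨a, rfl⟩, by simp only [map_sum, integer_smul_def, map_smul]⟩
  · rintro ⟨l, hl, rfl⟩
    obtain ⟨a, rfl⟩ := hb.mem_iff.mp hl
    exact ⟨a, by simp only [map_sum, integer_smul_def, map_smul]⟩

variable [TopologicalSpace V] [IsTopologicalAddGroup V] [ContinuousSMul E V] [T2Space V]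
variable [MeasurableSpace V] [BorelSpace V] {μ : Measure V}

theorem isOpen_nearDual (hD : RamifiedDatum c u q) (hb : IsLatticeBasis b K) :
    IsOpen (nearDual h K) := by
  have h1 : nearDual h K = ⋃ l ∈ K, ⋂ i, {y | ‖h (y - l) (b i)‖ ≤ 1} := by
    ext y
    simp only [nearDual, Set.mem_ofPred_eq, Set.mem_iUnion, Set.mem_iInter, exists_prop,
      hD.forall_mem_norm_le_iff hb zero_le_one]
  rw [h1]
  refine isOpen_biUnion fun l _ => isOpen_iInter_of_finite fun i => ?_
  have h2 : {y | ‖h (y - l) (b i)‖ ≤ 1}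
      = (fun y => h (y - l) (b i)) ⁻¹' Metric.closedBall (0 : E) 1 := by
    ext y
    simp
  rw [h2]
  exact (IsUltrametricDist.isOpen_closedBall _ one_ne_zero).preimage
    ((hD.continuous_pairing_left (b i)).comp (continuous_sub_right l))

theorem measurableSet_nearDual (hD : RamifiedDatum c u q) (hb : IsLatticeBasis b K) :
    MeasurableSet (nearDual h K) := (hD.isOpen_nearDual hb).measurableSet

/-- The measure of the generators of integral lattices in a half space. -/
theorem measure_isotropic_eq (hD : RamifiedDatum c u q) (hh : IsHermitianSpace h)
    (hμ : IsTranslationInvariant μ (⊤ : Submodule E V)) (hK : IsIntegralHyperlattice u h m K)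
    (hb : IsLatticeBasis b K) (hξK : ξ ∉ ambient K) (hξ : 1 < ‖h ξ ξ‖)
    (hξv : ∀ v ∈ K, ‖h ξ v‖ ≤ ‖(u : E)‖⁻¹) :
    μ {y | (∀ v ∈ K, ‖h y v‖ ≤ ‖(u : E)‖⁻¹) ∧ ‖h y y‖ ≤ 1 ∧ ‖h y ξ‖ ≤ ‖(u : E)‖⁻¹}
      = (q : ENNReal) ^ (corank u h b - 1)
        * μ {y | y ∈ nearDual h K ∧ ‖h y y‖ ≤ 1 ∧ ‖h y ξ‖ ≤ ‖(u : E)‖⁻¹} := by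
  have := hD.properSpace
  have h0 : h ξ ξ ≠ 0 := norm_pos_iff.mp (zero_lt_one.trans hξ)
  set B : Set V := {y | ‖h y ξ‖ ≤ ‖(u : E)‖⁻¹} with hB
  have hBm : MeasurableSet B := hD.measurableSet_pairing_le ξ _
  have hprm : Measurable (orthProj h ξ) :=
    (orthProj h ξ).continuous_of_finiteDimensional.measurable
  -- Pushing the half-space measure forward to the complement of `ξ` turns both sides into measures
  -- of sets defined by the projected lattice `K₂`. Translations by vectors orthogonal to `ξ`
  -- preserve the half space, so the pushforward is invariant under them.
  set ν : Measure V := (μ.restrict B).map (orthProj h ξ) with hν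
  have hνapp : ∀ S, MeasurableSet S → ν S = μ {y | orthProj h ξ y ∈ S ∧ y ∈ B} := fun S hS => by
    rw [hν, Measure.map_apply hprm hS, Measure.restrict_apply (hprm hS)]
    rfl
  have hb₂ := isLatticeBasis_orthProj (h := h) hb hξK
  set K₂ := Submodule.span (Valued.integer E) (Set.range fun i => orthProj h ξ (b i)) with hK₂
  have hmem₂ : ∀ y, y ∈ K₂ ↔ ∃ l ∈ K, orthProj h ξ l = y := fun y => mem_span_orthProj_iff hb
  have hamb := orthProj_mem_ambient hK hb hξK h0 hb₂
  have hamb0 : ∀ y ∈ ambient K₂, h y ξ = 0 := by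
    have h1 : ambient K₂ ≤ LinearMap.ker (h.flip ξ) := ambient_le_iff.mpr fun y hy => by
      obtain ⟨l, -, rfl⟩ := (hmem₂ y).mp hy
      exact pairing_orthProj h0 l
    exact fun y hy => h1 hy
  have hKξ : ∀ v ∈ K, ‖h v ξ‖ ≤ ‖(u : E)‖⁻¹ := fun v hv => by
    rw [hD.norm_pairing_comm hh]
    exact hξv v hv
  have hinv := hD.one_lt_inv_norm
  have hclose : ∀ {C : ℝ}, 1 ≤ C → ∀ {y z : V}, y ∈ B → z ∈ B →
      (‖h (orthProj h ξ y) (orthProj h ξ z)‖ ≤ C ↔ ‖h y z‖ ≤ C) := fun hC y z hy hz => by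
    have h1 := (hD.norm_pairing_sub_orthProj_le hh hξ hy hz).trans hC
    constructor
    · intro H
      have := norm_add_le_of_le h1 H
      rwa [sub_add_cancel] at this
    · intro H
      have := norm_sub_le_of_le' H h1
      rwa [sub_sub_cancel] at this
  have hint₂ : IsIntegralLattice u h K₂ := by
    rw [hD.isIntegralLattice_iff]
    intro y hy z hz
    obtain ⟨l, hl, rfl⟩ := (hmem₂ y).mp hy
    obtain ⟨l', hl', rfl⟩ := (hmem₂ z).mp hz
    exact (hclose hinv.le (hKξ l hl) (hKξ l' hl')).mpr
      (hD.isIntegralLattice_iff.mp hK.integral l hl l' hl')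
  have hnd₂ : NondegenerateOn h K₂ := by
    intro x hx hxy
    refine hh.nondegenerate x fun y => ?_
    rw [← orthProj_add_smul (h := h) ξ y, map_add, pairing_smul_right, hamb0 x hx, mul_zero,
      add_zero]
    exact hxy _ (hamb y)
  -- Integral changes of the pairings become multiples of `u` in the Gram matrix of `u h`, hence are
  -- invisible modulo `u`.
  have hcorank : corank u h (fun i => orthProj h ξ (b i)) = corank u h b := by
    have h1 : residueGram u h (fun i => orthProj h ξ (b i)) = residueGram u h b := by
      funext i j
      rw [residueGram, residueGram, hD.residue_eq_iff, hD.coe_gram hint₂ hb₂,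
        hD.coe_gram hK.integral hb, ← mul_sub, norm_mul, norm_sub_rev]
      exact (mul_le_of_le_one_right hD.norm_pos.le (hD.norm_pairing_sub_orthProj_le hh hξ
        (hKξ _ (hb.mem i)) (hKξ _ (hb.mem j)))).trans_lt hD.norm_lt_one
    rw [corank, corank, h1]
  have hνinv : IsTranslationInvariant ν (ambient K₂) := by
    intro a ha S hS
    have haξ := hamb0 a ha
    have hSm : MeasurableSet {y : V | y - a ∈ S} := (measurable_sub_const a) hS
    rw [hνapp _ hSm, hνapp _ hS]
    have hSB : MeasurableSet {y | orthProj h ξ y ∈ S ∧ y ∈ B} := (hprm hS).inter hBm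
    rw [← hμ a Submodule.mem_top _ hSB]
    congr 1
    ext y
    have h1 : orthProj h ξ (y - a) = orthProj h ξ y - a := by
      rw [map_sub, orthProj_of_pairing_eq_zero haξ]
    have h2 : h (y - a) ξ = h y ξ := by rw [map_sub, LinearMap.sub_apply, haξ, sub_zero]
    simp only [Set.mem_ofPred_eq, h1, hB, h2]
  have key := hD.measure_isotropic_dual hh hνinv hint₂ hb₂ hnd₂ hK.odd
  have hm1 : MeasurableSet {y | y ∈ dual u h K₂ ∧ ‖h y y‖ ≤ 1} :=
    hD.measurableSet_dual.inter (hD.measurableSet_self_le hh 1)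
  have hm2 : MeasurableSet {y | y ∈ ambient K₂ ∧ y ∈ nearDual h K₂ ∧ ‖h y y‖ ≤ 1} :=
    (Submodule.closed_of_finiteDimensional (ambient K₂)).measurableSet.inter
      ((hD.measurableSet_nearDual hb₂).inter (hD.measurableSet_self_le hh 1))
  rw [hcorank, hνapp _ hm1, hνapp _ hm2] at key
  convert key using 3
  · ext y
    simp only [Set.mem_ofPred_eq, hD.mem_dual, hamb y, true_and]
    constructor
    · rintro ⟨h1, h2, h3⟩
      refine ⟨⟨fun v hv => ?_, (hclose le_rfl h3 h3).mpr h2⟩, h3⟩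
      obtain ⟨l, hl, rfl⟩ := (hmem₂ v).mp hv
      exact (hclose hinv.le h3 (hKξ l hl)).mpr (h1 l hl)
    · rintro ⟨⟨h1, h2⟩, h3⟩
      exact ⟨fun v hv => (hclose hinv.le h3 (hKξ v hv)).mp (h1 _ ((hmem₂ _).mpr ⟨v, hv, rfl⟩)),
        (hclose le_rfl h3 h3).mp h2, h3⟩
  · ext y
    simp only [Set.mem_ofPred_eq, hamb y, true_and]
    have hsub : ∀ l ∈ K, y ∈ B → y - l ∈ B := fun l hl hy => by
      rw [hB, Set.mem_ofPred_eq, map_sub, LinearMap.sub_apply]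
      exact norm_sub_le_of_le' hy (hKξ l hl)
    constructor
    · rintro ⟨⟨l, hl, hyl⟩, h2, h3⟩
      refine ⟨⟨⟨_, (hmem₂ _).mpr ⟨l, hl, rfl⟩, fun v hv => ?_⟩, (hclose le_rfl h3 h3).mpr h2⟩, h3⟩
      obtain ⟨l', hl', rfl⟩ := (hmem₂ v).mp hv
      rw [← map_sub]
      exact (hclose le_rfl (hsub l hl h3) (hKξ l' hl')).mpr (hyl l' hl')
    · rintro ⟨⟨⟨l₂, hl₂, hyl⟩, h2⟩, h3⟩
      obtain ⟨l, hl, rfl⟩ := (hmem₂ l₂).mp hl₂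
      refine ⟨⟨l, hl, fun v hv => ?_⟩, (hclose le_rfl h3 h3).mp h2, h3⟩
      have h4 := hyl _ ((hmem₂ _).mpr ⟨v, hv, rfl⟩)
      rw [← map_sub] at h4
      exact (hclose le_rfl (hsub l hl h3) (hKξ v hv)).mp h4

end RamifiedDatum

end Orthogonal

/-! ### Volumes of the lattices over a hyperlattice. -/

section FiberSums

variable {F : Type*} [NontriviallyNormedField F]
variable {E : Type*} [NontriviallyNormedField E] [IsUltrametricDist E] [NormedAlgebra F E]
variable {c : E ≃ₐ[F] E} {u : Valued.integer E} {q : ℕ}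
variable {V : Type*} [AddCommGroup V] [Module E V] {h : Pairing c V}
variable {L K : Submodule (Valued.integer E) V} {m : ℕ} {b : Fin m → V} {ξ Y : V}

/-- The vectors that generate `L` over `K`. -/
def generators (K L : Submodule (Valued.integer E) V) : Set V :=
  {Y | Y ∉ ambient K ∧ K ⊔ Submodule.span (Valued.integer E) {Y} = L}

/-- The contribution of a lattice to the weighted count of integral lattices over `K`. -/
def fiberWeight (q : ℕ) (u : Valued.integer E) (h : Pairing c V)
    (K L : Submodule (Valued.integer E) V) : ℤ :=
  if latticeType u h L = latticeType u h K + 1 then 1 - q ^ (latticeType u h K - 1) else 1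

variable [TopologicalSpace V] [IsTopologicalAddGroup V]
variable [MeasurableSpace V] [BorelSpace V] {μ : Measure V} [μ.IsAddHaarMeasure]

theorem isTranslationInvariant_top : IsTranslationInvariant μ (⊤ : Submodule E V) := by
  intro a _ S _
  have h1 := measure_preimage_add_right μ (-a) S
  rw [← h1]
  congr 1
  ext y
  simp [sub_eq_add_neg]

namespace RamifiedDatum

variable [ContinuousSMul E V] [T2Space V] [FiniteDimensional E V]

theorem generators_eq_diff (hD : RamifiedDatum c u q) (hY : Y ∉ ambient K) :
    generators K (K ⊔ Submodule.span (Valued.integer E) {Y})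
      = ((K ⊔ Submodule.span (Valued.integer E) {Y} : Submodule (Valued.integer E) V) : Set V) \
        ((K ⊔ Submodule.span (Valued.integer E) {(u : E) • Y} :
          Submodule (Valued.integer E) V) : Set V) := by
  ext X
  refine ⟨fun hX => (hD.sup_span_eq_iff hY).mp hX.2, fun hX => ⟨fun hXK => hX.2 ?_,
    (hD.sup_span_eq_iff hY).mpr hX⟩⟩
  have h1 : X ∈ (K ⊔ Submodule.span (Valued.integer E) {Y}) ⊓
      (ambient K).restrictScalars (Valued.integer E) := ⟨hX.1, hXK⟩
  rw [sup_span_inf_ambient hY] at h1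
  exact Submodule.mem_sup_left h1

theorem measure_lattice_ne_top (hD : RamifiedDatum c u q) (hL : L.FG) : μ L ≠ ⊤ := by
  obtain ⟨b, hb⟩ := hD.exists_isLatticeBasis hL rfl
  exact (hD.isCompact_lattice hb).measure_ne_top

theorem measure_lattice_ne_zero (hD : RamifiedDatum c u q) (hL : L.FG) (htop : ambient L = ⊤) :
    μ L ≠ 0 :=
  (hD.isOpen_lattice hL htop).measure_ne_zero μ ⟨0, L.zero_mem⟩

theorem measure_sup_span (hD : RamifiedDatum c u q) (hK : K.FG) (hY : Y ∉ ambient K) :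
    μ (K ⊔ Submodule.span (Valued.integer E) {Y} : Submodule (Valued.integer E) V)
      = q * μ (K ⊔ Submodule.span (Valued.integer E) {(u : E) • Y} :
        Submodule (Valued.integer E) V) := by
  have := hD.finite_residueField
  have hmeas : MeasurableSet ((K ⊔ Submodule.span (Valued.integer E) {(u : E) • Y} :
      Submodule (Valued.integer E) V) : Set V) :=
    (hD.isClosed_lattice (hK.sup (Submodule.fg_span_singleton _))).measurableSet
  have hsmul : ∀ a : E, a • Y ∈ K ⊔ Submodule.span (Valued.integer E) {(u : E) • Y} ↔
      ‖a‖ < 1 := by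
    intro a
    rw [mem_sup_span_iff]
    constructor
    · rintro ⟨l, hl, a', hla⟩
      have h1 : (a - a' * u) • Y ∈ ambient K := by
        rw [sub_smul, ← hla, mul_smul, add_sub_cancel_right]
        exact mem_ambient hl
      have h2 : a - a' * u = 0 := by
        by_contra h0
        exact hY ((Submodule.smul_mem_iff _ h0).mp h1)
      rw [sub_eq_zero.mp h2, norm_mul]
      exact mul_lt_one_of_nonneg_of_lt_one_right (norm_coe_integer_le _) (norm_nonneg _)
        hD.norm_lt_one
    · intro ha
      obtain ⟨a', ha'⟩ := hD.dvd_iff.mpr (show ‖((toInteger a : Valued.integer E) : E)‖ < 1 by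
        rwa [coe_toInteger ha.le])
      refine ⟨0, K.zero_mem, a', ?_⟩
      have h1 := congrArg (fun x : Valued.integer E => (x : E)) ha'
      simp only [coe_toInteger ha.le] at h1
      rw [h1, zero_add, smul_smul, mul_comm]
      rfl
  have hle : K ⊔ Submodule.span (Valued.integer E) {(u : E) • Y}
      ≤ K ⊔ Submodule.span (Valued.integer E) {Y} := by
    refine sup_le le_sup_left ?_
    rw [Submodule.span_singleton_le_iff_mem]
    exact Submodule.smul_mem _ u mem_sup_span_self
  rw [← hD.card_residue]
  refine measure_eq_card_mul (fun κ => (residueLift κ : E) • Y) hmeas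
    (fun κ => isTranslationInvariant_top (E := E) _ Submodule.mem_top _ hmeas)
    (fun y => ?_) fun y i j hi hj => ?_
  · constructor
    · intro hy
      obtain ⟨l, hl, a, rfl⟩ := mem_sup_span_iff.mp hy
      refine ⟨IsLocalRing.residue _ a, ?_⟩
      change l + (a : E) • Y - _ ∈ K ⊔ Submodule.span (Valued.integer E) {(u : E) • Y}
      rw [add_sub_assoc, ← sub_smul]
      refine add_mem (Submodule.mem_sup_left hl) ((hsmul _).mpr ?_)
      rw [← hD.residue_eq_iff, residue_residueLift]
    · rintro ⟨κ, hκ⟩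
      have h1 := add_mem (hle hκ) (Submodule.smul_mem _ (residueLift κ) mem_sup_span_self)
      rw [integer_smul_def, sub_add_cancel] at h1
      exact h1
  · have h1 := sub_mem hj hi
    rw [sub_sub_sub_cancel_left, ← sub_smul, hsmul, ← hD.residue_eq_iff, residue_residueLift,
      residue_residueLift] at h1
    exact h1

theorem measurableSet_generators (hD : RamifiedDatum c u q) (hh : IsHermitianSpace h)
    (hK : IsIntegralHyperlattice u h m K) (hL : L ∈ fiberLattices u h K) :
    MeasurableSet (generators K L) := by
  obtain ⟨Y, hY, rfl⟩ := hD.exists_generator hh hK hL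
  rw [hD.generators_eq_diff hY]
  exact (hD.isClosed_lattice hL.1).measurableSet.diff
    (hD.isClosed_lattice (hK.fg.sup (Submodule.fg_span_singleton _))).measurableSet

/-- The generators of `K + ⟨Y⟩` over `K` are the complement of the sublattice `K + ⟨u Y⟩` of index
`q`. -/
theorem measure_generators (hD : RamifiedDatum c u q) (hh : IsHermitianSpace h)
    (hK : IsIntegralHyperlattice u h m K) (hL : L ∈ fiberLattices u h K) :
    μ (generators K L) = (1 - (q : ENNReal)⁻¹) * μ L := by
  obtain ⟨Y, hY, rfl⟩ := hD.exists_generator hh hK hL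
  have hfg : (K ⊔ Submodule.span (Valued.integer E) {(u : E) • Y}).FG :=
    hK.fg.sup (Submodule.fg_span_singleton _)
  have hq : (q : ENNReal) ≠ 0 := Nat.cast_ne_zero.mpr (zero_lt_one.trans hD.one_lt_q).ne'
  have hle : K ⊔ Submodule.span (Valued.integer E) {(u : E) • Y}
      ≤ K ⊔ Submodule.span (Valued.integer E) {Y} := by
    refine sup_le le_sup_left ?_
    rw [Submodule.span_singleton_le_iff_mem]
    exact Submodule.smul_mem _ u mem_sup_span_self
  rw [hD.generators_eq_diff hY, measure_sdiff hle (hD.isClosed_lattice hfg).nullMeasurableSet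
    (hD.measure_lattice_ne_top hfg), ENNReal.sub_mul
      (fun _ _ => hD.measure_lattice_ne_top hL.1), one_mul]
  congr 1
  rw [hD.measure_sup_span hK.fg hY, ← mul_assoc,
    ENNReal.inv_mul_cancel hq (ENNReal.natCast_ne_top q), one_mul]

theorem one_sub_inv_ne_zero (hD : RamifiedDatum c u q) : (1 - (q : ENNReal)⁻¹) ≠ 0 := by
  rw [ne_eq, tsub_eq_zero_iff_le, not_le, ENNReal.inv_lt_one]
  exact_mod_cast hD.one_lt_q

/-- A sum of measures over integral lattices as the measure of the set of generators. -/
theorem tsum_measure (hD : RamifiedDatum c u q) (hh : IsHermitianSpace h)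
    (hK : IsIntegralHyperlattice u h m K) (P : Submodule (Valued.integer E) V → Prop)
    [DecidablePred P] :
    (1 - (q : ENNReal)⁻¹) * ∑' L : fiberLattices u h K, (if P L then μ (L : Set V) else 0)
      = μ {Y | Y ∉ ambient K ∧ K ⊔ Submodule.span (Valued.integer E) {Y} ∈ fiberLattices u h K ∧
          P (K ⊔ Submodule.span (Valued.integer E) {Y})} := by
  have := (hD.countable_fiberLattices hh hK).to_subtype
  have h1 : {Y | Y ∉ ambient K ∧
        K ⊔ Submodule.span (Valued.integer E) {Y} ∈ fiberLattices u h K ∧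
          P (K ⊔ Submodule.span (Valued.integer E) {Y})}
      = ⋃ L : fiberLattices u h K, (if P L then generators K L else ∅) := by
    ext Y
    simp only [Set.mem_iUnion, Set.mem_ofPred_eq]
    constructor
    · rintro ⟨hY, hL, hP⟩
      refine ⟨⟨_, hL⟩, ?_⟩
      rw [if_pos hP]
      exact ⟨hY, rfl⟩
    · rintro ⟨⟨L, hL⟩, hY⟩
      by_cases hP : P L
      · rw [if_pos hP] at hY
        obtain ⟨hY, rfl⟩ := hY
        exact ⟨hY, hL, hP⟩
      · rw [if_neg hP] at hY
        exact hY.elim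
  rw [h1, measure_iUnion, ← ENNReal.tsum_mul_left]
  · refine tsum_congr fun L => ?_
    split_ifs
    · exact (hD.measure_generators hh hK L.2).symm
    · simp
  · intro L L' hne
    rw [Function.onFun, Set.disjoint_left]
    intro Y hY hY'
    refine hne (Subtype.ext ?_)
    split_ifs at hY hY' <;> first | exact hY.elim | exact hY'.elim | exact hY.2.symm.trans hY'.2
  · intro L
    split_ifs
    · exact hD.measurableSet_generators hh hK L.2
    · exact MeasurableSet.empty

/-- The sets of generators of different lattices are disjoint and all lie in one bounding lattice of
finite measure. -/
theorem tsum_measure_ne_top (hD : RamifiedDatum c u q) (hh : IsHermitianSpace h)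
    (hK : IsIntegralHyperlattice u h m K) :
    ∑' L : fiberLattices u h K, μ (L : Set V) ≠ ⊤ := by
  intro H
  have h1 := hD.tsum_measure (μ := μ) hh hK (fun _ => True)
  simp only [if_true, H, ENNReal.mul_top hD.one_sub_inv_ne_zero] at h1
  obtain ⟨D, hDfg, -, -, hDle⟩ := hD.exists_bounding_lattice hh hK
  refine hD.measure_lattice_ne_top (μ := μ) hDfg (top_le_iff.mp (h1 ▸ measure_mono ?_))
  rintro Y ⟨-, hY, -⟩
  obtain ⟨h2, h3⟩ := hD.norm_le_of_mem_fiberLattices hh hY mem_sup_span_self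
  exact hDle Y h2 h3

theorem summable_measureReal (hD : RamifiedDatum c u q) (hh : IsHermitianSpace h)
    (hK : IsIntegralHyperlattice u h m K) :
    Summable fun L : fiberLattices u h K => μ.real (L : Set V) :=
  ENNReal.summable_toReal (hD.tsum_measure_ne_top hh hK)

/-- Bounded parts of a nondegenerate hyperplane are null sets. -/
theorem measure_ambient_inter (hD : RamifiedDatum c u q) (hh : IsHermitianSpace h)
    (hK : IsIntegralHyperlattice u h m K) {D : Submodule (Valued.integer E) V} (hDfg : D.FG) :
    μ ((ambient K : Set V) ∩ D) = 0 := by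
  obtain ⟨e, he, hee⟩ := hD.exists_normal hh hK
  have hfg : (D ⊔ Submodule.span (Valued.integer E) {e}).FG :=
    hDfg.sup (Submodule.fg_span_singleton e)
  have := hD.properSpace
  have hm : MeasurableSet ((ambient K : Set V) ∩ D) :=
    (Submodule.closed_of_finiteDimensional (ambient K)).measurableSet.inter
      (hD.isClosed_lattice hDfg).measurableSet
  -- Infinitely many disjoint translates, by `u ^ j e` with `e` normal, stay in a lattice of finite
  -- measure, so their common measure is zero.
  have hinv : ∀ j : ℕ, μ {y | y - (u : E) ^ j • e ∈ (ambient K : Set V) ∩ D}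
      = μ ((ambient K : Set V) ∩ D) := fun j =>
    isTranslationInvariant_top (E := E) _ Submodule.mem_top _ hm
  have hmj : ∀ j : ℕ, MeasurableSet {y | y - (u : E) ^ j • e ∈ (ambient K : Set V) ∩ D} :=
    fun j => (measurable_sub_const ((u : E) ^ j • e)) hm
  have hdisj : Pairwise (Function.onFun Disjoint
      fun j : ℕ => {y | y - (u : E) ^ j • e ∈ (ambient K : Set V) ∩ D}) := by
    intro i j hij
    rw [Function.onFun, Set.disjoint_left]
    rintro y ⟨hy, -⟩ ⟨hy', -⟩
    have h1 := (he _).mpr (sub_mem hy hy')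
    rw [sub_sub_sub_cancel_left, ← sub_smul, pairing_smul_left] at h1
    have h2 := sub_eq_zero.mp ((mul_eq_zero.mp h1).resolve_right hee)
    have h3 := congrArg norm h2
    rw [norm_pow, norm_pow] at h3
    exact hij (pow_right_injective₀ hD.norm_pos hD.norm_lt_one.ne h3).symm
  have hsub : (⋃ j : ℕ, {y | y - (u : E) ^ j • e ∈ (ambient K : Set V) ∩ D})
      ⊆ (D ⊔ Submodule.span (Valued.integer E) {e} : Submodule (Valued.integer E) V) := by
    intro y hy
    obtain ⟨j, -, hj⟩ := Set.mem_iUnion.mp hy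
    exact mem_sup_span_iff.mpr ⟨_, hj, u ^ j, by push_cast; abel⟩
  by_contra hne
  have h1 := measure_mono (μ := μ) hsub
  rw [measure_iUnion hdisj hmj, tsum_congr hinv, ENNReal.tsum_const_eq_top_of_ne_zero hne] at h1
  exact hD.measure_lattice_ne_top hfg (top_le_iff.mp h1)

/-- The weighted sum of the measures of the integral lattices in a half space vanishes. -/
theorem tsum_measure_eq (hD : RamifiedDatum c u q) (hh : IsHermitianSpace h)
    (hK : IsIntegralHyperlattice u h m K) (hξK : ξ ∉ ambient K) (hξ : 1 < ‖h ξ ξ‖)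
    (P : Submodule (Valued.integer E) V → Prop) [DecidablePred P]
    (hP : ∀ L, P L ↔ ξ ∈ dual u h L) :
    ∑' L : fiberLattices u h K, (if P L then μ (L : Set V) else 0)
      = (q : ENNReal) ^ (latticeType u h K - 1) * ∑' L : fiberLattices u h K,
        (if P L ∧ latticeType u h (L : Submodule (Valued.integer E) V) = latticeType u h K + 1
          then μ (L : Set V) else 0) := by
  by_cases hξv : ∀ v ∈ K, ‖h ξ v‖ ≤ ‖(u : E)‖⁻¹
  swap
  -- If `ξ` is not in the dual direction of `K`, no lattice over `K` has `ξ` in its dual and both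
  -- sides vanish.
  · have h1 : ∀ L : fiberLattices u h K, ¬P L := fun L hL => by
      refine hξv fun v hv => ?_
      exact (hD.mem_dual.mp ((hP _).mp hL)).2 v (le_of_mem_fiberLattices L.2 hv)
    simp [h1]
  obtain ⟨b, hb⟩ := hD.exists_isLatticeBasis hK.fg hK.finrank_ambient
  have htype : latticeType u h K = corank u h b :=
    hD.latticeType_eq hh hK.integral hb hK.nondegenerate
  obtain ⟨D, hDfg, -, -, hDle⟩ := hD.exists_bounding_lattice hh hK
  have hκ := hD.one_sub_inv_ne_zero
  have hκ' : (1 - (q : ENNReal)⁻¹) ≠ ⊤ := ENNReal.sub_ne_top ENNReal.one_ne_top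
  have key := hD.measure_isotropic_eq hh (μ := μ) isTranslationInvariant_top hK hb hξK hξ hξv
  have hnull := hD.measure_ambient_inter (μ := μ) hh hK hDfg
  have hdiff : ∀ S : Set V, S ⊆ D → μ (S \ ambient K) = μ S := fun S hS => by
    refine measure_sdiff_null' (measure_mono_null ?_ hnull)
    exact fun y hy => ⟨hy.2, hS hy.1⟩
  have hnear : ∀ y ∈ nearDual h K, ∀ v ∈ K, ‖h y v‖ ≤ ‖(u : E)‖⁻¹ := by
    rintro y ⟨l, hl, hyl⟩ v hv
    have h1 := norm_add_le_of_le ((hyl v hv).trans hD.one_lt_inv_norm.le)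
      (hD.isIntegralLattice_iff.mp hK.integral l hl v hv)
    rwa [← LinearMap.add_apply, ← map_add, sub_add_cancel] at h1
  -- Multiplying by the proportion of generators replaces both sums by measures of sets of
  -- generators. Up to the null hyperplane these are the two sets of `measure_isotropic_eq`: type `t
  -- + 1` corresponds to near-dual generators.
  rw [← ENNReal.mul_right_inj hκ hκ', hD.tsum_measure hh hK P, mul_left_comm,
    hD.tsum_measure hh hK (fun L => P L ∧ latticeType u h L = latticeType u h K + 1), htype]
  have hmemP : ∀ Y, Y ∉ ambient K → K ⊔ Submodule.span (Valued.integer E) {Y}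
      ∈ fiberLattices u h K → (P (K ⊔ Submodule.span (Valued.integer E) {Y}) ↔
        ‖h Y ξ‖ ≤ ‖(u : E)‖⁻¹) := fun Y hY hL => by
    rw [hP, hD.mem_dual_sup_span_iff hL.2.1, hD.norm_pairing_comm hh Y]
    exact ⟨fun H => H.2, fun H => ⟨hξv, H⟩⟩
  have h1 : {Y | Y ∉ ambient K ∧ K ⊔ Submodule.span (Valued.integer E) {Y} ∈ fiberLattices u h K ∧
          P (K ⊔ Submodule.span (Valued.integer E) {Y})}
      = {y | (∀ v ∈ K, ‖h y v‖ ≤ ‖(u : E)‖⁻¹) ∧ ‖h y y‖ ≤ 1 ∧ ‖h y ξ‖ ≤ ‖(u : E)‖⁻¹}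
        \ ambient K := by
    ext Y
    constructor
    · rintro ⟨hY, hL, hPL⟩
      obtain ⟨h2, h3⟩ := hD.norm_le_of_mem_fiberLattices hh hL mem_sup_span_self
      exact ⟨⟨h2, h3, (hmemP Y hY hL).mp hPL⟩, hY⟩
    · rintro ⟨⟨h2, h3, h4⟩, hY⟩
      have hL := hD.sup_span_mem_fiberLattices hh hK hY h2 h3
      exact ⟨hY, hL, (hmemP Y hY hL).mpr h4⟩
  have h2 : {Y | Y ∉ ambient K ∧ K ⊔ Submodule.span (Valued.integer E) {Y} ∈ fiberLattices u h K ∧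
          P (K ⊔ Submodule.span (Valued.integer E) {Y}) ∧
          latticeType u h (K ⊔ Submodule.span (Valued.integer E) {Y}) = corank u h b + 1}
      = {y | y ∈ nearDual h K ∧ ‖h y y‖ ≤ 1 ∧ ‖h y ξ‖ ≤ ‖(u : E)‖⁻¹} \ ambient K := by
    ext Y
    constructor
    · rintro ⟨hY, hL, hPL, htL⟩
      obtain ⟨-, h3⟩ := hD.norm_le_of_mem_fiberLattices hh hL mem_sup_span_self
      refine ⟨⟨?_, h3, (hmemP Y hY hL).mp hPL⟩, hY⟩
      by_contra hYn
      have := (hD.latticeType_sup_span hh hK hb hY hL).2 hYn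
      omega
    · rintro ⟨⟨h2, h3, h4⟩, hY⟩
      have hL := hD.sup_span_mem_fiberLattices hh hK hY (hnear Y h2) h3
      exact ⟨hY, hL, (hmemP Y hY hL).mpr h4, (hD.latticeType_sup_span hh hK hb hY hL).1 h2⟩
  rw [h1, h2, hdiff _ fun y hy => hDle y hy.1 hy.2.1,
    hdiff _ fun y hy => hDle y (hnear y hy.1) hy.2.1, key]

end RamifiedDatum

end FiberSums

/-! ### Fourier transforms of lattice functions. -/

section FourierLattices

variable {F : Type*} [NontriviallyNormedField F]
variable {E : Type*} [NontriviallyNormedField E] [IsUltrametricDist E] [NormedAlgebra F E]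
variable {c : E ≃ₐ[F] E} {u : Valued.integer E} {q : ℕ}
variable {V : Type*} [AddCommGroup V] [Module E V] {h : Pairing c V}
variable {L M : Submodule (Valued.integer E) V} {m : ℕ} {b : Fin m → V}
variable {ψ : AddChar F ℂ}

theorem indicator_one_congr {x y : V} (hxy : x ∈ L ↔ y ∈ L) :
    (L : Set V).indicator (1 : V → ℂ) x = (L : Set V).indicator 1 y := by
  classical
  simp only [Set.indicator_apply, SetLike.mem_coe, hxy, Pi.one_apply]

namespace RamifiedDatum

/-- The trace maps `u⁻¹ O_E` into `O_F`, because traces have even valuation. This is why the dual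
lattice is normalized by `u⁻¹`. -/
theorem char_trace_eq_one (hD : RamifiedDatum c u q) (h2 : Module.finrank F E = 2)
    (hψ : HasConductorIntegers ψ) {z : E} (hz : ‖z‖ ≤ ‖(u : E)‖⁻¹) :
    ψ (Algebra.trace F E z) = 1 := by
  have h1 : ‖Algebra.trace F E z‖ ≤ 1 := by
    rw [hD.norm_trace h2]
    refine hD.symm_norm_le_one (by rw [map_add, hD.conj_conj, add_comm]) ?_
    exact norm_add_le_of_le hz (by rwa [hD.norm_conj])
  have h3 := (hψ 1).mpr (by rw [norm_one]) _ h1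
  rwa [mul_one] at h3

/-- The multiples of a `z` outside `u⁻¹ O_E` contain `u ^ (-2) O_F`, where the trace is doubling and
`ψ` is nontrivial. -/
theorem exists_char_trace_ne_one (hD : RamifiedDatum c u q) (h2 : Module.finrank F E = 2)
    (hψ : HasConductorIntegers ψ) {z : E} (hz : ¬‖z‖ ≤ ‖(u : E)‖⁻¹) :
    ∃ a : Valued.integer E, ψ (Algebra.trace F E (c (a : E) * z)) ≠ 1 := by
  have hu := hD.coe_ne_zero
  have hz0 : z ≠ 0 := fun h0 => hz (by
    rw [h0, norm_zero]
    exact inv_nonneg.mpr (norm_nonneg _))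
  have hzn : ‖(u : E)‖ ^ (-2 : ℤ) ≤ ‖z‖ := by
    obtain ⟨i, hi⟩ := hD.exists_zpow z hz0
    rw [hi] at hz ⊢
    rw [← zpow_neg_one] at hz
    rw [zpow_le_zpow_iff_right_of_lt_one₀ hD.norm_pos hD.norm_lt_one] at hz ⊢
    omega
  obtain ⟨y, hy⟩ := hD.mem_range_of_symm (((u : E) ^ 2)⁻¹) (by
    rw [map_inv₀, map_pow, hD.conj_u, neg_sq])
  have hyn : ‖y‖ = ‖(u : E)‖ ^ (-2 : ℤ) := by
    rw [← norm_algebraMap' E y, ← hy, norm_inv, norm_pow, zpow_neg]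
    rfl
  have hy1 : ¬‖y‖ ≤ 1 := by
    rw [hyn]
    exact not_le.mpr hD.one_le_zpow_neg_two
  obtain ⟨s, hs, hne⟩ : ∃ s : F, ‖s‖ ≤ 1 ∧ ψ (s * y) ≠ 1 := by
    by_contra! H
    exact hy1 ((hψ y).mp H)
  have h2F : (2 : F) ≠ 0 := by
    intro h0
    have h4 := hD.norm_two
    rw [← map_ofNat (algebraMap F E) 2, norm_algebraMap', h0, norm_zero] at h4
    exact zero_ne_one h4
  have h2n : ‖(2 : F)‖ = 1 := by
    rw [← norm_algebraMap' E, map_ofNat]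
    exact hD.norm_two
  have han : ‖c (algebraMap F E (s * y / 2) / z)‖ ≤ 1 := by
    rw [hD.norm_conj, norm_div, norm_algebraMap', norm_div, norm_mul, h2n, div_one, hyn]
    refine div_le_one_of_le₀ (le_trans ?_ hzn) (norm_nonneg _)
    exact mul_le_of_le_one_left (zpow_nonneg (norm_nonneg _) _) hs
  -- Chosen so that the product with `z` is `s y / 2` in `F`, whose trace is `s y`.
  refine ⟨toInteger (c (algebraMap F E (s * y / 2) / z)), ?_⟩
  rw [coe_toInteger han, hD.conj_conj, div_mul_cancel₀ _ hz0, Algebra.trace_algebraMap, h2]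
  have h4 : 2 • (s * y / 2) = s * y := by
    rw [nsmul_eq_mul, Nat.cast_ofNat, mul_div_cancel₀ _ h2F]
  rwa [h4]

theorem char_pairing_add_right (x y z : V) :
    ψ (Algebra.trace F E (h x (y + z)))
      = ψ (Algebra.trace F E (h x y)) * ψ (Algebra.trace F E (h x z)) := by
  rw [map_add, map_add, AddChar.map_add_eq_mul]

theorem char_pairing_add_left (x y z : V) :
    ψ (Algebra.trace F E (h (x + y) z))
      = ψ (Algebra.trace F E (h x z)) * ψ (Algebra.trace F E (h y z)) := by
  rw [map_add, LinearMap.add_apply, map_add, AddChar.map_add_eq_mul]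

theorem exists_pow_smul_mem_dual (hD : RamifiedDatum c u q) (hL : L.FG) (htop : ambient L = ⊤)
    (x : V) : ∃ N : ℕ, (u : E) ^ N • x ∈ dual u h L := by
  obtain ⟨b, hb⟩ := hD.exists_isLatticeBasis hL rfl
  obtain ⟨N, hN⟩ := hD.exists_pow_mul_le_one (∑ i, ‖h x (b i)‖)
  refine ⟨N, hD.mem_dual.mpr ⟨by rw [htop]; trivial, ?_⟩⟩
  refine (hD.forall_mem_norm_le_iff hb (inv_nonneg.mpr (norm_nonneg _))).mpr fun i => ?_
  rw [pairing_smul_left, norm_mul, norm_pow]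
  refine le_trans ?_ (hN.trans hD.one_lt_inv_norm.le)
  gcongr
  exact Finset.single_le_sum (f := fun i => ‖h x (b i)‖) (fun _ _ => norm_nonneg _)
    (Finset.mem_univ i)

theorem ambient_dual_eq_top (hD : RamifiedDatum c u q) (hL : L.FG) (htop : ambient L = ⊤) :
    ambient (dual u h L) = ⊤ := by
  refine eq_top_iff.mpr fun x _ => ?_
  obtain ⟨N, hN⟩ := hD.exists_pow_smul_mem_dual (h := h) hL htop x
  exact (Submodule.smul_mem_iff _ (pow_ne_zero N hD.coe_ne_zero)).mp (mem_ambient hN)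

theorem fg_dual_of_ambient_eq_top (hD : RamifiedDatum c u q) (hh : IsHermitianSpace h)
    (hL : L.FG) (htop : ambient L = ⊤) : (dual u h L).FG := by
  obtain ⟨b, hb⟩ := hD.exists_isLatticeBasis hL rfl
  exact hD.fg_dual hb (hh.nondegenerateOn htop)

variable [TopologicalSpace V] [IsTopologicalAddGroup V] [ContinuousSMul E V] [T2Space V]
variable [FiniteDimensional E V]

theorem isLocallyConstant_of_invariant (hD : RamifiedDatum c u q) (hL : L.FG)
    (htop : ambient L = ⊤) {X : Type*} {f : V → X} (hf : ∀ x, ∀ k ∈ L, f (x + k) = f x) :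
    IsLocallyConstant f := by
  rw [IsLocallyConstant.iff_exists_open]
  refine fun x => ⟨{y | y - x ∈ L}, (hD.isOpen_lattice hL htop).preimage (continuous_sub_right x),
    ?_, fun y hy => ?_⟩
  · rw [Set.mem_ofPred_eq, sub_self]
    exact L.zero_mem
  · have := hf x _ hy
    rwa [add_sub_cancel] at this

theorem continuous_char_pairing (hD : RamifiedDatum c u q) (h2 : Module.finrank F E = 2)
    (hψ : HasConductorIntegers ψ) (hh : IsHermitianSpace h) (x : V) :
    Continuous fun y => ψ (Algebra.trace F E (h x y)) := by
  refine IsLocallyConstant.continuous ?_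
  rw [IsLocallyConstant.iff_exists_open]
  have hpos := inv_pos.mpr hD.norm_pos
  refine fun y => ⟨{y' | h x (y' - y) ∈ Metric.closedBall (0 : E) ‖(u : E)‖⁻¹},
    (IsUltrametricDist.isOpen_closedBall _ hpos.ne').preimage
      ((hD.continuous_pairing_right hh x).comp (continuous_sub_right y)), ?_, fun y' hy' => ?_⟩
  · simp
  · have h3 := char_pairing_add_right (ψ := ψ) (h := h) x (y' - y) y
    rw [sub_add_cancel] at h3
    rw [h3, hD.char_trace_eq_one h2 hψ (mem_closedBall_zero_iff.mp hy'), one_mul]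

theorem hasCompactSupport_of_lattice (hD : RamifiedDatum c u q) (hL : L.FG) {f : V → ℂ}
    (hf : ∀ x, x ∉ L → f x = 0) : HasCompactSupport f := by
  obtain ⟨b, hb⟩ := hD.exists_isLatticeBasis hL rfl
  exact HasCompactSupport.intro (hD.isCompact_lattice hb) hf

variable [MeasurableSpace V] {μ : Measure V}

theorem fourier_add_of_mem_dual (hD : RamifiedDatum c u q) (h2 : Module.finrank F E = 2)
    (hψ : HasConductorIntegers ψ) {f : V → ℂ} (hf : ∀ y, y ∉ L → f y = 0) (x : V) {k : V}
    (hk : k ∈ dual u h L) : fourier μ ψ h f (x + k) = fourier μ ψ h f x := by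
  refine integral_congr_ae (Eventually.of_forall fun y => ?_)
  by_cases hy : y ∈ L
  · have h1 := hD.char_trace_eq_one h2 hψ ((hD.mem_dual.mp hk).2 y hy)
    simp only [char_pairing_add_left, h1, mul_one]
  · simp only [hf y hy, zero_mul]

variable [BorelSpace V] [μ.IsAddHaarMeasure]

/-- Translating the variable by a suitable vector of `L` multiplies the integral by a character
value different from one. -/
theorem fourier_eq_zero_of_not_mem_dual (hD : RamifiedDatum c u q)
    (h2 : Module.finrank F E = 2) (hψ : HasConductorIntegers ψ) {f : V → ℂ}
    (htop : ambient L = ⊤) (hf : ∀ y, ∀ k ∈ L, f (y + k) = f y) {x : V}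
    (hx : x ∉ dual u h L) : fourier μ ψ h f x = 0 := by
  have h1 : ∃ v ∈ L, ¬‖h x v‖ ≤ ‖(u : E)‖⁻¹ := by
    by_contra! H
    exact hx (hD.mem_dual.mpr ⟨by rw [htop]; trivial, H⟩)
  obtain ⟨v, hv, hxv⟩ := h1
  obtain ⟨a, ha⟩ := hD.exists_char_trace_ne_one h2 hψ hxv
  have h3 : fourier μ ψ h f x = fourier μ ψ h f x * ψ (Algebra.trace F E (c (a : E) * h x v)) := by
    conv_lhs => rw [fourier, ← integral_add_right_eq_self _ ((a : E) • v)]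
    rw [fourier, ← integral_mul_const]
    refine integral_congr_ae (Eventually.of_forall fun y => ?_)
    have h4 := hf y _ (L.smul_mem a hv)
    rw [integer_smul_def] at h4
    simp only [h4, char_pairing_add_right, pairing_smul_right, mul_assoc]
  by_contra h0
  exact ha (mul_left_cancel₀ h0 (by rw [mul_one]; exact h3.symm))

/-- The Fourier transform of the characteristic function of a lattice. -/
theorem fourier_indicator (hD : RamifiedDatum c u q) (h2 : Module.finrank F E = 2)
    (hψ : HasConductorIntegers ψ) (hL : L.FG) (htop : ambient L = ⊤) (x : V) :
    fourier μ ψ h ((L : Set V).indicator 1) x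
      = (dual u h L : Set V).indicator (fun _ => (μ.real L : ℂ)) x := by
  have hmeas : MeasurableSet (L : Set V) := (hD.isClosed_lattice hL).measurableSet
  by_cases hx : x ∈ dual u h L
  · rw [Set.indicator_of_mem (by exact hx)]
    have h1 : fourier μ ψ h ((L : Set V).indicator 1) x
        = ∫ y, (L : Set V).indicator (fun _ => (1 : ℂ)) y ∂μ := by
      refine integral_congr_ae (Eventually.of_forall fun y => ?_)
      by_cases hy : y ∈ (L : Set V)
      · simp only [Set.indicator_of_mem hy, Pi.one_apply, one_mul]
        exact hD.char_trace_eq_one h2 hψ ((hD.mem_dual.mp hx).2 y hy)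
      · simp only [Set.indicator_of_notMem hy, zero_mul]
    rw [h1, integral_indicator_const _ hmeas]
    simp
  · rw [Set.indicator_of_notMem (by exact hx)]
    refine hD.fourier_eq_zero_of_not_mem_dual h2 hψ htop (fun y k hk => ?_) hx
    exact indicator_one_congr (L.add_mem_iff_left hk)

/-- Fourier inversion for the characteristic function of a lattice. -/
theorem measure_mul_fourier_indicator_dual (hD : RamifiedDatum c u q)
    (h2 : Module.finrank F E = 2) (hψ : HasConductorIntegers ψ) (hμ : IsSelfDualHaar μ ψ h)
    (hL : L.FG) (htop : ambient L = ⊤) (x : V) :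
    (μ.real L : ℂ) * fourier μ ψ h ((dual u h L : Set V).indicator 1) x
      = (L : Set V).indicator 1 x := by
  have h1 := hμ.inversion ((L : Set V).indicator 1)
    (hD.isLocallyConstant_of_invariant hL htop fun y k hk => ?_)
    (hD.hasCompactSupport_of_lattice hL fun y hy => Set.indicator_of_notMem (by exact hy) _) x
  · have h3 : fourier μ ψ h ((L : Set V).indicator 1)
        = fun y => (μ.real L : ℂ) * (dual u h L : Set V).indicator 1 y := by
      funext y
      rw [hD.fourier_indicator h2 hψ hL htop]
      by_cases hy : y ∈ (dual u h L : Set V)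
      · simp only [Set.indicator_of_mem hy, Pi.one_apply, mul_one]
      · simp only [Set.indicator_of_notMem hy, mul_zero]
    have h4 : (L : Set V).indicator (1 : V → ℂ) (-x) = (L : Set V).indicator 1 x :=
      indicator_one_congr neg_mem_iff
    rw [← h4, ← h1, h3, fourier, fourier, ← integral_const_mul]
    simp only [mul_assoc]
  · exact indicator_one_congr (L.add_mem_iff_left hk)

end RamifiedDatum

end FourierLattices

/-! ### The weighted sum of characteristic functions of duals and its Fourier transform. -/

section FiberTransform

variable {F : Type*} [NontriviallyNormedField F]
variable {E : Type*} [NontriviallyNormedField E] [IsUltrametricDist E] [NormedAlgebra F E]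
variable {c : E ≃ₐ[F] E} {u : Valued.integer E} {q : ℕ}
variable {V : Type*} [AddCommGroup V] [Module E V] {h : Pairing c V}
variable {L K D : Submodule (Valued.integer E) V} {m : ℕ} {ξ : V}
variable {ψ : AddChar F ℂ}

/-- The weighted sum of the Fourier transforms of the characteristic functions of the integral
lattices over `K`. -/
def fiberTransform [MeasurableSpace V] (q : ℕ) (u : Valued.integer E) (h : Pairing c V)
    (μ : Measure V) (K : Submodule (Valued.integer E) V) (ξ : V) : ℂ :=
  ∑' L : fiberLattices u h K, (dual u h (L : Submodule (Valued.integer E) V) : Set V).indicator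
    (fun _ => (fiberWeight q u h K L : ℂ) * (μ.real (L : Set V) : ℂ)) ξ

theorem norm_fiberWeight_le :
    ‖(fiberWeight q u h K L : ℂ)‖ ≤ 1 + (q : ℝ) ^ (latticeType u h K - 1) := by
  rw [fiberWeight]
  split_ifs
  · push_cast
    refine (norm_sub_le _ _).trans ?_
    rw [norm_one, norm_pow, Complex.norm_natCast]
  · have : (0 : ℝ) ≤ (q : ℝ) ^ (latticeType u h K - 1) := by positivity
    simp

namespace RamifiedDatum

theorem dual_anti (hD : RamifiedDatum c u q) {L' : Submodule (Valued.integer E) V}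
    (hle : L ≤ L') (htop : ambient L = ⊤) : dual u h L' ≤ dual u h L := fun x hx => by
  refine hD.mem_dual.mpr ⟨by rw [htop]; trivial, fun y hy => ?_⟩
  exact (hD.mem_dual.mp hx).2 y (hle hy)

variable [TopologicalSpace V] [IsTopologicalAddGroup V] [ContinuousSMul E V] [T2Space V]
variable [FiniteDimensional E V] [MeasurableSpace V] [BorelSpace V]
variable {μ : Measure V} [μ.IsAddHaarMeasure]

theorem mem_bounding_of_mem_fiberLattices (hD : RamifiedDatum c u q) (hh : IsHermitianSpace h)
    (hDle : ∀ x : V, (∀ v ∈ K, ‖h x v‖ ≤ ‖(u : E)‖⁻¹) → ‖h x x‖ ≤ 1 → x ∈ D)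
    (hL : L ∈ fiberLattices u h K) : L ≤ D := fun x hx => by
  obtain ⟨h1, h2⟩ := hD.norm_le_of_mem_fiberLattices hh hL hx
  exact hDle x h1 h2

theorem summable_norm_weight (hD : RamifiedDatum c u q) (hh : IsHermitianSpace h)
    (hK : IsIntegralHyperlattice u h m K) :
    Summable fun L : fiberLattices u h K =>
      ‖(fiberWeight q u h K L : ℂ) * (μ.real (L : Set V) : ℂ)‖ := by
  refine Summable.of_nonneg_of_le (fun _ => norm_nonneg _) (fun L => ?_)
    ((hD.summable_measureReal (μ := μ) hh hK).mul_left (1 + (q : ℝ) ^ (latticeType u h K - 1)))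
  rw [norm_mul, Complex.norm_real, Real.norm_of_nonneg measureReal_nonneg]
  exact mul_le_mul_of_nonneg_right norm_fiberWeight_le measureReal_nonneg

/-- The weight is `1`, minus `q ^ (t - 1)` in type `t + 1`, so the real part of the work is the
volume identity `tsum_measure_eq`; summability allows splitting the series. -/
theorem fiberTransform_eq_zero_of_not_mem (hD : RamifiedDatum c u q) (hh : IsHermitianSpace h)
    (hK : IsIntegralHyperlattice u h m K) (hξK : ξ ∉ ambient K) (hξ : 1 < ‖h ξ ξ‖) :
    fiberTransform q u h μ K ξ = 0 := by
  classical
  have h1 := congrArg ENNReal.toReal (hD.tsum_measure_eq (μ := μ) hh hK hξK hξ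
    (fun L => ξ ∈ dual u h L) fun L => Iff.rfl)
  have hne : ∀ (p : Prop) [Decidable p] (L : fiberLattices u h K),
      (if p then μ (L : Set V) else 0) ≠ ⊤ := fun p _ L => by
    split_ifs
    · exact hD.measure_lattice_ne_top L.2.1
    · exact ENNReal.zero_ne_top
  rw [ENNReal.toReal_mul, ENNReal.tsum_toReal_eq fun L => hne _ L,
    ENNReal.tsum_toReal_eq fun L => hne _ L] at h1
  have hite : ∀ (p : Prop) [Decidable p] (L : fiberLattices u h K),
      (if p then μ (L : Set V) else 0).toReal = if p then μ.real (L : Set V) else 0 :=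
    fun p _ L => by split_ifs <;> rfl
  simp only [hite, ENNReal.toReal_pow, ENNReal.toReal_natCast] at h1
  have hs := hD.summable_measureReal (μ := μ) hh hK
  have hsum : ∀ p : fiberLattices u h K → Prop, ∀ [DecidablePred p],
      Summable fun L : fiberLattices u h K => if p L then μ.real (L : Set V) else 0 :=
    fun p _ => Summable.of_nonneg_of_le (fun L => by
      split_ifs
      · exact measureReal_nonneg
      · exact le_rfl) (fun L => by
      split_ifs
      · exact le_rfl
      · exact measureReal_nonneg) hs
  have h2 : fiberTransform q u h μ K ξ = ((∑' L : fiberLattices u h K,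
      ((if ξ ∈ dual u h (L : Submodule (Valued.integer E) V) then μ.real (L : Set V) else 0)
        - (q : ℝ) ^ (latticeType u h K - 1) *
          (if ξ ∈ dual u h (L : Submodule (Valued.integer E) V) ∧
            latticeType u h (L : Submodule (Valued.integer E) V) = latticeType u h K + 1
            then μ.real (L : Set V) else 0)) : ℝ) : ℂ) := by
    rw [Complex.ofReal_tsum]
    refine tsum_congr fun L => ?_
    by_cases h3 : ξ ∈ dual u h (L : Submodule (Valued.integer E) V)
    · rw [Set.indicator_of_mem (by exact h3), fiberWeight]
      by_cases h4 : latticeType u h (L : Submodule (Valued.integer E) V)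
          = latticeType u h K + 1
      · simp only [h3, h4, and_self, if_true]
        push_cast
        ring
      · simp only [h3, h4, and_false, if_true, if_false]
        push_cast
        ring
    · rw [Set.indicator_of_notMem (by exact h3)]
      simp [h3]
  rw [h2, Summable.tsum_sub (hsum _) ((hsum _).mul_left _), tsum_mul_left, h1, sub_self,
    Complex.ofReal_zero]

/-- All lattices over `K` lie in `D`, so all their duals contain the dual of `D`. -/
theorem fiberTransform_add (hD : RamifiedDatum c u q) (hh : IsHermitianSpace h)
    (hDle : ∀ x : V, (∀ v ∈ K, ‖h x v‖ ≤ ‖(u : E)‖⁻¹) → ‖h x x‖ ≤ 1 → x ∈ D)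
    {k : V} (hk : k ∈ dual u h D) :
    fiberTransform q u h μ K (ξ + k) = fiberTransform q u h μ K ξ := by
  classical
  refine tsum_congr fun L => ?_
  have h1 := hD.dual_anti (hD.mem_bounding_of_mem_fiberLattices hh hDle L.2) L.2.2.1 hk
  have h2 := Submodule.add_mem_iff_left (dual u h (L : Submodule (Valued.integer E) V))
    (x := ξ) h1
  simp only [Set.indicator_apply, SetLike.mem_coe, h2]

/-- Off the hyperplane this is the key vanishing statement. A vector of the hyperplane is first
moved off it by a small multiple of the normal, which changes neither the transform nor the
nonintegrality of the norm. -/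
theorem norm_self_le_of_fiberTransform_ne_zero (hD : RamifiedDatum c u q)
    (hh : IsHermitianSpace h) (hK : IsIntegralHyperlattice u h m K)
    (hξ : fiberTransform q u h μ K ξ ≠ 0) :
    (∀ v ∈ K, ‖h ξ v‖ ≤ ‖(u : E)‖⁻¹) ∧ ‖h ξ ξ‖ ≤ 1 := by
  obtain ⟨D, hDfg, hDtop, -, hDle⟩ := hD.exists_bounding_lattice hh hK
  constructor
  · by_contra! H
    obtain ⟨v, hv, hξv⟩ := H
    refine hξ ?_
    have h1 : ∀ L : fiberLattices u h K,
        ξ ∉ (dual u h (L : Submodule (Valued.integer E) V) : Set V) := fun L hL => by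
      exact not_le.mpr hξv ((hD.mem_dual.mp hL).2 v (le_of_mem_fiberLattices L.2 hv))
    simp only [fiberTransform, Set.indicator_of_notMem (h1 _), tsum_zero]
  · by_contra! H
    by_cases hξK : ξ ∈ ambient K
    swap
    · exact hξ (hD.fiberTransform_eq_zero_of_not_mem hh hK hξK H)
    obtain ⟨e, he, hee⟩ := hD.exists_normal hh hK
    obtain ⟨N, hN⟩ := hD.exists_pow_smul_mem_dual (h := h) hDfg hDtop e
    obtain ⟨N', hN'⟩ := hD.exists_pow_mul_le_one ‖h e e‖
    -- `N` puts the perturbation in the dual of `D`; `N'` makes its own norm integral.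
    have hk : (u : E) ^ (N' + N) • e ∈ dual u h D := by
      rw [pow_add, mul_smul]
      exact Submodule.smul_mem (dual u h D) (u ^ N') hN
    have hw : (u : E) ^ (N' + N) ≠ 0 := pow_ne_zero _ hD.coe_ne_zero
    rw [← hD.fiberTransform_add hh hDle hk] at hξ
    refine hξ (hD.fiberTransform_eq_zero_of_not_mem hh hK (fun H2 => hee ?_) ?_)
    · have h1 := sub_mem H2 hξK
      rw [add_sub_cancel_left, Submodule.smul_mem_iff _ hw] at h1
      exact (he e).mpr h1
    · have h1 : h ξ e = 0 := (he ξ).mpr hξK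
      have h2 : h e ξ = 0 := by rw [hh.symm ξ e, h1, map_zero]
      rw [pairing_add_self]
      simp only [pairing_smul_left, pairing_smul_right, h1, h2, mul_zero, add_zero]
      by_contra! H3
      refine not_le.mpr H ?_
      have h4 : ‖(u : E) ^ (N' + N) * (c ((u : E) ^ (N' + N)) * h e e)‖ ≤ 1 := by
        rw [norm_mul, norm_mul, hD.norm_conj, norm_pow]
        have h5 : ‖(u : E)‖ ^ (N' + N) * ‖h e e‖ ≤ 1 := by
          refine le_trans ?_ hN'
          gcongr ?_ * _
          exact pow_le_pow_of_le_one (norm_nonneg _) hD.norm_lt_one.le (Nat.le_add_right _ _)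
        exact mul_le_one₀ (pow_le_one₀ (norm_nonneg _) hD.norm_lt_one.le) (by positivity) h5
      have h6 := norm_sub_le_of_le' H3 h4
      rwa [mul_left_comm, add_sub_cancel_right] at h6

theorem isLocallyConstant_fiberTransform (hD : RamifiedDatum c u q) (hh : IsHermitianSpace h)
    (hK : IsIntegralHyperlattice u h m K) : IsLocallyConstant (fiberTransform q u h μ K) := by
  obtain ⟨D, hDfg, hDtop, -, hDle⟩ := hD.exists_bounding_lattice hh hK
  exact hD.isLocallyConstant_of_invariant (hD.fg_dual_of_ambient_eq_top hh hDfg hDtop)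
    (hD.ambient_dual_eq_top hDfg hDtop) fun x k hk => hD.fiberTransform_add hh hDle hk

theorem hasCompactSupport_fiberTransform (hD : RamifiedDatum c u q) (hh : IsHermitianSpace h)
    (hK : IsIntegralHyperlattice u h m K) : HasCompactSupport (fiberTransform q u h μ K) := by
  obtain ⟨D, hDfg, -, -, hDle⟩ := hD.exists_bounding_lattice hh hK
  refine hD.hasCompactSupport_of_lattice hDfg fun x hx => ?_
  by_contra h0
  obtain ⟨h1, h2⟩ := hD.norm_self_le_of_fiberTransform_ne_zero hh hK h0
  exact hx (hDle x h1 h2)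

theorem isLocallyConstant_fourier_fiberTransform (hD : RamifiedDatum c u q)
    (h2 : Module.finrank F E = 2) (hψ : HasConductorIntegers ψ) (hh : IsHermitianSpace h)
    (hK : IsIntegralHyperlattice u h m K) :
    IsLocallyConstant (fourier μ ψ h (fiberTransform q u h μ K)) := by
  obtain ⟨D, hDfg, hDtop, -, hDle⟩ := hD.exists_bounding_lattice hh hK
  refine hD.isLocallyConstant_of_invariant (hD.fg_dual_of_ambient_eq_top hh hDfg hDtop)
    (hD.ambient_dual_eq_top hDfg hDtop) fun x k hk =>
      hD.fourier_add_of_mem_dual h2 hψ (fun y hy => ?_) x hk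
  by_contra h0
  obtain ⟨h1, h3⟩ := hD.norm_self_le_of_fiberTransform_ne_zero hh hK h0
  exact hy (hDle y h1 h3)

theorem hasCompactSupport_fourier_fiberTransform (hD : RamifiedDatum c u q)
    (h2 : Module.finrank F E = 2) (hψ : HasConductorIntegers ψ) (hh : IsHermitianSpace h)
    (hK : IsIntegralHyperlattice u h m K) :
    HasCompactSupport (fourier μ ψ h (fiberTransform q u h μ K)) := by
  obtain ⟨D, hDfg, hDtop, -, hDle⟩ := hD.exists_bounding_lattice hh hK
  have hfg := hD.fg_dual_of_ambient_eq_top hh hDfg hDtop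
  have htop := hD.ambient_dual_eq_top (h := h) hDfg hDtop
  exact hD.hasCompactSupport_of_lattice (hD.fg_dual_of_ambient_eq_top hh hfg htop) fun x hx =>
    hD.fourier_eq_zero_of_not_mem_dual h2 hψ htop
      (fun y k hk => hD.fiberTransform_add hh hDle hk) hx

/-- The Fourier transform of `fiberTransform` is the weighted count of the integral lattices over
`K` that contain a given vector. -/
theorem fourier_fiberTransform (hD : RamifiedDatum c u q) (h2 : Module.finrank F E = 2)
    (hψ : HasConductorIntegers ψ) (hh : IsHermitianSpace h) (hμ : IsSelfDualHaar μ ψ h)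
    (hK : IsIntegralHyperlattice u h m K) {x : V} (hx : x ∉ ambient K) :
    fourier μ ψ h (fiberTransform q u h μ K) x
      = ∑' L : fiberLattices u h K,
        ((L : Submodule (Valued.integer E) V) : Set V).indicator
          (fun _ => (fiberWeight q u h K L : ℂ)) x := by
  have := (hD.countable_fiberLattices hh hK).to_subtype
  obtain ⟨D, hDfg, hDtop, -, hDle⟩ := hD.exists_bounding_lattice hh hK
  obtain ⟨N, hN⟩ := hD.exists_pow_smul_mem_dual (h := h) hDfg hDtop x
  -- A small multiple of `x` whose pairings with `D` have valuation at least `-1`. Replacing each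
  -- `L` by `L + ⟨z⟩` confines all duals to the dual of the fixed lattice `K + ⟨z⟩`, and so supplies
  -- the domination needed to exchange sum and integral. The exponent is `N + 1` so that it is
  -- positive even when `N = 0`.
  set z : V := (u : E) ^ (N + 1) • x with hz
  have hzD : ∀ y ∈ D, ‖h y z‖ ≤ ‖(u : E)‖⁻¹ := fun y hy => by
    have h3 : z ∈ dual u h D := by
      rw [hz, pow_succ', mul_smul]
      exact Submodule.smul_mem (dual u h D) u hN
    rw [hD.norm_pairing_comm hh]
    exact (hD.mem_dual.mp h3).2 y hy
  have hzK : z ∉ ambient K := fun H =>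
    hx ((Submodule.smul_mem_iff _ (pow_ne_zero _ hD.coe_ne_zero)).mp H)
  obtain ⟨b, hb⟩ := hD.exists_isLatticeBasis hK.fg hK.finrank_ambient
  set Q := K ⊔ Submodule.span (Valued.integer E) {z} with hQ
  have hQfg : Q.FG := hK.fg.sup (Submodule.fg_span_singleton z)
  have hQtop : ambient Q = ⊤ := (hb.cons hzK).ambient_eq_top hK.finrank_space
  have hPfg : ∀ L : fiberLattices u h K,
      ((L : Submodule (Valued.integer E) V) ⊔ Submodule.span (Valued.integer E) {z}).FG :=
    fun L => L.2.1.sup (Submodule.fg_span_singleton z)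
  have hPtop : ∀ L : fiberLattices u h K,
      ambient ((L : Submodule (Valued.integer E) V) ⊔ Submodule.span (Valued.integer E) {z}) = ⊤ :=
    fun L => ambient_eq_top_of_le le_sup_left L.2.2.1
  have hdual : ∀ (L : fiberLattices u h K) (y : V),
      y ∈ dual u h ((L : Submodule (Valued.integer E) V) ⊔
        Submodule.span (Valued.integer E) {z}) ↔
      y ∈ dual u h (L : Submodule (Valued.integer E) V) ∧ ‖h y z‖ ≤ ‖(u : E)‖⁻¹ := fun L y =>
    hD.mem_dual_sup_span (by rw [L.2.2.1]; trivial)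
  let a : fiberLattices u h K → ℂ := fun L =>
    (fiberWeight q u h K L : ℂ) * (μ.real (L : Set V) : ℂ)
  let P : fiberLattices u h K → Submodule (Valued.integer E) V := fun L =>
    (L : Submodule (Valued.integer E) V) ⊔ Submodule.span (Valued.integer E) {z}
  let G : fiberLattices u h K → V → ℂ := fun L y =>
    a L * ((dual u h (P L) : Set V).indicator 1 y * ψ (Algebra.trace F E (h x y)))
  have hpoint : ∀ y, fiberTransform q u h μ K y * ψ (Algebra.trace F E (h x y))
      = ∑' L, G L y := by
    intro y
    -- On vectors pairing suitably with `z` the two duals agree. Elsewhere the transform vanishes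
    -- because it is supported in `D`, and the new duals contain nothing.
    have h3 : fiberTransform q u h μ K y
        = ∑' L, a L * (dual u h (P L) : Set V).indicator 1 y := by
      by_cases hy : ‖h y z‖ ≤ ‖(u : E)‖⁻¹
      · refine tsum_congr fun L => ?_
        by_cases hyL : y ∈ dual u h (L : Submodule (Valued.integer E) V)
        · rw [Set.indicator_of_mem (by exact hyL),
            Set.indicator_of_mem (by exact (hdual L y).mpr ⟨hyL, hy⟩), Pi.one_apply, mul_one]
        · rw [Set.indicator_of_notMem (by exact hyL),
            Set.indicator_of_notMem (by exact fun H => hyL ((hdual L y).mp H).1), mul_zero]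
      · have h4 : fiberTransform q u h μ K y = 0 := by
          by_contra h0
          obtain ⟨h5, h6⟩ := hD.norm_self_le_of_fiberTransform_ne_zero hh hK h0
          exact hy (hzD y (hDle y h5 h6))
        have h5 : ∀ L, a L * (dual u h (P L) : Set V).indicator 1 y = 0 := fun L => by
          rw [Set.indicator_of_notMem (by exact fun H => hy ((hdual L y).mp H).2), mul_zero]
        rw [h4]
        simp only [h5, tsum_zero]
    rw [h3, ← tsum_mul_right]
    exact tsum_congr fun L => by ring
  have hcont := hD.continuous_char_pairing h2 hψ hh x
  have hcompact : ∀ {M : Submodule (Valued.integer E) V}, M.FG → ambient M = ⊤ →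
      IsCompact (dual u h M : Set V) := fun hM hMtop => by
    obtain ⟨b', hb'⟩ := hD.exists_isLatticeBasis (hD.fg_dual_of_ambient_eq_top hh hM hMtop) rfl
    exact hD.isCompact_lattice hb'
  have hind : ∀ (M : Submodule (Valued.integer E) V) (y : V),
      (dual u h M : Set V).indicator 1 y * ψ (Algebra.trace F E (h x y))
        = (dual u h M : Set V).indicator (fun y => ψ (Algebra.trace F E (h x y))) y := fun M y => by
    by_cases hy : y ∈ (dual u h M : Set V)
    · simp only [Set.indicator_of_mem hy, Pi.one_apply, one_mul]
    · simp only [Set.indicator_of_notMem hy, zero_mul]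
  obtain ⟨C, hC⟩ := (hcompact hQfg hQtop).exists_bound_of_continuousOn hcont.continuousOn
  have hint : ∀ L, Integrable (G L) μ := fun L => by
    refine Integrable.const_mul ?_ _
    simp only [hind]
    exact (hcont.continuousOn.integrableOn_compact (hcompact (hPfg L) (hPtop L))).integrable_indicator
      hD.measurableSet_dual
  have hsum : Summable fun L => ∫ y, ‖G L y‖ ∂μ := by
    refine Summable.of_nonneg_of_le (fun L => integral_nonneg fun y => norm_nonneg _)
      (fun L => ?_) ((hD.summable_norm_weight (μ := μ) hh hK).mul_right
        (C * μ.real (dual u h Q : Set V)))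
    have h3 : ∀ y, ‖G L y‖ ≤ (dual u h Q : Set V).indicator (fun _ => ‖a L‖ * C) y := fun y => by
      by_cases hy : y ∈ dual u h (P L)
      · have hyQ : y ∈ dual u h Q := hD.dual_anti
          (sup_le_sup_right (le_of_mem_fiberLattices L.2) _) hQtop hy
        rw [Set.indicator_of_mem (by exact hyQ)]
        simp only [G]
        rw [hind, Set.indicator_of_mem (by exact hy), norm_mul]
        exact mul_le_mul_of_nonneg_left (hC y hyQ) (norm_nonneg _)
      · simp only [G]
        rw [hind, Set.indicator_of_notMem (by exact hy), mul_zero, norm_zero]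
        refine Set.indicator_nonneg (fun y' hy' => ?_) y
        exact mul_nonneg (norm_nonneg _) ((norm_nonneg _).trans (hC y' hy'))
    calc ∫ y, ‖G L y‖ ∂μ ≤ ∫ y, (dual u h Q : Set V).indicator (fun _ => ‖a L‖ * C) y ∂μ := by
          refine integral_mono (hint L).norm ?_ h3
          exact (integrableOn_const (hcompact hQfg hQtop).measure_ne_top).integrable_indicator
            hD.measurableSet_dual
      _ = ‖a L‖ * (C * μ.real (dual u h Q : Set V)) := by
          rw [integral_indicator_const _ hD.measurableSet_dual, smul_eq_mul]
          ring
  have hswap := integral_tsum_of_summable_integral_norm hint hsum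
  rw [fourier, integral_congr_ae (Eventually.of_forall hpoint), ← hswap]
  refine tsum_congr fun L => ?_
  have h3 := hD.measure_mul_fourier_indicator_dual h2 hψ hμ (hPfg L) (hPtop L) x
  have h4 : ∫ y, G L y ∂μ = a L * fourier μ ψ h ((dual u h (P L) : Set V).indicator 1) x :=
    integral_const_mul _ _
  rw [h4]
  have hne : ∀ {M : Submodule (Valued.integer E) V}, M.FG → ambient M = ⊤ →
      (μ.real (M : Set V) : ℂ) ≠ 0 := fun hM hMtop => by
    rw [ne_eq, Complex.ofReal_eq_zero, measureReal_def, ENNReal.toReal_eq_zero_iff]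
    rintro (H | H)
    · exact hD.measure_lattice_ne_zero hM hMtop H
    · exact hD.measure_lattice_ne_top hM H
  -- Nakayama: a positive power of `u` times `x` contributes nothing new, since `1 - w u ^ (N + 1)`
  -- is a unit.
  have hxP : x ∈ P L ↔ x ∈ (L : Submodule (Valued.integer E) V) := by
    refine ⟨fun H => ?_, fun H => Submodule.mem_sup_left H⟩
    obtain ⟨l, hl, w, hlw⟩ := mem_sup_span_iff.mp H
    have h5 : ‖(w : E) * (u : E) ^ (N + 1)‖ < 1 := by
      rw [norm_mul, norm_pow]
      exact mul_lt_one_of_nonneg_of_lt_one_right (norm_coe_integer_le w)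
        (pow_nonneg (norm_nonneg _) _)
        (pow_lt_one₀ (norm_nonneg _) hD.norm_lt_one (Nat.succ_ne_zero N))
    have h6 : ‖1 - (w : E) * (u : E) ^ (N + 1)‖ = 1 := by
      rw [sub_eq_add_neg, IsUltrametricDist.norm_add_eq_max_of_norm_ne_norm]
      · rw [norm_neg, norm_one, max_eq_left h5.le]
      · rw [norm_neg, norm_one]
        exact h5.ne'
    have h7 : (1 - (w : E) * (u : E) ^ (N + 1)) • x = l := by
      rw [sub_smul, one_smul, mul_smul, ← hz]
      nth_rewrite 1 [← hlw]
      abel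
    have h8 : 1 - (w : E) * (u : E) ^ (N + 1) ≠ 0 := norm_pos_iff.mp (by rw [h6]; exact one_pos)
    have h9 : ‖(1 - (w : E) * (u : E) ^ (N + 1))⁻¹‖ ≤ 1 := by rw [norm_inv, h6, inv_one]
    rw [← inv_smul_smul₀ h8 x, h7, ← coe_toInteger h9]
    exact Submodule.smul_mem _ _ hl
  -- If `x ∈ L`, then `L + ⟨z⟩ = L` and the volumes cancel; otherwise the Fourier value is zero, and
  -- the different volume of `L + ⟨z⟩` does not matter.
  by_cases hxL : x ∈ (L : Submodule (Valued.integer E) V)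
  · have hPL : P L = (L : Submodule (Valued.integer E) V) := by
      refine sup_eq_left.mpr ?_
      rw [Submodule.span_singleton_le_iff_mem]
      exact Submodule.smul_mem _ (u ^ (N + 1)) hxL
    change (μ.real (P L : Set V) : ℂ)
      * fourier μ ψ h ((dual u h (P L) : Set V).indicator 1) x = _ at h3
    rw [Set.indicator_of_mem (by exact hxP.mpr hxL), Pi.one_apply] at h3
    rw [Set.indicator_of_mem (by exact hxL)]
    have h5 : a L = (fiberWeight q u h K L : ℂ) * (μ.real (P L : Set V) : ℂ) := by rw [hPL]
    rw [h5, mul_assoc, h3, mul_one]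
  · rw [Set.indicator_of_notMem (by exact fun H => hxL (hxP.mp H))] at h3
    rw [(mul_eq_zero.mp h3).resolve_left (hne (hPfg L) (hPtop L)), mul_zero,
      Set.indicator_of_notMem (by exact hxL)]

end RamifiedDatum

end FiberTransform

/-! ### Decomposition of the vertical part and its extension across the hyperplane. -/

section VerticalPart

variable {F : Type*} [NontriviallyNormedField F] [IsUltrametricDist F]
variable {E : Type*} [NontriviallyNormedField E] [IsUltrametricDist E] [NormedAlgebra F E]
variable {c : E ≃ₐ[F] E} {u : Valued.integer E}
variable {V : Type*} [AddCommGroup V] [Module E V] {h : Pairing c V}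
variable {L K Lb : Submodule (Valued.integer E) V} {m r q : ℕ} {ψ : AddChar F ℂ}

theorem typeWeight_of_le_two {t : ℕ} (ht : t ≤ 2) : typeWeight q t = 1 := by
  have h1 : Finset.Ico 1 (t / 2) = ∅ := Finset.Ico_eq_empty (by omega)
  rw [typeWeight, h1, Finset.prod_empty]

/-- Passing from `t - 1` to `t + 1` adds the single factor with `2 j = t - 1`. For `t = 1` this
would be `j = 0`, which the weight omits; hence the exclusion. -/
theorem typeWeight_succ {t : ℕ} (ht : Odd t) (ht1 : t ≠ 1) :
    typeWeight q (t + 1) = typeWeight q (t - 1) * (1 - (q : ℤ) ^ (t - 1)) := by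
  obtain ⟨i, rfl⟩ := ht
  have h1 : (2 * i + 1 + 1) / 2 = i + 1 := by omega
  have h2 : (2 * i + 1 - 1) / 2 = i := by omega
  have h3 : 2 * i + 1 - 1 = 2 * i := by omega
  rw [typeWeight, typeWeight, h1, h2, h3, Finset.prod_Ico_succ_top (by omega)]

/-- The integral lattices in the hyperplane spanned by `Lb` that contain `Lb`. -/
def hyperplaneLattices (u : Valued.integer E) (h : Pairing c V)
    (Lb : Submodule (Valued.integer E) V) : Set (Submodule (Valued.integer E) V) :=
  {K | Lb ≤ K ∧ IsIntegralLattice u h K ∧ K ≤ (ambient Lb).restrictScalars (Valued.integer E)}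

theorem ambient_of_mem_hyperplaneLattices (hK : K ∈ hyperplaneLattices u h Lb) :
    ambient K = ambient Lb :=
  le_antisymm (ambient_le_iff.mpr fun _ hx => hK.2.2 hx) (ambient_mono hK.1)

namespace RamifiedDatum

theorem le_dual_of_mem_hyperplaneLattices (hD : RamifiedDatum c u q)
    (hK : K ∈ hyperplaneLattices u h Lb) : K ≤ dual u h Lb := fun x hx =>
  hD.mem_dual.mpr ⟨hK.2.2 hx, fun y hy => hD.isIntegralLattice_iff.mp hK.2.1 x hx y (hK.1 hy)⟩

theorem finite_hyperplaneLattices (hD : RamifiedDatum c u q)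
    (hLb : IsHermitianModule h Lb m) : (hyperplaneLattices u h Lb).Finite := by
  obtain ⟨b, hb⟩ := hD.exists_isLatticeBasis hLb.fg hLb.rank_eq
  obtain ⟨a, ha⟩ := hD.exists_pow_smul_dual hb hLb.nondegenerate
  exact (hD.finite_between (hD.fg_dual hb hLb.nondegenerate) ha).subset fun K hK =>
    ⟨hK.1, hD.le_dual_of_mem_hyperplaneLattices hK⟩

theorem isIntegralHyperlattice_of_mem (hD : RamifiedDatum c u q) (hLb : IsHermitianModule h Lb m)
    (hm : Odd m) (hV : Module.finrank E V = m + 1) (hK : K ∈ hyperplaneLattices u h Lb) :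
    IsIntegralHyperlattice u h m K := by
  obtain ⟨b, hb⟩ := hD.exists_isLatticeBasis hLb.fg hLb.rank_eq
  have hamb := ambient_of_mem_hyperplaneLattices hK
  refine ⟨hD.fg_of_le (hD.fg_dual hb hLb.nondegenerate) (hD.le_dual_of_mem_hyperplaneLattices hK),
    hK.2.1, by rw [hamb, hLb.rank_eq], ?_, hm, hV⟩
  rw [NondegenerateOn, hamb]
  exact hLb.nondegenerate

variable [FiniteDimensional E V]

/-- The type of `K` is odd, and a lattice over `K` has type one more or one less; in the first case
`typeWeight_succ` supplies the factor `1 - q ^ (t - 1)`. -/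
theorem typeWeight_eq_mul_fiberWeight (hD : RamifiedDatum c u q) (hh : IsHermitianSpace h)
    (hK : IsIntegralHyperlattice u h m K) (hK1 : latticeType u h K ≠ 1)
    (hL : L ∈ fiberLattices u h K) :
    typeWeight q (latticeType u h L)
      = typeWeight q (latticeType u h K - 1) * fiberWeight q u h K L := by
  obtain ⟨b, hb⟩ := hD.exists_isLatticeBasis hK.fg hK.finrank_ambient
  have htype := hD.latticeType_eq hh hK.integral hb hK.nondegenerate
  have hodd : Odd (latticeType u h K) := by
    have h1 := hD.even_add_corank hh hK.integral hb
    rw [htype, ← Nat.not_even_iff_odd]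
    rw [Nat.even_add] at h1
    exact fun H => Nat.not_even_iff_odd.mpr hK.odd (h1.mpr H)
  rw [fiberWeight]
  split_ifs with h1
  · rw [h1, typeWeight_succ hodd hK1]
  · obtain ⟨Y, hY, rfl⟩ := hD.exists_generator hh hK hL
    obtain ⟨h2, h3⟩ := hD.latticeType_sup_span hh hK hb hY hL
    have h4 := h3 fun H => h1 (by rw [htype]; exact h2 H)
    rw [htype, ← h4, Nat.add_sub_cancel, mul_one]

theorem latticeType_le (hD : RamifiedDatum c u q) (hh : IsHermitianSpace h)
    (hK : IsIntegralHyperlattice u h m K) (hL : L ∈ fiberLattices u h K) :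
    latticeType u h L ≤ latticeType u h K + 1 := by
  obtain ⟨b, hb⟩ := hD.exists_isLatticeBasis hK.fg hK.finrank_ambient
  have htype := hD.latticeType_eq hh hK.integral hb hK.nondegenerate
  obtain ⟨Y, hY, rfl⟩ := hD.exists_generator hh hK hL
  obtain ⟨h2, h3⟩ := hD.latticeType_sup_span hh hK hb hY hL
  by_cases H : Y ∈ nearDual h K
  · rw [h2 H, htype]
  · have := h3 H
    omega

theorem inf_mem_hyperplaneLattices (hD : RamifiedDatum c u q) {x : V}
    (hL : L ∈ integralOverlattices u h (Lb ⊔ Submodule.span (Valued.integer E) {x})) :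
    L ⊓ (ambient Lb).restrictScalars (Valued.integer E) ∈ hyperplaneLattices u h Lb := by
  refine ⟨le_inf (le_sup_left.trans hL.1) fun y hy => mem_ambient hy, ?_, inf_le_right⟩
  rw [hD.isIntegralLattice_iff]
  exact fun y hy z hz => hD.isIntegralLattice_iff.mp hL.2 y hy.1 z hz.1

/-- The vertical part, as a sum over the integral lattices in the hyperplane. -/
theorem derivDenVert_eq (hD : RamifiedDatum c u (residueCard F)) (hh : IsHermitianSpace h)
    (hV : Module.finrank E V = 2 * r) (hns : ¬IsSplit h) (hLb : IsHermitianModule h Lb m)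
    (hm : Odd m) (hmr : m + 1 = 2 * r) (T : Finset (Submodule (Valued.integer E) V))
    (hT : ∀ K, K ∈ T ↔ K ∈ hyperplaneLattices u h Lb ∧ latticeType u h K ≠ 1) {x : V}
    (hx : x ∉ ambient Lb) :
    (derivDenVert u h r Lb x : ℂ)
      = ∑ K ∈ T, 2 * (typeWeight (residueCard F) (latticeType u h K - 1) : ℂ)
        * ∑' L : fiberLattices u h K, ((L : Submodule (Valued.integer E) V) : Set V).indicator
          (fun _ => (fiberWeight (residueCard F) u h K L : ℂ)) x := by
  classical
  have hVm : Module.finrank E V = m + 1 := by rw [hV, hmr]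
  obtain ⟨b, hb⟩ := hD.exists_isLatticeBasis hLb.fg hLb.rank_eq
  set M := Lb ⊔ Submodule.span (Valued.integer E) {x} with hM
  have hMfg : M.FG := hLb.fg.sup (Submodule.fg_span_singleton x)
  have hMtop : ambient M = ⊤ := (hb.cons hx).ambient_eq_top hVm
  obtain ⟨b₀, hb₀⟩ := hD.exists_isLatticeBasis (m := 2 * r) hMfg (by rw [hMtop, finrank_top, hV])
  have hfin := hD.finite_integralOverlattices hh hb₀ hMtop
  set S := hfin.toFinset with hS
  have hSmem : ∀ L, L ∈ S ↔ L ∈ integralOverlattices u h M := fun L => hfin.mem_toFinset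
  have hMle : ∀ L, M ≤ L ↔ Lb ≤ L ∧ x ∈ L := fun L => by
    rw [hM, sup_le_iff, Submodule.span_singleton_le_iff_mem]
  let π : Submodule (Valued.integer E) V → Submodule (Valued.integer E) V := fun L =>
    L ⊓ (ambient Lb).restrictScalars (Valued.integer E)
  have hfiber : ∀ K ∈ hyperplaneLattices u h Lb, ∀ L,
      (L ∈ S ∧ π L = K) ↔ (L ∈ fiberLattices u h K ∧ x ∈ L) := by
    intro K hK L
    have hamb := ambient_of_mem_hyperplaneLattices hK
    rw [hSmem]
    constructor
    · rintro ⟨hL, hLK⟩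
      refine ⟨⟨hD.fg_of_mem_integralOverlattices hh hb₀ hMtop hL,
        ambient_eq_top_of_le hL.1 hMtop, hL.2, ?_⟩, ((hMle L).mp hL.1).2⟩
      rw [hamb]
      exact hLK
    · rintro ⟨hL, hxL⟩
      refine ⟨⟨(hMle L).mpr ⟨hK.1.trans (le_of_mem_fiberLattices hL), hxL⟩, hL.2.2.1⟩, ?_⟩
      have h1 := hL.2.2.2
      rwa [hamb] at h1
  -- Over a `K` of type one, lattices have type at most two and weight one, so the horizontal part
  -- is exactly the corresponding part of `∂Den`.
  have hhor : derivDenHor u h Lb x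
      = 2 * ∑ L ∈ S with latticeType u h (π L) = 1,
        typeWeight (residueCard F) (latticeType u h L) := by
    rw [derivDenHor, finsum_mem_eq_sum_of_inter_support_eq
      (t := {L ∈ S | latticeType u h (π L) = 1})]
    · congr 1
      refine Finset.sum_congr rfl fun L hL => ?_
      obtain ⟨hLS, hL1⟩ := Finset.mem_filter.mp hL
      have hLo := (hSmem L).mp hLS
      have hK := hD.inf_mem_hyperplaneLattices hLo
      have hLf := ((hfiber _ hK L).mp ⟨hLS, rfl⟩).1
      have h1 := hD.latticeType_le hh (hD.isIntegralHyperlattice_of_mem hLb hm hVm hK) hLf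
      rw [Set.indicator_of_mem (by exact ((hMle L).mp hLo.1).2), typeWeight_of_le_two]
      exact h1.trans (by change latticeType u h (π L) + 1 ≤ 2; rw [hL1])
    · ext L
      simp only [Set.mem_inter_iff, Function.mem_support, Finset.mem_coe, Finset.mem_filter,
        hSmem]
      refine and_congr_left fun hxL => ?_
      have hxL : x ∈ L := by
        by_contra H
        exact hxL (Set.indicator_of_notMem (by exact H) _)
      constructor
      · rintro ⟨-, h1, h2, h3⟩
        exact ⟨⟨(hMle L).mpr ⟨h1, hxL⟩, h2⟩, h3⟩
      · rintro ⟨hL, h3⟩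
        exact ⟨⟨hD.fg_of_mem_integralOverlattices hh hb₀ hMtop hL,
          ambient_eq_top_of_le hL.1 hMtop⟩, ((hMle L).mp hL.1).1, hL.2, h3⟩
  have hvert : derivDenVert u h r Lb x
      = 2 * ∑ L ∈ S with latticeType u h (π L) ≠ 1,
        typeWeight (residueCard F) (latticeType u h L) := by
    rw [derivDenVert, hhor, derivDenAt, hD.derivDen_eq hh hV hns hb₀ hMtop S hSmem,
      ← Finset.sum_filter_add_sum_filter_not S (fun L => latticeType u h (π L) = 1)]
    ring
  rw [hvert, ← Finset.sum_fiberwise_of_maps_to (t := T) (g := π) fun L hL => ?_]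
  swap
  · obtain ⟨hLS, hL1⟩ := Finset.mem_filter.mp hL
    exact (hT _).mpr ⟨hD.inf_mem_hyperplaneLattices ((hSmem L).mp hLS), hL1⟩
  rw [Finset.mul_sum]
  push_cast
  refine Finset.sum_congr rfl fun K hK => ?_
  obtain ⟨hKh, hK1⟩ := (hT K).mp hK
  have hKint := hD.isIntegralHyperlattice_of_mem hLb hm hVm hKh
  have hmem : ∀ L, L ∈ ((S.filter fun L => latticeType u h (π L) ≠ 1).filter fun L => π L = K) ↔
      L ∈ fiberLattices u h K ∧ x ∈ L := fun L => by
    rw [← hfiber K hKh, Finset.mem_filter, Finset.mem_filter]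
    constructor
    · rintro ⟨⟨h1, -⟩, h2⟩
      exact ⟨h1, h2⟩
    · rintro ⟨h1, rfl⟩
      exact ⟨⟨h1, hK1⟩, rfl⟩
  -- For `x` off the hyperplane only finitely many lattices over `K` contain `x`, so the series is a
  -- finite sum.
  have htsum : ∑' L : fiberLattices u h K, ((L : Submodule (Valued.integer E) V) : Set V).indicator
        (fun _ => (fiberWeight (residueCard F) u h K L : ℂ)) x
      = ∑ L ∈ ((S.filter fun L => latticeType u h (π L) ≠ 1).filter fun L => π L = K),
        (fiberWeight (residueCard F) u h K L : ℂ) := by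
    rw [tsum_subtype (fiberLattices u h K) fun L : Submodule (Valued.integer E) V =>
      (L : Set V).indicator (fun _ => (fiberWeight (residueCard F) u h K L : ℂ)) x,
      tsum_eq_sum (s := ((S.filter fun L => latticeType u h (π L) ≠ 1).filter fun L => π L = K))]
    · refine Finset.sum_congr rfl fun L hL => ?_
      obtain ⟨h1, h2⟩ := (hmem L).mp hL
      rw [Set.indicator_of_mem h1, Set.indicator_of_mem (by exact h2)]
    · intro L hL
      by_cases h1 : L ∈ fiberLattices u h K
      · rw [Set.indicator_of_mem h1, Set.indicator_of_notMem]
        exact fun h2 => hL ((hmem L).mpr ⟨h1, h2⟩)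
      · rw [Set.indicator_of_notMem h1]
  rw [htsum, mul_assoc, Finset.mul_sum, Finset.mul_sum, Finset.mul_sum]
  refine Finset.sum_congr rfl fun L hL => ?_
  rw [hD.typeWeight_eq_mul_fiberWeight hh hKint hK1 ((hmem L).mp hL).1]
  push_cast
  rfl

variable [TopologicalSpace V] [IsTopologicalAddGroup V] [ContinuousSMul E V] [T2Space V]

theorem isClosed_intSet (hD : RamifiedDatum c u q) (hh : IsHermitianSpace h) :
    IsClosed (intSet h) := by
  have h1 : intSet h = {x | ‖h x x‖ ≤ 1} := Set.ext fun x => hD.mem_intSet_iff hh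
  rw [h1]
  exact isClosed_le (hD.continuous_self hh).norm continuous_const

variable [MeasurableSpace V] [BorelSpace V] {μ : Measure V}

/-- Test functions whose Fourier transform is supported on integral vectors. -/
structure IsIntegralTestFunction (μ : Measure V) (ψ : AddChar F ℂ) (h : Pairing c V)
    (f : V → ℂ) : Prop where
  isLocallyConstant : IsLocallyConstant f
  hasCompactSupport : HasCompactSupport f
  fourier_eq_zero : ∀ x, x ∉ intSet h → fourier μ ψ h f x = 0

theorem isIntegralTestFunction_zero : IsIntegralTestFunction μ ψ h 0 where
  isLocallyConstant := IsLocallyConstant.const 0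
  hasCompactSupport := HasCompactSupport.zero
  fourier_eq_zero x _ := by simp [fourier]

theorem IsIntegralTestFunction.const_mul {f : V → ℂ} (hf : IsIntegralTestFunction μ ψ h f)
    (a : ℂ) : IsIntegralTestFunction μ ψ h fun x => a * f x where
  isLocallyConstant := hf.isLocallyConstant.comp fun z => a * z
  hasCompactSupport := hf.hasCompactSupport.comp_left (g := fun z => a * z) (mul_zero a)
  fourier_eq_zero x hx := by
    have h1 := hf.fourier_eq_zero x hx
    rw [fourier] at h1 ⊢
    simp only [mul_assoc]
    rw [integral_const_mul, h1, mul_zero]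

theorem IsIntegralTestFunction.add [μ.IsAddHaarMeasure] (hD : RamifiedDatum c u q)
    (h2 : Module.finrank F E = 2) (hψ : HasConductorIntegers ψ) (hh : IsHermitianSpace h)
    {f g : V → ℂ} (hf : IsIntegralTestFunction μ ψ h f) (hg : IsIntegralTestFunction μ ψ h g) :
    IsIntegralTestFunction μ ψ h (f + g) where
  isLocallyConstant := hf.isLocallyConstant.add hg.isLocallyConstant
  hasCompactSupport := hf.hasCompactSupport.add hg.hasCompactSupport
  fourier_eq_zero x hx := by
    have hint : ∀ {f : V → ℂ}, IsIntegralTestFunction μ ψ h f →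
        Integrable (fun y => f y * ψ (Algebra.trace F E (h x y))) μ := fun hf =>
      (hf.isLocallyConstant.continuous.mul
        (hD.continuous_char_pairing h2 hψ hh x)).integrable_of_hasCompactSupport
          hf.hasCompactSupport.mul_right
    have h1 := hf.fourier_eq_zero x hx
    have h3 := hg.fourier_eq_zero x hx
    rw [fourier] at h1 h3 ⊢
    simp only [Pi.add_apply, add_mul]
    rw [integral_add (hint hf) (hint hg), h1, h3, add_zero]

/-- By inversion, the second transform is `fiberTransform` at `-x`, which vanishes unless `(x, x)`
is integral. -/
theorem isIntegralTestFunction_fourier_fiberTransform (hD : RamifiedDatum c u q)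
    (h2 : Module.finrank F E = 2) (hψ : HasConductorIntegers ψ) (hh : IsHermitianSpace h)
    (hμ : IsSelfDualHaar μ ψ h) (hK : IsIntegralHyperlattice u h m K) :
    IsIntegralTestFunction μ ψ h (fourier μ ψ h (fiberTransform q u h μ K)) := by
  have := hμ.isAddHaar
  refine ⟨hD.isLocallyConstant_fourier_fiberTransform h2 hψ hh hK,
    hD.hasCompactSupport_fourier_fiberTransform h2 hψ hh hK, fun x hx => ?_⟩
  rw [hμ.inversion _ (hD.isLocallyConstant_fiberTransform hh hK)
    (hD.hasCompactSupport_fiberTransform hh hK)]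
  by_contra h0
  have h1 := (hD.norm_self_le_of_fiberTransform_ne_zero hh hK h0).2
  refine hx ((hD.mem_intSet_iff hh).mpr ?_)
  simpa using h1

theorem exists_isIntegralTestFunction (hD : RamifiedDatum c u (residueCard F))
    (h2 : Module.finrank F E = 2) (hψ : HasConductorIntegers ψ) (hh : IsHermitianSpace h)
    (hμ : IsSelfDualHaar μ ψ h)
    (hV : Module.finrank E V = 2 * r) (hns : ¬IsSplit h) (hLb : IsHermitianModule h Lb m)
    (hm : Odd m) (hmr : m + 1 = 2 * r) :
    ∃ f : V → ℂ, IsIntegralTestFunction μ ψ h f ∧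
      ∀ x, x ∉ ambient Lb → f x = (derivDenVert u h r Lb x : ℂ) := by
  classical
  have := hμ.isAddHaar
  -- The type-one lattices are precisely what the horizontal part removes.
  let T : Finset (Submodule (Valued.integer E) V) :=
    (hD.finite_hyperplaneLattices hLb).toFinset.filter fun K => latticeType u h K ≠ 1
  have hT : ∀ K, K ∈ T ↔ K ∈ hyperplaneLattices u h Lb ∧ latticeType u h K ≠ 1 := fun K => by
    simp only [T, Finset.mem_filter, Set.Finite.mem_toFinset]
  have hKint : ∀ K ∈ T, IsIntegralHyperlattice u h m K := fun K hK =>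
    hD.isIntegralHyperlattice_of_mem hLb hm (by rw [hV, hmr]) ((hT K).mp hK).1
  refine ⟨∑ K ∈ T, fun x => 2 * (typeWeight (residueCard F) (latticeType u h K - 1) : ℂ)
    * fourier μ ψ h (fiberTransform (residueCard F) u h μ K) x, ?_, fun x hx => ?_⟩
  · exact Finset.sum_induction _ (IsIntegralTestFunction μ ψ h)
      (fun f g hf hg => hf.add hD h2 hψ hh hg) isIntegralTestFunction_zero
      fun K hK => (hD.isIntegralTestFunction_fourier_fiberTransform h2 hψ hh hμ
        (hKint K hK)).const_mul _
  · rw [hD.derivDenVert_eq hh hV hns hLb hm hmr T hT hx, Finset.sum_apply]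
    refine Finset.sum_congr rfl fun K hK => ?_
    rw [hD.fourier_fiberTransform h2 hψ hh hμ (hKint K hK)]
    rwa [ambient_of_mem_hyperplaneLattices ((hT K).mp hK).1]

end RamifiedDatum

/-- Locally constant functions are determined by their values off a proper subspace. -/
theorem IsLocallyConstant.eq_of_eq_off_submodule [TopologicalSpace V] [IsTopologicalAddGroup V]
    [ContinuousSMul E V] {W : Submodule E V} (hW : W ≠ ⊤) {f g : V → ℂ}
    (hf : IsLocallyConstant f) (hg : IsLocallyConstant g) (hfg : ∀ x, x ∉ W → f x = g x) :
    f = g := by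
  have h1 : interior (W : Set V) = ∅ := by
    by_contra hne
    exact hW (Submodule.eq_top_of_nonempty_interior' W (Set.nonempty_iff_ne_empty.mpr hne))
  exact Continuous.ext_on (interior_eq_empty_iff_dense_compl.mp h1) hf.continuous hg.continuous
    fun x hx => hfg x hx

end VerticalPart

end KRAnalytic

end

theorem proposition2p13
    (p : ℕ) [Fact p.Prime] (hp : p ≠ 2)
    {F : Type*} [NontriviallyNormedField F] [IsUltrametricDist F]
    [NormedAlgebra ℚ_[p] F] [FiniteDimensional ℚ_[p] F]
    {E : Type*} [NontriviallyNormedField E] [IsUltrametricDist E] [NormedAlgebra F E]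
    (hEF : KRAnalytic.IsRamifiedQuadratic F E)
    (c : E ≃ₐ[F] E) (u : Valued.integer E) (hu : Irreducible u) (hcu : c (u : E) = -(u : E))
    (ψ : AddChar F ℂ) (hψ : KRAnalytic.HasConductorIntegers ψ)
    (r : ℕ) (hr : 0 < r)
    {V : Type*} [AddCommGroup V] [Module E V] [TopologicalSpace V] [IsTopologicalAddGroup V]
    [ContinuousSMul E V] [T2Space V] [MeasurableSpace V] [BorelSpace V]
    (hV : Module.finrank E V = 2 * r)
    (h : KRAnalytic.Pairing c V) (hh : KRAnalytic.IsHermitianSpace h)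
    (hns : ¬ KRAnalytic.IsSplit h)
    (μ : MeasureTheory.Measure V) (hμ : KRAnalytic.IsSelfDualHaar μ ψ h) :
    (∀ L : Submodule (Valued.integer E) V, Submodule.IsLattice E L →
      ∃! P : Polynomial ℤ, KRAnalytic.IsSiegelSeries u h r L P) ∧
    ∀ Lb : Submodule (Valued.integer E) V, KRAnalytic.IsHermitianModule h Lb (2 * r - 1) →
      ∃ f : V → ℂ,
        (∀ x : V, x ∉ KRAnalytic.ambient Lb →
          f x = (KRAnalytic.derivDenVert u h r Lb x : ℂ)) ∧
        IsLocallyConstant f ∧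
        HasCompactSupport f ∧
        (∀ g : V → ℂ, IsLocallyConstant g →
          (∀ x : V, x ∉ KRAnalytic.ambient Lb →
            g x = (KRAnalytic.derivDenVert u h r Lb x : ℂ)) → g = f) ∧
        tsupport (KRAnalytic.fourier μ ψ h f) ⊆ KRAnalytic.intSet h := by
  classical
  have hD := KRAnalytic.ramifiedDatum p hp hEF hu hcu
  have : FiniteDimensional E V := Module.finite_of_finrank_pos (by omega)
  refine ⟨fun L hL => ?_, fun Lb hLb => ?_⟩
  · have htop : KRAnalytic.ambient L = ⊤ := hL.span_eq_top
    obtain ⟨b, hb⟩ := hD.exists_isLatticeBasis (m := 2 * r) hL.fg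
      (by rw [htop, finrank_top, hV])
    obtain ⟨ℓ, hℓ⟩ := hD.exists_isSiegelSeries hh hb htop
      (hD.finite_integralOverlattices hh hb htop).toFinset fun L' => Set.Finite.mem_toFinset _
    exact ⟨_, hℓ, fun Q hQ => hD.isSiegelSeries_unique hQ hℓ⟩
  -- Positivity of `r` makes the rank `2 * r - 1` odd and one less than the dimension.
  · obtain ⟨f, hf, hfv⟩ := hD.exists_isIntegralTestFunction hEF.finrank_eq_two hψ hh hμ hV hns hLb
      ⟨r - 1, by omega⟩ (by omega)
    refine ⟨f, hfv, hf.isLocallyConstant, hf.hasCompactSupport, fun g hg hgv => ?_, ?_⟩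
    · refine KRAnalytic.IsLocallyConstant.eq_of_eq_off_submodule (W := KRAnalytic.ambient Lb)
        (fun htop => ?_) hg hf.isLocallyConstant fun x hx => (hgv x hx).trans (hfv x hx).symm
      have h1 := hLb.rank_eq
      rw [htop, finrank_top, hV] at h1
      omega
    -- The set of integral vectors is closed, so it contains the closure of the nonvanishing locus.
    · refine closure_minimal (fun x hx => ?_) (hD.isClosed_intSet hh)
      by_contra H
      exact hx (hf.fourier_eq_zero x H)
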